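/- Let $N\ge 1$, $\alpha\in(0,2)$, $\kappa_0>0$. Let $F:\mathbb R^N\to\mathbb R$ be integrable, even, positive a.e., with $\int_{\mathbb R^N}F\,dv=1$ and $F(v)\sim \kappa_0|v|^{-N-\alpha}$ as $|v|\to\infty$, and let $L(f)=\rho F-f$ with $\rho=\int_{\mathbb R^N}f\,dv$. Write $L^2(F^{-1})=L^2(\mathbb R^N\times\mathbb R^N;\,F(v)^{-1}dx\,dv)$, let $f_0\in L^2(F^{-1})$ and $\rho_0(x)=\int f_0(x,v)\,dv$. For every $\varepsilon>0$ let $f^\varepsilon\in L^\infty_{\rm loc}([0,\infty);L^2(F^{-1}))$ be the weak solution (tested against $C_c^\infty([0,\infty)\times\mathbb R^N\times\mathbb R^N)$) of $$\varepsilon^\alpha\,\partial_t f^\varepsilon+\varepsilon\, v\cdot\nabla_x f^\varepsilon=L(f^\varepsilon)\ \text{ in }(0,\infty)\times\mathbb R^N\times\mathbb R^N,\qquad f^\varepsilon(0,\cdot)=f_0 .$$ Let $$\kappa=\int_{\mathbb R^N}\frac{w_1^2}{1+w_1^2}\,\frac{\kappa_0}{|w|^{N+\alpha}}\,dw .$$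 Then this integral converges, and the fractional heat equation $$\partial_t\rho+\kappa(-\Delta)^{\alpha/2}\rho=0\ \text{ in }(0,\infty)\times\mathbb R^N,\qquad \rho(0,\cdot)=\rho_0,$$ where $(-\Delta)^{\alpha/2}\psi=\mathcal F^{-1}(|k|^\alpha\mathcal F\psi)$, has a unique weak solution $\rho\in L^\infty_{\rm loc}([0,\infty);L^2(\mathbb R^N))$. Moreover, for every $T>0$, as $\varepsilon\to0^+$, $$f^\varepsilon\rightharpoonup \rho(t,x)F(v)\quad\text{weakly-* in } L^\infty(0,T;L^2(F^{-1})),$$ and, whenever $F\in L^2(\mathbb R^N)$ and $f_0\in L^2(\mathbb R^N\times\mathbb R^N)$ (in particular whenever $F$ is bounded), also weakly-* in $L^\infty(0,T;L^2(\mathbb R^N\times\mathbb R^N))$ with the flat measure. -/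

import Mathlib

open MeasureTheory Filter Topology Set
open scoped FourierTransform ContDiff ENNReal

noncomputable section

namespace FractionalDiffusion

/-- Physical space and velocity space: `ℝ^N` with its Euclidean norm. -/
abbrev Space (N : ℕ) : Type := EuclideanSpace ℝ (Fin N)

section Bochner

variable {Y : Type*} [MeasurableSpace Y]

/-- `g ∈ L^∞(0,T; L²(ν))`, for a function `g` of `(t,y)`. -/
def MemLinftyL2 (T : ℝ) (ν : Measure Y) (g : ℝ × Y → ℝ) : Prop :=
  AEStronglyMeasurable g ((volume.restrict (Ioo 0 T)).prod ν) ∧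
    ∃ C : ℝ, ∀ᵐ t ∂(volume.restrict (Ioo 0 T)),
      eLpNorm (fun y => g (t, y)) 2 ν ≤ ENNReal.ofReal C

/-- `φ ∈ L¹(0,T; L²(ν))`, for a function `φ` of `(t,y)`. -/
def MemL1L2 (T : ℝ) (ν : Measure Y) (φ : ℝ × Y → ℝ) : Prop :=
  AEStronglyMeasurable φ ((volume.restrict (Ioo 0 T)).prod ν) ∧
    ∫⁻ t in Ioo 0 T, eLpNorm (fun y => φ (t, y)) 2 ν < ⊤

/-- `g ε ⇀ g₀` weakly-* in `L^∞(0,T; L²(ν)) = (L¹(0,T; L²(ν)))'` as `ε → 0⁺`: all the functions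
belong to the space, and the pairings with every element of the predual converge. -/
def TendstoWeakStar (T : ℝ) (ν : Measure Y) (g : ℝ → ℝ × Y → ℝ) (g₀ : ℝ × Y → ℝ) : Prop :=
  (∀ ε : ℝ, 0 < ε → MemLinftyL2 T ν (g ε)) ∧ MemLinftyL2 T ν g₀ ∧
    ∀ φ : ℝ × Y → ℝ, MemL1L2 T ν φ →
      Tendsto (fun ε : ℝ => ∫ z, g ε z * φ z ∂((volume.restrict (Ioo 0 T)).prod ν))
        (𝓝[>] 0) (𝓝 (∫ z, g₀ z * φ z ∂((volume.restrict (Ioo 0 T)).prod ν)))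

end Bochner

variable {N : ℕ}

/-- `F` is a normalized, almost everywhere positive, even equilibrium function. -/
structure IsEquilibrium (F : Space N → ℝ) : Prop where
  integrable : Integrable F
  pos : ∀ᵐ v, 0 < F v
  even : ∀ v, F (-v) = F v
  integral_eq_one : ∫ v, F v = 1

/-- The measure `F(v)⁻¹ dx dv` on phase space, so that `L²(F⁻¹)` is the `L²` space of this
measure. -/
def invWeight (F : Space N → ℝ) : Measure (Space N × Space N) :=
  volume.withDensity (fun y => ENNReal.ofReal (F y.2)⁻¹)

/-- The linear relaxation operator `L(g) = (∫ g dw) F - g`. -/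
def relaxation (F : Space N → ℝ) (g : Space N → ℝ) (v : Space N) : ℝ :=
  (∫ w, g w) * F v - g v

/-- `f = f(t,x,v)` is a weak solution, in `L^∞_loc([0,∞); L²(F⁻¹))`, of
`θ ∂_t f + ε v · ∇_x f = L(f)` on `(0,∞) × ℝ^N × ℝ^N` with `f(0,·) = f₀`.
The test functions are smooth with compact support in `[0,∞) × ℝ^N × ℝ^N` (restrictions of test
functions on `ℝ × ℝ^N × ℝ^N`), so that they see the initial datum. -/
def IsKineticSolution (F : Space N → ℝ) (θ ε : ℝ) (f₀ : Space N × Space N → ℝ)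
    (f : ℝ × Space N × Space N → ℝ) : Prop :=
  (∀ T : ℝ, 0 < T → MemLinftyL2 T (invWeight F) f) ∧
    ∀ φ : ℝ × Space N × Space N → ℝ, ContDiff ℝ ∞ φ → HasCompactSupport φ →
      (∫ z in Ioi (0 : ℝ) ×ˢ (univ : Set (Space N × Space N)),
          (f z * (θ * fderiv ℝ φ z (1, 0, 0) + ε * fderiv ℝ φ z (0, z.2.2, 0))
            + relaxation F (fun w => f (z.1, z.2.1, w)) z.2.2 * φ z))
        + θ * ∫ y, f₀ y * φ (0, y) = 0

/-- The fractional Laplacian `(-Δ)^{α/2} ψ = 𝓕⁻¹(|k|^α 𝓕 ψ)`. Mathlib's Fourier transform has the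
phase `exp (-2πi x·ξ)`, that is `k = 2πξ`. -/
def fracLaplacian (α : ℝ) (ψ : Space N → ℝ) (x : Space N) : ℝ :=
  (𝓕⁻ (fun ξ : Space N =>
    (((2 * Real.pi * ‖ξ‖) ^ α : ℝ) : ℂ) * 𝓕 (fun y : Space N => (ψ y : ℂ)) ξ) x).re

/-- `ρ = ρ(t,x)` is a weak solution, in `L^∞_loc([0,∞); L²(ℝ^N))`, of
`∂_t ρ + κ (-Δ)^{α/2} ρ = 0` on `(0,∞) × ℝ^N` with `ρ(0,·) = ρ₀`. -/
def IsFracHeatSolution (α κ : ℝ) (ρ₀ : Space N → ℝ) (ρ : ℝ × Space N → ℝ) : Prop :=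
  (∀ T : ℝ, 0 < T → MemLinftyL2 T volume ρ) ∧
    ∀ φ : ℝ × Space N → ℝ, ContDiff ℝ ∞ φ → HasCompactSupport φ →
      (∫ z in Ioi (0 : ℝ) ×ˢ (univ : Set (Space N)),
          ρ z * (fderiv ℝ φ z (1, 0) - κ * fracLaplacian α (fun x => φ (z.1, x)) z.2))
        + ∫ x, ρ₀ x * φ (0, x) = 0

/-- The integrand `w₁² / (1 + w₁²) · κ₀ / |w|^{N+α}`. -/
def kappaIntegrand [NeZero N] (α κ₀ : ℝ) (w : Space N) : ℝ :=
  (w 0) ^ 2 / (1 + (w 0) ^ 2) * (κ₀ / ‖w‖ ^ ((N : ℝ) + α))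

/-- The diffusion coefficient `κ = ∫ w₁² / (1 + w₁²) · κ₀ / |w|^{N+α} dw`. -/
def kappa (N : ℕ) [NeZero N] (α κ₀ : ℝ) : ℝ :=
  ∫ w : Space N, kappaIntegrand α κ₀ w

end FractionalDiffusion

end

/-! Write θ = ε^α. Along the free trajectories x + (ε/θ) t v the kinetic equation is a linear ODE in
t, so a solution obeys Duhamel's formula (`IsKineticSolution.mild`). Its value at time t is the
initial datum with weight exp(-t/θ), plus the source ρF averaged with the kernel θ⁻¹ exp(-(t-s)/θ).
These weights add up to one, transport preserves the norm, and F has norm one in L²(F⁻¹). By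
convexity the L²(F⁻¹) norm never exceeds that of f₀, uniformly in ε
(`IsKineticSolution.lintegral_sq_le_initial`).

Pairing Duhamel's formula with a function Φ(t,x), and exchanging the two time variables, gives
(`IsKineticSolution.integral_density_mul`) ∫ ρ^ε θ⁻¹ (Φ - ∫ F AΦ dv) = ∫ f₀ AΦ(0,·), where AΦ is the
mean of Φ at the end of a free flight of exponential duration (`kineticAverage`). In Fourier
variables A acts by multipliers. The mean of the phase over the flight time and over F, whose
evenness kills the odd part, is 1 - ∫ F(v) (k·εv)²/(1 + (k·εv)²) dv with k = 2πξ. Divided by ε^α,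
the missing mass tends to κ|k|^α: bounded velocities contribute O(ε^(2-α)), and after substituting w
= εv the tail density converges to κ₀|w|^(-N-α) (`tendsto_rescaled_integral`,
`integral_dissipation_div`). The shift in time contributes -∂_t. So the operator applied to Φ on the
left tends to -∂_t + κ(-Δ)^(α/2) (`HasDissipationLimit.tendsto_multiplier`).

Now take for Φ the solution of the backward equation -∂_tΦ + κ(-Δ)^(α/2)Φ = η(t)φ(x) that vanishes
for late times, with φ band limited. Its Fourier transform is explicit (`adjointFlow`). The
multipliers converge boundedly on a fixed compact band, so Plancherel and the uniform bound on ρ^ε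
yield ∫ ρ^ε ηφ → ∫ ρ₀ Φ(0) (`tendsto_density_mul`). The explicit heat flow with datum ρ₀ has exactly
this pairing with ηφ (`integral_heatFlow_mul`). Thus the limit is identified directly, without
compactness and without uniqueness.

Testing the kinetic equation itself with tensor products shows that f^ε - ρ^ε F is small in the weak
sense (`IsKineticSolution.integral_mul_sub`). The uniform bounds extend the convergence from total
families of tests to the whole predual L¹(0,T; L²) (`TendstoWeakStar.of_isTotalL2`).

Uniqueness for the heat equation is a Picard iteration. Paired with functions of a fixed frequency
band, on which the fractional Laplacian is bounded by some L, the difference of two solutions is at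
most a constant times (L t)^n / n! for every n (`IsHeatNull.ae_abs_le`). -/

namespace FractionalDiffusion

/-! ### Total families in L² and their tensor products -/

section L2

variable {X Y : Type*} [MeasurableSpace X] [MeasurableSpace Y] {E : Type*} [NormedAddCommGroup E]

theorem sq_lintegral_mul_le (μ : Measure X) {f g : X → ℝ≥0∞} (hf : AEMeasurable f μ)
    (hg : AEMeasurable g μ) :
    (∫⁻ x, f x * g x ∂μ) ^ 2 ≤ (∫⁻ x, f x ^ 2 ∂μ) * ∫⁻ x, g x ^ 2 ∂μ := by
  have h := ENNReal.lintegral_mul_le_Lp_mul_Lq μ (p := 2) (q := 2)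
    (Real.HolderConjugate.two_two) hf hg
  calc (∫⁻ x, f x * g x ∂μ) ^ 2 ≤ _ := pow_le_pow_left' h 2
    _ = _ := by
      rw [mul_pow, ← ENNReal.rpow_natCast, ← ENNReal.rpow_natCast, ← ENNReal.rpow_mul,
        ← ENNReal.rpow_mul]
      norm_num

theorem eLpNorm_two_sq (μ : Measure X) (f : X → E) :
    eLpNorm f 2 μ ^ 2 = ∫⁻ x, ‖f x‖ₑ ^ 2 ∂μ := by
  have := eLpNorm_nnreal_pow_eq_lintegral (f := f) (μ := μ) (p := 2) two_ne_zero
  norm_num at this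
  exact_mod_cast this

theorem memLp_two_iff {μ : Measure X} {f : X → E} :
    MemLp f 2 μ ↔ AEStronglyMeasurable f μ ∧ ∫⁻ x, ‖f x‖ₑ ^ 2 ∂μ < ⊤ := by
  rw [← eLpNorm_two_sq, MemLp]
  simp [ENNReal.pow_lt_top_iff]

theorem eLpNorm_two_le_iff {μ : Measure X} {f : X → E} {C : ℝ≥0∞} :
    eLpNorm f 2 μ ≤ C ↔ ∫⁻ x, ‖f x‖ₑ ^ 2 ∂μ ≤ C ^ 2 := by
  rw [← eLpNorm_two_sq]
  exact (ENNReal.pow_le_pow_left_iff two_ne_zero).symm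

/-- A family of square-integrable functions with trivial orthogonal complement in `L²(μ)`. -/
structure IsTotalL2 (μ : Measure X) (𝒜 : Set (X → ℝ)) : Prop where
  memLp : ∀ a ∈ 𝒜, MemLp a 2 μ
  ae_eq_zero : ∀ h : X → ℝ, MemLp h 2 μ → (∀ a ∈ 𝒜, ∫ x, h x * a x ∂μ = 0) → h =ᵐ[μ] 0

theorem _root_.MeasureTheory.MemLp.mul_prod_two {μ : Measure X} {ν : Measure Y} [SFinite μ] [SFinite ν]
    {a : X → ℝ} {b : Y → ℝ} (ha : MemLp a 2 μ) (hb : MemLp b 2 ν) :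
    MemLp (fun z : X × Y => a z.1 * b z.2) 2 (μ.prod ν) := by
  rw [memLp_two_iff] at *
  refine ⟨ha.1.comp_fst.mul hb.1.comp_snd, ?_⟩
  simp only [enorm_mul, mul_pow]
  rw [lintegral_prod_mul (ha.1.enorm.pow_const 2) (hb.1.enorm.pow_const 2)]
  exact ENNReal.mul_lt_top ha.2 hb.2

/-- Pairing a square-integrable function on a product with one of the first variable. -/
theorem _root_.MeasureTheory.MemLp.integral_mul_left_two {μ : Measure X} {ν : Measure Y} [SFinite μ] [SFinite ν]
    {h : X × Y → ℝ} {a : X → ℝ} (hh : MemLp h 2 (μ.prod ν)) (ha : MemLp a 2 μ) :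
    MemLp (fun y => ∫ x, h (x, y) * a x ∂μ) 2 ν := by
  rw [memLp_two_iff] at *
  refine ⟨(hh.1.prod_swap.mul ha.1.comp_snd).integral_prod_right', ?_⟩
  have hm := hh.1.prod_swap
  have h1 : ∀ᵐ y ∂ν, ‖∫ x, h (x, y) * a x ∂μ‖ₑ ^ 2 ≤
      (∫⁻ x, ‖h (x, y)‖ₑ ^ 2 ∂μ) * ∫⁻ x, ‖a x‖ₑ ^ 2 ∂μ := by
    filter_upwards [hm.prodMk_left] with y hy
    refine le_trans ?_ (sq_lintegral_mul_le μ hy.enorm ha.1.enorm)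
    refine pow_le_pow_left' ((enorm_integral_le_lintegral_enorm _).trans (le_of_eq ?_)) 2
    simp [enorm_mul]
  refine (lintegral_mono_ae h1).trans_lt ?_
  have hm2 : AEMeasurable (fun y => ∫⁻ x, ‖h (x, y)‖ₑ ^ 2 ∂μ) ν :=
    (hm.enorm.pow_const 2).lintegral_prod_right'
  rw [lintegral_mul_const'' _ hm2, ← lintegral_prod_symm _ (hh.1.enorm.pow_const 2)]
  exact ENNReal.mul_lt_top hh.2 ha.2

/-- On boxes of finite measure a square-integrable function is integrable. Rectangles form a
π-system generating the product σ-algebra, so there the vanishing passes from rectangles to all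
measurable sets, and σ-finiteness exhausts the space by such boxes. -/
theorem ae_eq_zero_of_setIntegral_prod_eq_zero {μ : Measure X} {ν : Measure Y} [SigmaFinite μ]
    [SigmaFinite ν] {h : X × Y → ℝ} (hh : MemLp h 2 (μ.prod ν))
    (h0 : ∀ A B, MeasurableSet A → MeasurableSet B → μ A < ⊤ → ν B < ⊤ →
      ∫ z in A ×ˢ B, h z ∂(μ.prod ν) = 0) : h =ᵐ[μ.prod ν] 0 := by
  set S : ℕ → Set (X × Y) := fun n => spanningSets μ n ×ˢ spanningSets ν n with hS
  have hSm : ∀ n, MeasurableSet (S n) := fun n =>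
    (measurableSet_spanningSets μ n).prod (measurableSet_spanningSets ν n)
  have hSf : ∀ n, (μ.prod ν) (S n) < ⊤ := fun n => by
    rw [hS, Measure.prod_prod]
    exact ENNReal.mul_lt_top (measure_spanningSets_lt_top μ n) (measure_spanningSets_lt_top ν n)
  have hSU : (⋃ n, S n) = univ := by
    rw [eq_univ_iff_forall]
    rintro ⟨x, y⟩
    have hx := mem_iUnion.1 ((iUnion_spanningSets μ).symm ▸ mem_univ x : x ∈ ⋃ n, spanningSets μ n)
    have hy := mem_iUnion.1 ((iUnion_spanningSets ν).symm ▸ mem_univ y : y ∈ ⋃ n, spanningSets ν n)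
    obtain ⟨n, hn⟩ := hx
    obtain ⟨m, hm⟩ := hy
    refine mem_iUnion.2 ⟨max n m, ?_, ?_⟩
    · exact monotone_spanningSets μ (le_max_left n m) hn
    · exact monotone_spanningSets ν (le_max_right n m) hm
  have key : ∀ n, h =ᵐ[(μ.prod ν).restrict (S n)] 0 := by
    intro n
    have : IsFiniteMeasure ((μ.prod ν).restrict (S n)) := ⟨by simpa using hSf n⟩
    have hi : Integrable h ((μ.prod ν).restrict (S n)) :=
      (hh.restrict (S n)).integrable (by norm_num)
    refine hi.ae_eq_zero_of_forall_setIntegral_eq_zero fun s hs _ => ?_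
    induction s, hs using MeasurableSpace.induction_on_inter generateFrom_prod.symm
      isPiSystem_prod with
    | empty => simp
    | basic t ht =>
      obtain ⟨A, hA, B, hB, rfl⟩ := ht
      rw [Measure.restrict_restrict (hA.prod hB), hS, prod_inter_prod]
      refine h0 _ _ (MeasurableSet.inter hA (measurableSet_spanningSets μ n))
        (MeasurableSet.inter hB (measurableSet_spanningSets ν n)) ?_ ?_
      · exact (measure_mono inter_subset_right).trans_lt (measure_spanningSets_lt_top μ n)
      · exact (measure_mono inter_subset_right).trans_lt (measure_spanningSets_lt_top ν n)
    | compl t ht ih =>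
      have h1 := integral_add_compl ht hi
      have h2 : ∫ z, h z ∂((μ.prod ν).restrict (S n)) = 0 :=
        h0 _ _ (measurableSet_spanningSets μ n) (measurableSet_spanningSets ν n)
          (measure_spanningSets_lt_top μ n) (measure_spanningSets_lt_top ν n)
      have h3 := ih (measure_lt_top _ _)
      rw [h2, h3, zero_add] at h1
      exact h1
    | iUnion t hd ht ih =>
      rw [integral_iUnion ht hd hi.integrableOn]
      simp [ih _ (measure_lt_top _ _)]
  have := ae_restrict_iUnion_iff S (p := fun z => h z = 0) (μ := μ.prod ν)
  rw [hSU, Measure.restrict_univ] at this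
  exact this.2 key

/-- Products of total families are total. -/
theorem IsTotalL2.prod {μ : Measure X} {ν : Measure Y} [SigmaFinite μ] [SigmaFinite ν]
    {𝒜 : Set (X → ℝ)} {ℬ : Set (Y → ℝ)} (hA : IsTotalL2 μ 𝒜) (hB : IsTotalL2 ν ℬ) :
    IsTotalL2 (μ.prod ν) {φ | ∃ a ∈ 𝒜, ∃ b ∈ ℬ, φ = fun z => a z.1 * b z.2} := by
  refine ⟨?_, fun h hh h0 => ?_⟩
  · rintro _ ⟨a, ha, b, hb, rfl⟩
    exact (hA.memLp a ha).mul_prod_two (hB.memLp b hb)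
  -- For a fixed first factor, the partial pairing is a function of y orthogonal to all of ℬ.
  have h1 : ∀ a ∈ 𝒜, (fun y => ∫ x, h (x, y) * a x ∂μ) =ᵐ[ν] 0 := by
    intro a ha
    refine hB.ae_eq_zero _ (hh.integral_mul_left_two (hA.memLp a ha)) fun b hb => ?_
    have hi := hh.integrable_mul ((hA.memLp a ha).mul_prod_two (hB.memLp b hb))
    have := h0 _ ⟨a, ha, b, hb, rfl⟩
    have h2 := integral_prod_symm _ hi
    simp only [Pi.mul_apply] at h2
    rw [this] at h2
    rw [h2]
    congr 1
    ext y
    rw [← integral_mul_const]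
    congr 1
    ext x
    ring
  refine ae_eq_zero_of_setIntegral_prod_eq_zero hh fun A B mA mB fA fB => ?_
  have iB : MemLp (B.indicator (fun _ => (1 : ℝ))) 2 ν :=
    memLp_indicator_const 2 mB 1 (Or.inr fB.ne)
  have iA : MemLp (A.indicator (fun _ => (1 : ℝ))) 2 μ :=
    memLp_indicator_const 2 mA 1 (Or.inr fA.ne)
  have hsw : MemLp (fun z : Y × X => h z.swap) 2 (ν.prod μ) :=
    hh.comp_measurePreserving Measure.measurePreserving_swap
  -- Since the partial pairing with a vanishes a.e. in y, the second factor may be any function, in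
  -- particular an indicator. Reading the double integral in the other order puts totality of 𝒜 to
  -- work in x.
  have h3 : (fun x => ∫ y, h (x, y) * B.indicator (fun _ => (1 : ℝ)) y ∂ν) =ᵐ[μ] 0 := by
    refine hA.ae_eq_zero _ (hsw.integral_mul_left_two iB) fun a ha => ?_
    have hi := hh.integrable_mul ((hA.memLp a ha).mul_prod_two iB)
    have h2 := integral_prod_symm _ hi
    have h4 := integral_prod _ hi
    simp only [Pi.mul_apply] at h2 h4
    have h5 : ∫ y, ∫ x, h (x, y) * (a x * B.indicator (fun _ => (1 : ℝ)) y) ∂μ ∂ν = 0 := by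
      rw [integral_eq_zero_of_ae]
      filter_upwards [h1 a ha] with y hy
      simp only [Pi.zero_apply] at hy ⊢
      simp_rw [← mul_assoc]
      rw [integral_mul_const, hy, zero_mul]
    rw [h5] at h2
    rw [h2] at h4
    rw [h4]
    congr 1
    ext x
    rw [← integral_mul_const]
    congr 1
    ext y
    ring
  have hi := hh.integrable_mul (iA.mul_prod_two iB)
  have h4 := integral_prod _ hi
  rw [← integral_indicator (mA.prod mB)]
  have h6 : (A ×ˢ B).indicator h = h * fun z => A.indicator (fun _ => (1 : ℝ)) z.1 *
      B.indicator (fun _ => (1 : ℝ)) z.2 := by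
    ext ⟨x, y⟩
    by_cases hx : x ∈ A <;> by_cases hy : y ∈ B <;> simp [indicator, hx, hy]
  rw [h6, h4, integral_eq_zero_of_ae]
  filter_upwards [h3] with x hx
  simp only [Pi.zero_apply, Pi.mul_apply] at hx ⊢
  have : ∀ y, h (x, y) * (A.indicator (fun _ => (1 : ℝ)) x * B.indicator (fun _ => (1 : ℝ)) y) =
      A.indicator (fun _ => (1 : ℝ)) x * (h (x, y) * B.indicator (fun _ => (1 : ℝ)) y) := by
    intro y; ring
  simp_rw [this]
  rw [integral_const_mul, hx, mul_zero]

end L2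

end FractionalDiffusion

namespace FractionalDiffusion

/-! ### Weak-* convergence from bounds and a total family of tests -/

section WeakStar

variable {Y : Type*} [MeasurableSpace Y]

theorem lintegral_sq_le_of_ae_eLpNorm_le {T : ℝ} {ν : Measure Y} [SFinite ν] {g : ℝ × Y → ℝ} {C : ℝ≥0∞}
    (hg : AEStronglyMeasurable g ((volume.restrict (Ioo 0 T)).prod ν))
    (hC : ∀ᵐ t ∂(volume.restrict (Ioo 0 T)), eLpNorm (fun y => g (t, y)) 2 ν ≤ C) :
    ∫⁻ z, ‖g z‖ₑ ^ 2 ∂((volume.restrict (Ioo 0 T)).prod ν) ≤ C ^ 2 * ENNReal.ofReal T := by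
  rw [lintegral_prod _ (hg.enorm.pow_const 2)]
  calc _ ≤ ∫⁻ _ in Ioo 0 T, C ^ 2 := by
        refine lintegral_mono_ae ?_
        filter_upwards [hC] with t ht
        exact eLpNorm_two_le_iff.1 ht
    _ = _ := by simp

theorem memLp_two_of_ae_eLpNorm_le {T : ℝ} {ν : Measure Y} [SFinite ν] {g : ℝ × Y → ℝ} {C : ℝ}
    (hg : AEStronglyMeasurable g ((volume.restrict (Ioo 0 T)).prod ν))
    (hC : ∀ᵐ t ∂(volume.restrict (Ioo 0 T)),
      eLpNorm (fun y => g (t, y)) 2 ν ≤ ENNReal.ofReal C) :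
    MemLp g 2 ((volume.restrict (Ioo 0 T)).prod ν) :=
  memLp_two_iff.2 ⟨hg, (lintegral_sq_le_of_ae_eLpNorm_le hg hC).trans_lt (by finiteness)⟩

/-- Weak convergence of a bounded family in `L²` follows from convergence against a total
family. -/
theorem tendsto_integral_mul_of_isTotalL2 {μ : Measure Y} {𝒜 : Set (Y → ℝ)} (hA : IsTotalL2 μ 𝒜)
    {l : Filter ℝ} {g : ℝ → Y → ℝ} {g₀ : Y → ℝ} {M : ℝ}
    (hg : ∀ᶠ ε in l, MemLp (g ε) 2 μ ∧ eLpNorm (g ε) 2 μ ≤ ENNReal.ofReal M)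
    (hg₀ : MemLp g₀ 2 μ)
    (hlim : ∀ φ ∈ 𝒜, Tendsto (fun ε => ∫ z, g ε z * φ z ∂μ) l (𝓝 (∫ z, g₀ z * φ z ∂μ)))
    {φ : Y → ℝ} (hφ : MemLp φ 2 μ) :
    Tendsto (fun ε => ∫ z, g ε z * φ z ∂μ) l (𝓝 (∫ z, g₀ z * φ z ∂μ)) := by
  classical
  have inner_eq : ∀ {u w : Y → ℝ} (hu : MemLp u 2 μ) (hw : MemLp w 2 μ),
      inner ℝ (hu.toLp u) (hw.toLp w) = ∫ z, u z * w z ∂μ := by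
    intro u w hu hw
    rw [L2.inner_def]
    refine integral_congr_ae ?_
    filter_upwards [hu.coeFn_toLp, hw.coeFn_toLp] with z h1 h2
    rw [h1, h2]
    simp [mul_comm]
  set S : Submodule ℝ (Lp ℝ 2 μ) :=
    Submodule.span ℝ {u | ∃ a, ∃ h : a ∈ 𝒜, u = (hA.memLp a h).toLp a} with hS
  -- In a Hilbert space a trivial orthogonal complement is the same as a dense span.
  have hdense : S.topologicalClosure = ⊤ := by
    rw [Submodule.topologicalClosure_eq_top_iff, Submodule.eq_bot_iff]
    intro u hu
    rw [Submodule.mem_orthogonal'] at hu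
    have hu' : MemLp u 2 μ := Lp.memLp u
    have h0 := hA.ae_eq_zero u hu' fun a ha => by
      have h1 := hu _ (Submodule.subset_span ⟨a, ha, rfl⟩)
      rw [← inner_eq hu' (hA.memLp a ha), Lp.toLp_coeFn]
      exact h1
    exact (Lp.eq_zero_iff_ae_eq_zero).2 h0
  set G : ℝ → Lp ℝ 2 μ := fun ε => if h : MemLp (g ε) 2 μ then h.toLp (g ε) - hg₀.toLp g₀ else 0
    with hG
  have hGb : ∀ᶠ ε in l, ‖G ε‖ ≤ |M| + ‖hg₀.toLp g₀‖ := by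
    filter_upwards [hg] with ε hε
    simp only [hG, hε.1, dif_pos]
    refine (norm_sub_le _ _).trans ?_
    gcongr
    rw [Lp.norm_toLp]
    refine ENNReal.toReal_le_of_le_ofReal (abs_nonneg _) (hε.2.trans ?_)
    exact ENNReal.ofReal_le_ofReal (le_abs_self _)
  have hGi : ∀ {w : Y → ℝ} (hw : MemLp w 2 μ), ∀ᶠ ε in l,
      inner ℝ (G ε) (hw.toLp w) = ∫ z, g ε z * w z ∂μ - ∫ z, g₀ z * w z ∂μ := by
    intro w hw
    filter_upwards [hg] with ε hε
    simp only [hG, hε.1, dif_pos]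
    rw [inner_sub_left, inner_eq, inner_eq]
  have hspan : ∀ s ∈ S, Tendsto (fun ε => inner ℝ (G ε) s) l (𝓝 0) := by
    intro s hs
    induction hs using Submodule.span_induction with
    | mem x hx =>
      obtain ⟨a, ha, rfl⟩ := hx
      have := tendsto_sub_nhds_zero_iff.2 (hlim a ha)
      refine this.congr' ?_
      filter_upwards [hGi (hA.memLp a ha)] with ε hε using hε.symm
    | zero => simpa using tendsto_const_nhds
    | add x y _ _ hx hy => simpa [inner_add_right] using hx.add hy
    | smul c x _ hx => simpa [inner_smul_right] using hx.const_mul c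
  rw [← tendsto_sub_nhds_zero_iff]
  suffices h : Tendsto (fun ε => inner ℝ (G ε) (hφ.toLp φ)) l (𝓝 0) from
    h.congr' (hGi hφ)
  rw [Metric.tendsto_nhds]
  intro δ hδ
  set B := |M| + ‖hg₀.toLp g₀‖ + 1 with hB
  have hBpos : 0 < B := by positivity
  have hmem : hφ.toLp φ ∈ closure (S : Set (Lp ℝ 2 μ)) := by
    have : hφ.toLp φ ∈ S.topologicalClosure := by rw [hdense]; trivial
    exact this
  obtain ⟨s, hs, hds⟩ := Metric.mem_closure_iff.1 hmem (δ / (2 * B)) (by positivity)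
  filter_upwards [hGb, Metric.tendsto_nhds.1 (hspan s hs) (δ / 2) (by positivity)] with ε h1 h2
  rw [dist_zero_right, Real.norm_eq_abs] at *
  have h3 : inner ℝ (G ε) (hφ.toLp φ) = inner ℝ (G ε) s + inner ℝ (G ε) (hφ.toLp φ - s) := by
    rw [inner_sub_right]; ring
  have h4 := abs_real_inner_le_norm (G ε) (hφ.toLp φ - s)
  rw [dist_eq_norm] at hds
  have h5 : ‖G ε‖ * ‖hφ.toLp φ - s‖ ≤ B * (δ / (2 * B)) := by
    gcongr
    linarith
  have h6 : B * (δ / (2 * B)) = δ / 2 := by field_simp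
  rw [h3]
  linarith [abs_add_le (inner ℝ (G ε) s) (inner ℝ (G ε) (hφ.toLp φ - s))]

/-- Hölder's inequality for the duality of `L^∞ L²` and `L¹ L²`. -/
theorem lintegral_enorm_mul_le {T : ℝ} {ν : Measure Y} [SFinite ν] {g φ : ℝ × Y → ℝ} {C : ℝ≥0∞}
    (hg : AEStronglyMeasurable g ((volume.restrict (Ioo 0 T)).prod ν))
    (hC : ∀ᵐ t ∂(volume.restrict (Ioo 0 T)), eLpNorm (fun y => g (t, y)) 2 ν ≤ C)
    (hφ : AEStronglyMeasurable φ ((volume.restrict (Ioo 0 T)).prod ν)) :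
    ∫⁻ z, ‖g z * φ z‖ₑ ∂((volume.restrict (Ioo 0 T)).prod ν) ≤
      ∫⁻ t in Ioo 0 T, C * eLpNorm (fun y => φ (t, y)) 2 ν := by
  have hm : AEMeasurable (fun z => ‖g z * φ z‖ₑ) ((volume.restrict (Ioo 0 T)).prod ν) :=
    (hg.mul hφ).enorm
  rw [lintegral_prod _ hm]
  refine lintegral_mono_ae ?_
  filter_upwards [hC, hg.prodMk_left, hφ.prodMk_left] with t h1 h2 h3
  refine le_trans ?_ (mul_le_mul_left h1 _)
  rw [← ENNReal.pow_le_pow_left_iff two_ne_zero, mul_pow, eLpNorm_two_sq, eLpNorm_two_sq]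
  simp_rw [enorm_mul]
  exact sq_lintegral_mul_le ν h2.enorm h3.enorm

/-- A family that is bounded in `L^∞(0,T; L²(ν))` converges weakly-* as soon as it converges
against a total family of `L²((0,T) × ν)`. -/
theorem TendstoWeakStar.of_isTotalL2 {T : ℝ} {ν : Measure Y} [SFinite ν] {𝒜 : Set (ℝ × Y → ℝ)}
    (hA : IsTotalL2 ((volume.restrict (Ioo 0 T)).prod ν) 𝒜)
    {g : ℝ → ℝ × Y → ℝ} {g₀ : ℝ × Y → ℝ} {C : ℝ}
    (hg : ∀ ε : ℝ, 0 < ε → AEStronglyMeasurable (g ε) ((volume.restrict (Ioo 0 T)).prod ν))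
    (hgC : ∀ ε : ℝ, 0 < ε → ∀ᵐ t ∂(volume.restrict (Ioo 0 T)),
      eLpNorm (fun y => g ε (t, y)) 2 ν ≤ ENNReal.ofReal C)
    (hg₀ : MemLinftyL2 T ν g₀)
    (hlim : ∀ φ ∈ 𝒜,
      Tendsto (fun ε : ℝ => ∫ z, g ε z * φ z ∂((volume.restrict (Ioo 0 T)).prod ν))
        (𝓝[>] 0) (𝓝 (∫ z, g₀ z * φ z ∂((volume.restrict (Ioo 0 T)).prod ν)))) :
    TendstoWeakStar T ν g g₀ := by
  refine ⟨fun ε hε => ⟨hg ε hε, C, hgC ε hε⟩, hg₀, fun φ hφ => ?_⟩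
  obtain ⟨C₀, hC₀⟩ := hg₀.2
  set μ := (volume.restrict (Ioo (0 : ℝ) T)).prod ν with hμ
  have pos : ∀ᶠ ε : ℝ in 𝓝[>] 0, 0 < ε := eventually_mem_nhdsWithin
  have hgM : ∀ᶠ ε in 𝓝[>] (0 : ℝ), MemLp (g ε) 2 μ ∧
      eLpNorm (g ε) 2 μ ≤ ENNReal.ofReal (|C| * √|T|) := by
    filter_upwards [pos] with ε hε
    refine ⟨memLp_two_of_ae_eLpNorm_le (hg ε hε) (hgC ε hε), ?_⟩
    rw [eLpNorm_two_le_iff]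
    refine (lintegral_sq_le_of_ae_eLpNorm_le (hg ε hε) (hgC ε hε)).trans ?_
    rw [ENNReal.ofReal_mul (abs_nonneg _), mul_pow, ← ENNReal.ofReal_pow (Real.sqrt_nonneg _),
      Real.sq_sqrt (abs_nonneg _)]
    gcongr <;> exact le_abs_self _
  -- the pairing with square-integrable functions
  have hL2 : ∀ {φ : ℝ × Y → ℝ}, MemLp φ 2 μ →
      Tendsto (fun ε : ℝ => ∫ z, g ε z * φ z ∂μ) (𝓝[>] 0) (𝓝 (∫ z, g₀ z * φ z ∂μ)) :=
    fun hφ => tendsto_integral_mul_of_isTotalL2 hA hgM (memLp_two_of_ae_eLpNorm_le hg₀.1 hC₀)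
      hlim hφ
  -- A strongly measurable representative makes the norm of the time slices a measurable function of
  -- t, so that truncation at a level of this norm is possible.
  set ψ := hφ.1.mk φ with hψ
  have hψm : StronglyMeasurable ψ := hφ.1.stronglyMeasurable_mk
  have hψe : φ =ᵐ[μ] ψ := hφ.1.ae_eq_mk
  have hcongr : ∀ u : ℝ × Y → ℝ, ∫ z, u z * φ z ∂μ = ∫ z, u z * ψ z ∂μ := by
    intro u
    refine integral_congr_ae ?_
    filter_upwards [hψe] with z hz
    rw [hz]
  simp_rw [hcongr]
  set n : ℝ → ℝ≥0∞ := fun t => eLpNorm (fun y => ψ (t, y)) 2 ν with hn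
  have hnsq : ∀ t, n t ^ 2 = ∫⁻ y, ‖ψ (t, y)‖ₑ ^ 2 ∂ν := fun t => eLpNorm_two_sq _ _
  have hnm : Measurable n := by
    have h1 : Measurable fun t => n t ^ 2 := by
      simp_rw [hnsq]
      exact Measurable.lintegral_prod_right' (hψm.measurable.enorm.pow_const 2)
    have h2 : n = fun t => (n t ^ 2) ^ ((1 : ℝ) / 2) := by
      ext t
      rw [← ENNReal.rpow_natCast, ← ENNReal.rpow_mul]
      norm_num
    rw [h2]
    exact h1.pow_const _
  have hnfin : ∫⁻ t in Ioo 0 T, n t < ⊤ := by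
    refine lt_of_eq_of_lt (lintegral_congr_ae ?_) hφ.2
    filter_upwards [Measure.ae_ae_of_ae_prod hψe] with t ht
    exact (eLpNorm_congr_ae ht).symm
  -- An element of L¹(0,T; L²) need not be square integrable in time. Discarding the times at which
  -- its slice norm exceeds k leaves an element of L^∞(0,T; L²), hence of L² of the product, and the
  -- discarded part is small in L¹(0,T; L²).
  set ψk : ℕ → ℝ × Y → ℝ := fun k z => if n z.1 ≤ k then ψ z else 0 with hψk
  have hset : ∀ k : ℕ, MeasurableSet {z : ℝ × Y | n z.1 ≤ k} := fun k =>
    measurableSet_le (hnm.comp measurable_fst) measurable_const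
  have hψkm : ∀ k, StronglyMeasurable (ψk k) := fun k =>
    StronglyMeasurable.ite (hset k) hψm stronglyMeasurable_const
  have hψk2 : ∀ k, MemLp (ψk k) 2 μ := by
    intro k
    refine memLp_two_of_ae_eLpNorm_le (C := k) (hψkm k).aestronglyMeasurable ?_
    refine Eventually.of_forall fun t => ?_
    by_cases h : n t ≤ k
    · have e : (fun y => ψk k (t, y)) = fun y => ψ (t, y) := funext fun y => if_pos h
      rw [e, ENNReal.ofReal_natCast]
      exact h
    · have e : (fun y => ψk k (t, y)) = 0 := funext fun y => if_neg h
      simp [e]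
  set tail : ℕ → ℝ≥0∞ := fun k => ∫⁻ t in Ioo 0 T, if n t ≤ k then 0 else n t with htail
  have htail0 : Tendsto tail atTop (𝓝 0) := by
    have h1 := tendsto_lintegral_of_dominated_convergence (μ := volume.restrict (Ioo 0 T))
      (F := fun (k : ℕ) t => if n t ≤ k then 0 else n t) (f := fun _ => 0) n
      (fun k => Measurable.ite (measurableSet_le hnm measurable_const) measurable_const hnm)
      (fun k => Eventually.of_forall fun t => by dsimp only; split_ifs <;> simp) hnfin.ne ?_
    · simpa using h1
    · filter_upwards [ae_lt_top hnm hnfin.ne] with t ht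
      obtain ⟨k, hk⟩ := ENNReal.exists_nat_gt ht.ne
      refine tendsto_const_nhds.congr' ?_
      filter_upwards [eventually_ge_atTop k] with j hj
      rw [if_pos]
      exact hk.le.trans (by exact_mod_cast hj)
  -- The truncation error depends on u only through its bound c, hence is uniform in ε and also
  -- applies to the limit.
  have hbound : ∀ {u : ℝ × Y → ℝ} {c : ℝ}, AEStronglyMeasurable u μ →
      (∀ᵐ t ∂(volume.restrict (Ioo 0 T)), eLpNorm (fun y => u (t, y)) 2 ν ≤ ENNReal.ofReal c) →
      ∀ k, ‖∫ z, u z * ψ z ∂μ - ∫ z, u z * ψk k z ∂μ‖ₑ ≤ ENNReal.ofReal c * tail k := by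
    intro u c hu hc k
    have i1 : Integrable (fun z => u z * ψ z) μ := by
      refine ⟨hu.mul hψm.aestronglyMeasurable, ?_⟩
      refine (lintegral_enorm_mul_le hu hc hψm.aestronglyMeasurable).trans_lt ?_
      rw [lintegral_const_mul _ hnm]
      exact ENNReal.mul_lt_top ENNReal.ofReal_lt_top hnfin
    have i2 : Integrable (fun z => u z * ψk k z) μ :=
      (memLp_two_of_ae_eLpNorm_le hu hc).integrable_mul (hψk2 k)
    rw [← integral_sub i1 i2]
    refine (enorm_integral_le_lintegral_enorm _).trans ?_
    simp_rw [← mul_sub]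
    refine (lintegral_enorm_mul_le hu hc
      (hψm.sub (hψkm k)).aestronglyMeasurable).trans (le_of_eq ?_)
    rw [htail, ← lintegral_const_mul _ (Measurable.ite (measurableSet_le hnm measurable_const)
      measurable_const hnm)]
    refine lintegral_congr fun t => ?_
    congr 1
    by_cases h : n t ≤ k
    · have e : (fun y => (ψ - ψk k) (t, y)) = 0 := funext fun y => by
        simp [hψk, if_pos h]
      rw [if_pos h, e, eLpNorm_zero]
    · have e : (fun y => (ψ - ψk k) (t, y)) = fun y => ψ (t, y) := funext fun y => by
        simp [hψk, if_neg h]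
      rw [if_neg h, e]
  rw [← tendsto_sub_nhds_zero_iff, Metric.tendsto_nhds]
  intro δ hδ
  have hsum : Tendsto (fun k => ENNReal.ofReal C * tail k + ENNReal.ofReal C₀ * tail k) atTop
      (𝓝 0) := by
    have h1 := ENNReal.Tendsto.const_mul (a := ENNReal.ofReal C) htail0
      (Or.inr ENNReal.ofReal_ne_top)
    have h2 := ENNReal.Tendsto.const_mul (a := ENNReal.ofReal C₀) htail0
      (Or.inr ENNReal.ofReal_ne_top)
    simpa using h1.add h2
  obtain ⟨k, hk⟩ := ((tendsto_order.1 hsum).2 (ENNReal.ofReal (δ / 2)) (by simpa using hδ)).exists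
  filter_upwards [pos, Metric.tendsto_nhds.1 (tendsto_sub_nhds_zero_iff.2 (hL2 (hψk2 k))) (δ / 2)
    (by positivity)] with ε hε h2
  rw [dist_zero_right] at *
  have e1 := hbound (hg ε hε) (hgC ε hε) k
  have e2 := hbound hg₀.1 hC₀ k
  have e3 : ‖(∫ z, g ε z * ψ z ∂μ - ∫ z, g ε z * ψk k z ∂μ)‖ +
      ‖(∫ z, g₀ z * ψ z ∂μ - ∫ z, g₀ z * ψk k z ∂μ)‖ < δ / 2 := by
    rw [← ENNReal.ofReal_lt_ofReal_iff (by positivity),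
      ENNReal.ofReal_add (norm_nonneg _) (norm_nonneg _), ofReal_norm,
      ofReal_norm]
    exact (add_le_add e1 e2).trans_lt hk
  calc ‖∫ z, g ε z * ψ z ∂μ - ∫ z, g₀ z * ψ z ∂μ‖ = ‖(∫ z, g ε z * ψ z ∂μ - ∫ z, g ε z * ψk k z ∂μ)
        + (∫ z, g ε z * ψk k z ∂μ - ∫ z, g₀ z * ψk k z ∂μ)
        - (∫ z, g₀ z * ψ z ∂μ - ∫ z, g₀ z * ψk k z ∂μ)‖ := by congr 1; ring
    _ ≤ ‖∫ z, g ε z * ψ z ∂μ - ∫ z, g ε z * ψk k z ∂μ‖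
        + ‖∫ z, g ε z * ψk k z ∂μ - ∫ z, g₀ z * ψk k z ∂μ‖
        + ‖∫ z, g₀ z * ψ z ∂μ - ∫ z, g₀ z * ψk k z ∂μ‖ :=
      (norm_sub_le _ _).trans (by gcongr; exact norm_add_le _ _)
    _ < δ := by linarith

end WeakStar

/-! ### Smooth compactly supported functions as a total family -/

section Families

/-- Smooth functions with compact support in an open set. -/
def testFunctions {E : Type*} [NormedAddCommGroup E] [NormedSpace ℝ E] (U : Set E) :
    Set (E → ℝ) :=
  {a | ContDiff ℝ ∞ a ∧ HasCompactSupport a ∧ tsupport a ⊆ U}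

/-- Square integrability implies local integrability for a locally finite measure, so this is the
fundamental lemma of the calculus of variations. -/
theorem isTotalL2_testFunctions {E : Type*} [NormedAddCommGroup E] [NormedSpace ℝ E]
    [FiniteDimensional ℝ E] [MeasurableSpace E] [BorelSpace E] (μ : Measure E)
    [IsLocallyFiniteMeasure μ] {U : Set E} (hU : IsOpen U) :
    IsTotalL2 (μ.restrict U) (testFunctions U) := by
  constructor
  · rintro a ⟨h1, h2, -⟩
    exact (h1.continuous.memLp_of_hasCompactSupport h2).restrict U
  · intro h hh h0
    have hl : LocallyIntegrableOn h U μ := by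
      intro x hx
      obtain ⟨s, hs, hf⟩ := (μ.finiteAt_nhdsWithin x U)
      refine ⟨s ∩ U, Filter.inter_mem hs self_mem_nhdsWithin, ?_⟩
      have : IsFiniteMeasure (μ.restrict (s ∩ U)) :=
        ⟨by simpa using (measure_mono inter_subset_left).trans_lt hf⟩
      exact (hh.mono_measure (Measure.restrict_mono inter_subset_right le_rfl)).integrable
        (by norm_num)
    have := hU.ae_eq_zero_of_integral_contDiff_smul_eq_zero hl fun g h1 h2 h3 => by
      rw [← h0 g ⟨h1, h2, h3⟩]
      simp_rw [smul_eq_mul, mul_comm (g _)]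
      symm
      refine setIntegral_eq_integral_of_forall_compl_eq_zero fun x hx => ?_
      rw [image_eq_zero_of_notMem_tsupport fun hx' => hx (h3 hx'), mul_zero]
    rw [EventuallyEq, ae_restrict_iff' hU.measurableSet]
    exact this

end Families

end FractionalDiffusion

namespace FractionalDiffusion

/-! ### Weak linear equations in the time variable -/

section WeakODE

variable {E : Type*} [NormedAddCommGroup E] [NormedSpace ℝ E]

theorem setIntegral_Ioo_indicator_Iio {T t : ℝ} (ht : t ≤ T) (w : ℝ → E) :
    ∫ s in Ioo 0 T, (Iio t).indicator w s = ∫ s in Ioo 0 t, w s := by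
  rw [setIntegral_indicator measurableSet_Iio]
  congr 2
  ext s
  simp only [mem_inter_iff, mem_Ioo, mem_Iio]
  constructor
  · rintro ⟨⟨h1, h2⟩, h3⟩; exact ⟨h1, h3⟩
  · rintro ⟨h1, h2⟩; exact ⟨⟨h1, h2.trans_le ht⟩, h2⟩

/-- A weak solution of `v' = w`, `v(0) = c` on `[0,T)` is given by the integral formula. -/
theorem ae_eq_add_setIntegral_of_weak [CompleteSpace E] {T : ℝ} (hT : 0 < T) {v w : ℝ → E} {c : E}
    (hv : IntegrableOn v (Ioo 0 T)) (hw : IntegrableOn w (Ioo 0 T))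
    (h : ∀ χ : ℝ → ℝ, ContDiff ℝ ∞ χ → HasCompactSupport χ → (∀ t, T ≤ t → χ t = 0) →
      (∫ t in Ioo 0 T, (deriv χ t • v t + χ t • w t)) + χ 0 • c = 0) :
    ∀ᵐ t ∂(volume.restrict (Ioo 0 T)), v t = c + ∫ s in Ioo 0 t, w s := by
  -- The primitive is written over the fixed interval (0,T), with the upper limit as an indicator,
  -- so that Fubini applies on a product measure.
  set W : ℝ → E := fun s => ∫ t in Ioo 0 T, (Iio s).indicator w t with hW
  have hms : MeasurableSet {p : ℝ × ℝ | p.2 < p.1} := measurableSet_lt measurable_snd measurable_fst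
  have hKi : ∀ η : ℝ → ℝ, IntegrableOn η (Ioo 0 T) →
      Integrable (fun p : ℝ × ℝ => η p.1 • (Iio p.1).indicator w p.2)
        ((volume.restrict (Ioo 0 T)).prod (volume.restrict (Ioo 0 T))) := by
    intro η hη
    refine ((hη.smul_prod hw).indicator hms).congr (Eventually.of_forall fun p => ?_)
    by_cases hp : p.2 < p.1
    · simp [indicator, hp]
    · simp [indicator, hp]
  have hWi : IntegrableOn W (Ioo 0 T) := by
    have := (hKi (fun _ => 1) (integrable_const _)).integral_prod_left
    simp only [one_smul] at this
    exact this
  have key : ∀ᵐ t : ℝ, t ∈ Ioo 0 T → v t - c - W t = 0 := by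
    refine isOpen_Ioo.ae_eq_zero_of_integral_contDiff_smul_eq_zero ?_ ?_
    · exact ((hv.sub (integrableOn_const (by simp))).sub hWi).locallyIntegrableOn
    intro η h1 h2 h3
    have hηc : Continuous η := h1.continuous
    have hη0 : ∀ t, t ∉ Ioo 0 T → η t = 0 := fun t ht =>
      image_eq_zero_of_notMem_tsupport fun h => ht (h3 h)
    set H : ℝ → ℝ := fun t => ∫ s in (0 : ℝ)..t, η s with hH
    have hHd : ∀ t, HasDerivAt H (η t) t := fun t =>
      intervalIntegral.integral_hasDerivAt_right (hηc.intervalIntegrable _ _)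
        (hηc.stronglyMeasurableAtFilter _ _) hηc.continuousAt
    have hHderiv : deriv H = η := funext fun t => (hHd t).deriv
    have hHs : ContDiff ℝ ∞ H := by
      rw [contDiff_infty_iff_deriv]
      exact ⟨fun t => (hHd t).differentiableAt, by rw [hHderiv]; exact h1⟩
    have hH0 : ∀ t ≤ 0, H t = 0 := by
      intro t ht
      simp only [hH]
      rw [intervalIntegral.integral_symm, intervalIntegral.integral_of_le ht,
        setIntegral_eq_zero_of_forall_eq_zero, neg_zero]
      exact fun s hs => hη0 s fun hs' => absurd hs.2 (not_le.2 hs'.1)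
    have hHT : ∀ t, T ≤ t → H t = H T := by
      intro t ht
      have := intervalIntegral.integral_interval_sub_left (μ := volume)
        (hηc.intervalIntegrable 0 t) (hηc.intervalIntegrable 0 T)
      have h0 : ∫ s in T..t, η s = 0 := by
        rw [intervalIntegral.integral_of_le ht, setIntegral_eq_zero_of_forall_eq_zero]
        exact fun s hs => hη0 s fun hs' => absurd hs.1 (not_lt.2 hs'.2.le)
      rw [h0] at this
      exact sub_eq_zero.1 this
    -- The primitive H of η is 0 before 0 and constant after T. This difference therefore has
    -- compact support, vanishes from T on, and equals H(T) - H(t) on [0,T]. There its derivative is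
    -- -η and its value at 0 is the integral of η, so the weak equation tests v - c - W against η.
    set χ : ℝ → ℝ := fun t => H (t + T) - H t with hχ
    have hχs : ContDiff ℝ ∞ χ := (hHs.comp (contDiff_id.add contDiff_const)).sub hHs
    have hχT : ∀ t, T ≤ t → χ t = 0 := fun t ht => by
      simp only [hχ]; rw [hHT t ht, hHT (t + T) (by linarith), sub_self]
    have hχc : HasCompactSupport χ := by
      refine HasCompactSupport.intro (isCompact_Icc (a := -T) (b := T)) fun t ht => ?_
      by_cases h : T ≤ t
      · exact hχT t h
      · have : t < -T := by
          by_contra h'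
          exact ht ⟨not_lt.1 h', (not_le.1 h).le⟩
        simp only [hχ]
        rw [hH0 _ (by linarith), hH0 _ (by linarith), sub_self]
    have hmain := h χ hχs hχc hχT
    have hχ0 : χ 0 = H T := by simp only [hχ]; rw [hH0 0 le_rfl]; simp
    have hχd : ∀ t ∈ Ioo 0 T, deriv χ t = -η t := by
      intro t ht
      have : HasDerivAt χ (η (t + T) - η t) t := ((hHd (t + T)).comp_add_const t T).sub (hHd t)
      rw [this.deriv, hη0 (t + T) (fun h => by linarith [h.2, ht.1]), zero_sub]
    have hHT' : H T = ∫ s in Ioo 0 T, η s := by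
      simp only [hH]
      rw [intervalIntegral.integral_of_le hT.le, integral_Ioc_eq_integral_Ioo]
    have hχt : ∀ t ∈ Ioo 0 T, χ t = ∫ s in Ioo 0 T, (Ioi t).indicator η s := by
      intro t ht
      simp only [hχ]
      rw [hHT _ (by linarith [ht.1])]
      have := intervalIntegral.integral_interval_sub_left (μ := volume)
        (hηc.intervalIntegrable 0 T) (hηc.intervalIntegrable 0 t)
      simp only [hH]
      rw [this, intervalIntegral.integral_of_le ht.2.le, setIntegral_indicator measurableSet_Ioi,
        integral_Ioc_eq_integral_Ioo]
      congr 2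
      ext s
      simp only [mem_inter_iff, mem_Ioo, mem_Ioi]
      constructor
      · rintro ⟨a, b⟩; exact ⟨⟨ht.1.trans a, b⟩, a⟩
      · rintro ⟨⟨a, b⟩, d⟩; exact ⟨d, b⟩
    have hηi : IntegrableOn η (Ioo 0 T) := (hηc.integrable_of_hasCompactSupport h2).integrableOn
    have i1 : IntegrableOn (fun t => η t • v t) (Ioo 0 T) := by
      obtain ⟨C, hC⟩ := hηc.bounded_above_of_compact_support h2
      exact hv.bdd_smul C hηc.aestronglyMeasurable (Eventually.of_forall hC)
    have i2 : IntegrableOn (fun t => η t • W t) (Ioo 0 T) := by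
      obtain ⟨C, hC⟩ := hηc.bounded_above_of_compact_support h2
      exact hWi.bdd_smul C hηc.aestronglyMeasurable (Eventually.of_forall hC)
    have hF : ∫ t in Ioo 0 T, χ t • w t = ∫ s in Ioo 0 T, η s • W s := by
      have hsw := integral_integral_swap (f := fun s t => η s • (Iio s).indicator w t) (hKi η hηi)
      simp_rw [hW, ← integral_smul]
      rw [hsw]
      refine setIntegral_congr_fun measurableSet_Ioo fun t ht => ?_
      rw [hχt t ht, ← integral_smul_const]
      congr 1
      ext s
      by_cases hs : t < s <;> simp [indicator, hs]
    have i3 : IntegrableOn (fun t => χ t • w t) (Ioo 0 T) := by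
      obtain ⟨C, hC⟩ := hχs.continuous.bounded_above_of_compact_support hχc
      exact hw.bdd_smul C hχs.continuous.aestronglyMeasurable (Eventually.of_forall hC)
    have h5 : ∫ t in Ioo 0 T, (deriv χ t • v t + χ t • w t) =
        -(∫ t in Ioo 0 T, η t • v t) + ∫ s in Ioo 0 T, η s • W s := by
      rw [← hF, ← integral_neg, ← integral_add (f := fun t => -(η t • v t)) i1.neg i3]
      refine setIntegral_congr_fun measurableSet_Ioo fun t ht => ?_
      simp only [hχd t ht, neg_smul]
    rw [h5, hχ0, hHT', ← integral_smul_const] at hmain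
    have h6 : ∫ t, η t • (v t - c - W t) = ∫ t in Ioo 0 T, η t • (v t - c - W t) := by
      symm
      refine setIntegral_eq_integral_of_forall_compl_eq_zero fun t ht => ?_
      rw [hη0 t ht, zero_smul]
    rw [h6]
    simp_rw [smul_sub]
    have i4 : IntegrableOn (fun t => η t • c) (Ioo 0 T) := hηi.smul_const c
    rw [integral_sub (f := fun t => η t • v t - η t • c) (i1.sub i4) i2, integral_sub i1 i4]
    rw [← neg_eq_zero, ← hmain]
    abel
  rw [ae_restrict_iff' measurableSet_Ioo]
  filter_upwards [key] with t ht htm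
  have h1 := ht htm
  simp only [hW] at h1
  rw [setIntegral_Ioo_indicator_Iio htm.2.le] at h1
  rw [sub_sub, sub_eq_zero] at h1
  exact h1

end WeakODE

/-! ### The weight F⁻¹ in velocity -/

section Weights

variable {X : Type*} [MeasurableSpace X]

/-- An everywhere positive measurable probability density. -/
structure IsPosDensity (μ : Measure X) (F : X → ℝ) : Prop where
  measurable : Measurable F
  pos : ∀ v, 0 < F v
  integrable : Integrable F μ
  integral_eq_one : ∫ v, F v ∂μ = 1

/-- The measure `F⁻¹ dμ`. -/
noncomputable def velWeight (μ : Measure X) (F : X → ℝ) : Measure X :=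
  μ.withDensity (fun v => ENNReal.ofReal (F v)⁻¹)

variable {μ : Measure X} {F : X → ℝ}

instance [SFinite μ] : SFinite (velWeight μ F) := by unfold velWeight; infer_instance

instance [SigmaFinite μ] : SigmaFinite (velWeight μ F) :=
  SigmaFinite.withDensity_ofReal (fun v => (F v)⁻¹)

theorem IsPosDensity.lintegral_eq_one (hF : IsPosDensity μ F) :
    ∫⁻ v, ENNReal.ofReal (F v) ∂μ = 1 := by
  rw [← ofReal_integral_eq_lintegral_ofReal hF.integrable
    (Eventually.of_forall fun v => (hF.pos v).le), hF.integral_eq_one, ENNReal.ofReal_one]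

theorem velWeight_ac : velWeight μ F ≪ μ := withDensity_absolutelyContinuous _ _

theorem prod_velWeight {Z : Type*} [MeasurableSpace Z] (m : Measure Z) [SFinite m] [SFinite μ]
    (hm : Measurable F) :
    m.prod (velWeight μ F) = velWeight (m.prod μ) (fun z => F z.2) := by
  have h : Measurable fun v => ENNReal.ofReal (F v)⁻¹ := hm.inv.ennreal_ofReal
  unfold velWeight
  rw [prod_withDensity_right h]

theorem measurable_weight (hm : Measurable F) : Measurable fun v => ENNReal.ofReal (F v)⁻¹ := hm.inv.ennreal_ofReal

theorem lintegral_velWeight (hm : Measurable F) (g : X → ℝ≥0∞) :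
    ∫⁻ v, g v ∂(velWeight μ F) = ∫⁻ v, ENNReal.ofReal (F v)⁻¹ * g v ∂μ := by
  unfold velWeight
  rw [lintegral_withDensity_eq_lintegral_mul_non_measurable μ (measurable_weight hm)
    (Eventually.of_forall fun _ => ENNReal.ofReal_lt_top)]
  rfl

/-- The factor F of the test function cancels the weight. Tests of the form cF therefore turn
pairings in L²(F⁻¹) into flat integrals, which is how the weak formulation and the weighted space
communicate throughout. -/
theorem integral_velWeight_mul (hm : Measurable F) (hp : ∀ v, 0 < F v)
    (h c : X → ℝ) :
    ∫ v, h v * (c v * F v) ∂(velWeight μ F) = ∫ v, h v * c v ∂μ := by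
  unfold velWeight
  rw [integral_withDensity_eq_integral_toReal_smul (measurable_weight hm)
    (Eventually.of_forall fun _ => ENNReal.ofReal_lt_top)]
  refine integral_congr_ae (Eventually.of_forall fun v => ?_)
  simp only
  rw [ENNReal.toReal_ofReal (inv_nonneg.2 (hp v).le), smul_eq_mul]
  have := (hp v).ne'
  field_simp

theorem ac_velWeight (hm : Measurable F) (hp : ∀ v, 0 < F v)
    : μ ≪ velWeight μ F :=
  withDensity_absolutelyContinuous' (measurable_weight hm).aemeasurable
    (Eventually.of_forall fun v => by simpa using hp v)

theorem integrable_velWeight_mul_iff (hm : Measurable F) (hp : ∀ v, 0 < F v)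
    {h c : X → ℝ} :
    Integrable (fun v => h v * (c v * F v)) (velWeight μ F) ↔
      Integrable (fun v => h v * c v) μ := by
  unfold velWeight
  rw [integrable_withDensity_iff_integrable_smul' (measurable_weight hm)
    (Eventually.of_forall fun _ => ENNReal.ofReal_lt_top)]
  refine integrable_congr (Eventually.of_forall fun v => ?_)
  simp only [smul_eq_mul]
  rw [ENNReal.toReal_ofReal (inv_nonneg.2 (hp v).le)]
  have := (hp v).ne'
  field_simp

/-- The weighted square of cF is c²F, and F is integrable; no square integrability of F for the flat
measure enters. -/
theorem IsPosDensity.memLp_mul (hF : IsPosDensity μ F) {c : X → ℝ} (hc : Measurable c) {C : ℝ}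
    (hC : ∀ v, ‖c v‖ ≤ C) : MemLp (fun v => c v * F v) 2 (velWeight μ F) := by
  rw [memLp_two_iff]
  refine ⟨(hc.mul hF.measurable).aestronglyMeasurable, ?_⟩
  rw [lintegral_velWeight hF.measurable]
  calc _ ≤ ∫⁻ v, ENNReal.ofReal C ^ 2 * ENNReal.ofReal (F v) ∂μ := by
        refine lintegral_mono fun v => ?_
        have h1 : ‖c v * F v‖ₑ ≤ ENNReal.ofReal C * ENNReal.ofReal (F v) := by
          rw [enorm_mul, Real.enorm_of_nonneg (hF.pos v).le]
          gcongr
          rw [← ofReal_norm]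
          exact ENNReal.ofReal_le_ofReal (hC v)
        calc _ ≤ ENNReal.ofReal (F v)⁻¹ * (ENNReal.ofReal C * ENNReal.ofReal (F v)) ^ 2 := by
              gcongr
          _ = ENNReal.ofReal C ^ 2 * ENNReal.ofReal (F v) *
              (ENNReal.ofReal (F v)⁻¹ * ENNReal.ofReal (F v)) := by ring
          _ = _ := by
            rw [← ENNReal.ofReal_mul (inv_nonneg.2 (hF.pos v).le), inv_mul_cancel₀ (hF.pos v).ne']
            simp
    _ < ⊤ := by
      rw [lintegral_const_mul _ hF.measurable.ennreal_ofReal, hF.lintegral_eq_one]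
      finiteness

theorem IsPosDensity.memLp_self (hF : IsPosDensity μ F) : MemLp F 2 (velWeight μ F) := by
  simpa using hF.memLp_mul (c := fun _ => 1) measurable_const (C := 1) (by simp)

theorem IsPosDensity.integrable_of_memLp (hF : IsPosDensity μ F) {h : X → ℝ}
    (hh : MemLp h 2 (velWeight μ F)) : Integrable h μ := by
  have h1 := hh.integrable_mul hF.memLp_self
  have h2 := (integrable_velWeight_mul_iff (μ := μ) hF.measurable hF.pos (h := h)
    (c := fun _ => 1)).1
  simp only [one_mul, mul_one] at h2
  exact h2 h1

/-- Cauchy–Schwarz for h = (h F^(-1/2)) F^(1/2). As F has mass one the constant is exactly one,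
which the contraction estimate needs. -/
theorem IsPosDensity.sq_enorm_integral_le (hF : IsPosDensity μ F) {h : X → ℝ}
    (hh : AEMeasurable h μ) :
    ‖∫ v, h v ∂μ‖ₑ ^ 2 ≤ ∫⁻ v, ‖h v‖ₑ ^ 2 ∂(velWeight μ F) := by
  have e : ∀ v, ‖h v‖ₑ = ENNReal.ofReal (F v)⁻¹ * (‖h v‖ₑ * ENNReal.ofReal (F v)) := fun v => by
    rw [mul_left_comm, ← ENNReal.ofReal_mul (inv_nonneg.2 (hF.pos v).le),
      inv_mul_cancel₀ (hF.pos v).ne']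
    simp
  have e1 : ∫⁻ v, ‖h v‖ₑ ∂μ = ∫⁻ v, ‖h v‖ₑ * ENNReal.ofReal (F v) ∂(velWeight μ F) := by
    rw [lintegral_velWeight hF.measurable]
    exact lintegral_congr e
  have e2 : ∫⁻ v, ENNReal.ofReal (F v) ^ 2 ∂(velWeight μ F) = 1 := by
    rw [lintegral_velWeight hF.measurable, ← hF.lintegral_eq_one]
    refine lintegral_congr fun v => ?_
    rw [sq, ← mul_assoc, ← ENNReal.ofReal_mul (inv_nonneg.2 (hF.pos v).le),
      inv_mul_cancel₀ (hF.pos v).ne']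
    simp
  calc ‖∫ v, h v ∂μ‖ₑ ^ 2 ≤ (∫⁻ v, ‖h v‖ₑ ∂μ) ^ 2 :=
        pow_le_pow_left' (enorm_integral_le_lintegral_enorm _) 2
    _ ≤ _ := by
      rw [e1]
      refine (sq_lintegral_mul_le _ ((hh.mono_ac velWeight_ac).enorm)
        hF.measurable.ennreal_ofReal.aemeasurable).trans ?_
      rw [e2, mul_one]

/-- The density `∫ g dv` of a function in `L²(F⁻¹)` is square integrable. -/
theorem IsPosDensity.memLp_integral (hF : IsPosDensity μ F) [SFinite μ] {Z : Type*}
    [MeasurableSpace Z] {m : Measure Z} [SFinite m] {g : Z × X → ℝ}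
    (hg : MemLp g 2 (m.prod (velWeight μ F))) : MemLp (fun z => ∫ v, g (z, v) ∂μ) 2 m := by
  have h1 : MemLp (fun z : X × Z => g z.swap) 2 ((velWeight μ F).prod m) :=
    hg.comp_measurePreserving Measure.measurePreserving_swap
  have h2 := h1.integral_mul_left_two hF.memLp_self
  convert h2 using 2 with z
  have := integral_velWeight_mul (μ := μ) hF.measurable hF.pos (fun v => g (z, v)) (fun _ => 1)
  simpa using this.symm

end Weights

/-- Orthogonality to cF with the weight is orthogonality to c without it, and elements of L²(F⁻¹)
are integrable because F itself belongs to this space. -/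
theorem IsPosDensity.isTotalL2 {E : Type*} [NormedAddCommGroup E] [NormedSpace ℝ E]
    [FiniteDimensional ℝ E] [MeasurableSpace E] [BorelSpace E] {μ : Measure E}
    [IsLocallyFiniteMeasure μ] {F : E → ℝ} (hF : IsPosDensity μ F) :
    IsTotalL2 (velWeight μ F)
      {φ | ∃ c ∈ testFunctions (univ : Set E), φ = fun v => c v * F v} := by
  constructor
  · rintro _ ⟨c, ⟨h1, h2, -⟩, rfl⟩
    obtain ⟨C, hC⟩ := h1.continuous.bounded_above_of_compact_support h2
    exact hF.memLp_mul h1.continuous.measurable hC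
  · intro h hh h0
    refine velWeight_ac (F := F).ae_eq ?_
    refine ae_eq_zero_of_integral_contDiff_smul_eq_zero
      (hF.integrable_of_memLp hh).locallyIntegrable fun g h1 h2 => ?_
    have := h0 _ ⟨g, ⟨h1, h2, subset_univ _⟩, rfl⟩
    rw [integral_velWeight_mul hF.measurable hF.pos] at this
    rw [← this]
    simp_rw [smul_eq_mul, mul_comm]

theorem invWeight_eq_prod {N : ℕ} {F : Space N → ℝ} (hF : Measurable F) :
    invWeight F = volume.prod (velWeight volume F) := by
  unfold invWeight velWeight
  have h : Measurable fun v => ENNReal.ofReal (F v)⁻¹ := hF.inv.ennreal_ofReal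
  rw [prod_withDensity_right h]
  rfl

end FractionalDiffusion

namespace FractionalDiffusion

/-! ### Free transport preserves measures -/

section Shear

variable {X : Type*} [NormedAddCommGroup X] [NormedSpace ℝ X] [MeasurableSpace X] [BorelSpace X]
  [SecondCountableTopology X]

/-- The free transport `(x, v) ↦ (x + τ v, v)`. -/
def shear (τ : ℝ) : X × X ≃ᵐ X × X where
  toFun y := (y.1 + τ • y.2, y.2)
  invFun y := (y.1 - τ • y.2, y.2)
  left_inv y := by simp
  right_inv y := by simp
  measurable_toFun := by simp only [Equiv.coe_fn_mk]; fun_prop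
  measurable_invFun := by simp only [Equiv.coe_fn_symm_mk]; fun_prop

/-- The free transport `(t, x, v) ↦ (t, x + t β v, v)`. -/
def timeShear (β : ℝ) : ℝ × X × X ≃ᵐ ℝ × X × X where
  toFun z := (z.1, z.2.1 + (β * z.1) • z.2.2, z.2.2)
  invFun z := (z.1, z.2.1 - (β * z.1) • z.2.2, z.2.2)
  left_inv z := by simp
  right_inv z := by simp
  measurable_toFun := by simp only [Equiv.coe_fn_mk]; fun_prop
  measurable_invFun := by simp only [Equiv.coe_fn_symm_mk]; fun_prop

theorem shear_apply (τ : ℝ) (y : X × X) : shear τ y = (y.1 + τ • y.2, y.2) := rfl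

theorem timeShear_apply (β : ℝ) (z : ℝ × X × X) :
    timeShear β z = (z.1, z.2.1 + (β * z.1) • z.2.2, z.2.2) := rfl

theorem timeShear_mk (β t : ℝ) (y : X × X) : timeShear β (t, y) = (t, shear (β * t) y) := rfl

variable (μ : Measure X) [SFinite μ] [μ.IsAddRightInvariant] (ν : Measure X) [SFinite ν]

/-- At fixed velocity the map is a translation in x, and velocities do not move, so the velocity
measure is arbitrary. Both the flat measure and the weight F⁻¹ are needed. -/
theorem measurePreserving_shear (τ : ℝ) :
    MeasurePreserving (shear τ : X × X → X × X) (μ.prod ν) (μ.prod ν) := by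
  have h : MeasurePreserving (fun p : X × X => (p.1, p.2 + τ • p.1)) (ν.prod μ) (ν.prod μ) :=
    (MeasurePreserving.id ν).skew_product (g := fun v x => x + τ • v) (by
      simp only [Function.uncurry_def]; fun_prop)
      (Eventually.of_forall fun v => (measurePreserving_add_right μ (τ • v)).map_eq)
  exact (Measure.measurePreserving_swap.comp h).comp Measure.measurePreserving_swap

theorem measurePreserving_timeShear (m : Measure ℝ) [SFinite m] (β : ℝ) :
    MeasurePreserving (timeShear β : ℝ × X × X → ℝ × X × X) (m.prod (μ.prod ν))
      (m.prod (μ.prod ν)) :=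
  (MeasurePreserving.id m).skew_product (g := fun t y => shear (β * t) y) (by
      simp only [Function.uncurry_def, shear_apply]; fun_prop)
      (Eventually.of_forall fun t => (measurePreserving_shear μ ν (β * t)).map_eq)

end Shear

/-! ### Test functions carried by the characteristics -/

section Characteristics

variable {N : ℕ}

/-- The point x - (ε/θ) t v is constant in the direction (θ, εv, 0), so only the time factor is
differentiated. The exponential is chosen so that the term with χ cancels the loss term -f of the
collision operator. -/
theorem fderiv_transport_test {θ ε : ℝ} (hθ : θ ≠ 0) {χ : ℝ → ℝ} {a c : Space N → ℝ}
    (hχ : ContDiff ℝ ∞ χ) (ha : ContDiff ℝ ∞ a) (hc : ContDiff ℝ ∞ c) (z : ℝ × Space N × Space N) :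
    θ * fderiv ℝ (fun z : ℝ × Space N × Space N => Real.exp (z.1 / θ) * χ z.1 *
        (a (z.2.1 - (ε / θ * z.1) • z.2.2) * c z.2.2)) z (1, 0, 0) +
      ε * fderiv ℝ (fun z : ℝ × Space N × Space N => Real.exp (z.1 / θ) * χ z.1 *
        (a (z.2.1 - (ε / θ * z.1) • z.2.2) * c z.2.2)) z (0, z.2.2, 0) =
      Real.exp (z.1 / θ) * (χ z.1 + θ * deriv χ z.1) *
        (a (z.2.1 - (ε / θ * z.1) • z.2.2) * c z.2.2) := by
  set φ : ℝ × Space N × Space N → ℝ := fun z => Real.exp (z.1 / θ) * χ z.1 *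
        (a (z.2.1 - (ε / θ * z.1) • z.2.2) * c z.2.2) with hφ
  have hd : DifferentiableAt ℝ φ z := by
    have h1 : ContDiff ℝ ∞ φ := by fun_prop
    exact h1.differentiable (by simp) z
  obtain ⟨t, x, v⟩ := z
  -- The two partial derivatives are computed together, as one derivative along a characteristic
  -- line.
  have hline : HasDerivAt (fun s : ℝ => ((t, x, v) : ℝ × Space N × Space N) + s • (θ, ε • v, 0))
      (θ, ε • v, 0) 0 := by
    have := ((hasDerivAt_id (0 : ℝ)).smul_const
      ((θ, ε • v, 0) : ℝ × Space N × Space N)).const_add ((t, x, v) : ℝ × Space N × Space N)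
    simpa using this
  have h1 : HasDerivAt (fun s : ℝ => φ ((t, x, v) + s • (θ, ε • v, 0)))
      (fderiv ℝ φ (t, x, v) (θ, ε • v, 0)) 0 := by
    have h := hd.hasFDerivAt
    have h' : HasFDerivAt φ (fderiv ℝ φ (t, x, v))
      (((t, x, v) : ℝ × Space N × Space N) + (0 : ℝ) • (θ, ε • v, 0)) := by simpa using h
    exact h'.comp_hasDerivAt 0 hline
  have h2 : ∀ s : ℝ, φ ((t, x, v) + s • (θ, ε • v, 0)) =
      Real.exp ((t + s * θ) / θ) * χ (t + s * θ) * (a (x - (ε / θ * t) • v) * c v) := by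
    intro s
    simp only [hφ, Prod.fst_add, Prod.snd_add, Prod.smul_fst, Prod.smul_snd, smul_eq_mul,
      smul_zero, add_zero]
    congr 3
    rw [smul_smul, sub_eq_sub_iff_add_eq_add, add_right_comm, add_assoc,
      add_right_inj, ← add_smul]
    congr 1
    field_simp
  have h3 : HasDerivAt (fun s : ℝ => Real.exp ((t + s * θ) / θ) * χ (t + s * θ) *
      (a (x - (ε / θ * t) • v) * c v))
      (Real.exp (t / θ) * (χ t + θ * deriv χ t) * (a (x - (ε / θ * t) • v) * c v)) 0 := by
    refine HasDerivAt.mul_const ?_ _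
    have hl : HasDerivAt (fun s : ℝ => t + s * θ) θ 0 := by
      simpa using ((hasDerivAt_id (0 : ℝ)).mul_const θ).const_add t
    have hl2 : HasDerivAt (fun s : ℝ => (t + s * θ) / θ) 1 0 := by
      simpa [hθ] using hl.div_const θ
    have he := hl2.exp
    have hχd : HasDerivAt χ (deriv χ t) (t + 0 * θ) := by
      simpa using (hχ.differentiable (by simp) t).hasDerivAt
    have hc := HasDerivAt.comp (0 : ℝ) hχd hl
    have := he.mul hc
    refine this.congr_deriv ?_
    simp only [Function.comp_apply, zero_mul, add_zero, mul_one]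
    ring
  have h4 : fderiv ℝ φ (t, x, v) (θ, ε • v, 0) = _ :=
    h1.unique (h3.congr_of_eventuallyEq (Eventually.of_forall h2))
  rw [← h4]
  have e : ((θ, ε • v, 0) : ℝ × Space N × Space N) = θ • (1, 0, 0) + ε • (0, v, 0) := by
    simp
  rw [e, map_add, map_smul, map_smul]
  rfl

theorem hasCompactSupport_transport_test {θ β : ℝ} {χ : ℝ → ℝ} {a c : Space N → ℝ}
    (hχ : HasCompactSupport χ) (ha : HasCompactSupport a) (hc : HasCompactSupport c) :
    HasCompactSupport (fun z : ℝ × Space N × Space N => Real.exp (z.1 / θ) * χ z.1 *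
        (a (z.2.1 - (β * z.1) • z.2.2) * c z.2.2)) := by
  have hK : IsCompact ((fun z : ℝ × Space N × Space N =>
      (z.1, z.2.1 + (β * z.1) • z.2.2, z.2.2)) '' (tsupport χ ×ˢ (tsupport a ×ˢ tsupport c))) := by
    refine (hχ.isCompact.prod (ha.isCompact.prod hc.isCompact)).image ?_
    fun_prop
  refine HasCompactSupport.intro hK fun z hz => ?_
  by_contra h
  refine hz ⟨(z.1, z.2.1 - (β * z.1) • z.2.2, z.2.2), ⟨?_, ?_, ?_⟩, by simp⟩
  · by_contra h'; exact h (by simp [image_eq_zero_of_notMem_tsupport h'])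
  · by_contra h'; exact h (by simp [image_eq_zero_of_notMem_tsupport h'])
  · by_contra h'; exact h (by simp [image_eq_zero_of_notMem_tsupport h'])

/-- At the endpoint T only values on the right are known to vanish; a right derivative already
determines the derivative. -/
theorem deriv_eq_zero_of_eq_zero_on_Ici {χ : ℝ → ℝ} {T : ℝ} (hχ : ContDiff ℝ ∞ χ)
    (h : ∀ t, T ≤ t → χ t = 0) {t : ℝ} (ht : T ≤ t) : deriv χ t = 0 := by
  have h1 : HasDerivWithinAt χ (deriv χ t) (Ici t) t :=
    (hχ.differentiable (by simp) t).hasDerivAt.hasDerivWithinAt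
  have h2 : HasDerivWithinAt χ 0 (Ici t) t :=
    (hasDerivWithinAt_const t (Ici t) (0 : ℝ)).congr (fun s hs => h s (ht.trans hs)) (h t ht)
  exact (uniqueDiffOn_Ici t t self_mem_Ici).eq_deriv _ h1 h2

/-- The slab `(0,T) × ℝ^N × ℝ^N` with the weight `F⁻¹`. -/
noncomputable abbrev slab (T : ℝ) (F : Space N → ℝ) : Measure (ℝ × Space N × Space N) :=
  (volume.restrict (Ioo 0 T)).prod (volume.prod (velWeight volume F))

variable {F : Space N → ℝ} {θ ε : ℝ} {f₀ : Space N × Space N → ℝ}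
  {f : ℝ × Space N × Space N → ℝ}

theorem IsKineticSolution.memLp (hF : IsPosDensity volume F) (hf : IsKineticSolution F θ ε f₀ f)
    {T : ℝ} (hT : 0 < T) : MemLp f 2 (slab T F) := by
  obtain ⟨h1, C, h2⟩ := hf.1 T hT
  rw [invWeight_eq_prod hF.measurable] at h1 h2
  exact memLp_two_of_ae_eLpNorm_le h1 h2

/-- The source term `ρ F` along characteristics. -/
noncomputable def source (F : Space N → ℝ) (f : ℝ × Space N × Space N → ℝ)
    (z : ℝ × Space N × Space N) : ℝ := (∫ w, f (z.1, z.2.1, w)) * F z.2.2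

theorem memLp_density (hF : IsPosDensity volume F) {T : ℝ} (hf : MemLp f 2 (slab T F)) :
    MemLp (fun p : ℝ × Space N => ∫ w, f (p.1, p.2, w)) 2
      ((volume.restrict (Ioo 0 T)).prod volume) := by
  have h := hf.comp_measurePreserving
    (measurePreserving_prodAssoc (volume.restrict (Ioo (0 : ℝ) T)) (volume : Measure (Space N))
      (velWeight volume F))
  exact hF.memLp_integral h

theorem memLp_source (hF : IsPosDensity volume F) {T : ℝ} (hf : MemLp f 2 (slab T F)) :
    MemLp (source F f) 2 (slab T F) := by
  have h := (memLp_density hF hf).mul_prod_two hF.memLp_self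
  exact h.comp_measurePreserving
    (measurePreserving_prodAssoc (volume.restrict (Ioo (0 : ℝ) T)) (volume : Measure (Space N))
      (velWeight volume F)).symm

end Characteristics

end FractionalDiffusion

namespace FractionalDiffusion

/-! ### Duhamel's formula along characteristics -/

section Mild

variable {N : ℕ} {F : Space N → ℝ} {θ ε : ℝ} {f₀ : Space N × Space N → ℝ}
  {f : ℝ × Space N × Space N → ℝ}

theorem measurePreserving_slab (T β : ℝ) :
    MeasurePreserving (timeShear β : ℝ × Space N × Space N → ℝ × Space N × Space N)
      (slab T F) (slab T F) :=
  measurePreserving_timeShear _ _ _ β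

/-- Integrals against the flat measure, expressed with the weight `F⁻¹`. -/
theorem integral_slab_mul (hF : IsPosDensity volume F) (T : ℝ)
    (h c : ℝ × Space N × Space N → ℝ) :
    ∫ z, h z * (c z * F z.2.2) ∂(slab T F) =
      ∫ z, h z * c z ∂((volume.restrict (Ioo 0 T)).prod (volume.prod volume)) := by
  have hm : Measurable fun y : Space N × Space N => F y.2 := hF.measurable.comp measurable_snd
  have hm' : Measurable fun z : ℝ × Space N × Space N => F z.2.2 := hm.comp measurable_snd
  rw [slab, prod_velWeight _ hF.measurable, prod_velWeight _ hm]
  exact integral_velWeight_mul (F := fun z : ℝ × Space N × Space N => F z.2.2) hm'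
    (fun z => hF.pos _) h c

theorem integral_prod_velWeight_mul (hF : IsPosDensity volume F)
    (h c : Space N × Space N → ℝ) :
    ∫ y, h y * (c y * F y.2) ∂((volume : Measure (Space N)).prod (velWeight volume F)) =
      ∫ y, h y * c y := by
  have hm : Measurable fun y : Space N × Space N => F y.2 := hF.measurable.comp measurable_snd
  rw [prod_velWeight _ hF.measurable]
  exact integral_velWeight_mul (F := fun y : Space N × Space N => F y.2) hm
    (fun z => hF.pos _) h c

/-- Passage from the half space of the weak formulations to a slab of finite duration, once the test
function has died out. Being an equality of integrals of the same function over nested sets, it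
needs no integrability. -/
theorem setIntegral_Ioi_prod_eq {Y : Type*} [MeasureSpace Y] [SFinite (volume : Measure Y)]
    {T : ℝ} (g : ℝ × Y → ℝ) (hg : ∀ z : ℝ × Y, T ≤ z.1 → g z = 0) :
    ∫ z in Ioi (0 : ℝ) ×ˢ (univ : Set Y), g z =
      ∫ z, g z ∂((volume.restrict (Ioo 0 T)).prod volume) := by
  have e : (volume.restrict (Ioo (0 : ℝ) T)).prod (volume : Measure Y) =
      (volume : Measure (ℝ × Y)).restrict (Ioo 0 T ×ˢ univ) := by
    rw [Measure.volume_eq_prod, ← Measure.prod_restrict, Measure.restrict_univ]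
  rw [e]
  refine setIntegral_eq_of_subset_of_forall_sdiff_eq_zero (measurableSet_Ioi.prod .univ)
    (prod_mono (fun t ht => ht.1) subset_rfl) fun z hz => hg z ?_
  by_contra h
  exact hz.2 ⟨⟨hz.1.1, not_le.1 h⟩, trivial⟩

/-- The weak formulation along characteristics. -/
theorem IsKineticSolution.weak_transport (hF : IsPosDensity volume F) (hθ : 0 < θ)
    (hf : IsKineticSolution F θ ε f₀ f) {T : ℝ} {χ : ℝ → ℝ} {a c : Space N → ℝ}
    (hχ : ContDiff ℝ ∞ χ) (hχc : HasCompactSupport χ) (hχT : ∀ t, T ≤ t → χ t = 0)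
    (ha : ContDiff ℝ ∞ a) (hac : HasCompactSupport a)
    (hc : ContDiff ℝ ∞ c) (hcc : HasCompactSupport c) :
    ∫ z, (deriv χ z.1 * (θ * (Real.exp (z.1 / θ) * f (timeShear (ε / θ) z)))
        + χ z.1 * (Real.exp (z.1 / θ) * source F f (timeShear (ε / θ) z))) *
          (a z.2.1 * c z.2.2 * F z.2.2) ∂(slab T F) +
      χ 0 * (∫ y, (θ * f₀ y) * (a y.1 * c y.2 * F y.2)
        ∂((volume : Measure (Space N)).prod (velWeight volume F))) = 0 := by
  set φ : ℝ × Space N × Space N → ℝ := fun z => Real.exp (z.1 / θ) * χ z.1 *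
        (a (z.2.1 - (ε / θ * z.1) • z.2.2) * c z.2.2) with hφ
  have h := hf.2 φ (by fun_prop) (hasCompactSupport_transport_test hχc hac hcc)
  have hA : ∀ z : ℝ × Space N × Space N,
      f z * (θ * fderiv ℝ φ z (1, 0, 0) + ε * fderiv ℝ φ z (0, z.2.2, 0))
        + relaxation F (fun w => f (z.1, z.2.1, w)) z.2.2 * φ z =
      (deriv χ z.1 * (θ * (Real.exp (z.1 / θ) * f z))
        + χ z.1 * (Real.exp (z.1 / θ) * source F f z)) *
        (a (z.2.1 - (ε / θ * z.1) • z.2.2) * c z.2.2) := by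
    intro z
    rw [fderiv_transport_test hθ.ne' hχ ha hc]
    simp only [relaxation, source, hφ]
    ring
  simp_rw [hA] at h
  rw [setIntegral_Ioi_prod_eq (T := T)] at h
  swap
  · intro z hz
    rw [hχT _ hz, deriv_eq_zero_of_eq_zero_on_Ici hχ hχT hz]
    ring
  -- Following the characteristics straightens the test function to χ(t) a(x) c(v), and the solution
  -- is then evaluated on trajectories.
  have h1 := (measurePreserving_slab (N := N) (F := F) T (ε / θ)).integral_comp'
    (g := fun z => (deriv χ z.1 * (θ * (Real.exp (z.1 / θ) * f z))
        + χ z.1 * (Real.exp (z.1 / θ) * source F f z)) *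
        (a (z.2.1 - (ε / θ * z.1) • z.2.2) * c z.2.2 * F z.2.2))
  rw [integral_slab_mul hF T (fun z => deriv χ z.1 * (θ * (Real.exp (z.1 / θ) * f z))
        + χ z.1 * (Real.exp (z.1 / θ) * source F f z))
        (fun z => a (z.2.1 - (ε / θ * z.1) • z.2.2) * c z.2.2)] at h1
  rw [Measure.volume_eq_prod (Space N) (Space N), ← h1] at h
  rw [integral_prod_velWeight_mul hF (fun y => θ * f₀ y) (fun y => a y.1 * c y.2)]
  refine Eq.trans ?_ h
  congr 1
  · refine integral_congr_ae (Eventually.of_forall fun z => ?_)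
    simp [timeShear_apply]
  · rw [← integral_const_mul, ← integral_const_mul]
    refine integral_congr_ae (Eventually.of_forall fun z => ?_)
    simp [hφ]
    ring

/-- The family of test functions used on phase space with the weight `F⁻¹`. -/
def phaseTests (F : Space N → ℝ) : Set (Space N × Space N → ℝ) :=
  {φ | ∃ a ∈ testFunctions (univ : Set (Space N)),
    ∃ b ∈ {φ | ∃ c ∈ testFunctions (univ : Set (Space N)), φ = fun v => c v * F v},
      φ = fun z => a z.1 * b z.2}

theorem isTotalL2_phaseTests (hF : IsPosDensity volume F) :
    IsTotalL2 ((volume : Measure (Space N)).prod (velWeight volume F)) (phaseTests F) := by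
  have h := isTotalL2_testFunctions (volume : Measure (Space N)) isOpen_univ
  rw [Measure.restrict_univ] at h
  exact h.prod hF.isTotalL2

/-- The integral in time of a square-integrable function is square integrable. -/
theorem memLp_two_setIntegral_Iio {Y : Type*} [MeasurableSpace Y] {ν : Measure Y} [SFinite ν]
    {T : ℝ} {R : ℝ × Y → ℝ} (hR : MemLp R 2 ((volume.restrict (Ioo 0 T)).prod ν)) :
    MemLp (fun z : ℝ × Y => ∫ s in Ioo 0 T, (Iio z.1).indicator (fun s => R (s, z.2)) s) 2
      ((volume.restrict (Ioo 0 T)).prod ν) := by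
  set m := (volume.restrict (Ioo (0 : ℝ) T))
  have h1 : MemLp (fun z : ℝ × ℝ × Y => (Iio z.2.1).indicator (fun s => R (s, z.2.2)) z.1) 2
      (m.prod (m.prod ν)) := by
    have h2 : MemLp (fun z : ℝ × (ℝ × Y) => R z.2) 2 (m.prod (m.prod ν)) := hR.comp_snd m
    have h3 : MeasurePreserving (fun z : ℝ × ℝ × Y => (z.2.1, (z.1, z.2.2)))
        (m.prod (m.prod ν)) (m.prod (m.prod ν)) := by
      have e1 := measurePreserving_prodAssoc m m ν
      have e2 := (Measure.measurePreserving_swap (μ := m) (ν := m)).prod (MeasurePreserving.id ν)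
      exact (e1.comp e2).comp e1.symm
    have h4 := h2.comp_measurePreserving h3
    have hms : MeasurableSet {z : ℝ × ℝ × Y | z.1 < z.2.1} :=
      measurableSet_lt measurable_fst (measurable_fst.comp measurable_snd)
    refine (h4.indicator hms).ae_eq (Eventually.of_forall fun z => ?_)
    by_cases hz : z.1 < z.2.1 <;> simp [indicator, hz]
  have h5 := h1.integral_mul_left_two (memLp_const (1 : ℝ))
  simpa using h5

theorem integrable_slab_mul {Y : Type*} [MeasurableSpace Y] {ν : Measure Y} [SFinite ν]
    {T : ℝ} {R : ℝ × Y → ℝ} (hR : MemLp R 2 ((volume.restrict (Ioo 0 T)).prod ν)) {e : Y → ℝ}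
    (he : MemLp e 2 ν) :
    Integrable (fun z : ℝ × Y => R z * e z.2) ((volume.restrict (Ioo 0 T)).prod ν) :=
  hR.integrable_mul (he.comp_snd _)

/-- Duhamel's formula along characteristics. -/
theorem IsKineticSolution.mild (hF : IsPosDensity volume F) (hθ : 0 < θ)
    (hf : IsKineticSolution F θ ε f₀ f) (hf₀ : MemLp f₀ 2 (invWeight F)) {T : ℝ} (hT : 0 < T) :
    ∀ᵐ z ∂(slab T F), θ * (Real.exp (z.1 / θ) * f (timeShear (ε / θ) z)) =
      θ * f₀ z.2 + ∫ s in Ioo 0 z.1,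
        Real.exp (s / θ) * source F f (timeShear (ε / θ) (s, z.2)) := by
  set ν := (volume : Measure (Space N)).prod (velWeight volume F) with hν
  set H : ℝ × Space N × Space N → ℝ :=
    fun z => θ * (Real.exp (z.1 / θ) * f (timeShear (ε / θ) z)) with hH
  set R : ℝ × Space N × Space N → ℝ :=
    fun z => Real.exp (z.1 / θ) * source F f (timeShear (ε / θ) z) with hR
  have hexp : ∀ {u : ℝ × Space N × Space N → ℝ}, MemLp u 2 (slab T F) →
      MemLp (fun z => Real.exp (z.1 / θ) * u z) 2 (slab T F) := by
    intro u hu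
    have hm : MemLp (fun z : ℝ × Space N × Space N => Real.exp (z.1 / θ)) ⊤ (slab T F) := by
      refine memLp_top_of_bound (by fun_prop) (Real.exp (T / θ)) ?_
      have : ∀ᵐ z ∂(slab T F), z.1 ∈ Ioo 0 T :=
        Measure.quasiMeasurePreserving_fst.ae (ae_restrict_mem measurableSet_Ioo)
      filter_upwards [this] with z hz
      rw [Real.norm_eq_abs, abs_of_pos (Real.exp_pos _)]
      gcongr
      exact hz.2.le
    exact hu.mul hm
  have hfL := hf.memLp hF hT
  have hHL : MemLp H 2 (slab T F) :=
    (hexp (hfL.comp_measurePreserving (measurePreserving_slab T (ε / θ)))).const_mul θ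
  have hRL : MemLp R 2 (slab T F) :=
    hexp ((memLp_source hF hfL).comp_measurePreserving (measurePreserving_slab T (ε / θ)))
  have hf₀' : MemLp f₀ 2 ν := by rw [invWeight_eq_prod hF.measurable] at hf₀; exact hf₀
  have hg₀ : MemLp (fun y => θ * f₀ y) 2 ν := hf₀'.const_mul θ
  set J : ℝ × Space N × Space N → ℝ :=
    fun z => ∫ s in Ioo 0 T, (Iio z.1).indicator (fun s => R (s, z.2)) s with hJ
  have hJL : MemLp J 2 (slab T F) := memLp_two_setIntegral_Iio hRL
  have hg₀L : MemLp (fun z : ℝ × Space N × Space N => θ * f₀ z.2) 2 (slab T F) :=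
    hg₀.comp_snd _
  have hPT := isTotalL2_phaseTests hF
  -- testing in the phase variables only
  have hweak : ∀ e ∈ phaseTests F, ∀ᵐ t ∂(volume.restrict (Ioo 0 T)),
      ∫ y, H (t, y) * e y ∂ν =
        ∫ y, (θ * f₀ y) * e y ∂ν + ∫ s in Ioo 0 t, ∫ y, R (s, y) * e y ∂ν := by
    intro e he
    have heL := hPT.memLp e he
    have iH := integrable_slab_mul hHL heL
    have iR := integrable_slab_mul hRL heL
    obtain ⟨a, ⟨a1, a2, -⟩, b, ⟨c, ⟨c1, c2, -⟩, rfl⟩, rfl⟩ := he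
    -- With the phase test fixed, the straightened weak formulation is a weak scalar ODE in t whose
    -- initial value is the pairing with θ f₀.
    refine ae_eq_add_setIntegral_of_weak hT iH.integral_prod_left iR.integral_prod_left
      fun χ h1 h2 h3 => ?_
    have h := hf.weak_transport hF hθ (T := T) h1 h2 h3 a1 a2 c1 c2
    have b1 : MemLp (fun z : ℝ × Space N × Space N => χ z.1) ⊤ (slab T F) := by
      obtain ⟨C, hC⟩ := h1.continuous.bounded_above_of_compact_support h2
      exact memLp_top_of_bound (h1.continuous.comp continuous_fst).aestronglyMeasurable C
        (Eventually.of_forall fun z => hC _)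
    have b2 : MemLp (fun z : ℝ × Space N × Space N => deriv χ z.1) ⊤ (slab T F) := by
      have hd : Continuous (deriv χ) := h1.continuous_deriv (by simp)
      obtain ⟨C, hC⟩ := hd.bounded_above_of_compact_support h2.deriv
      exact memLp_top_of_bound (hd.comp continuous_fst).aestronglyMeasurable C
        (Eventually.of_forall fun z => hC _)
    have i0 : Integrable (fun z : ℝ × Space N × Space N =>
        (deriv χ z.1 * H z + χ z.1 * R z) * (a z.2.1 * c z.2.2 * F z.2.2)) (slab T F) := by
      have : MemLp (fun z : ℝ × Space N × Space N => deriv χ z.1 * H z + χ z.1 * R z) 2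
          (slab T F) := (hHL.mul b2).add (hRL.mul b1)
      have h5 := integrable_slab_mul this heL
      refine h5.congr (Eventually.of_forall fun z => ?_)
      simp only
      ring
    rw [integral_prod _ i0] at h
    refine Eq.trans ?_ h
    rw [smul_eq_mul]
    congr 1
    · refine integral_congr_ae ?_
      filter_upwards [iH.prod_right_ae, iR.prod_right_ae] with t ht1 ht2
      simp only [smul_eq_mul]
      rw [← integral_const_mul, ← integral_const_mul, ← integral_add (ht1.const_mul _)
        (ht2.const_mul _)]
      refine integral_congr_ae (Eventually.of_forall fun y => ?_)
      simp only
      ring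
    · congr 2
      ext y
      ring
  -- The exceptional set of times above depends on the phase test. Testing in time as well, and
  -- using totality of tensor products, removes this dependence.
  have hzero : (fun z => H z - θ * f₀ z.2 - J z) =ᵐ[slab T F] 0 := by
    have hTot := (isTotalL2_testFunctions (volume : Measure ℝ) (isOpen_Ioo (a := 0) (b := T))).prod
      hPT
    refine hTot.ae_eq_zero _ ((hHL.sub hg₀L).sub hJL) ?_
    rintro _ ⟨η, ⟨η1, η2, η3⟩, e, he, rfl⟩
    have heL := hPT.memLp e he
    have iH := integrable_slab_mul hHL heL
    have iJ := integrable_slab_mul hJL heL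
    have iR := integrable_slab_mul hRL heL
    have hηL : MemLp η 2 (volume.restrict (Ioo 0 T)) :=
      (η1.continuous.memLp_of_hasCompactSupport η2).restrict _
    have i0 := ((hHL.sub hg₀L).sub hJL).integrable_mul (hηL.mul_prod_two heL)
    have h0 := integral_prod _ i0
    simp only [Pi.mul_apply, Pi.sub_apply] at h0
    rw [h0]
    refine integral_eq_zero_of_ae ?_
    filter_upwards [iH.prod_right_ae, iJ.prod_right_ae, hweak e he,
      ae_restrict_mem measurableSet_Ioo] with t ht1 ht2 ht3 ht
    simp only [Pi.zero_apply]
    have hJt : ∫ y, J (t, y) * e y ∂ν = ∫ s in Ioo 0 t, ∫ y, R (s, y) * e y ∂ν := by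
      rw [← setIntegral_Ioo_indicator_Iio ht.2.le (fun s => ∫ y, R (s, y) * e y ∂ν)]
      have hsw := integral_integral_swap (μ := volume.restrict (Ioo 0 T)) (ν := ν)
        (f := fun s y => (Iio t).indicator (fun s => R (s, y) * e y) s) ?_
      · have e1 : ∀ s, (Iio t).indicator (fun s => ∫ y, R (s, y) * e y ∂ν) s =
            ∫ y, (Iio t).indicator (fun s => R (s, y) * e y) s ∂ν := by
          intro s
          by_cases hs : s < t <;> simp [indicator, hs]
        simp_rw [e1]
        rw [hsw]
        refine integral_congr_ae (Eventually.of_forall fun y => ?_)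
        simp only [hJ]
        rw [← integral_mul_const]
        congr 1
        ext s
        by_cases hs : s < t <;> simp [indicator, hs]
      · have hms : MeasurableSet {z : ℝ × Space N × Space N | z.1 < t} :=
          measurableSet_lt measurable_fst measurable_const
        refine (iR.indicator hms).congr (Eventually.of_forall fun z => ?_)
        by_cases hz : z.1 < t <;> simp [indicator, hz, Function.uncurry]
    have i3 : Integrable (fun y => θ * f₀ y * e y) ν := hg₀.integrable_mul heL
    have h4 : ∀ y, (H (t, y) - θ * f₀ y - J (t, y)) * (η t * e y) =
        η t * (H (t, y) * e y - θ * f₀ y * e y - J (t, y) * e y) := fun y => by ring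
    simp_rw [h4]
    have hsub : Integrable (fun y => H (t, y) * e y - θ * f₀ y * e y) ν := ht1.sub i3
    rw [integral_const_mul, integral_sub hsub ht2, integral_sub ht1 i3, ht3, hJt]
    ring
  have hmem : ∀ᵐ z ∂(slab T F), z.1 ∈ Ioo 0 T :=
    Measure.quasiMeasurePreserving_fst.ae (ae_restrict_mem measurableSet_Ioo)
  filter_upwards [hzero, hmem] with z hz hzm
  have h1 : H z - θ * f₀ z.2 - J z = 0 := hz
  have h2 : J z = ∫ s in Ioo 0 z.1, R (s, z.2) := setIntegral_Ioo_indicator_Iio hzm.2.le _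
  rw [h2] at h1
  linarith

end Mild

end FractionalDiffusion

namespace FractionalDiffusion

/-! ### Uniform bounds by convexity -/

section Bounds

/-- Convexity of the square for the combination of A with weight m and x/W with weight W. Multiplied
by W, the defect is at least m(WA - x)². Infinite values of y or A make the bound trivial and are
split off. -/
theorem sq_add_le_of_sq_le {m W A x y : ℝ≥0∞} (hm : m ≠ 0) (hW : W ≠ 0) (hmW : m + W = 1)
    (hxy : x ^ 2 ≤ W * y) : (m * A + x) ^ 2 ≤ m * A ^ 2 + y := by
  rcases eq_or_ne y ⊤ with rfl | hy
  · simp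
  rcases eq_or_ne A ⊤ with rfl | hA
  · simp [ENNReal.mul_top hm]
  have hm1 : m ≠ ⊤ := ne_top_of_le_ne_top ENNReal.one_ne_top (hmW ▸ le_self_add)
  have hW1 : W ≠ ⊤ := ne_top_of_le_ne_top ENNReal.one_ne_top (hmW ▸ le_add_self)
  have hx : x ≠ ⊤ := by
    rintro rfl
    have := ENNReal.mul_ne_top hW1 hy
    simp at hxy
    exact this hxy
  lift y to NNReal using hy
  lift A to NNReal using hA
  lift m to NNReal using hm1
  lift W to NNReal using hW1
  lift x to NNReal using hx
  norm_cast at *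
  have h1 : (m : ℝ) + W = 1 := by exact_mod_cast hmW
  have h2 : (x : ℝ) ^ 2 ≤ W * y := by exact_mod_cast hxy
  have hW0 : (0 : ℝ) < W := by exact_mod_cast pos_iff_ne_zero.2 hW
  have key : ((m : ℝ) * A + x) ^ 2 ≤ m * A ^ 2 + y := by
    have h3 : (m : ℝ) = 1 - W := by linarith
    have h4 : 0 ≤ (m : ℝ) * (W * A - x) ^ 2 := by positivity
    have h5 : (W : ℝ) * ((m : ℝ) * A + x) ^ 2 ≤ W * (m * A ^ 2 + y) := by
      rw [h3] at h4 ⊢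
      nlinarith
    exact le_of_mul_le_mul_left h5 hW0
  exact_mod_cast key

/-- The kernel `θ⁻¹ exp (-(t-s)/θ)` of Duhamel's formula. -/
noncomputable def expKernel (θ t s : ℝ) : ℝ := θ⁻¹ * Real.exp (-(t - s) / θ)

theorem expKernel_pos {θ : ℝ} (hθ : 0 < θ) (t s : ℝ) : 0 < expKernel θ t s :=
  mul_pos (inv_pos.2 hθ) (Real.exp_pos _)

theorem measurable_expKernel (θ t : ℝ) : Measurable (expKernel θ t) := by
  unfold expKernel; fun_prop

theorem lintegral_expKernel {θ t : ℝ} (hθ : 0 < θ) (ht : 0 < t) :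
    ∫⁻ s in Ioo 0 t, ENNReal.ofReal (expKernel θ t s) =
      ENNReal.ofReal (1 - Real.exp (-t / θ)) := by
  have hc : Continuous (expKernel θ t) := by unfold expKernel; fun_prop
  rw [← ofReal_integral_eq_lintegral_ofReal]
  · congr 1
    rw [← integral_Ioc_eq_integral_Ioo, ← intervalIntegral.integral_of_le ht.le]
    have hd : ∀ s ∈ uIcc 0 t, HasDerivAt (fun s => Real.exp (-(t - s) / θ)) (expKernel θ t s) s := by
      intro s _
      have h1 : HasDerivAt (fun s : ℝ => -(t - s) / θ) (θ⁻¹) s := by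
        have := (((hasDerivAt_id s).const_sub t).neg).div_const θ
        simpa using this
      have := h1.exp
      rw [expKernel, mul_comm]
      exact this
    rw [intervalIntegral.integral_eq_sub_of_hasDerivAt hd (hc.intervalIntegrable _ _)]
    simp
  · exact (hc.integrableOn_Icc).mono_set Ioo_subset_Icc_self
  · exact Eventually.of_forall fun s => (expKernel_pos hθ t s).le

/-- Solved for b, Duhamel's formula is an average: the weight exp(-t/θ) on a and the mass 1 -
exp(-t/θ) of the kernel add up to one. Cauchy–Schwarz with respect to the kernel bounds the source
part, and convexity combines it with the initial part. -/
theorem sq_enorm_le_of_duhamel {θ t a b : ℝ} (hθ : 0 < θ) (ht : 0 < t) {g : ℝ → ℝ}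
    (hg : Measurable g)
    (h : θ * (Real.exp (t / θ) * b) = θ * a + ∫ s in Ioo 0 t, Real.exp (s / θ) * g s) :
    ‖b‖ₑ ^ 2 ≤ ENNReal.ofReal (Real.exp (-t / θ)) * ‖a‖ₑ ^ 2 +
      ∫⁻ s in Ioo 0 t, ENNReal.ofReal (expKernel θ t s) * ‖g s‖ₑ ^ 2 := by
  have hb : b = Real.exp (-t / θ) * a + ∫ s in Ioo 0 t, expKernel θ t s * g s := by
    have e1 : ∫ s in Ioo 0 t, expKernel θ t s * g s =
        θ⁻¹ * Real.exp (-t / θ) * ∫ s in Ioo 0 t, Real.exp (s / θ) * g s := by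
      rw [← integral_const_mul]
      congr 1
      ext s
      rw [expKernel, show -(t - s) / θ = -t / θ + s / θ by ring, Real.exp_add]
      ring
    rw [e1, ← sub_eq_iff_eq_add'.2 h]
    have : Real.exp (-t / θ) * Real.exp (t / θ) = 1 := by
      rw [← Real.exp_add]; simp [neg_div]
    have h2 : θ⁻¹ * θ = 1 := inv_mul_cancel₀ hθ.ne'
    linear_combination (a * Real.exp (-t / θ) - b * Real.exp (-t / θ) * Real.exp (t / θ)) * h2
      - b * this
  have h1 : ‖b‖ₑ ≤ ENNReal.ofReal (Real.exp (-t / θ)) * ‖a‖ₑ +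
      ∫⁻ s in Ioo 0 t, ENNReal.ofReal (expKernel θ t s) * ‖g s‖ₑ := by
    rw [hb]
    refine (enorm_add_le _ _).trans (add_le_add ?_ ?_)
    · rw [enorm_mul, Real.enorm_of_nonneg (Real.exp_pos _).le]
    · refine (enorm_integral_le_lintegral_enorm _).trans (le_of_eq ?_)
      refine lintegral_congr fun s => ?_
      rw [enorm_mul, Real.enorm_of_nonneg (expKernel_pos hθ t s).le]
  refine (pow_le_pow_left' h1 2).trans (sq_add_le_of_sq_le
    (W := ENNReal.ofReal (1 - Real.exp (-t / θ))) ?_ ?_ ?_ ?_)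
  · simpa using Real.exp_pos _
  · have : Real.exp (-t / θ) < 1 := by
      rw [Real.exp_lt_one_iff, neg_div]
      have := div_pos ht hθ
      linarith
    simpa using this
  · rw [← ENNReal.ofReal_add (Real.exp_pos _).le]
    · simp
    · rw [sub_nonneg, Real.exp_le_one_iff, neg_div]
      have := div_pos ht hθ
      linarith
  · have hm := (measurable_expKernel θ t).ennreal_ofReal
    have h2 := sq_lintegral_mul_le
      ((volume.restrict (Ioo 0 t)).withDensity fun s => ENNReal.ofReal (expKernel θ t s))
      (f := fun _ => 1) (g := fun s => ‖g s‖ₑ) aemeasurable_const hg.enorm.aemeasurable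
    rw [lintegral_withDensity_eq_lintegral_mul _ hm (by fun_prop),
      lintegral_withDensity_eq_lintegral_mul _ hm (by fun_prop),
      lintegral_withDensity_eq_lintegral_mul _ hm (by fun_prop)] at h2
    simp only [Pi.mul_apply, one_mul, one_pow, mul_one] at h2
    rw [lintegral_expKernel hθ ht] at h2
    exact h2

/-- Take for M the essential supremum of U, finite because of C. If it exceeded A, the hypothesis
would bound U on (0,T) by the combination giving A the weight exp(-T/θ) > 0, which is strictly below
M, a contradiction. No Gronwall argument and no continuity in time are needed. -/
theorem ae_le_of_ae_le_convex {T θ : ℝ} (hθ : 0 < θ) {U : ℝ → ℝ≥0∞} {A C : ℝ≥0∞}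
    (hC : C ≠ ⊤) (hA : A ≠ ⊤) (hUC : ∀ᵐ t ∂(volume.restrict (Ioo 0 T)), U t ≤ C)
    (h : ∀ M : ℝ≥0∞, (∀ᵐ t ∂(volume.restrict (Ioo 0 T)), U t ≤ M) →
      ∀ᵐ t ∂(volume.restrict (Ioo 0 T)), U t ≤ ENNReal.ofReal (Real.exp (-t / θ)) * A +
        ENNReal.ofReal (1 - Real.exp (-t / θ)) * M) :
    ∀ᵐ t ∂(volume.restrict (Ioo 0 T)), U t ≤ A := by
  obtain ⟨M, hM⟩ : ∃ M, M = essSup U (volume.restrict (Ioo 0 T)) := ⟨_, rfl⟩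
  have hUM : ∀ᵐ t ∂(volume.restrict (Ioo 0 T)), U t ≤ M := hM ▸ ENNReal.ae_le_essSup U
  have hMC : M ≤ C := hM ▸ essSup_le_of_ae_le C hUC
  have hMt : M ≠ ⊤ := ne_top_of_le_ne_top hC hMC
  rcases le_or_gt M A with hMA | hAM
  · filter_upwards [hUM] with t ht using ht.trans hMA
  exfalso
  lift A to NNReal using hA
  lift M to NNReal using hMt
  have hAM' : (A : ℝ) < M := by exact_mod_cast hAM
  set B : ℝ := Real.exp (-T / θ) * A + (1 - Real.exp (-T / θ)) * M with hB
  have hBM : B < M := by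
    have := Real.exp_pos (-T / θ)
    nlinarith
  have h1 : ∀ᵐ t ∂(volume.restrict (Ioo 0 T)), U t ≤ ENNReal.ofReal B := by
    filter_upwards [h M hUM, ae_restrict_mem measurableSet_Ioo] with t ht htm
    refine ht.trans ?_
    have e1 : Real.exp (-t / θ) ≤ 1 := by
      rw [Real.exp_le_one_iff, neg_div]
      have := div_pos htm.1 hθ
      linarith
    have e2 : Real.exp (-T / θ) ≤ Real.exp (-t / θ) := by
      gcongr
      exact htm.2.le
    rw [← ENNReal.ofReal_coe_nnreal, ← ENNReal.ofReal_coe_nnreal,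
      ← ENNReal.ofReal_mul (Real.exp_pos _).le, ← ENNReal.ofReal_mul (sub_nonneg.2 e1),
      ← ENNReal.ofReal_add (mul_nonneg (Real.exp_pos _).le A.coe_nonneg)
        (mul_nonneg (sub_nonneg.2 e1) M.coe_nonneg)]
    refine ENNReal.ofReal_le_ofReal ?_
    nlinarith
  have h2 : (M : ℝ≥0∞) ≤ ENNReal.ofReal B := by
    have := essSup_le_of_ae_le _ h1
    rwa [← hM] at this
  rw [← ENNReal.ofReal_coe_nnreal] at h2
  have h3 := (ENNReal.ofReal_le_ofReal_iff' ).1 h2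
  rcases h3 with h3 | h3
  · linarith
  · linarith [A.2]

variable {N : ℕ} {F : Space N → ℝ} {θ ε : ℝ} {f₀ : Space N × Space N → ℝ}
  {f : ℝ × Space N × Space N → ℝ}

theorem measurable_density (hfm : Measurable f) :
    Measurable fun p : ℝ × Space N => ∫ w, f (p.1, p.2, w) := by
  have h : StronglyMeasurable fun q : (ℝ × Space N) × Space N => f (q.1.1, q.1.2, q.2) :=
    (hfm.comp (by fun_prop)).stronglyMeasurable
  exact h.integral_prod_right'.measurable

theorem measurable_source (hF : Measurable F) (hfm : Measurable f) : Measurable (source F f) := by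
  have h1 := (measurable_density hfm).comp
    (g := fun p : ℝ × Space N => ∫ w, f (p.1, p.2, w))
    (f := fun z : ℝ × Space N × Space N => (z.1, z.2.1)) (by fun_prop)
  exact h1.mul (hF.comp (by fun_prop))

theorem volume_ac_slab (hF : IsPosDensity volume F) (T : ℝ) (σ : Measure (Space N)) [SFinite σ]
    (hσ : σ ≪ volume) :
    (volume.restrict (Ioo 0 T)).prod (volume.prod σ) ≪ slab T F :=
  Measure.AbsolutelyContinuous.rfl.prod (Measure.AbsolutelyContinuous.rfl.prod
    (hσ.trans (ac_velWeight hF.measurable hF.pos)))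

/-- The `L²` norm of a kinetic solution, with an arbitrary weight in the velocity, is controlled
by the initial datum and the norm of the density. -/
theorem IsKineticSolution.lintegral_sq_le (hF : IsPosDensity volume F) (hθ : 0 < θ)
    (hf : IsKineticSolution F θ ε f₀ f) (hf₀ : MemLp f₀ 2 (invWeight F)) (hfm : Measurable f)
    (hf₀m : Measurable f₀) {T : ℝ} (hT : 0 < T) (σ : Measure (Space N)) [SFinite σ]
    (hσ : σ ≪ volume) {M : ℝ≥0∞}
    (hM : ∀ᵐ s ∂(volume.restrict (Ioo 0 T)), ∫⁻ x, ‖∫ w, f (s, x, w)‖ₑ ^ 2 ≤ M) :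
    ∀ᵐ t ∂(volume.restrict (Ioo 0 T)),
      ∫⁻ y, ‖f (t, y)‖ₑ ^ 2 ∂((volume : Measure (Space N)).prod σ) ≤
        ENNReal.ofReal (Real.exp (-t / θ)) *
            ∫⁻ y, ‖f₀ y‖ₑ ^ 2 ∂((volume : Measure (Space N)).prod σ) +
          ENNReal.ofReal (1 - Real.exp (-t / θ)) * (M * ∫⁻ v, ‖F v‖ₑ ^ 2 ∂σ) := by
  set ν := (volume : Measure (Space N)).prod σ with hν
  have hmild := (volume_ac_slab hF T σ hσ).ae_le (hf.mild hF hθ hf₀ hT)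
  have hsm := measurable_source hF.measurable hfm
  filter_upwards [Measure.ae_ae_of_ae_prod hmild, ae_restrict_mem measurableSet_Ioo] with t ht htm
  have hmeas : Measurable fun z : ℝ × Space N × Space N =>
      ENNReal.ofReal (expKernel θ t z.1) * ‖source F f (timeShear (ε / θ) z)‖ₑ ^ 2 :=
    (((measurable_expKernel θ t).comp measurable_fst).ennreal_ofReal).mul
      ((hsm.comp (timeShear (ε / θ)).measurable).enorm.pow_const 2)
  -- Transport leaves the norm unchanged, and the source is a product of the density in x and F in
  -- v.
  have h1 : ∀ s, ∫⁻ y, ‖source F f (timeShear (ε / θ) (s, y))‖ₑ ^ 2 ∂ν =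
      (∫⁻ x, ‖∫ w, f (s, x, w)‖ₑ ^ 2) * ∫⁻ v, ‖F v‖ₑ ^ 2 ∂σ := by
    intro s
    simp_rw [timeShear_mk]
    have h2 : Measurable fun y : Space N × Space N => ‖source F f (s, y)‖ₑ ^ 2 :=
      (hsm.comp (by fun_prop)).enorm.pow_const 2
    rw [(measurePreserving_shear volume σ (ε / θ * s)).lintegral_comp h2]
    simp only [source, enorm_mul, mul_pow]
    have h3 : Measurable fun x : Space N => ∫ w, f (s, x, w) :=
      (measurable_density hfm).comp measurable_prodMk_left
    rw [lintegral_prod_mul (f := fun x : Space N => ‖∫ w, f (s, x, w)‖ₑ ^ 2)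
      (g := fun v => ‖F v‖ₑ ^ 2) (h3.enorm.pow_const 2).aemeasurable
      (hF.measurable.enorm.pow_const 2).aemeasurable]
  calc ∫⁻ y, ‖f (t, y)‖ₑ ^ 2 ∂ν = ∫⁻ y, ‖f (timeShear (ε / θ) (t, y))‖ₑ ^ 2 ∂ν := by
        simp_rw [timeShear_mk]
        have h2 : Measurable fun y : Space N × Space N => ‖f (t, y)‖ₑ ^ 2 :=
          (hfm.comp (by fun_prop)).enorm.pow_const 2
        rw [(measurePreserving_shear volume σ (ε / θ * t)).lintegral_comp h2]
    _ ≤ ∫⁻ y, (ENNReal.ofReal (Real.exp (-t / θ)) * ‖f₀ y‖ₑ ^ 2 + ∫⁻ s in Ioo 0 t,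
          ENNReal.ofReal (expKernel θ t s) * ‖source F f (timeShear (ε / θ) (s, y))‖ₑ ^ 2) ∂ν := by
        refine lintegral_mono_ae ?_
        filter_upwards [ht] with y hy
        exact sq_enorm_le_of_duhamel hθ htm.1
          (hsm.comp ((timeShear (ε / θ)).measurable.comp (by fun_prop))) hy
    _ = ENNReal.ofReal (Real.exp (-t / θ)) * ∫⁻ y, ‖f₀ y‖ₑ ^ 2 ∂ν +
          ∫⁻ s in Ioo 0 t, ENNReal.ofReal (expKernel θ t s) *
            ((∫⁻ x, ‖∫ w, f (s, x, w)‖ₑ ^ 2) * ∫⁻ v, ‖F v‖ₑ ^ 2 ∂σ) := by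
        rw [lintegral_add_left ((hf₀m.enorm.pow_const 2).const_mul _),
          lintegral_const_mul _ (hf₀m.enorm.pow_const 2)]
        congr 1
        rw [lintegral_lintegral_swap (f := fun y s => ENNReal.ofReal (expKernel θ t s) *
          ‖source F f (timeShear (ε / θ) (s, y))‖ₑ ^ 2) (hmeas.comp measurable_swap).aemeasurable]
        refine lintegral_congr fun s => ?_
        have h5 : Measurable fun y => ‖source F f (timeShear (ε / θ) (s, y))‖ₑ ^ 2 :=
          (hsm.comp ((timeShear (ε / θ)).measurable.comp (by fun_prop))).enorm.pow_const 2
        rw [lintegral_const_mul _ h5, h1]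
    _ ≤ _ := by
        gcongr
        rw [← lintegral_expKernel hθ htm.1,
          ← lintegral_mul_const _ (measurable_expKernel θ t).ennreal_ofReal]
        refine lintegral_mono_ae ?_
        have hM' := ae_restrict_of_ae_restrict_of_subset (Ioo_subset_Ioo_right htm.2.le) hM
        filter_upwards [hM'] with s hs
        gcongr

theorem lintegral_sq_density_le (hF : IsPosDensity volume F) (hfm : Measurable f) (s : ℝ) :
    ∫⁻ x, ‖∫ w, f (s, x, w)‖ₑ ^ 2 ≤
      ∫⁻ y, ‖f (s, y)‖ₑ ^ 2 ∂((volume : Measure (Space N)).prod (velWeight volume F)) := by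
  have h2 : Measurable fun y : Space N × Space N => ‖f (s, y)‖ₑ ^ 2 :=
      (hfm.comp (by fun_prop)).enorm.pow_const 2
  rw [lintegral_prod _ h2.aemeasurable]
  refine lintegral_mono fun x => ?_
  exact hF.sq_enorm_integral_le (hfm.comp (by fun_prop)).aemeasurable

theorem IsPosDensity.lintegral_sq_eq_one (hF : IsPosDensity volume F) :
    ∫⁻ v, ‖F v‖ₑ ^ 2 ∂(velWeight volume F) = 1 := by
  rw [lintegral_velWeight hF.measurable, ← hF.lintegral_eq_one]
  refine lintegral_congr fun v => ?_
  rw [Real.enorm_of_nonneg (hF.pos v).le, sq, ← mul_assoc,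
    ← ENNReal.ofReal_mul (inv_nonneg.2 (hF.pos v).le), inv_mul_cancel₀ (hF.pos v).ne']
  simp

/-- Kinetic solutions do not increase the norm of `L²(F⁻¹)`. -/
theorem IsKineticSolution.lintegral_sq_le_initial (hF : IsPosDensity volume F) (hθ : 0 < θ)
    (hf : IsKineticSolution F θ ε f₀ f) (hf₀ : MemLp f₀ 2 (invWeight F)) (hfm : Measurable f)
    (hf₀m : Measurable f₀) {T : ℝ} (hT : 0 < T) :
    ∀ᵐ t ∂(volume.restrict (Ioo 0 T)),
      ∫⁻ y, ‖f (t, y)‖ₑ ^ 2 ∂((volume : Measure (Space N)).prod (velWeight volume F)) ≤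
        ∫⁻ y, ‖f₀ y‖ₑ ^ 2 ∂((volume : Measure (Space N)).prod (velWeight volume F)) := by
  obtain ⟨-, C, hC⟩ := hf.1 T hT
  rw [invWeight_eq_prod hF.measurable] at hC hf₀
  -- With the weight F⁻¹, a bound on the norm of f bounds that of the density, and F has norm one,
  -- so the estimate closes on itself.
  refine ae_le_of_ae_le_convex hθ (C := ENNReal.ofReal C ^ 2) (by finiteness)
    (memLp_two_iff.1 hf₀).2.ne ?_ fun M hM => ?_
  · filter_upwards [hC] with t ht using eLpNorm_two_le_iff.1 ht
  · have h := hf.lintegral_sq_le hF hθ (by rwa [invWeight_eq_prod hF.measurable]) hfm hf₀m hT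
      (velWeight volume F) velWeight_ac (M := M) ?_
    · rwa [hF.lintegral_sq_eq_one, mul_one] at h
    · filter_upwards [hM] with s hs using (lintegral_sq_density_le hF hfm s).trans hs

end Bounds

end FractionalDiffusion

namespace FractionalDiffusion

/-! ### Heavy tails and the coefficient κ -/

section Kappa

variable {N : ℕ}

/-- The weight `min(1,|w|²) / |w|^{N+α}`. -/
noncomputable def levyWeight (N : ℕ) (α : ℝ) (w : Space N) : ℝ :=
  min 1 (‖w‖ ^ 2) / ‖w‖ ^ ((N : ℝ) + α)

/-- In polar coordinates the radial density is r^(1-α) near the origin and r^(-1-α) at infinity;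
these are integrable because α < 2 and α > 0 respectively. -/
theorem integrable_levyWeight [NeZero N] {α : ℝ} (hα : α ∈ Ioo (0 : ℝ) 2) :
    Integrable (levyWeight N α) := by
  have hN : 1 ≤ N := NeZero.one_le
  have : Nontrivial (Space N) := by
    have : Nonempty (Fin N) := ⟨0⟩
    infer_instance
  have h := integrable_fun_norm_addHaar (volume : Measure (Space N))
    (f := fun r : ℝ => min 1 (r ^ 2) / r ^ ((N : ℝ) + α))
  refine h.2 ?_
  simp only [finrank_euclideanSpace, Fintype.card_fin, smul_eq_mul]
  have e : ∀ r ∈ Ioi (0 : ℝ), r ^ (N - 1) * (min 1 (r ^ 2) / r ^ ((N : ℝ) + α)) =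
      min 1 (r ^ 2) * r ^ (-1 - α) := by
    intro r hr
    have hr' : (0 : ℝ) < r := hr
    have h1 : r ^ ((N : ℝ) - 1) = r ^ (N - 1) := by
      rw [← Real.rpow_natCast, Nat.cast_sub hN, Nat.cast_one]
    rw [show (-1 - α : ℝ) = ((N : ℝ) - 1) - (N + α) by ring, Real.rpow_sub hr' ((N : ℝ) - 1), h1]
    ring
  rw [integrableOn_congr_fun e measurableSet_Ioi, ← Ioc_union_Ioi_eq_Ioi zero_le_one]
  refine IntegrableOn.union ?_ ?_
  · have h1 : IntegrableOn (fun r : ℝ => r ^ (1 - α)) (Ioc 0 1) := by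
      rw [← intervalIntegrable_iff_integrableOn_Ioc_of_le zero_le_one]
      exact intervalIntegral.intervalIntegrable_rpow' (by linarith [hα.2])
    refine h1.congr_fun (fun r hr => ?_) measurableSet_Ioc
    have : r ^ 2 ≤ 1 := pow_le_one₀ hr.1.le hr.2
    simp only
    rw [min_eq_right this, ← Real.rpow_two, ← Real.rpow_add hr.1]
    congr 1
    ring
  · have h1 : IntegrableOn (fun r : ℝ => r ^ (-1 - α)) (Ioi 1) :=
      integrableOn_Ioi_rpow_of_lt (by linarith [hα.1]) one_pos
    refine h1.congr_fun (fun r hr => ?_) measurableSet_Ioi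
    have : 1 ≤ r ^ 2 := one_le_pow₀ (le_of_lt hr)
    simp only
    rw [min_eq_left this, one_mul]

/-- The symbol `(k·w)² / (1 + (k·w)²)`. -/
noncomputable def dissipation (k w : Space N) : ℝ := inner ℝ k w ^ 2 / (1 + inner ℝ k w ^ 2)

theorem dissipation_nonneg (k w : Space N) : 0 ≤ dissipation k w := by
  unfold dissipation; positivity

theorem continuous_dissipation (k : Space N) : Continuous (dissipation k) := by
  unfold dissipation
  refine Continuous.div (by fun_prop) (by fun_prop) fun w => ?_
  positivity

theorem dissipation_le (k w : Space N) :
    dissipation k w ≤ (1 + ‖k‖ ^ 2) * min 1 (‖w‖ ^ 2) := by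
  have h0 : 0 ≤ inner ℝ k w ^ 2 := sq_nonneg _
  have h1 : dissipation k w ≤ 1 := by
    unfold dissipation
    rw [div_le_one (by positivity)]
    linarith
  have h2 : dissipation k w ≤ ‖k‖ ^ 2 * ‖w‖ ^ 2 := by
    refine (div_le_self h0 (by linarith)).trans ?_
    rw [← mul_pow, ← sq_abs]
    exact pow_le_pow_left₀ (abs_nonneg _) (abs_real_inner_le_norm k w) 2
  have hk : 0 ≤ ‖k‖ ^ 2 := by positivity
  have hw : 0 ≤ ‖w‖ ^ 2 := by positivity
  rcases le_total 1 (‖w‖ ^ 2) with h | h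
  · rw [min_eq_left h]; linarith
  · rw [min_eq_right h]; nlinarith

theorem integrable_dissipation_div [NeZero N] {α κ₀ : ℝ} (hα : α ∈ Ioo (0 : ℝ) 2) (hκ₀ : 0 < κ₀)
    (k : Space N) :
    Integrable fun w : Space N => dissipation k w * (κ₀ / ‖w‖ ^ ((N : ℝ) + α)) := by
  refine ((integrable_levyWeight (N := N) hα).const_mul (κ₀ * (1 + ‖k‖ ^ 2))).mono' ?_ ?_
  · have := (continuous_dissipation k).measurable
    exact (this.mul (by fun_prop)).aestronglyMeasurable
  · refine Eventually.of_forall fun w => ?_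
    have h1 := dissipation_nonneg k w
    rw [Real.norm_of_nonneg (by positivity)]
    calc _ ≤ (1 + ‖k‖ ^ 2) * min 1 (‖w‖ ^ 2) * (κ₀ / ‖w‖ ^ ((N : ℝ) + α)) := by
          gcongr
          exact dissipation_le k w
      _ = _ := by unfold levyWeight; ring

theorem kappaIntegrand_eq [NeZero N] (α κ₀ : ℝ) (w : Space N) :
    kappaIntegrand α κ₀ w =
      dissipation (EuclideanSpace.single 0 1) w * (κ₀ / ‖w‖ ^ ((N : ℝ) + α)) := by
  simp [kappaIntegrand, dissipation, EuclideanSpace.inner_single_left]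

theorem integrable_kappaIntegrand [NeZero N] {α κ₀ : ℝ} (hα : α ∈ Ioo (0 : ℝ) 2) (hκ₀ : 0 < κ₀) :
    Integrable (fun w : Space N => kappaIntegrand α κ₀ w) := by
  simp_rw [kappaIntegrand_eq]
  exact integrable_dissipation_div hα hκ₀ _

/-- The density is rotation invariant, so a reflection carries the direction of k to the first
coordinate axis. It is also homogeneous of degree -(N+α), so rescaling by |k| yields |k|^(N+α)
|k|^(-N) = |k|^α. -/
theorem integral_dissipation_div [NeZero N] {α κ₀ : ℝ} (hα : α ∈ Ioo (0 : ℝ) 2) (k : Space N) :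
    ∫ w : Space N, dissipation k w * (κ₀ / ‖w‖ ^ ((N : ℝ) + α)) = kappa N α κ₀ * ‖k‖ ^ α := by
  rcases eq_or_ne k 0 with rfl | hk
  · simp [dissipation, Real.zero_rpow hα.1.ne']
  have hr : 0 < ‖k‖ := norm_pos_iff.2 hk
  set e : Space N := ‖k‖⁻¹ • k with he
  have hke : k = ‖k‖ • e := by rw [he, smul_smul, mul_inv_cancel₀ hr.ne', one_smul]
  have hne : ‖e‖ = ‖(EuclideanSpace.single 0 1 : Space N)‖ := by
    rw [he, norm_smul, norm_inv, norm_norm, inv_mul_cancel₀ hr.ne']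
    simp
  -- rotation
  have hrot : ∫ w : Space N, dissipation e w * (κ₀ / ‖w‖ ^ ((N : ℝ) + α)) = kappa N α κ₀ := by
    set R := ((ℝ ∙ (e - EuclideanSpace.single 0 1))ᗮ).reflection
    have hR : R e = EuclideanSpace.single 0 1 := Submodule.reflection_sub hne
    have h1 := R.measurePreserving.integral_comp R.toHomeomorph.measurableEmbedding
      (fun w : Space N => kappaIntegrand α κ₀ w)
    rw [kappa, ← h1]
    congr 1
    ext w
    rw [kappaIntegrand_eq, ← hR]
    simp only [dissipation, LinearIsometryEquiv.inner_map_map, LinearIsometryEquiv.norm_map]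
  -- scaling
  have hsc := Measure.integral_comp_smul (volume : Measure (Space N))
    (fun w : Space N => dissipation e w * (κ₀ / ‖w‖ ^ ((N : ℝ) + α))) ‖k‖
  rw [hrot, finrank_euclideanSpace, Fintype.card_fin] at hsc
  have h2 : ∀ w : Space N, dissipation k w * (κ₀ / ‖w‖ ^ ((N : ℝ) + α)) =
      ‖k‖ ^ ((N : ℝ) + α) *
        (dissipation e (‖k‖ • w) * (κ₀ / ‖‖k‖ • w‖ ^ ((N : ℝ) + α))) := by
    intro w
    have h3 : dissipation e (‖k‖ • w) = dissipation k w := by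
      conv_rhs => rw [hke]
      simp [dissipation, inner_smul_left, inner_smul_right]
    rw [h3, norm_smul, norm_norm, Real.mul_rpow hr.le (norm_nonneg _)]
    have : ‖k‖ ^ ((N : ℝ) + α) ≠ 0 := (Real.rpow_pos_of_pos hr _).ne'
    field_simp
  simp_rw [h2]
  rw [integral_const_mul, hsc, abs_of_pos (by positivity), Real.rpow_add hr, Real.rpow_natCast,
    smul_eq_mul]
  have : ‖k‖ ^ N ≠ 0 := (pow_pos hr _).ne'
  field_simp

variable {F : Space N → ℝ} {α κ₀ : ℝ}

theorem exists_tail_bound (hκ₀ : 0 < κ₀)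
    (hFtail : Asymptotics.IsEquivalent (cocompact (Space N)) F
      (fun v => κ₀ / ‖v‖ ^ ((N : ℝ) + α))) :
    ∃ R : ℝ, 0 < R ∧ ∀ v, R ≤ ‖v‖ → |F v| ≤ 2 * (κ₀ / ‖v‖ ^ ((N : ℝ) + α)) := by
  have h1 := hFtail.isLittleO.def (c := 1) one_pos
  rw [← Metric.cobounded_eq_cocompact] at h1
  obtain ⟨R, -, hR⟩ := (hasBasis_cobounded_norm (E := Space N)).eventually_iff.1 h1
  refine ⟨max R 1, by positivity, fun v hv => ?_⟩
  have h2 := @hR v ((le_max_left _ _).trans hv)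
  have h3 : 0 ≤ κ₀ / ‖v‖ ^ ((N : ℝ) + α) := by positivity
  simp only [Pi.sub_apply, Real.norm_eq_abs, one_mul, abs_of_nonneg h3] at h2
  have := abs_le.1 h2
  rw [abs_le]
  constructor <;> linarith

/-- Substituting w = εv, the Jacobian supplies ε^(-N). In this form the rescaled tail is compared
directly with its homogeneous limit. -/
theorem tail_integral_eq {ε : ℝ} (he : 0 < ε) (R : ℝ)
    (g : Space N → ℝ) :
    (ε ^ α)⁻¹ * ∫ v, {v : Space N | R ≤ ‖v‖}.indicator F v * g (ε • v) =
      ∫ w, (ε ^ ((N : ℝ) + α))⁻¹ * ({v : Space N | R ≤ ‖v‖}.indicator F (ε⁻¹ • w) * g w) := by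
  have h := Measure.integral_comp_smul (volume : Measure (Space N))
    (fun w : Space N => {v : Space N | R ≤ ‖v‖}.indicator F (ε⁻¹ • w) * g w) ε
  simp only [smul_smul, inv_mul_cancel₀ he.ne', one_smul] at h
  rw [h, integral_const_mul, finrank_euclideanSpace, Fintype.card_fin, abs_of_pos (by positivity),
    Real.rpow_add he, Real.rpow_natCast, smul_eq_mul]
  ring

theorem abs_tail_le {R : ℝ} (hR : ∀ v, R ≤ ‖v‖ → |F v| ≤ 2 * (κ₀ / ‖v‖ ^ ((N : ℝ) + α)))
    (hκ₀ : 0 < κ₀) {ε B : ℝ} (he : 0 < ε) {g : Space N → ℝ}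
    (hgB : ∀ w, |g w| ≤ B * min 1 (‖w‖ ^ 2)) (w : Space N) :
    |(ε ^ ((N : ℝ) + α))⁻¹ * ({v : Space N | R ≤ ‖v‖}.indicator F (ε⁻¹ • w) * g w)| ≤
      2 * κ₀ * B * levyWeight N α w := by
  have hB : 0 ≤ B * min 1 (‖w‖ ^ 2) := (abs_nonneg _).trans (hgB w)
  have h1 : |{v : Space N | R ≤ ‖v‖}.indicator F (ε⁻¹ • w)| ≤
      2 * (κ₀ / ‖ε⁻¹ • w‖ ^ ((N : ℝ) + α)) := by
    by_cases h : R ≤ ‖ε⁻¹ • w‖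
    · rw [indicator_of_mem (by exact h)]; exact hR _ h
    · rw [indicator_of_notMem (by exact h), abs_zero]; positivity
  rw [abs_mul, abs_mul, abs_of_pos (by positivity)]
  calc _ ≤ (ε ^ ((N : ℝ) + α))⁻¹ * (2 * (κ₀ / ‖ε⁻¹ • w‖ ^ ((N : ℝ) + α)) *
        (B * min 1 (‖w‖ ^ 2))) := by gcongr; exact hgB w
    _ = _ := by
      unfold levyWeight
      rw [norm_smul, norm_inv, Real.norm_of_nonneg he.le,
        Real.mul_rpow (inv_nonneg.2 he.le) (norm_nonneg _), Real.inv_rpow he.le]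
      have : ε ^ ((N : ℝ) + α) ≠ 0 := (Real.rpow_pos_of_pos he _).ne'
      field_simp

/-- Heavy tails: limit of rescaled averages of a function vanishing quadratically at the origin. -/
theorem tendsto_rescaled_integral [NeZero N] (hα : α ∈ Ioo (0 : ℝ) 2) (hκ₀ : 0 < κ₀)
    (hFi : Integrable F)
    (hFtail : Asymptotics.IsEquivalent (cocompact (Space N)) F
      (fun v => κ₀ / ‖v‖ ^ ((N : ℝ) + α))) :
    (∀ (g : Space N → ℝ) (B : ℝ), Measurable g → (∀ w, |g w| ≤ B * min 1 (‖w‖ ^ 2)) →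
      Tendsto (fun ε : ℝ => (ε ^ α)⁻¹ * ∫ v, F v * g (ε • v)) (𝓝[>] 0)
        (𝓝 (∫ w, g w * (κ₀ / ‖w‖ ^ ((N : ℝ) + α))))) ∧
    ∃ C : ℝ, ∀ (g : Space N → ℝ) (B : ℝ), Measurable g → (∀ w, |g w| ≤ B * min 1 (‖w‖ ^ 2)) →
      ∀ ε ∈ Ioc (0 : ℝ) 1, |(ε ^ α)⁻¹ * ∫ v, F v * g (ε • v)| ≤ C * B := by
  obtain ⟨R, hR0, hR⟩ := exists_tail_bound hκ₀ hFtail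
  set S : Set (Space N) := {v | R ≤ ‖v‖} with hS
  have hSm : MeasurableSet S := measurableSet_le measurable_const measurable_norm
  have hbd : ∀ {g : Space N → ℝ} {B : ℝ}, (∀ w, |g w| ≤ B * min 1 (‖w‖ ^ 2)) → 0 ≤ B := by
    intro g B hg
    have h1 := (abs_nonneg _).trans (hg (EuclideanSpace.single 0 1))
    simpa using h1
  have hg1 : ∀ {g : Space N → ℝ} {B : ℝ}, (∀ w, |g w| ≤ B * min 1 (‖w‖ ^ 2)) → ∀ w, ‖g w‖ ≤ B := by
    intro g B hg w
    exact (hg w).trans (mul_le_of_le_one_right (hbd hg) (min_le_left _ _))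
  have hsplit : ∀ {g : Space N → ℝ} {B : ℝ}, Measurable g →
      (∀ w, |g w| ≤ B * min 1 (‖w‖ ^ 2)) → ∀ ε : ℝ,
      ∫ v, F v * g (ε • v) = (∫ v, Sᶜ.indicator F v * g (ε • v)) +
        ∫ v, S.indicator F v * g (ε • v) := by
    intro g B hgm hg ε
    have hb : ∀ᵐ v : Space N, ‖g (ε • v)‖ ≤ B := Eventually.of_forall fun v => hg1 hg _
    have hgs : AEStronglyMeasurable (fun v : Space N => g (ε • v)) :=
      (hgm.comp (by fun_prop)).aestronglyMeasurable
    rw [← integral_add ((hFi.indicator hSm.compl).mul_bdd hgs hb)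
      ((hFi.indicator hSm).mul_bdd hgs hb)]
    congr 1
    ext v
    by_cases hv : v ∈ S <;> simp [hv]
  -- bounded velocities
  have hnear : ∀ {g : Space N → ℝ} {B : ℝ}, Measurable g →
      (∀ w, |g w| ≤ B * min 1 (‖w‖ ^ 2)) → ∀ ε : ℝ, 0 < ε →
      |(ε ^ α)⁻¹ * ∫ v, Sᶜ.indicator F v * g (ε • v)| ≤
        ε ^ (2 - α) * (B * R ^ 2 * ∫ v, ‖F v‖) := by
    intro g B hgm hg ε hε
    -- On the ball of radius R the quadratic vanishing of g at the origin gives a factor ε², which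
    -- beats ε^α.
    have h1 : |∫ v, Sᶜ.indicator F v * g (ε • v)| ≤ ε ^ 2 * (B * R ^ 2 * ∫ v, ‖F v‖) := by
      rw [← mul_assoc, ← integral_const_mul, ← Real.norm_eq_abs]
      refine norm_integral_le_of_norm_le (hFi.norm.const_mul _) (Eventually.of_forall fun v => ?_)
      have hB := hbd hg
      by_cases hv : v ∈ S
      · simp [hv]; positivity
      · have hv' : ‖v‖ ≤ R := le_of_lt (not_le.1 hv)
        rw [indicator_of_mem (by simpa using hv), norm_mul, mul_comm]
        gcongr
        refine (hg _).trans ?_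
        calc B * min 1 (‖ε • v‖ ^ 2) ≤ B * ‖ε • v‖ ^ 2 := by gcongr; exact min_le_right _ _
          _ = ε ^ 2 * (B * ‖v‖ ^ 2) := by rw [norm_smul, Real.norm_of_nonneg hε.le]; ring
          _ ≤ _ := by gcongr
    rw [abs_mul, abs_of_pos (by positivity), Real.rpow_sub hε, Real.rpow_two, div_mul_eq_mul_div,
      ← div_eq_inv_mul]
    gcongr
  -- The first term of the constant dominates the tail, the second the bounded velocities, where
  -- ε^(2-α) ≤ 1 is used.
  refine ⟨fun g B hgm hg => ?_, 2 * κ₀ * (∫ w, levyWeight N α w) + R ^ 2 * ∫ v, ‖F v‖,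
    fun g B hgm hg ε hε => ?_⟩
  · have hlim1 : Tendsto (fun ε : ℝ => (ε ^ α)⁻¹ * ∫ v, Sᶜ.indicator F v * g (ε • v)) (𝓝[>] 0)
        (𝓝 0) := by
      have h2 : Tendsto (fun ε : ℝ => ε ^ (2 - α) * (B * R ^ 2 * ∫ v, ‖F v‖)) (𝓝[>] 0) (𝓝 0) := by
        have h3 : Tendsto (fun ε : ℝ => ε ^ (2 - α)) (𝓝[>] 0) (𝓝 0) := by
          have := (Real.continuousAt_rpow_const 0 (2 - α) (Or.inr (by linarith [hα.2]))).tendsto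
          rw [Real.zero_rpow (by linarith [hα.2])] at this
          exact this.mono_left nhdsWithin_le_nhds
        simpa using h3.mul_const (B * R ^ 2 * ∫ v, ‖F v‖)
      refine squeeze_zero_norm' ?_ h2
      filter_upwards [self_mem_nhdsWithin] with ε hε
      exact hnear hgm hg ε hε
    have hlim2 : Tendsto (fun ε : ℝ => (ε ^ α)⁻¹ * ∫ v, S.indicator F v * g (ε • v)) (𝓝[>] 0)
        (𝓝 (∫ w, g w * (κ₀ / ‖w‖ ^ ((N : ℝ) + α)))) := by
      -- For w ≠ 0 the argument w/ε escapes to infinity, where F is equivalent to its homogeneous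
      -- tail. The tail bound with the factor 2 provides an ε-independent multiple of the Lévy
      -- weight as dominating function.
      have h3 : Tendsto (fun ε : ℝ => ∫ w, (ε ^ ((N : ℝ) + α))⁻¹ * (S.indicator F (ε⁻¹ • w) * g w))
          (𝓝[>] 0) (𝓝 (∫ w, g w * (κ₀ / ‖w‖ ^ ((N : ℝ) + α)))) := by
        refine tendsto_integral_filter_of_dominated_convergence
          (fun w => 2 * κ₀ * B * levyWeight N α w) ?_ ?_
          ((integrable_levyWeight hα).const_mul _) ?_
        · filter_upwards [self_mem_nhdsWithin] with ε hε
          have h4 : AEStronglyMeasurable (fun w : Space N => S.indicator F (ε⁻¹ • w)) :=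
            (((hFi.indicator hSm).comp_smul (inv_ne_zero (ne_of_gt hε)))).aestronglyMeasurable
          exact (h4.mul hgm.aestronglyMeasurable).const_mul _
        · filter_upwards [self_mem_nhdsWithin] with ε hε
          exact Eventually.of_forall fun w => abs_tail_le hR hκ₀ hε hg w
        · have : NeZero (Module.finrank ℝ (Space N)) := ⟨by
            simpa using NeZero.ne N⟩
          have : Nontrivial (Space N) := Module.nontrivial_of_finrank_pos (R := ℝ)
            (by simpa using NeZero.pos N)
          have hae : ∀ᵐ w : Space N, w ≠ 0 := by simp [ae_iff]
          filter_upwards [hae] with w hw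
          have hw' : 0 < ‖w‖ := norm_pos_iff.2 hw
          have hto : Tendsto (fun ε : ℝ => ε⁻¹ • w) (𝓝[>] 0) (cocompact (Space N)) := by
            rw [← Metric.cobounded_eq_cocompact, ← tendsto_norm_atTop_iff_cobounded]
            simp_rw [norm_smul]
            refine Tendsto.atTop_mul_const hw' ?_
            exact tendsto_norm_atTop_atTop.comp tendsto_inv_nhdsGT_zero
          have hne : ∀ᶠ v in cocompact (Space N), κ₀ / ‖v‖ ^ ((N : ℝ) + α) ≠ 0 := by
            have : ∀ᶠ v in cocompact (Space N), v ≠ 0 := by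
              have := (isCompact_singleton (x := (0 : Space N))).compl_mem_cocompact
              filter_upwards [this] with v hv using hv
            filter_upwards [this] with v hv
            have := norm_pos_iff.2 hv
            positivity
          have h5 := ((Asymptotics.isEquivalent_iff_tendsto_one hne).1 hFtail).comp hto
          have h6 : Tendsto (fun ε : ℝ => (F (ε⁻¹ • w) / (κ₀ / ‖ε⁻¹ • w‖ ^ ((N : ℝ) + α))) *
              (g w * (κ₀ / ‖w‖ ^ ((N : ℝ) + α)))) (𝓝[>] 0)
              (𝓝 (g w * (κ₀ / ‖w‖ ^ ((N : ℝ) + α)))) := by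
            simpa using h5.mul_const (g w * (κ₀ / ‖w‖ ^ ((N : ℝ) + α)))
          refine h6.congr' ?_
          have hSc : ∀ᶠ v in cocompact (Space N), v ∈ S := by
            rw [← Metric.cobounded_eq_cocompact]
            exact (hasBasis_cobounded_norm (E := Space N)).mem_of_mem (i := R) trivial
          filter_upwards [self_mem_nhdsWithin, hto.eventually hSc] with ε hε hεS
          have hε' : (0 : ℝ) < ε := hε
          rw [indicator_of_mem hεS, norm_smul, norm_inv, Real.norm_of_nonneg hε'.le,
            Real.mul_rpow (inv_nonneg.2 hε'.le) (norm_nonneg _), Real.inv_rpow hε'.le]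
          have h7 : ε ^ ((N : ℝ) + α) ≠ 0 := (Real.rpow_pos_of_pos hε' _).ne'
          have h8 : ‖w‖ ^ ((N : ℝ) + α) ≠ 0 := (Real.rpow_pos_of_pos hw' _).ne'
          field_simp
      refine h3.congr' ?_
      filter_upwards [self_mem_nhdsWithin] with ε hε
      exact (tail_integral_eq hε R g).symm
    have := hlim1.add hlim2
    rw [zero_add] at this
    refine this.congr fun ε => ?_
    rw [hsplit hgm hg ε, mul_add]
  · have hB := hbd hg
    rw [hsplit hgm hg ε, mul_add, tail_integral_eq hε.1 R g]
    refine (abs_add_le _ _).trans ?_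
    have h1 := hnear hgm hg ε hε.1
    have h2 : |∫ w, (ε ^ ((N : ℝ) + α))⁻¹ * (S.indicator F (ε⁻¹ • w) * g w)| ≤
        ∫ w, 2 * κ₀ * B * levyWeight N α w := by
      rw [← Real.norm_eq_abs]
      exact norm_integral_le_of_norm_le ((integrable_levyWeight hα).const_mul _)
        (Eventually.of_forall fun w => abs_tail_le hR hκ₀ hε.1 hg w)
    rw [integral_const_mul (2 * κ₀ * B)] at h2
    have h3 : ε ^ (2 - α) ≤ 1 := Real.rpow_le_one hε.1.le hε.2 (by linarith [hα.2])
    have h4 : 0 ≤ B * R ^ 2 * ∫ v, ‖F v‖ :=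
      mul_nonneg (by positivity) (integral_nonneg fun v => norm_nonneg _)
    have h5 := h1.trans (mul_le_of_le_one_left h4 h3)
    linarith

end Kappa

end FractionalDiffusion

namespace FractionalDiffusion

/-! ### The Fourier transform on L² and for integrable functions -/

section FourierL2

open SchwartzMap

variable {V : Type*} [NormedAddCommGroup V] [InnerProductSpace ℝ V] [FiniteDimensional ℝ V]
  [MeasurableSpace V] [BorelSpace V]

/-- Square integrable complex functions, up to equality almost everywhere. -/
noncomputable abbrev L2 (V : Type*) [NormedAddCommGroup V] [InnerProductSpace ℝ V] [FiniteDimensional ℝ V]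
  [MeasurableSpace V] [BorelSpace V] := Lp (α := V) ℂ 2 volume

/-- The class of a square integrable function. -/
noncomputable abbrev toL2 {u : V → ℂ} (h : MemLp u 2) : L2 V := h.toLp u

theorem continuous_fourier {u : V → ℂ} (hu : Integrable u) : Continuous (𝓕 u) :=
  VectorFourier.fourierIntegral_continuous Real.continuous_fourierChar
    (by exact continuous_inner) hu

theorem continuous_fourierInv {u : V → ℂ} (hu : Integrable u) : Continuous (𝓕⁻ u) := by
  rw [Real.fourierInv_eq_fourier_comp_neg]
  exact continuous_fourier hu.comp_neg

theorem integral_fourier_mul_eq {u g : V → ℂ} (hu : Integrable u) (hg : Integrable g) :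
    ∫ x, 𝓕 u x * g x = ∫ ξ, u ξ * 𝓕 g ξ := by
  have := VectorFourier.integral_fourierIntegral_smul_eq_flip (L := innerₗ V)
    (μ := volume) (ν := volume) Real.continuous_fourierChar continuous_inner hu hg
  simpa using! this

theorem integral_fourierInv_mul_eq {u g : V → ℂ} (hu : Integrable u) (hg : Integrable g) :
    ∫ x, 𝓕⁻ u x * g x = ∫ ξ, u ξ * 𝓕⁻ g ξ := by
  simp only [Real.fourierInv_eq_fourier_neg]
  rw [← integral_neg_eq_self]
  simp only [neg_neg]
  rw [integral_fourier_mul_eq hu hg.comp_neg]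
  congr 1; ext x
  rw [← Real.fourierInv_eq_fourier_neg, Real.fourierInv_eq_fourier_comp_neg]

/-- The `L²` inverse Fourier transform of an integrable function is given by the integral. -/
theorem coeFn_fourierInv_toLp {u : V → ℂ} (h1 : Integrable u) (h2 : MemLp u 2) :
    ((𝓕⁻ (toL2 h2) : L2 V) : V → ℂ) =ᵐ[volume] 𝓕⁻ u := by
  refine ae_eq_of_integral_contDiff_smul_eq
    ((Lp.memLp _).locallyIntegrable (by norm_num)) (continuous_fourierInv h1).locallyIntegrable ?_
  intro g hg hgc
  have hgc' : HasCompactSupport (fun x => (g x : ℂ)) := hgc.comp_left (g := ((↑) : ℝ → ℂ)) rfl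
  let G : 𝓢(V, ℂ) := hgc'.toSchwartzMap (Complex.ofRealCLM.contDiff.comp hg)
  have hG : ∀ x, G x = (g x : ℂ) := fun x => rfl
  -- Both versions of the transform are compared as distributions, the abstract one through its
  -- definition by duality and the integral one by Fubini.
  have key := congrArg (fun T => T G) (Lp.fourierInv_toTemperedDistribution_eq (toL2 h2))
  simp only [TemperedDistribution.fourierInv_apply, Lp.toTemperedDistribution_apply] at key
  have e1 : ∫ x, g x • ((𝓕⁻ (toL2 h2) : L2 V) : V → ℂ) x
      = ∫ x, G x • ((𝓕⁻ (toL2 h2) : L2 V) : V → ℂ) x := by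
    simp [hG]
  rw [e1, ← key]
  have e2 : ∫ x, (𝓕⁻ G) x • (toL2 h2) x = ∫ x, u x * 𝓕⁻ (G : V → ℂ) x := by
    refine integral_congr_ae ?_
    filter_upwards [h2.coeFn_toLp] with x hx
    rw [hx, SchwartzMap.fourierInv_coe, smul_eq_mul, mul_comm]
  rw [e2, ← integral_fourierInv_mul_eq h1 G.integrable]
  congr 1; ext x
  rw [hG, Complex.real_smul, mul_comm]

theorem coeFn_fourier_toLp {u : V → ℂ} (h1 : Integrable u) (h2 : MemLp u 2) :
    ((𝓕 (toL2 h2) : L2 V) : V → ℂ) =ᵐ[volume] 𝓕 u := by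
  refine ae_eq_of_integral_contDiff_smul_eq
    ((Lp.memLp _).locallyIntegrable (by norm_num))
    (continuous_fourier h1).locallyIntegrable ?_
  intro g hg hgc
  have hgc' : HasCompactSupport (fun x => (g x : ℂ)) := hgc.comp_left (g := ((↑) : ℝ → ℂ)) rfl
  let G : 𝓢(V, ℂ) := hgc'.toSchwartzMap (Complex.ofRealCLM.contDiff.comp hg)
  have hG : ∀ x, G x = (g x : ℂ) := fun x => rfl
  have key := congrArg (fun T => T G) (Lp.fourier_toTemperedDistribution_eq (toL2 h2))
  simp only [TemperedDistribution.fourier_apply, Lp.toTemperedDistribution_apply] at key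
  have e1 : ∫ x, g x • ((𝓕 (toL2 h2) : L2 V) : V → ℂ) x
      = ∫ x, G x • ((𝓕 (toL2 h2) : L2 V) : V → ℂ) x := by
    simp [hG]
  rw [e1, ← key]
  have e2 : ∫ x, (𝓕 G) x • (toL2 h2) x = ∫ x, u x * 𝓕 (G : V → ℂ) x := by
    refine integral_congr_ae ?_
    filter_upwards [h2.coeFn_toLp] with x hx
    rw [hx, SchwartzMap.fourier_coe, smul_eq_mul, mul_comm]
  rw [e2, ← integral_fourier_mul_eq h1 G.integrable]
  congr 1; ext x
  rw [hG, Complex.real_smul, mul_comm]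

theorem memLp_fourierInv {u : V → ℂ} (h1 : Integrable u) (h2 : MemLp u 2) :
    MemLp (𝓕⁻ u) 2 := (memLp_congr_ae (coeFn_fourierInv_toLp h1 h2)).1 (Lp.memLp _)

theorem memLp_fourier {u : V → ℂ} (h1 : Integrable u) (h2 : MemLp u 2) :
    MemLp (𝓕 u) 2 := (memLp_congr_ae (coeFn_fourier_toLp h1 h2)).1 (Lp.memLp _)

theorem eLpNorm_coeFn_fourierInv (f : L2 V) :
    eLpNorm (𝓕⁻ f : L2 V) 2 volume = eLpNorm f 2 volume := by
  have h : ‖(𝓕⁻ f : L2 V)‖ = ‖f‖ := (Lp.fourierTransformₗᵢ V ℂ).symm.norm_map f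
  rw [Lp.norm_def, Lp.norm_def] at h
  exact (ENNReal.toReal_eq_toReal_iff' (Lp.memLp _).2.ne (Lp.memLp _).2.ne).1 h

/-- Plancherel for integrable functions. -/
theorem eLpNorm_fourierInv {u : V → ℂ} (h1 : Integrable u) (h2 : MemLp u 2) :
    eLpNorm (𝓕⁻ u) 2 volume = eLpNorm u 2 volume := by
  rw [← eLpNorm_congr_ae (coeFn_fourierInv_toLp h1 h2), eLpNorm_coeFn_fourierInv,
    eLpNorm_congr_ae h2.coeFn_toLp]

theorem eLpNorm_fourier {u : V → ℂ} (h1 : Integrable u) (h2 : MemLp u 2) :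
    eLpNorm (𝓕 u) 2 volume = eLpNorm u 2 volume := by
  rw [← eLpNorm_congr_ae (coeFn_fourier_toLp h1 h2), ← eLpNorm_congr_ae h2.coeFn_toLp]
  have h : ‖(𝓕 (toL2 h2) : L2 V)‖ = ‖toL2 h2‖ := Lp.norm_fourier_eq _
  rw [Lp.norm_def, Lp.norm_def] at h
  exact (ENNReal.toReal_eq_toReal_iff' (Lp.memLp _).2.ne (Lp.memLp _).2.ne).1 h

/-- Both sides are continuous bilinear forms on L², so it suffices to check Schwartz functions, by
density in one argument and then in the other. -/
theorem integral_mul_coeFn_fourierInv (f g : L2 V) :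
    ∫ x, f x * (𝓕⁻ g : L2 V) x = ∫ x, (𝓕⁻ f : L2 V) x * g x := by
  have hB : ∀ f g : L2 V, (ContinuousLinearMap.mul ℂ ℂ).lpPairing volume 2 2 f g
      = ∫ x, f x * g x := fun f g => by
    rw [ContinuousLinearMap.lpPairing_eq_integral]; simp only [ContinuousLinearMap.mul_apply']
  rw [← hB, ← hB]
  refine DenseRange.induction_on (p := fun f : L2 V =>
      (ContinuousLinearMap.mul ℂ ℂ).lpPairing volume 2 2 f (𝓕⁻ g) =
      (ContinuousLinearMap.mul ℂ ℂ).lpPairing volume 2 2 (𝓕⁻ f) g)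
    (SchwartzMap.denseRange_toLpCLM (p := 2) ENNReal.ofNat_ne_top) f ?_ ?_
  · exact isClosed_eq (by fun_prop) (by
      have : Continuous fun f : L2 V => 𝓕⁻ f :=
        (Lp.fourierTransformₗᵢ V ℂ).symm.continuous
      fun_prop)
  intro φ
  refine DenseRange.induction_on (p := fun g : L2 V =>
      (ContinuousLinearMap.mul ℂ ℂ).lpPairing volume 2 2 (toLpCLM ℂ ℂ 2 volume φ) (𝓕⁻ g) =
      (ContinuousLinearMap.mul ℂ ℂ).lpPairing volume 2 2 (𝓕⁻ (toLpCLM ℂ ℂ 2 volume φ)) g)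
    (SchwartzMap.denseRange_toLpCLM (p := 2) ENNReal.ofNat_ne_top) g ?_ ?_
  · refine isClosed_eq ?_ (by fun_prop)
    have : Continuous fun f : L2 V => 𝓕⁻ f :=
        (Lp.fourierTransformₗᵢ V ℂ).symm.continuous
    fun_prop
  intro ψ
  rw [hB, hB]
  simp only [toLpCLM_apply, SchwartzMap.toLp_fourierInv_eq]
  have e1 : ∫ x, (φ.toLp 2 : V → ℂ) x * ((𝓕⁻ ψ).toLp 2 : V → ℂ) x
      = ∫ x, φ x * 𝓕⁻ (ψ : V → ℂ) x := by
    refine integral_congr_ae ?_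
    filter_upwards [φ.coeFn_toLp 2, (𝓕⁻ ψ).coeFn_toLp 2] with x h1 h2
    rw [h1, h2, SchwartzMap.fourierInv_coe]
  have e2 : ∫ x, ((𝓕⁻ φ).toLp 2 : V → ℂ) x * (ψ.toLp 2 : V → ℂ) x
      = ∫ x, 𝓕⁻ (φ : V → ℂ) x * ψ x := by
    refine integral_congr_ae ?_
    filter_upwards [ψ.coeFn_toLp 2, (𝓕⁻ φ).coeFn_toLp 2] with x h1 h2
    rw [h1, h2, SchwartzMap.fourierInv_coe]
  rw [e1, e2, integral_fourierInv_mul_eq φ.integrable ψ.integrable]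

/-- Every `h ∈ L²` has an `L²` Fourier transform `R`, determined by duality. -/
theorem exists_fourierInv_two {h : V → ℂ} (hh : MemLp h 2) :
    ∃ R : V → ℂ, StronglyMeasurable R ∧ MemLp R 2 ∧ eLpNorm R 2 volume = eLpNorm h 2 volume ∧
      ∀ u : V → ℂ, Integrable u → MemLp u 2 → ∫ x, h x * 𝓕⁻ u x = ∫ ξ, R ξ * u ξ := by
  refine ⟨(𝓕⁻ (toL2 hh) : L2 V), Lp.stronglyMeasurable _, Lp.memLp _, ?_, ?_⟩
  · rw [eLpNorm_coeFn_fourierInv, eLpNorm_congr_ae hh.coeFn_toLp]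
  intro u h1 h2
  have := integral_mul_coeFn_fourierInv (toL2 hh) (toL2 h2)
  have e1 : ∫ x, h x * 𝓕⁻ u x = ∫ x, toL2 hh x * (𝓕⁻ (toL2 h2) : L2 V) x := by
    refine integral_congr_ae ?_
    filter_upwards [hh.coeFn_toLp, coeFn_fourierInv_toLp h1 h2] with x h1 h2
    rw [h1, h2]
  rw [e1, this]
  refine integral_congr_ae ?_
  filter_upwards [h2.coeFn_toLp] with x h1
  rw [h1]

/-- Parseval in bilinear form: the self-duality of the inverse transform, applied to the transform
of u. -/
theorem integral_fourier_mul_fourierInv {u w : V → ℂ} (hu : Integrable u) (hu2 : MemLp u 2)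
    (hw : Integrable w) (hw2 : MemLp w 2) :
    ∫ x, 𝓕 u x * 𝓕⁻ w x = ∫ ξ, u ξ * w ξ := by
  have := integral_mul_coeFn_fourierInv (𝓕 (toL2 hu2)) (toL2 hw2)
  have h3 : 𝓕⁻ (𝓕 (toL2 hu2) : L2 V) = toL2 hu2 :=
    FourierTransform.fourierInv_fourier_eq _
  rw [h3] at this
  have e1 : ∫ x, 𝓕 u x * 𝓕⁻ w x = ∫ x, (𝓕 (toL2 hu2) : L2 V) x
      * (𝓕⁻ (toL2 hw2) : L2 V) x := by
    refine integral_congr_ae ?_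
    filter_upwards [coeFn_fourier_toLp hu hu2, coeFn_fourierInv_toLp hw hw2] with x h1 h2
    rw [h1, h2]
  rw [e1, this]
  refine integral_congr_ae ?_
  filter_upwards [hu2.coeFn_toLp, hw2.coeFn_toLp] with x h1 h2
  rw [h1, h2]

end FourierL2

end FractionalDiffusion

namespace FractionalDiffusion

/-! ### Band-limited functions -/

section BandLimited

variable {V : Type*} [NormedAddCommGroup V] [InnerProductSpace ℝ V] [FiniteDimensional ℝ V]
  [MeasurableSpace V] [BorelSpace V] {Z : Type*} [MeasurableSpace Z]

/-- Bounded measurable functions of bounded support. -/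
structure IsBand (b : V → ℂ) : Prop where
  measurable : Measurable b
  bounded : ∃ B : ℝ, ∀ ξ, ‖b ξ‖ ≤ B
  support : ∃ r : ℝ, ∀ ξ, r < ‖ξ‖ → b ξ = 0

theorem IsBand.exists_le_indicator {b : V → ℂ} (hb : IsBand b) : ∃ B r : ℝ, 0 ≤ B ∧
    ∀ ξ, ‖b ξ‖ ≤ (Metric.closedBall (0 : V) r).indicator (fun _ => B) ξ := by
  obtain ⟨B, hB⟩ := hb.bounded
  obtain ⟨r, hr⟩ := hb.support
  refine ⟨B, r, (norm_nonneg _).trans (hB 0), fun ξ => ?_⟩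
  by_cases h : ξ ∈ Metric.closedBall (0 : V) r
  · rw [indicator_of_mem h]; exact hB ξ
  · rw [indicator_of_notMem h, hr ξ (by simpa using h), norm_zero]

theorem memLp_indicator_closedBall (p : ℝ≥0∞) (r B : ℝ) :
    MemLp ((Metric.closedBall (0 : V) r).indicator (fun _ => B)) p :=
  memLp_indicator_const _ Metric.isClosed_closedBall.measurableSet _
    (Or.inr (isCompact_closedBall _ _).measure_lt_top.ne)

theorem IsBand.memLp {b : V → ℂ} (hb : IsBand b) (p : ℝ≥0∞) : MemLp b p := by
  obtain ⟨B, r, hB, h⟩ := hb.exists_le_indicator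
  refine (memLp_indicator_closedBall p r B).of_le hb.measurable.aestronglyMeasurable
    (ae_of_all _ fun ξ => (h ξ).trans (le_abs_self _))

theorem IsBand.integrable {b : V → ℂ} (hb : IsBand b) : Integrable b :=
  memLp_one_iff_integrable.1 (hb.memLp 1)

theorem IsBand.mul {b c : V → ℂ} (hb : IsBand b) (hc : Measurable c)
    (hC : ∀ r : ℝ, ∃ C : ℝ, ∀ ξ, ‖ξ‖ ≤ r → ‖c ξ‖ ≤ C) : IsBand (fun ξ => b ξ * c ξ) := by
  obtain ⟨B, hB⟩ := hb.bounded
  obtain ⟨r, hr⟩ := hb.support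
  obtain ⟨C, hC⟩ := hC r
  refine ⟨hb.measurable.mul hc, ⟨B * max C 0, fun ξ => ?_⟩, r, fun ξ h => by simp [hr ξ h]⟩
  rcases le_or_gt ‖ξ‖ r with h | h
  · rw [norm_mul]
    exact mul_le_mul (hB ξ) ((hC ξ h).trans (le_max_left _ _)) (norm_nonneg _)
      ((norm_nonneg _).trans (hB ξ))
  · rw [hr ξ h, zero_mul, norm_zero]
    exact mul_nonneg ((norm_nonneg _).trans (hB ξ)) (le_max_right _ _)

theorem IsBand.const_mul {b : V → ℂ} (hb : IsBand b) (c : ℂ) : IsBand (fun ξ => c * b ξ) := by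
  simpa only [mul_comm] using hb.mul (c := fun _ => c) measurable_const
    (fun _ => ⟨‖c‖, fun _ _ => le_rfl⟩)

theorem fourierInv_const_mul (c : ℂ) (b : V → ℂ) (x : V) :
    𝓕⁻ (fun ξ => c * b ξ) x = c * 𝓕⁻ b x := by
  simp only [Real.fourierInv_eq', smul_eq_mul]
  rw [← integral_const_mul]
  congr 1; ext; ring

theorem fourierInv_sub {b c : V → ℂ} (hb : Integrable b) (hc : Integrable c) (x : V) :
    𝓕⁻ (fun ξ => b ξ - c ξ) x = 𝓕⁻ b x - 𝓕⁻ c x := by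
  have h : ∀ {b : V → ℂ}, Integrable b → Integrable (fun ξ => 𝐞 (inner ℝ ξ x) • b ξ) := by
    intro b hb
    refine (hb.norm).mono' ?_ (ae_of_all _ fun ξ => by simp)
    have : Continuous fun ξ : V => (𝐞 (inner ℝ ξ x) : Circle) := by fun_prop
    exact this.aestronglyMeasurable.smul hb.1
  simp only [Real.fourierInv_eq]
  rw [← integral_sub (h hb) (h hc)]
  simp only [smul_sub]

theorem memLp_re_fourierInv {b : V → ℂ} (hb : IsBand b) :
    MemLp (fun x => (𝓕⁻ b x).re) 2 := (memLp_fourierInv hb.integrable (hb.memLp 2)).re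

theorem re_integral_ofReal_mul {X : Type*} [MeasurableSpace X] {μ : Measure X} {h : X → ℝ}
    {w : X → ℂ} (hh : MemLp h 2 μ) (hw : MemLp w 2 μ) :
    (∫ x, (h x : ℂ) * w x ∂μ).re = ∫ x, h x * (w x).re ∂μ := by
  have hi : Integrable (fun x => (h x : ℂ) * w x) μ := hh.ofReal.integrable_mul hw
  have := integral_re hi
  simp only [RCLike.re_eq_complex_re] at this
  rw [← this]
  simp

/-- The real parts of band limited functions are total in `L²`. -/
theorem isTotalL2_re_fourierInv :
    IsTotalL2 (volume : Measure V) {φ | ∃ b : V → ℂ, IsBand b ∧ φ = fun x => (𝓕⁻ b x).re} := by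
  refine ⟨?_, ?_⟩
  · rintro _ ⟨b, hb, rfl⟩
    exact memLp_re_fourierInv hb
  intro h hh h0
  have hh' : MemLp (fun x => (h x : ℂ)) 2 := hh.ofReal
  obtain ⟨R, hRm, hR2, hRn, hR⟩ := exists_fourierInv_two hh'
  -- The hypothesis only sees real parts. Using both b and -i b recovers the whole complex pairing.
  have hRb : ∀ b, IsBand b → ∫ ξ, R ξ * b ξ = 0 := by
    intro b hb
    have h1 := h0 _ ⟨b, hb, rfl⟩
    have h2 := h0 _ ⟨_, hb.const_mul (-Complex.I), rfl⟩
    have hm := memLp_fourierInv hb.integrable (hb.memLp 2)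
    have hm' := memLp_fourierInv (hb.const_mul (-Complex.I)).integrable
      ((hb.const_mul (-Complex.I)).memLp 2)
    rw [← re_integral_ofReal_mul hh hm] at h1
    rw [← re_integral_ofReal_mul hh hm'] at h2
    rw [← hR b hb.integrable (hb.memLp 2)]
    apply Complex.ext
    · simpa using h1
    · have : (fun x : V => (h x : ℂ) * 𝓕⁻ (fun ξ => -Complex.I * b ξ) x)
          = fun x : V => -Complex.I * ((h x : ℂ) * 𝓕⁻ b x) := by
        ext x; rw [fourierInv_const_mul]; ring
      rw [this, integral_const_mul] at h2
      simpa using h2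
  have hR0 : ∀ n : ℕ, ∀ᵐ ξ, ξ ∈ Metric.closedBall (0 : V) n → R ξ = 0 := by
    intro n
    have hS : MeasurableSet (Metric.closedBall (0 : V) n) := Metric.isClosed_closedBall.measurableSet
    -- The damping makes the conjugate of R a bounded test, and the product with R is |R|²/(1+|R|²)
    -- ≥ 0, whose integral vanishes only if R = 0 a.e. on the ball.
    have hb : IsBand ((Metric.closedBall (0 : V) n).indicator
        (fun ξ => (starRingEnd ℂ (R ξ)) * (((1 + ‖R ξ‖ ^ 2)⁻¹ : ℝ) : ℂ))) := by
      refine ⟨?_, ⟨1, fun ξ => ?_⟩, n, fun ξ h => indicator_of_notMem (by simpa using h) _⟩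
      · refine Measurable.indicator ?_ hS
        have := hRm.measurable
        exact (Complex.continuous_conj.measurable.comp this).mul
          (Complex.measurable_ofReal.comp (by fun_prop))
      · refine (norm_indicator_le_norm_self _ _).trans ?_
        rw [norm_mul, RCLike.norm_conj, Complex.norm_real, Real.norm_of_nonneg (by positivity),
          ← div_eq_mul_inv, div_le_one (by positivity)]
        nlinarith [norm_nonneg (R ξ), sq_nonneg (‖R ξ‖ - 1)]
    have h1 := hRb _ hb
    have e : (fun ξ => R ξ * (Metric.closedBall (0 : V) n).indicator
        (fun ξ => (starRingEnd ℂ (R ξ)) * (((1 + ‖R ξ‖ ^ 2)⁻¹ : ℝ) : ℂ)) ξ) =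
        fun ξ => (((Metric.closedBall (0 : V) n).indicator
          (fun ξ => ‖R ξ‖ ^ 2 * (1 + ‖R ξ‖ ^ 2)⁻¹) ξ : ℝ) : ℂ) := by
      ext ξ
      by_cases h : ξ ∈ Metric.closedBall (0 : V) n
      · rw [indicator_of_mem h, indicator_of_mem h, ← mul_assoc, Complex.mul_conj']
        push_cast; ring
      · rw [indicator_of_notMem h, indicator_of_notMem h]; simp
    have hint : Integrable (fun ξ => R ξ * (Metric.closedBall (0 : V) n).indicator
        (fun ξ => (starRingEnd ℂ (R ξ)) * (((1 + ‖R ξ‖ ^ 2)⁻¹ : ℝ) : ℂ)) ξ) :=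
      hR2.integrable_mul (hb.memLp 2)
    rw [e, integral_complex_ofReal, Complex.ofReal_eq_zero, integral_eq_zero_iff_of_nonneg] at h1
    · filter_upwards [h1] with ξ hξ hmem
      rw [indicator_of_mem hmem] at hξ
      have : ‖R ξ‖ ^ 2 * (1 + ‖R ξ‖ ^ 2)⁻¹ = 0 := hξ
      rcases mul_eq_zero.1 this with h | h
      · simpa using h
      · exact absurd h (by positivity)
    · intro ξ
      exact indicator_nonneg (fun _ _ => by positivity) _
    · rw [e] at hint
      simpa using hint.re
  have hRz : R =ᵐ[volume] 0 := by
    filter_upwards [ae_all_iff.2 hR0] with ξ hξ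
    obtain ⟨n, hn⟩ := exists_nat_ge ‖ξ‖
    exact hξ n (by simpa using hn)
  have : eLpNorm (fun x => (h x : ℂ)) 2 volume = 0 := by
    rw [← hRn, eLpNorm_congr_ae hRz, eLpNorm_zero]
  rw [eLpNorm_eq_zero_iff hh'.1 (by norm_num)] at this
  filter_upwards [this] with x hx
  simpa using hx

/-- Families of bounded measurable functions with a uniformly bounded support. -/
structure IsBandFamily (w : Z × V → ℂ) : Prop where
  measurable : Measurable w
  bounded : ∃ B : ℝ, ∀ z, ‖w z‖ ≤ B
  support : ∃ r : ℝ, ∀ z : Z × V, r < ‖z.2‖ → w z = 0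

theorem IsBandFamily.slice {w : Z × V → ℂ} (hw : IsBandFamily w) (ζ : Z) :
    IsBand (fun ξ => w (ζ, ξ)) := by
  obtain ⟨B, hB⟩ := hw.bounded
  obtain ⟨r, hr⟩ := hw.support
  exact ⟨hw.measurable.comp (by fun_prop), ⟨B, fun ξ => hB _⟩, r, fun ξ h => hr _ h⟩

/-- The real part of the inverse Fourier transform of the slices of a family. -/
noncomputable def synth (w : Z × V → ℂ) (z : Z × V) : ℝ := (𝓕⁻ (fun ξ => w (z.1, ξ)) z.2).re

theorem stronglyMeasurable_fourierInv_slice {w : Z × V → ℂ} (hw : Measurable w) :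
    StronglyMeasurable (fun z : Z × V => 𝓕⁻ (fun ξ => w (z.1, ξ)) z.2) := by
  simp only [Real.fourierInv_eq', smul_eq_mul]
  refine StronglyMeasurable.integral_prod_right' (f := fun p : (Z × V) × V =>
    Complex.exp (↑(2 * Real.pi * inner ℝ p.2 p.1.2) * Complex.I) * w (p.1.1, p.2)) ?_
  refine Measurable.stronglyMeasurable ?_
  refine Measurable.mul ?_ (hw.comp (measurable_fst.fst.prodMk measurable_snd))
  have : Measurable fun p : (Z × V) × V => inner ℝ p.2 p.1.2 :=
    measurable_snd.inner measurable_fst.snd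
  fun_prop

theorem measurable_synth {w : Z × V → ℂ} (hw : Measurable w) : Measurable (synth w) :=
  Complex.measurable_re.comp (stronglyMeasurable_fourierInv_slice hw).measurable

theorem lintegral_sq_synth_slice_le {w : Z × V → ℂ} (hw : IsBandFamily w) (ζ : Z) :
    ∫⁻ x, ‖synth w (ζ, x)‖ₑ ^ 2 ≤ ∫⁻ ξ : V, ‖w (ζ, ξ)‖ₑ ^ 2 := by
  have hb := hw.slice ζ
  rw [← eLpNorm_two_sq volume (fun ξ : V => w (ζ, ξ)), ← eLpNorm_fourierInv hb.integrable (hb.memLp 2),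
    eLpNorm_two_sq]
  refine lintegral_mono fun x => ?_
  gcongr
  simp only [synth]
  rw [← ofReal_norm, ← ofReal_norm]
  exact ENNReal.ofReal_le_ofReal (Complex.abs_re_le_norm _)

theorem lintegral_sq_synth_le {w : Z × V → ℂ} (hw : IsBandFamily w) (m : Measure Z) [SFinite m] :
    ∫⁻ z, ‖synth w z‖ₑ ^ 2 ∂(m.prod volume) ≤ ∫⁻ z, ‖w z‖ₑ ^ 2 ∂(m.prod volume) := by
  rw [lintegral_prod _ (by have := measurable_synth hw.measurable; fun_prop),
    lintegral_prod _ (by have := hw.measurable; fun_prop)]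
  exact lintegral_mono fun ζ => lintegral_sq_synth_slice_le hw ζ

theorem IsBandFamily.exists_lintegral_sq_le {w : Z × V → ℂ} (hw : IsBandFamily w) :
    ∃ C : ℝ≥0∞, C < ⊤ ∧ ∀ ζ, ∫⁻ ξ : V, ‖w (ζ, ξ)‖ₑ ^ 2 ≤ C := by
  obtain ⟨B, hB⟩ := hw.bounded
  obtain ⟨r, hr⟩ := hw.support
  refine ⟨∫⁻ ξ : V, ‖(Metric.closedBall (0 : V) r).indicator (fun _ => B) ξ‖ₑ ^ 2,
    (memLp_two_iff.1 (memLp_indicator_closedBall 2 r B)).2, fun ζ => lintegral_mono fun ξ => ?_⟩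
  gcongr
  by_cases h : ξ ∈ Metric.closedBall (0 : V) r
  · rw [indicator_of_mem h, ← ofReal_norm, ← ofReal_norm]
    exact ENNReal.ofReal_le_ofReal ((hB _).trans (le_abs_self _))
  · rw [indicator_of_notMem h, hr _ (by simpa using h)]; simp

theorem memLp_synth {w : Z × V → ℂ} (hw : IsBandFamily w) (m : Measure Z) [IsFiniteMeasure m] :
    MemLp (synth w) 2 (m.prod volume) := by
  refine memLp_two_iff.2 ⟨(measurable_synth hw.measurable).aestronglyMeasurable, ?_⟩
  refine (lintegral_sq_synth_le hw m).trans_lt ?_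
  obtain ⟨C, hC, h⟩ := hw.exists_lintegral_sq_le
  rw [lintegral_prod _ (by have := hw.measurable; fun_prop)]
  calc ∫⁻ ζ, (∫⁻ ξ : V, ‖w (ζ, ξ)‖ₑ ^ 2) ∂m ≤ ∫⁻ _, C ∂m := lintegral_mono h
    _ < ⊤ := by rw [lintegral_const]; exact ENNReal.mul_lt_top hC (measure_lt_top _ _)

theorem synth_sub {w w' : Z × V → ℂ} (hw : IsBandFamily w) (hw' : IsBandFamily w') (z : Z × V) :
    synth (fun p => w p - w' p) z = synth w z - synth w' z := by
  simp only [synth]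
  rw [← Complex.sub_re]
  congr 1
  have h1 := (hw.slice z.1).integrable
  have h2 := (hw'.slice z.1).integrable
  exact fourierInv_sub h1 h2 _

theorem synth_const_mul (c : ℝ) (w : Z × V → ℂ) (z : Z × V) :
    synth (fun p => (c : ℂ) * w p) z = c * synth w z := by
  simp only [synth]
  rw [fourierInv_const_mul, Complex.re_ofReal_mul]

/-- Pairings of a bounded family with functions whose Fourier transforms tend to zero
boundedly tend to zero. -/
theorem tendsto_integral_mul_synth_sub {m : Measure Z} [IsFiniteMeasure m] {l : Filter ℝ}
    [l.IsCountablyGenerated] {g : ℝ → Z × V → ℝ} {C : ℝ≥0∞} (hC : C < ⊤)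
    (hg : ∀ᶠ ε in l, MemLp (g ε) 2 (m.prod volume) ∧ ∫⁻ z, ‖g ε z‖ₑ ^ 2 ∂(m.prod volume) ≤ C)
    {w : ℝ → Z × V → ℂ} {w₀ : Z × V → ℂ} {B r : ℝ}
    (hw : ∀ᶠ ε in l, Measurable (w ε)) (hwB : ∀ᶠ ε in l, ∀ z, ‖w ε z‖ ≤ B)
    (hwr : ∀ᶠ ε in l, ∀ z : Z × V, r < ‖z.2‖ → w ε z = 0) (hw₀ : IsBandFamily w₀)
    (hr₀ : ∀ z : Z × V, r < ‖z.2‖ → w₀ z = 0)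
    (hlim : ∀ z, Tendsto (fun ε => w ε z) l (𝓝 (w₀ z))) :
    Tendsto (fun ε => ∫ z, g ε z * synth (w ε) z ∂(m.prod volume)
      - ∫ z, g ε z * synth w₀ z ∂(m.prod volume)) l (𝓝 0) := by
  -- By Cauchy–Schwarz and Plancherel the difference of pairings is controlled by the L² distance of
  -- the multipliers. This tends to zero by domination, since the supports lie in one ball and the
  -- measure on the parameters is finite.
  have hlin : Tendsto (fun ε => C * ∫⁻ z, ‖w ε z - w₀ z‖ₑ ^ 2 ∂(m.prod volume)) l (𝓝 0) := by
    have h0 : Tendsto (fun ε => ∫⁻ z, ‖w ε z - w₀ z‖ₑ ^ 2 ∂(m.prod volume)) l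
        (𝓝 (∫⁻ z, 0 ∂(m.prod (volume : Measure V)))) := by
      obtain ⟨B₀, hB₀⟩ := hw₀.bounded
      refine tendsto_lintegral_filter_of_dominated_convergence
        (fun z => ‖(Metric.closedBall (0 : V) r).indicator (fun _ => B + B₀) z.2‖ₑ ^ 2) ?_ ?_ ?_ ?_
      · filter_upwards [hw] with ε h
        have := hw₀.measurable
        fun_prop
      · filter_upwards [hwB, hwr] with ε h1 h2
        refine ae_of_all _ fun z => ?_
        gcongr
        by_cases h : z.2 ∈ Metric.closedBall (0 : V) r
        · rw [indicator_of_mem h, ← ofReal_norm, ← ofReal_norm]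
          exact ENNReal.ofReal_le_ofReal ((norm_sub_le _ _).trans
            ((add_le_add (h1 z) (hB₀ z)).trans (le_abs_self _)))
        · have h' : r < ‖z.2‖ := by simpa using h
          rw [indicator_of_notMem h, h2 z h', hr₀ z h']; simp
      · have hm : Measurable fun ξ : V => ‖(Metric.closedBall (0 : V) r).indicator
            (fun _ => B + B₀) ξ‖ₑ ^ 2 := by
          have : Measurable ((Metric.closedBall (0 : V) r).indicator (fun _ => B + B₀)) :=
            measurable_const.indicator Metric.isClosed_closedBall.measurableSet
          fun_prop
        rw [lintegral_prod (fun z : Z × V => ‖(Metric.closedBall (0 : V) r).indicator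
            (fun _ => B + B₀) z.2‖ₑ ^ 2) (hm.comp measurable_snd).aemeasurable]
        simp only [lintegral_const]
        exact (ENNReal.mul_lt_top (memLp_two_iff.1 (memLp_indicator_closedBall 2 r _)).2
          (measure_lt_top _ _)).ne
      · refine ae_of_all _ fun z => ?_
        have h1 := (hlim z).sub_const (w₀ z)
        rw [sub_self] at h1
        have h2 := ENNReal.Tendsto.pow (n := 2) h1.enorm
        simpa using h2
    rw [lintegral_zero] at h0
    simpa using ENNReal.Tendsto.const_mul h0 (Or.inr hC.ne)
  have hsq : Tendsto (fun ε => ‖∫ z, g ε z * synth (w ε) z ∂(m.prod volume)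
      - ∫ z, g ε z * synth w₀ z ∂(m.prod volume)‖ₑ ^ 2) l (𝓝 0) := by
    refine tendsto_of_tendsto_of_tendsto_of_le_of_le' tendsto_const_nhds hlin
      (Eventually.of_forall fun _ => zero_le) ?_
    filter_upwards [hg, hw, hwB, hwr] with ε hg hw hwB hwr
    have hwε : IsBandFamily (w ε) := ⟨hw, ⟨B, hwB⟩, r, hwr⟩
    have hd : IsBandFamily (fun z => w ε z - w₀ z) := by
      obtain ⟨B₀, hB₀⟩ := hw₀.bounded
      exact ⟨hw.sub hw₀.measurable, ⟨B + B₀, fun z => (norm_sub_le _ _).trans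
        (add_le_add (hwB z) (hB₀ z))⟩, r, fun z h => by rw [hwr z h, hr₀ z h, sub_zero]⟩
    have hi1 : Integrable (fun z => g ε z * synth (w ε) z) (m.prod volume) :=
      hg.1.integrable_mul (memLp_synth hwε m)
    have hi2 : Integrable (fun z => g ε z * synth w₀ z) (m.prod volume) :=
      hg.1.integrable_mul (memLp_synth hw₀ m)
    rw [← integral_sub hi1 hi2]
    have e : ∀ z, g ε z * synth (w ε) z - g ε z * synth w₀ z
        = g ε z * synth (fun z => w ε z - w₀ z) z := fun z => by
      rw [synth_sub hwε hw₀]; ring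
    simp only [e]
    calc ‖∫ z, g ε z * synth (fun z => w ε z - w₀ z) z ∂(m.prod volume)‖ₑ ^ 2
        ≤ (∫⁻ z, ‖g ε z‖ₑ * ‖synth (fun z => w ε z - w₀ z) z‖ₑ ∂(m.prod volume)) ^ 2 := by
          gcongr
          refine (enorm_integral_le_lintegral_enorm _).trans (le_of_eq ?_)
          simp only [enorm_mul]
      _ ≤ (∫⁻ z, ‖g ε z‖ₑ ^ 2 ∂(m.prod volume)) *
          ∫⁻ z, ‖synth (fun z => w ε z - w₀ z) z‖ₑ ^ 2 ∂(m.prod volume) :=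
          sq_lintegral_mul_le _ hg.1.1.enorm (measurable_synth hd.measurable).enorm.aemeasurable
      _ ≤ _ := mul_le_mul' hg.2 (lintegral_sq_synth_le hd m)
  rw [tendsto_iff_norm_sub_tendsto_zero]
  simp only [sub_zero]
  have h1 : Tendsto (fun ε => ‖∫ z, g ε z * synth (w ε) z ∂(m.prod volume)
      - ∫ z, g ε z * synth w₀ z ∂(m.prod volume)‖ ^ 2) l (𝓝 0) := by
    have := (ENNReal.tendsto_toReal ENNReal.zero_ne_top).comp hsq
    simpa [Function.comp_def] using this
  have := h1.sqrt
  simpa [Real.sqrt_sq_eq_abs] using this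

end BandLimited

end FractionalDiffusion

namespace FractionalDiffusion

/-! ### Duhamel's formula tested against functions of time and space -/

section Duality

variable {N : ℕ} {F : Space N → ℝ} {θ ε : ℝ} {f₀ : Space N × Space N → ℝ}
  {f : ℝ × Space N × Space N → ℝ}

/-- The flat measure on the slab `(0,T) × ℝ^N × ℝ^N`. -/
noncomputable abbrev flatSlab (N : ℕ) (T : ℝ) : Measure (ℝ × Space N × Space N) :=
  (volume.restrict (Ioo 0 T)).prod (volume.prod volume)

/-- The average of `Φ` along the trajectories of the rescaled kinetic process up to the first
exponential collision time. -/
noncomputable def kineticAverage (θ ε : ℝ) (Φ : ℝ × Space N → ℝ) (z : ℝ × Space N × Space N) : ℝ :=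
  ∫ r in Ioi (0 : ℝ), Real.exp (-r) * Φ (z.1 + θ * r, z.2.1 + (ε * r) • z.2.2)

theorem setIntegral_Ioi_comp_affine (hθ : 0 < θ) (s : ℝ) (g : ℝ → ℝ) :
    ∫ r in Ioi (0 : ℝ), g (s + θ * r) = θ⁻¹ * ∫ t in Ioi s, g t := by
  have h := integral_comp_mul_left_Ioi (fun t => g (s + t)) 0 hθ
  rw [h, mul_zero, smul_eq_mul]
  congr 1
  rw [← integral_indicator measurableSet_Ioi, ← integral_indicator measurableSet_Ioi,
    ← integral_add_left_eq_self (fun t => (Ioi s).indicator g t) s]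
  congr 1; ext t
  simp [indicator]

/-- The substitution t = s + θr turns the exponential law of r into the Duhamel kernel. The cut-off
at T costs nothing since Φ vanishes beyond it. -/
theorem kineticAverage_eq (hθ : 0 < θ) {T : ℝ} {Φ : ℝ × Space N → ℝ}
    (hΦT : ∀ z : ℝ × Space N, T ≤ z.1 → Φ z = 0) {z : ℝ × Space N × Space N} (hz : 0 ≤ z.1) :
    ∫ t in Ioo 0 T, (Ioi z.1).indicator (fun t => expKernel θ t z.1 *
      Φ (t, z.2.1 + (ε / θ * (t - z.1)) • z.2.2)) t = kineticAverage θ ε Φ z := by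
  have h := setIntegral_Ioi_comp_affine hθ z.1 (fun t => Real.exp (-(t - z.1) / θ) *
    Φ (t, z.2.1 + (ε / θ * (t - z.1)) • z.2.2))
  have e : kineticAverage θ ε Φ z = ∫ r in Ioi (0 : ℝ), Real.exp (-(z.1 + θ * r - z.1) / θ) *
      Φ (z.1 + θ * r, z.2.1 + (ε / θ * (z.1 + θ * r - z.1)) • z.2.2) := by
    simp only [kineticAverage]
    congr 1; ext r
    have h1 : -(z.1 + θ * r - z.1) / θ = -r := by field_simp; ring
    have h2 : ε / θ * (z.1 + θ * r - z.1) = ε * r := by field_simp; ring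
    rw [h1, h2]
  rw [e, h, ← integral_const_mul, setIntegral_indicator measurableSet_Ioi]
  refine setIntegral_eq_of_subset_of_forall_sdiff_eq_zero measurableSet_Ioi
    (fun t ht => ht.2) (fun t ht => ?_) |>.symm.trans ?_
  · have : T ≤ t := by
      by_contra h'
      exact ht.2 ⟨⟨hz.trans_lt ht.1, not_le.1 h'⟩, ht.1⟩
    simp [hΦT (t, _) this]
  · refine setIntegral_congr_fun measurableSet_Ioi fun t _ => ?_
    simp only [expKernel]; ring

theorem measurePreserving_assoc_flatSlab (T : ℝ) (ν : Measure (Space N)) [SFinite ν] :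
    MeasurePreserving (fun z : ℝ × Space N × Space N => ((z.1, z.2.1), z.2.2))
      ((volume.restrict (Ioo 0 T)).prod (volume.prod ν))
      (((volume.restrict (Ioo 0 T)).prod volume).prod ν) :=
  (measurePreserving_prodAssoc _ _ _).symm

theorem integrable_flatSlab_mul {h : ℝ × Space N → ℝ} {T : ℝ}
    (hh : Integrable h ((volume.restrict (Ioo 0 T)).prod volume)) (hF : Integrable F) :
    Integrable (fun z => h (z.1, z.2.1) * F z.2.2) (flatSlab N T) :=
  (measurePreserving_assoc_flatSlab T volume).integrable_comp_of_integrable (hh.mul_prod hF)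

theorem memLp_slab_mul (hF : IsPosDensity volume F) {Φ : ℝ × Space N → ℝ} {T : ℝ}
    (hΦ : MemLp Φ 2 ((volume.restrict (Ioo 0 T)).prod volume)) :
    MemLp (fun z => Φ (z.1, z.2.1) * F z.2.2) 2 (slab T F) :=
  (hΦ.mul_prod_two hF.memLp_self).comp_measurePreserving
    (measurePreserving_assoc_flatSlab T (velWeight volume F))

theorem integrable_slab_mul_iff (hF : IsPosDensity volume F) {T : ℝ}
    {h c : ℝ × Space N × Space N → ℝ} :
    Integrable (fun z => h z * (c z * F z.2.2)) (slab T F) ↔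
      Integrable (fun z => h z * c z) (flatSlab N T) := by
  have hm : Measurable fun y : Space N × Space N => F y.2 := hF.measurable.comp measurable_snd
  have hm' : Measurable fun z : ℝ × Space N × Space N => F z.2.2 := hm.comp measurable_snd
  rw [slab, prod_velWeight _ hF.measurable, prod_velWeight _ hm]
  exact integrable_velWeight_mul_iff (F := fun z : ℝ × Space N × Space N => F z.2.2) hm'
    (fun z => hF.pos _)

theorem integral_flatSlab_mul (hF : IsPosDensity volume F) {T : ℝ} (hfL : MemLp f 2 (slab T F))
    {Φ : ℝ × Space N → ℝ} (hΦ : MemLp Φ 2 ((volume.restrict (Ioo 0 T)).prod volume)) :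
    ∫ z, f z * Φ (z.1, z.2.1) ∂(flatSlab N T) =
      ∫ p, (∫ w, f (p.1, p.2, w)) * Φ p ∂((volume.restrict (Ioo 0 T)).prod volume) := by
  have hi : Integrable (fun z => f z * Φ (z.1, z.2.1)) (flatSlab N T) :=
    (integrable_slab_mul_iff hF).1 (hfL.integrable_mul (memLp_slab_mul hF hΦ))
  have hmp := measurePreserving_prodAssoc (volume.restrict (Ioo (0 : ℝ) T))
    (volume : Measure (Space N)) (volume : Measure (Space N))
  rw [← hmp.integral_comp']
  refine (integral_prod _ (hmp.integrable_comp_of_integrable hi)).trans ?_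
  congr 1; ext p
  rw [← integral_mul_const]
  rfl

/-- Exchange of the time variables of the first and the last factor. -/
theorem measurePreserving_exchange (m : Measure ℝ) [SFinite m] {Y : Type*} [MeasurableSpace Y]
    (ν : Measure Y) [SFinite ν] :
    MeasurePreserving (fun p : (ℝ × Y) × ℝ => ((p.2, p.1.2), p.1.1)) ((m.prod ν).prod m)
      ((m.prod ν).prod m) := by
  have h1 : MeasurePreserving (Prod.swap : (ℝ × Y) × ℝ → ℝ × (ℝ × Y)) ((m.prod ν).prod m)
      (m.prod (m.prod ν)) := Measure.measurePreserving_swap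
  have h2 := (MeasurePreserving.id m).prod (Measure.measurePreserving_swap (μ := m) (ν := ν))
  exact ((measurePreserving_prodAssoc m ν m).symm.comp h2).comp h1

/-- Testing the mild formulation against a function of `(t, x)`. -/
theorem IsKineticSolution.integral_density_mul (hF : IsPosDensity volume F) (hθ : 0 < θ)
    (hf : IsKineticSolution F θ ε f₀ f) (hf₀ : MemLp f₀ 2 (invWeight F)) (hfm : Measurable f)
    {T : ℝ} (hT : 0 < T) {Φ : ℝ × Space N → ℝ} (hΦm : Measurable Φ)
    (hΦ : MemLp Φ 2 ((volume.restrict (Ioo 0 T)).prod volume))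
    (hΦT : ∀ z : ℝ × Space N, T ≤ z.1 → Φ z = 0) :
    ∫ p, (∫ w, f (p.1, p.2, w)) * Φ p ∂((volume.restrict (Ioo 0 T)).prod volume) =
      θ * (∫ y, f₀ y * kineticAverage θ ε Φ (0, y)) +
      ∫ p, (∫ w, f (p.1, p.2, w)) * (∫ v, F v * kineticAverage θ ε Φ (p.1, p.2, v))
        ∂((volume.restrict (Ioo 0 T)).prod volume) := by
  set I : Measure ℝ := volume.restrict (Ioo 0 T) with hI
  set S := timeShear (X := Space N) (ε / θ) with hS
  have hfL := hf.memLp hF hT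
  have hSmp : MeasurePreserving S (flatSlab N T) (flatSlab N T) :=
    measurePreserving_timeShear volume volume _ _
  have hρ := memLp_density hF hfL
  have hρm := measurable_density hfm
  have hsm : Measurable (source F f) := measurable_source hF.measurable hfm
  -- the mild formulation for the flat measure
  have hmild : ∀ᵐ z ∂(flatSlab N T), f (S z) = Real.exp (-z.1 / θ) * f₀ z.2 +
      ∫ s, (Iio z.1).indicator (fun s => expKernel θ z.1 s * source F f (S (s, z.2))) s ∂I := by
    have hin : ∀ᵐ z ∂(flatSlab N T), z.1 ∈ Ioo 0 T :=
      Measure.quasiMeasurePreserving_fst.ae (ae_restrict_mem measurableSet_Ioo)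
    filter_upwards [(volume_ac_slab hF T volume Measure.AbsolutelyContinuous.rfl).ae_le
      (hf.mild hF hθ hf₀ hT), hin] with z hz hz'
    rw [setIntegral_Ioo_indicator_Iio hz'.2.le]
    have e1 : ∫ s in Ioo 0 z.1, expKernel θ z.1 s * source F f (S (s, z.2)) =
        θ⁻¹ * Real.exp (-z.1 / θ) * ∫ s in Ioo 0 z.1,
          Real.exp (s / θ) * source F f (S (s, z.2)) := by
      rw [← integral_const_mul]
      congr 1; ext s
      have : Real.exp (-(z.1 - s) / θ) = Real.exp (-z.1 / θ) * Real.exp (s / θ) := by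
        rw [← Real.exp_add]; congr 1; ring
      simp only [expKernel]
      rw [this]; ring
    have e2 : f (S z) = θ⁻¹ * Real.exp (-z.1 / θ) * (θ * (Real.exp (z.1 / θ) * f (S z))) := by
      have : Real.exp (-z.1 / θ) * Real.exp (z.1 / θ) = 1 := by
        rw [← Real.exp_add, neg_div, neg_add_cancel, Real.exp_zero]
      rw [show θ⁻¹ * Real.exp (-z.1 / θ) * (θ * (Real.exp (z.1 / θ) * f (S z))) =
        θ⁻¹ * θ * (Real.exp (-z.1 / θ) * Real.exp (z.1 / θ)) * f (S z) by ring, this,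
        inv_mul_cancel₀ hθ.ne', one_mul, one_mul]
    rw [← hS] at hz
    rw [e1, e2, hz]
    field_simp
  -- the initial layer
  have hA : Integrable (fun z => Real.exp (-z.1 / θ) * f₀ z.2 * Φ ((S z).1, (S z).2.1))
      (flatSlab N T) := by
    have h1 : MemLp (fun z : ℝ × Space N × Space N => Real.exp (-z.1 / θ) * f₀ z.2) 2
        (slab T F) := by
      rw [invWeight_eq_prod hF.measurable] at hf₀
      have hm : MemLp (fun t : ℝ => Real.exp (-t / θ)) 2 I := by
        refine MemLp.of_bound (by fun_prop) 1 ?_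
        filter_upwards [ae_restrict_mem measurableSet_Ioo] with t ht
        rw [Real.norm_eq_abs, abs_of_pos (Real.exp_pos _), Real.exp_le_one_iff]
        exact div_nonpos_of_nonpos_of_nonneg (neg_nonpos.2 ht.1.le) hθ.le
      exact hm.mul_prod_two hf₀
    have h2 := (memLp_slab_mul hF hΦ).comp_measurePreserving (measurePreserving_slab T (ε / θ))
    exact (integrable_slab_mul_iff hF (c := fun z => Φ ((S z).1, (S z).2.1))).1
      (h1.integrable_mul h2)
  -- the collision term
  set G : (ℝ × Space N × Space N) × ℝ → ℝ := fun p =>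
    (Iio p.1.1).indicator (fun s => expKernel θ p.1.1 s * source F f (S (s, p.1.2))) p.2
      * Φ ((S p.1).1, (S p.1).2.1) with hG
  have hex := measurePreserving_exchange I ((volume : Measure (Space N)).prod (volume : Measure (Space N)))
  -- The kernel is at most θ⁻¹, and the product of density and test value is at most the sum of
  -- their squares, each carrying the integrable factor F. The two squares live at different times;
  -- exchanging the times brings both to the same form.
  have hGi : Integrable G ((flatSlab N T).prod I) := by
    have q1 := (hSmp.integrable_comp_of_integrable
      (integrable_flatSlab_mul hρ.integrable_sq hF.integrable)).comp_fst I
    have q2 := (hSmp.integrable_comp_of_integrable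
      (integrable_flatSlab_mul hΦ.integrable_sq hF.integrable)).comp_fst I
    have q1' := hex.integrable_comp_of_integrable q1
    refine ((q1'.add q2).const_mul θ⁻¹).mono' ?_ ?_
    · have hms : MeasurableSet {p : (ℝ × Space N × Space N) × ℝ | p.2 < p.1.1} :=
        measurableSet_lt measurable_snd (by fun_prop)
      have : G = fun p => {p : (ℝ × Space N × Space N) × ℝ | p.2 < p.1.1}.indicator
          (fun p => expKernel θ p.1.1 p.2 * source F f (S (p.2, p.1.2))) p
          * Φ ((S p.1).1, (S p.1).2.1) := by
        ext p; simp only [hG, indicator, mem_Iio, mem_ofPred_eq]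
      rw [this]
      refine (Measurable.mul (Measurable.indicator ?_ hms) ?_).aestronglyMeasurable
      · refine Measurable.mul ?_ (hsm.comp (S.measurable.comp (by fun_prop)))
        simp only [expKernel]; fun_prop
      · exact hΦm.comp (by have := S.measurable; fun_prop)
    · refine ae_of_all _ fun p => ?_
      have hFp := hF.pos p.1.2.2
      simp only [Pi.add_apply, Function.comp_apply]
      set a := ∫ w, f (p.2, p.1.2.1 + (ε / θ * p.2) • p.1.2.2, w) with ha
      set b := Φ ((S p.1).1, (S p.1).2.1) with hb
      change ‖G p‖ ≤ θ⁻¹ * (a ^ 2 * F p.1.2.2 + b ^ 2 * F p.1.2.2)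
      have hG' : ‖G p‖ ≤ θ⁻¹ * (|a| * F p.1.2.2) * |b| := by
        simp only [hG]
        rw [norm_mul, Real.norm_eq_abs b]
        refine mul_le_mul_of_nonneg_right ?_ (abs_nonneg _)
        by_cases h : p.2 ∈ Iio p.1.1
        · rw [indicator_of_mem h, norm_mul, Real.norm_of_nonneg (expKernel_pos hθ _ _).le]
          have h1 : expKernel θ p.1.1 p.2 ≤ θ⁻¹ := by
            have : Real.exp (-(p.1.1 - p.2) / θ) ≤ 1 := by
              rw [Real.exp_le_one_iff]
              exact div_nonpos_of_nonpos_of_nonneg (by simp only [mem_Iio] at h; linarith) hθ.le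
            simp only [expKernel]
            nlinarith [inv_pos.2 hθ]
          have h2 : ‖source F f (S (p.2, p.1.2))‖ = |a| * F p.1.2.2 := by
            simp only [source, hS, timeShear_apply, norm_mul, Real.norm_eq_abs, abs_of_pos hFp, ha]
          rw [h2]
          exact mul_le_mul_of_nonneg_right h1 (by positivity)
        · rw [indicator_of_notMem h, norm_zero]; positivity
      refine hG'.trans ?_
      have h3 : |a| * |b| ≤ a ^ 2 + b ^ 2 := by
        nlinarith [sq_nonneg (|a| - |b|), sq_abs a, sq_abs b, sq_nonneg a, sq_nonneg b]
      calc θ⁻¹ * (|a| * F p.1.2.2) * |b| = θ⁻¹ * F p.1.2.2 * (|a| * |b|) := by ring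
        _ ≤ θ⁻¹ * F p.1.2.2 * (a ^ 2 + b ^ 2) := by gcongr
        _ = _ := by ring
  -- After the exchange z carries the earlier time. Integrating over the later one, at which Φ is
  -- evaluated further along the same trajectory, produces the kinetic average at the earlier point.
  have hGe : ∀ᵐ z ∂(flatSlab N T), ∫ t, G ((t, z.2), z.1) ∂I =
      source F f (S z) * kineticAverage θ ε Φ (S z) := by
    have hin : ∀ᵐ z ∂(flatSlab N T), z.1 ∈ Ioo 0 T :=
      Measure.quasiMeasurePreserving_fst.ae (ae_restrict_mem measurableSet_Ioo)
    filter_upwards [hin] with z hz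
    rw [← kineticAverage_eq hθ hΦT (z := S z) hz.1.le, ← integral_const_mul]
    congr 1; ext t
    simp only [hG, hS, timeShear_apply, indicator, mem_Iio, mem_Ioi]
    split_ifs with h
    · have e : z.2.1 + (ε / θ * z.1) • z.2.2 + (ε / θ * (t - z.1)) • z.2.2
          = z.2.1 + (ε / θ * t) • z.2.2 := by
        rw [add_assoc, ← add_smul]; congr 2; ring
      rw [e]; ring
    · simp
  have hGi' : Integrable (fun p : (ℝ × Space N × Space N) × ℝ => G ((p.2, p.1.2), p.1.1))
      ((flatSlab N T).prod I) := hex.integrable_comp_of_integrable hGi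
  have hQ : Integrable (fun z => source F f z * kineticAverage θ ε Φ z) (flatSlab N T) := by
    have h1 := hGi'.integral_prod_left.congr hGe
    have h2 : Integrable ((fun z => source F f z * kineticAverage θ ε Φ z) ∘ S) (flatSlab N T) := h1
    exact (hSmp.integrable_comp_emb S.measurableEmbedding).1 h2
  have hcoll : ∫ z, (∫ s, G (z, s) ∂I) ∂(flatSlab N T) =
      ∫ z, source F f z * kineticAverage θ ε Φ z ∂(flatSlab N T) := by
    rw [← integral_prod _ hGi]
    have h1 : ∫ p, G p ∂((flatSlab N T).prod I) =
        ∫ p : (ℝ × Space N × Space N) × ℝ, G ((p.2, p.1.2), p.1.1) ∂((flatSlab N T).prod I) := by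
      conv_lhs => rw [← hex.map_eq]
      rw [integral_map hex.aemeasurable (by rw [hex.map_eq]; exact hGi.1)]
    rw [h1, integral_prod _ hGi', integral_congr_ae hGe]
    exact hSmp.integral_comp S.measurableEmbedding
      (fun z => source F f z * kineticAverage θ ε Φ z)
  have hfinal : ∫ z, source F f z * kineticAverage θ ε Φ z ∂(flatSlab N T) =
      ∫ p, (∫ w, f (p.1, p.2, w)) * (∫ v, F v * kineticAverage θ ε Φ (p.1, p.2, v))
        ∂(I.prod volume) := by
    have hmp := measurePreserving_prodAssoc I
      (volume : Measure (Space N)) (volume : Measure (Space N))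
    rw [← hmp.integral_comp']
    refine (integral_prod _ (hmp.integrable_comp_of_integrable hQ)).trans ?_
    congr 1; ext p
    rw [← integral_const_mul]
    congr 1; ext v
    change (∫ w, f (p.1, p.2, w)) * F v * kineticAverage θ ε Φ (p.1, p.2, v) = _
    ring
  have hinit : ∫ z, Real.exp (-z.1 / θ) * f₀ z.2 * Φ ((S z).1, (S z).2.1) ∂(flatSlab N T) =
      θ * ∫ y, f₀ y * kineticAverage θ ε Φ (0, y) := by
    rw [integral_prod_symm _ hA, ← integral_const_mul]
    change ∫ y, _ ∂(volume.prod volume) = ∫ y, _ ∂(volume.prod volume)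
    congr 1; ext y
    rw [← kineticAverage_eq hθ hΦT (z := (0, y)) le_rfl, ← integral_const_mul, ← integral_const_mul]
    refine setIntegral_congr_fun measurableSet_Ioo fun t ht => ?_
    simp only [indicator, mem_Ioi, ht.1, if_true, hS, timeShear_apply, expKernel, sub_zero]
    field_simp
  -- The left-hand side is moved onto trajectories, where Duhamel's formula splits it into the
  -- initial and collision terms.
  rw [← integral_flatSlab_mul hF hfL hΦ, ← hinit, ← hfinal, ← hcoll]
  rw [← hSmp.integral_comp S.measurableEmbedding (fun z => f z * Φ (z.1, z.2.1)),
    ← integral_add hA hGi.integral_prod_left]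
  refine integral_congr_ae ?_
  filter_upwards [hmild] with z hz
  rw [hz, add_mul]
  congr 1
  rw [← integral_mul_const]

end Duality

end FractionalDiffusion

namespace FractionalDiffusion

/-! ### The backward equation at a single frequency -/

section AdjointFlow

/-- The solution `A` of `A' = l A - η` that vanishes for large times. -/
noncomputable def adjointFlow (η : ℝ → ℝ) (l s : ℝ) : ℝ :=
  ∫ σ in Ioi s, Real.exp (-(l * (σ - s))) * η σ

variable {η : ℝ → ℝ} {T l s : ℝ}

theorem eq_zero_of_mem_testFunctions (hη : η ∈ testFunctions (Ioo 0 T)) {t : ℝ}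
    (ht : t ∉ Ioo 0 T) : η t = 0 :=
  image_eq_zero_of_notMem_tsupport fun h => ht (hη.2.2 h)

theorem adjointFlow_eq_zero (hη : η ∈ testFunctions (Ioo 0 T)) (hs : T ≤ s) :
    adjointFlow η l s = 0 := by
  refine setIntegral_eq_zero_of_forall_eq_zero fun σ hσ => ?_
  rw [eq_zero_of_mem_testFunctions hη fun h => not_lt.2 hs (lt_trans hσ h.2), mul_zero]

theorem integrable_of_mem_testFunctions (hη : η ∈ testFunctions (Ioo 0 T)) : Integrable η :=
  hη.1.continuous.integrable_of_hasCompactSupport hη.2.1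

/-- For l ≥ 0 the exponential is at most one, so the bound is uniform in time and in frequency. -/
theorem abs_adjointFlow_le (hη : η ∈ testFunctions (Ioo 0 T)) (hl : 0 ≤ l) :
    |adjointFlow η l s| ≤ ∫ σ, |η σ| := by
  have hi := (integrable_of_mem_testFunctions hη).abs
  calc |adjointFlow η l s| ≤ ∫ σ in Ioi s, |η σ| := by
        refine norm_integral_le_of_norm_le (f := fun σ => Real.exp (-(l * (σ - s))) * η σ)
          hi.integrableOn ?_
        filter_upwards [ae_restrict_mem measurableSet_Ioi] with σ hσ
        rw [norm_mul, Real.norm_eq_abs, Real.norm_eq_abs, abs_of_pos (Real.exp_pos _)]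
        refine mul_le_of_le_one_left (abs_nonneg _) (Real.exp_le_one_iff.2 ?_)
        exact neg_nonpos.2 (mul_nonneg hl (sub_nonneg.2 (le_of_lt hσ)))
    _ ≤ ∫ σ, |η σ| := setIntegral_le_integral hi (ae_of_all _ fun _ => abs_nonneg _)

theorem hasDerivAt_adjointFlow (hη : η ∈ testFunctions (Ioo 0 T)) (l s : ℝ) :
    HasDerivAt (adjointFlow η l) (l * adjointFlow η l s - η s) s := by
  set g : ℝ → ℝ := fun σ => Real.exp (-(l * σ)) * η σ with hg
  have hgc : Continuous g := by have := hη.1.continuous; fun_prop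
  have hgi : Integrable g := hgc.integrable_of_hasCompactSupport hη.2.1.mul_left
  -- Factoring out exp(ls) leaves a total integral minus a primitive, which can be differentiated.
  have e : ∀ s, adjointFlow η l s = Real.exp (l * s) * ((∫ σ in Ioi 0, g σ) - ∫ σ in (0 : ℝ)..s, g σ) := by
    intro s
    have h := intervalIntegral.integral_interval_add_Ioi' (f := g) (μ := volume) (a := 0) (b := s)
      (hgc.intervalIntegrable _ _) hgi.integrableOn
    rw [← h, add_sub_cancel_left, ← integral_const_mul]
    refine setIntegral_congr_fun measurableSet_Ioi fun σ _ => ?_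
    simp only [hg]
    rw [← mul_assoc, ← Real.exp_add]
    congr 2; ring
  have h1 : HasDerivAt (fun s => ∫ σ in (0 : ℝ)..s, g σ) (g s) s :=
    intervalIntegral.integral_hasDerivAt_right (hgc.intervalIntegrable _ _)
      hgc.aestronglyMeasurable.stronglyMeasurableAtFilter hgc.continuousAt
  have h2 : HasDerivAt (fun s => Real.exp (l * s)) (Real.exp (l * s) * l) s := by
    simpa using ((hasDerivAt_id s).const_mul l).exp
  have h3 := h2.mul (h1.const_sub (∫ σ in Ioi 0, g σ))
  rw [funext e]
  refine h3.congr_deriv ?_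
  have : Real.exp (l * s) * Real.exp (-(l * s)) = 1 := by
    rw [← Real.exp_add, add_neg_cancel, Real.exp_zero]
  simp only [hg]
  linear_combination (-(η s)) * this

theorem measurable_adjointFlow (hη : η ∈ testFunctions (Ioo 0 T)) :
    Measurable fun p : ℝ × ℝ => adjointFlow η p.1 p.2 := by
  have e : (fun p : ℝ × ℝ => adjointFlow η p.1 p.2) = fun p => ∫ σ,
      {q : (ℝ × ℝ) × ℝ | q.1.2 < q.2}.indicator
        (fun q => Real.exp (-(q.1.1 * (q.2 - q.1.2))) * η q.2) (p, σ) := by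
    ext p
    simp only [adjointFlow]
    rw [← integral_indicator measurableSet_Ioi]
    congr 1
  rw [e]
  have hm : Measurable η := hη.1.continuous.measurable
  refine (StronglyMeasurable.integral_prod_right' (f := {q : (ℝ × ℝ) × ℝ | q.1.2 < q.2}.indicator
        (fun q => Real.exp (-(q.1.1 * (q.2 - q.1.2))) * η q.2)) ?_).measurable
  refine (Measurable.indicator ?_ (measurableSet_lt (by fun_prop) (by fun_prop))).stronglyMeasurable
  fun_prop

/-- The derivative lA - η is bounded linearly in l. The explicit dependence on l gives a Lipschitz
constant uniform over a frequency band. -/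
theorem exists_lipschitz_adjointFlow (hη : η ∈ testFunctions (Ioo 0 T)) :
    ∃ C : ℝ, 0 ≤ C ∧ ∀ l s t, 0 ≤ l →
      |adjointFlow η l t - adjointFlow η l s| ≤ C * (1 + l) * |t - s| := by
  obtain ⟨B, hB⟩ := hη.1.continuous.bounded_above_of_compact_support hη.2.1
  set D := ∫ σ, |η σ|
  have hD : 0 ≤ D := integral_nonneg fun _ => abs_nonneg _
  have hB0 : 0 ≤ B := (norm_nonneg _).trans (hB 0)
  refine ⟨D + B, by positivity, fun l s t hl => ?_⟩
  refine Convex.norm_image_sub_le_of_norm_hasDerivWithin_le (s := univ)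
    (fun x _ => (hasDerivAt_adjointFlow hη l x).hasDerivWithinAt) (fun x _ => ?_) convex_univ
    (mem_univ s) (mem_univ t)
  calc ‖l * adjointFlow η l x - η x‖ ≤ ‖l * adjointFlow η l x‖ + ‖η x‖ := norm_sub_le _ _
    _ ≤ l * D + B := by
        rw [norm_mul, Real.norm_of_nonneg hl]
        exact add_le_add (mul_le_mul_of_nonneg_left (abs_adjointFlow_le hη hl) hl) (hB x)
    _ ≤ _ := by nlinarith [mul_nonneg hl hB0]

theorem adjointFlow_zero (hη : η ∈ testFunctions (Ioo 0 T)) (l : ℝ) :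
    adjointFlow η l 0 = ∫ σ in Ioo 0 T, Real.exp (-(l * σ)) * η σ := by
  simp only [adjointFlow, sub_zero]
  refine setIntegral_eq_of_subset_of_forall_sdiff_eq_zero measurableSet_Ioi (fun t ht => ht.1)
    (fun t ht => ?_)
  rw [eq_zero_of_mem_testFunctions hη ht.2, mul_zero]

end AdjointFlow

/-! ### The symbol of the generator -/

section Symbol

variable {V : Type*} [NormedAddCommGroup V]

/-- The symbol of `κ (-Δ)^{α/2}`. -/
noncomputable def symbol (α κ : ℝ) (ξ : V) : ℝ := κ * (2 * Real.pi * ‖ξ‖) ^ α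

theorem continuous_symbol {α : ℝ} (hα : 0 ≤ α) (κ : ℝ) : Continuous (symbol α κ : V → ℝ) := by
  unfold symbol
  exact continuous_const.mul ((by fun_prop : Continuous fun ξ : V => 2 * Real.pi * ‖ξ‖).rpow_const
    fun _ => Or.inr hα)

theorem symbol_nonneg {κ : ℝ} (hκ : 0 ≤ κ) (α : ℝ) (ξ : V) : 0 ≤ symbol α κ ξ := by
  unfold symbol; positivity

theorem symbol_le {α κ : ℝ} (hα : 0 ≤ α) (hκ : 0 ≤ κ) {ξ : V} {r : ℝ} (h : ‖ξ‖ ≤ r) :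
    symbol α κ ξ ≤ κ * (2 * Real.pi * r) ^ α := by
  unfold symbol; gcongr

end Symbol

/-! ### Kinetic averages as Fourier multipliers -/

section Families

variable {V : Type*} [NormedAddCommGroup V] [InnerProductSpace ℝ V] [FiniteDimensional ℝ V]
  [MeasurableSpace V] [BorelSpace V] {Z R : Type*} [MeasurableSpace Z] [MeasurableSpace R]

theorem IsBandFamily.integral {μ : Measure R} [SFinite μ] {F : R → ℝ} (hF : Integrable F μ)
    (hFm : Measurable F) {w : (Z × R) × V → ℂ} (hw : IsBandFamily w) :
    IsBandFamily (fun p : Z × V => ∫ r, (F r : ℂ) * w ((p.1, r), p.2) ∂μ) := by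
  obtain ⟨B, hB⟩ := hw.bounded
  obtain ⟨ρ, hρ⟩ := hw.support
  refine ⟨?_, ⟨(∫ r, |F r| ∂μ) * B, fun z => ?_⟩, ρ, fun z hz => ?_⟩
  · refine (StronglyMeasurable.integral_prod_right' (ν := μ)
      (f := fun q : (Z × V) × R => (F q.2 : ℂ) * w ((q.1.1, q.2), q.1.2)) ?_).measurable
    refine Measurable.stronglyMeasurable ?_
    have h1 : Measurable fun q : (Z × V) × R => w ((q.1.1, q.2), q.1.2) :=
      hw.measurable.comp (by fun_prop)
    exact (Complex.measurable_ofReal.comp (hFm.comp measurable_snd)).mul h1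
  · rw [← integral_mul_const]
    refine norm_integral_le_of_norm_le (hF.abs.mul_const B) (ae_of_all _ fun r => ?_)
    rw [norm_mul, Complex.norm_real, Real.norm_eq_abs]
    exact mul_le_mul_of_nonneg_left (hB _) (abs_nonneg _)
  · simp [hρ ((z.1, _), z.2) hz]

/-- Fubini: the common bound and common support of the slices make the double integral absolutely
convergent. -/
theorem integral_mul_synth {μ : Measure R} [SFinite μ] {F : R → ℝ} (hF : Integrable F μ)
    (hFm : Measurable F) {w : (Z × R) × V → ℂ} (hw : IsBandFamily w) (ζ : Z) (x : V) :
    ∫ r, F r * synth w ((ζ, r), x) ∂μ =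
      synth (fun p : Z × V => ∫ r, (F r : ℂ) * w ((p.1, r), p.2) ∂μ) (ζ, x) := by
  obtain ⟨B, hB⟩ := hw.bounded
  obtain ⟨ρ, hρ⟩ := hw.support
  set e : V → ℂ := fun ξ => Complex.exp (↑(2 * Real.pi * inner ℝ ξ x) * Complex.I) with he
  have hen : ∀ ξ, ‖e ξ‖ = 1 := fun ξ => Complex.norm_exp_ofReal_mul_I _
  have hec : Continuous e := by fun_prop
  have hi : Integrable (fun q : R × V => (F q.1 : ℂ) * (e q.2 * w ((ζ, q.1), q.2)))
      (μ.prod volume) := by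
    have hb : Integrable (fun q : R × V => |F q.1| *
        (Metric.closedBall (0 : V) ρ).indicator (fun _ => B) q.2) (μ.prod volume) :=
      hF.abs.mul_prod (memLp_one_iff_integrable.1 (memLp_indicator_closedBall 1 ρ B))
    refine hb.mono' ?_ (ae_of_all _ fun q => ?_)
    · have h1 : Measurable fun q : R × V => w ((ζ, q.1), q.2) := hw.measurable.comp (by fun_prop)
      exact ((Complex.measurable_ofReal.comp (hFm.comp measurable_fst)).mul
        ((hec.measurable.comp measurable_snd).mul h1)).aestronglyMeasurable
    · rw [norm_mul, norm_mul, hen, one_mul, Complex.norm_real, Real.norm_eq_abs]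
      refine mul_le_mul_of_nonneg_left ?_ (abs_nonneg _)
      by_cases h : q.2 ∈ Metric.closedBall (0 : V) ρ
      · rw [indicator_of_mem h]; exact hB _
      · rw [indicator_of_notMem h, hρ _ (by simpa using h), norm_zero]
  have h1 : ∀ r, F r * synth w ((ζ, r), x) =
      (∫ ξ, (F r : ℂ) * (e ξ * w ((ζ, r), ξ))).re := by
    intro r
    rw [integral_const_mul, Complex.re_ofReal_mul]
    simp only [synth, Real.fourierInv_eq', smul_eq_mul, he]
  have h2 : synth (fun p : Z × V => ∫ r, (F r : ℂ) * w ((p.1, r), p.2) ∂μ) (ζ, x) =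
      (∫ ξ, ∫ r, (F r : ℂ) * (e ξ * w ((ζ, r), ξ)) ∂μ).re := by
    simp only [synth, Real.fourierInv_eq', smul_eq_mul]
    congr 2; ext ξ
    rw [← integral_const_mul]
    congr 1; ext r
    simp only [he]; ring
  simp only [h1]
  rw [h2, ← integral_integral_swap hi]
  have := integral_re hi.integral_prod_left
  simpa using this

/-- The family shifted along trajectories. -/
theorem IsBandFamily.shift {w : ℝ × V → ℂ} (hw : IsBandFamily w) (θ ε : ℝ) :
    IsBandFamily (fun p : ((ℝ × V) × ℝ) × V =>
      Complex.exp (↑(2 * Real.pi * (ε * p.1.2) * inner ℝ p.2 p.1.1.2) * Complex.I) *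
        w (p.1.1.1 + θ * p.1.2, p.2)) := by
  obtain ⟨B, hB⟩ := hw.bounded
  obtain ⟨ρ, hρ⟩ := hw.support
  refine ⟨?_, ⟨B, fun z => ?_⟩, ρ, fun z hz => ?_⟩
  · have h1 : Measurable fun p : ((ℝ × V) × ℝ) × V => w (p.1.1.1 + θ * p.1.2, p.2) :=
      hw.measurable.comp (by fun_prop)
    have h2 : Measurable fun p : ((ℝ × V) × ℝ) × V => inner ℝ p.2 p.1.1.2 :=
      measurable_snd.inner measurable_fst.fst.snd
    refine Measurable.mul ?_ h1
    fun_prop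
  · rw [norm_mul, Complex.norm_exp_ofReal_mul_I, one_mul]; exact hB _
  · rw [hρ (z.1.1.1 + θ * z.1.2, z.2) hz, mul_zero]

/-- A displacement in x is a phase on the Fourier side; this is what makes transport a multiplier.
-/
theorem synth_add_smul (w : ℝ × V → ℂ) (θ ε s r : ℝ) (v x : V) :
    synth w (s + θ * r, x + (ε * r) • v) = synth (fun p : ((ℝ × V) × ℝ) × V =>
      Complex.exp (↑(2 * Real.pi * (ε * p.1.2) * inner ℝ p.2 p.1.1.2) * Complex.I) *
        w (p.1.1.1 + θ * p.1.2, p.2)) (((s, v), r), x) := by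
  simp only [synth, Real.fourierInv_eq', smul_eq_mul]
  congr 2; ext ξ
  rw [← mul_assoc, ← Complex.exp_add]
  congr 2
  rw [inner_add_right, inner_smul_right]
  push_cast; ring

/-- The multiplier of the average along trajectories. -/
noncomputable def averageFamily (θ ε : ℝ) (w : ℝ × V → ℂ) (p : (ℝ × V) × V) : ℂ :=
  ∫ r in Ioi (0 : ℝ), (Real.exp (-r) : ℂ) *
    (Complex.exp (↑(2 * Real.pi * (ε * r) * inner ℝ p.2 p.1.2) * Complex.I) *
        w (p.1.1 + θ * r, p.2))

theorem isBandFamily_averageFamily {w : ℝ × V → ℂ} (hw : IsBandFamily w) (θ ε : ℝ) :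
    IsBandFamily (averageFamily θ ε w) :=
  IsBandFamily.integral (μ := volume.restrict (Ioi (0 : ℝ))) (F := fun r => Real.exp (-r))
    (integrableOn_exp_neg_Ioi 0) (by fun_prop) (hw.shift θ ε)

/-- The shift along a trajectory is a phase together with a time shift, and the average over flight
times passes inside the transform. -/
theorem kineticAverage_synth {N : ℕ} {w : ℝ × Space N → ℂ} (hw : IsBandFamily w) (θ ε s : ℝ)
    (x v : Space N) :
    kineticAverage θ ε (synth w) (s, x, v) = synth (averageFamily θ ε w) ((s, v), x) := by
  simp only [kineticAverage, synth_add_smul]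
  exact integral_mul_synth (μ := volume.restrict (Ioi (0 : ℝ))) (F := fun r => Real.exp (-r))
    (integrableOn_exp_neg_Ioi 0) (by fun_prop) (hw.shift θ ε) (s, v) x

end Families

end FractionalDiffusion

namespace FractionalDiffusion

/-! ### Limit of the rescaled multipliers -/

section Multiplier

variable {N : ℕ} {α κ : ℝ} {F : Space N → ℝ}

/-- The small scale behaviour of the dissipation of an even equilibrium with heavy tails. -/
structure HasDissipationLimit (α κ : ℝ) (F : Space N → ℝ) : Prop where
  even : ∀ᵐ v, F (-v) = F v
  tendsto : ∀ k : Space N, Tendsto (fun ε : ℝ => (ε ^ α)⁻¹ * ∫ v, F v * dissipation k (ε • v))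
    (𝓝[>] 0) (𝓝 (κ * ‖k‖ ^ α))
  bound : ∃ C : ℝ, 0 ≤ C ∧ ∀ k : Space N, ∀ ε ∈ Ioc (0 : ℝ) 1,
    |(ε ^ α)⁻¹ * ∫ v, F v * dissipation k (ε • v)| ≤ C * (1 + ‖k‖ ^ 2)

/-- The phase picked up along a trajectory of velocity `v` in the rescaled time `r`. -/
noncomputable def phase (ε r : ℝ) (v ξ : Space N) : ℂ :=
  Complex.exp (↑(2 * Real.pi * (ε * r) * inner ℝ ξ v) * Complex.I)

theorem norm_phase (ε r : ℝ) (v ξ : Space N) : ‖phase ε r v ξ‖ = 1 :=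
  Complex.norm_exp_ofReal_mul_I _

theorem continuous_phase (ε : ℝ) (ξ : Space N) :
    Continuous fun p : Space N × ℝ => phase ε p.2 p.1 ξ := by
  unfold phase; fun_prop

/-- The characteristic function of the exponential law, at the frequency k·εv with k = 2πξ. -/
theorem integral_exp_phase (ε : ℝ) (v ξ : Space N) :
    ∫ r in Ioi (0 : ℝ), (Real.exp (-r) : ℂ) * phase ε r v ξ =
      (1 - (inner ℝ ((2 * Real.pi) • ξ) (ε • v) : ℝ) * Complex.I)⁻¹ := by
  have ha : (-1 + (inner ℝ ((2 * Real.pi) • ξ) (ε • v) : ℝ) * Complex.I).re < 0 := by simp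
  have h := integral_exp_mul_complex_Ioi ha 0
  have e : ∀ r : ℝ, (Real.exp (-r) : ℂ) * phase ε r v ξ =
      Complex.exp ((-1 + (inner ℝ ((2 * Real.pi) • ξ) (ε • v) : ℝ) * Complex.I) * r) := by
    intro r
    rw [phase, Complex.ofReal_exp, ← Complex.exp_add, real_inner_smul_left, real_inner_smul_right]
    congr 1; push_cast; ring
  simp only [e]
  rw [h, Complex.ofReal_zero, mul_zero, Complex.exp_zero, ← neg_div_neg_eq, neg_neg, one_div]
  congr 1; ring

theorem integrable_mul_dissipation (hF : IsPosDensity volume F) (k : Space N) (ε : ℝ) :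
    Integrable fun v => F v * dissipation k (ε • v) := by
  have hm : Continuous fun v : Space N => dissipation k (ε • v) :=
    (continuous_dissipation k).comp (by fun_prop)
  refine hF.integrable.mul_bdd (c := 1) hm.aestronglyMeasurable (ae_of_all _ fun v => ?_)
  rw [Real.norm_of_nonneg (dissipation_nonneg _ _)]
  unfold dissipation
  rw [div_le_one (by positivity)]; linarith

/-- The mean of the phase over the equilibrium and the exponential law. -/
theorem integral_phase (hF : IsPosDensity volume F) (hFe : ∀ᵐ v, F (-v) = F v) (ε : ℝ)
    (ξ : Space N) :
    ∫ v, (F v : ℂ) * (∫ r in Ioi (0 : ℝ), (Real.exp (-r) : ℂ) * phase ε r v ξ) =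
      ((1 - ∫ v, F v * dissipation ((2 * Real.pi) • ξ) (ε • v) : ℝ) : ℂ) := by
  set k := (2 * Real.pi) • ξ with hk
  -- Rationalizing 1/(1 - iφ) gives 1 - φ²/(1+φ²) + iφ/(1+φ²). The last part is odd in v and
  -- integrates to zero against the even F.
  set o : Space N → ℝ := fun v => F v * (inner ℝ k (ε • v) / (1 + inner ℝ k (ε • v) ^ 2)) with ho
  have hoi : Integrable o := by
    have hm : Continuous fun v : Space N => inner ℝ k (ε • v) / (1 + inner ℝ k (ε • v) ^ 2) := by
      refine Continuous.div (by fun_prop) (by fun_prop) fun v => by positivity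
    refine hF.integrable.mul_bdd (c := 1) hm.aestronglyMeasurable (ae_of_all _ fun v => ?_)
    rw [Real.norm_eq_abs, abs_div, abs_of_pos (by positivity : 0 < 1 + inner ℝ k (ε • v) ^ 2),
      div_le_one (by positivity), ← sq_abs]
    nlinarith [sq_nonneg (|inner ℝ k (ε • v)| - 1), abs_nonneg (inner ℝ k (ε • v))]
  have ho0 : ∫ v, o v = 0 := by
    have h1 : ∫ v, o (-v) = ∫ v, -o v := by
      refine integral_congr_ae ?_
      filter_upwards [hFe] with v hv
      simp only [ho, hv, smul_neg, inner_neg_right]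
      rw [neg_sq, neg_div]; ring
    rw [integral_neg_eq_self, integral_neg] at h1
    linarith
  have e : ∀ v, (F v : ℂ) * (∫ r in Ioi (0 : ℝ), (Real.exp (-r) : ℂ) * phase ε r v ξ) =
      ((F v - F v * dissipation k (ε • v) : ℝ) : ℂ) + (o v : ℂ) * Complex.I := by
    intro v
    rw [integral_exp_phase]
    simp only [ho, dissipation, ← hk]
    set φ : ℝ := inner ℝ k (ε • v)
    have h1 : (1 - (φ : ℂ) * Complex.I) * (1 + φ * Complex.I) = ((1 + φ ^ 2 : ℝ) : ℂ) := by
      push_cast; linear_combination (-(φ : ℂ) ^ 2) * Complex.I_sq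
    have h2 : ((1 + φ ^ 2 : ℝ) : ℂ) ≠ 0 := by
      have : 1 + φ ^ 2 ≠ 0 := by positivity
      exact_mod_cast this
    have h3 : (1 - (φ : ℂ) * Complex.I) ≠ 0 := fun h => h2 (by rw [← h1, h, zero_mul])
    have h4 : (1 - (φ : ℂ) * Complex.I)⁻¹ = (1 + φ * Complex.I) / ((1 + φ ^ 2 : ℝ) : ℂ) := by
      rw [eq_div_iff h2, ← h1, inv_mul_cancel_left₀ h3]
    rw [h4]
    push_cast at h2 ⊢
    field_simp
    ring
  simp only [e]
  have hi := integrable_mul_dissipation hF k ε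
  have hi1 : Integrable (fun v => ((F v - F v * dissipation k (ε • v) : ℝ) : ℂ)) :=
    (hF.integrable.sub hi).ofReal
  have hi2 : Integrable (fun v => (o v : ℂ) * Complex.I) := hoi.ofReal.mul_const _
  rw [integral_add hi1 hi2, integral_mul_const, integral_complex_ofReal, integral_complex_ofReal,
    ho0, integral_sub hF.integrable hi, hF.integral_eq_one]
  simp

variable {a : ℝ → ℝ} {a' s C₀ L : ℝ}

theorem integrableOn_exp_mul_id : IntegrableOn (fun r : ℝ => Real.exp (-r) * r) (Ioi 0) := by
  have := Real.GammaIntegral_convergent (s := 2) (by norm_num)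
  refine this.congr_fun (fun r _ => ?_) measurableSet_Ioi
  norm_num

theorem integral_exp_mul_id : ∫ r in Ioi (0 : ℝ), Real.exp (-r) * r = 1 := by
  have := Real.Gamma_eq_integral (s := 2) (by norm_num)
  rw [Real.Gamma_two] at this
  rw [this]
  refine setIntegral_congr_fun measurableSet_Ioi fun r _ => ?_
  norm_num

/-- The phase tends to one and the difference quotient to -a' r, and r has mean one under the
exponential law. The Lipschitz bound dominates the integrand by L r exp(-r). -/
theorem inner_integral_tendsto (hα : 0 < α) (ham : Measurable a) (hL : ∀ t, |a t - a s| ≤ L * |t - s|)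
    (ha' : HasDerivAt a a' s) (v ξ : Space N) :
    Tendsto (fun ε : ℝ => ∫ r in Ioi (0 : ℝ), (Real.exp (-r) : ℂ) *
      (phase ε r v ξ * (((a s - a (s + ε ^ α * r)) / ε ^ α : ℝ) : ℂ))) (𝓝[>] 0) (𝓝 (-a' : ℂ)) := by
  have hθ : Tendsto (fun ε : ℝ => ε ^ α) (𝓝[>] 0) (𝓝[>] 0) := by
    refine tendsto_nhdsWithin_iff.2 ⟨?_, ?_⟩
    · have := (Real.continuousAt_rpow_const 0 α (Or.inr hα.le)).tendsto
      rw [Real.zero_rpow hα.ne'] at this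
      exact this.mono_left nhdsWithin_le_nhds
    · filter_upwards [self_mem_nhdsWithin] with ε hε
      exact Real.rpow_pos_of_pos hε α
  have hlim : ∫ r in Ioi (0 : ℝ), (Real.exp (-r) : ℂ) * (1 * ((-a' * r : ℝ) : ℂ)) = (-a' : ℂ) := by
    have : ∀ r : ℝ, (Real.exp (-r) : ℂ) * (1 * ((-a' * r : ℝ) : ℂ))
        = ((-a' * (Real.exp (-r) * r) : ℝ) : ℂ) := fun r => by push_cast; ring
    simp only [this]
    rw [integral_complex_ofReal, integral_const_mul, integral_exp_mul_id]
    simp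
  rw [← hlim]
  refine tendsto_integral_filter_of_dominated_convergence (fun r => L * (Real.exp (-r) * r)) ?_ ?_
    (integrableOn_exp_mul_id.const_mul L) ?_
  · refine Eventually.of_forall fun ε => Measurable.aestronglyMeasurable ?_
    have h1 : Measurable fun r => phase ε r v ξ :=
      ((continuous_phase ε ξ).comp (by fun_prop : Continuous fun r : ℝ => (v, r))).measurable
    fun_prop
  · filter_upwards [self_mem_nhdsWithin] with ε hε
    have hεα : 0 < ε ^ α := Real.rpow_pos_of_pos hε α
    filter_upwards [ae_restrict_mem measurableSet_Ioi] with r hr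
    rw [norm_mul, norm_mul, norm_phase, one_mul, Complex.norm_real, Complex.norm_real,
      Real.norm_of_nonneg (Real.exp_pos _).le, Real.norm_eq_abs, abs_div, abs_of_pos hεα]
    have h1 := hL (s + ε ^ α * r)
    rw [abs_sub_comm, add_sub_cancel_left, abs_mul, abs_of_pos hεα, abs_of_pos (mem_Ioi.1 hr)] at h1
    have h2 : |a s - a (s + ε ^ α * r)| / ε ^ α ≤ L * r := by
      rw [div_le_iff₀ hεα]; linarith
    nlinarith [Real.exp_pos (-r)]
  · filter_upwards [ae_restrict_mem measurableSet_Ioi] with r hr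
    refine Tendsto.const_mul _ (Tendsto.mul ?_ ?_)
    · have : Continuous fun ε : ℝ => phase ε r v ξ := by unfold phase; fun_prop
      have := this.tendsto 0
      simp only [phase, zero_mul, mul_zero, Complex.ofReal_zero, Complex.exp_zero] at this
      exact this.mono_left nhdsWithin_le_nhds
    · refine (Complex.continuous_ofReal.tendsto _).comp ?_
      have h1 := ha'.tendsto_slope_zero
      have h2 : Tendsto (fun ε : ℝ => ε ^ α * r) (𝓝[>] 0) (𝓝[≠] 0) := by
        refine tendsto_nhdsWithin_iff.2 ⟨?_, ?_⟩
        · simpa using (hθ.mono_right nhdsWithin_le_nhds).mul_const r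
        · filter_upwards [self_mem_nhdsWithin] with ε hε
          exact (mul_pos (Real.rpow_pos_of_pos hε α) hr).ne'
      have h3 := ((h1.comp h2).mul_const (-r))
      rw [mul_neg, ← neg_mul] at h3
      refine h3.congr' ?_
      filter_upwards [self_mem_nhdsWithin] with ε hε
      have hεα : ε ^ α ≠ 0 := (Real.rpow_pos_of_pos hε α).ne'
      have hr0 : r ≠ 0 := (mem_Ioi.1 hr).ne'
      simp only [Function.comp_apply, smul_eq_mul]
      field_simp
      ring

theorem norm_inner_integral_le (hL : ∀ t, |a t - a s| ≤ L * |t - s|) {ε : ℝ} (hε : 0 < ε)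
    (v ξ : Space N) :
    ‖∫ r in Ioi (0 : ℝ), (Real.exp (-r) : ℂ) *
      (phase ε r v ξ * (((a s - a (s + ε ^ α * r)) / ε ^ α : ℝ) : ℂ))‖ ≤ L := by
  have hεα : 0 < ε ^ α := Real.rpow_pos_of_pos hε α
  have h := norm_integral_le_of_norm_le (μ := volume.restrict (Ioi (0 : ℝ)))
    (f := fun r => (Real.exp (-r) : ℂ) *
      (phase ε r v ξ * (((a s - a (s + ε ^ α * r)) / ε ^ α : ℝ) : ℂ)))
    (integrableOn_exp_mul_id.const_mul L) (by
      filter_upwards [ae_restrict_mem measurableSet_Ioi] with r hr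
      rw [norm_mul, norm_mul, norm_phase, one_mul, Complex.norm_real, Complex.norm_real,
        Real.norm_of_nonneg (Real.exp_pos _).le, Real.norm_eq_abs, abs_div, abs_of_pos hεα]
      have h1 := hL (s + ε ^ α * r)
      rw [abs_sub_comm, add_sub_cancel_left, abs_mul, abs_of_pos hεα,
        abs_of_pos (mem_Ioi.1 hr)] at h1
      have h2 : |a s - a (s + ε ^ α * r)| / ε ^ α ≤ L * r := by
        rw [div_le_iff₀ hεα]; linarith
      nlinarith [Real.exp_pos (-r)])
  rwa [integral_const_mul, integral_exp_mul_id, mul_one] at h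

theorem stronglyMeasurable_inner_integral (ham : Measurable a) (ε : ℝ) (ξ : Space N) :
    StronglyMeasurable fun v : Space N => ∫ r in Ioi (0 : ℝ), (Real.exp (-r) : ℂ) *
      (phase ε r v ξ * (a r : ℂ)) := by
  refine StronglyMeasurable.integral_prod_right' (f := fun p : Space N × ℝ =>
    (Real.exp (-p.2) : ℂ) * (phase ε p.2 p.1 ξ * (a p.2 : ℂ))) ?_
  have := (continuous_phase ε ξ).measurable
  exact Measurable.stronglyMeasurable (by fun_prop)

theorem integrable_exp_phase_mul {b : ℝ → ℝ} (hb : Measurable b) {C : ℝ} (hC : ∀ r, |b r| ≤ C)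
    (ε : ℝ) (v ξ : Space N) :
    IntegrableOn (fun r => (Real.exp (-r) : ℂ) * (phase ε r v ξ * (b r : ℂ))) (Ioi 0) := by
  refine ((integrableOn_exp_neg_Ioi 0).mul_const C).mono' ?_ (ae_of_all _ fun r => ?_)
  · have h1 : Measurable fun r => phase ε r v ξ :=
      ((continuous_phase ε ξ).comp (by fun_prop : Continuous fun r : ℝ => (v, r))).measurable
    exact Measurable.aestronglyMeasurable (by fun_prop)
  · rw [norm_mul, norm_mul, norm_phase, one_mul, Complex.norm_real, Complex.norm_real,
      Real.norm_of_nonneg (Real.exp_pos _).le]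
    exact mul_le_mul_of_nonneg_left (hC r) (Real.exp_pos _).le

theorem integrable_mul_inner_integral (hF : IsPosDensity volume F) {b : ℝ → ℝ} (hb : Measurable b)
    {C : ℝ} (hC : ∀ r, |b r| ≤ C) (ε : ℝ) (ξ : Space N) :
    Integrable fun v => (F v : ℂ) * ∫ r in Ioi (0 : ℝ), (Real.exp (-r) : ℂ) *
      (phase ε r v ξ * (b r : ℂ)) := by
  refine hF.integrable.ofReal.mul_bdd (c := C)
    (stronglyMeasurable_inner_integral hb ε ξ).aestronglyMeasurable (ae_of_all _ fun v => ?_)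
  have h := norm_integral_le_of_norm_le (μ := volume.restrict (Ioi (0 : ℝ)))
    (f := fun r => (Real.exp (-r) : ℂ) * (phase ε r v ξ * (b r : ℂ)))
    ((integrableOn_exp_neg_Ioi 0).mul_const C) (ae_of_all _ fun r => by
      rw [norm_mul, norm_mul, norm_phase, one_mul, Complex.norm_real, Complex.norm_real,
        Real.norm_of_nonneg (Real.exp_pos _).le]
      exact mul_le_mul_of_nonneg_left (hC r) (Real.exp_pos _).le)
  rwa [integral_mul_const, integral_exp_neg_Ioi_zero, one_mul] at h

/-- Write a(s + θr) = a(s) - θD(r). The frozen value a(s) meets the mean phase, whose defect from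
one is the dissipation; the difference quotient D carries the time derivative. -/
theorem multiplier_eq (hF : IsPosDensity volume F) (hFe : ∀ᵐ v, F (-v) = F v)
    (ham : Measurable a) (hC₀ : ∀ t, |a t| ≤ C₀) {ε : ℝ} (hε : 0 < ε) (ξ : Space N) :
    (((ε ^ α)⁻¹ : ℝ) : ℂ) * ((a s : ℂ) - ∫ v, (F v : ℂ) * ∫ r in Ioi (0 : ℝ),
      (Real.exp (-r) : ℂ) * (phase ε r v ξ * (a (s + ε ^ α * r) : ℂ))) =
    (a s : ℂ) * (((ε ^ α)⁻¹ * ∫ v, F v * dissipation ((2 * Real.pi) • ξ) (ε • v) : ℝ) : ℂ) +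
      ∫ v, (F v : ℂ) * ∫ r in Ioi (0 : ℝ), (Real.exp (-r) : ℂ) *
      (phase ε r v ξ * (((a s - a (s + ε ^ α * r)) / ε ^ α : ℝ) : ℂ)) := by
  set θ := ε ^ α with hθ
  have hθ0 : 0 < θ := Real.rpow_pos_of_pos hε α
  set D : ℝ → ℝ := fun r => (a s - a (s + θ * r)) / θ with hD
  have hDm : Measurable D := by fun_prop
  have hDC : ∀ r, |D r| ≤ (C₀ + C₀) / θ := fun r => by
    rw [abs_div, abs_of_pos hθ0]
    gcongr
    exact (abs_sub _ _).trans (add_le_add (hC₀ _) (hC₀ _))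
  have hone : ∀ r : ℝ, |(fun _ => (1 : ℝ)) r| ≤ 1 := fun _ => by simp
  have e : ∀ v, (F v : ℂ) * (∫ r in Ioi (0 : ℝ), (Real.exp (-r) : ℂ) *
        (phase ε r v ξ * (a (s + θ * r) : ℂ))) =
      (a s : ℂ) * ((F v : ℂ) * ∫ r in Ioi (0 : ℝ), (Real.exp (-r) : ℂ) *
        (phase ε r v ξ * ((1 : ℝ) : ℂ))) -
      (θ : ℂ) * ((F v : ℂ) * ∫ r in Ioi (0 : ℝ), (Real.exp (-r) : ℂ) *
        (phase ε r v ξ * (D r : ℂ))) := by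
    intro v
    have h1 := (integrable_exp_phase_mul measurable_const hone ε v ξ).const_mul (a s : ℂ)
    have h2 := (integrable_exp_phase_mul hDm hDC ε v ξ).const_mul (θ : ℂ)
    rw [mul_left_comm (a s : ℂ), mul_left_comm (θ : ℂ), ← mul_sub]
    congr 1
    rw [← integral_const_mul (a s : ℂ), ← integral_const_mul (θ : ℂ), ← integral_sub h1 h2]
    congr 1; ext r
    have h3 : a (s + θ * r) = a s - θ * D r := by simp only [hD]; field_simp; ring
    rw [h3]; push_cast; ring
  have h1 := (integrable_mul_inner_integral hF measurable_const hone ε ξ).const_mul (a s : ℂ)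
  have h2 := (integrable_mul_inner_integral hF hDm hDC ε ξ).const_mul (θ : ℂ)
  have h3 := integral_phase hF hFe ε ξ
  simp only [e]
  rw [integral_sub h1 h2, integral_const_mul, integral_const_mul]
  simp only [Complex.ofReal_one, mul_one]
  rw [h3]
  have hθc : (θ : ℂ) ≠ 0 := by exact_mod_cast hθ0.ne'
  generalize (∫ v, (F v : ℂ) * ∫ r in Ioi (0 : ℝ), (Real.exp (-r) : ℂ) *
    (phase ε r v ξ * (D r : ℂ))) = W
  push_cast
  field_simp
  ring

/-- The multipliers of the rescaled kinetic averages converge to the generator of the fractional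
heat equation. -/
theorem HasDissipationLimit.tendsto_multiplier (h : HasDissipationLimit α κ F) (hα : 0 < α)
    (hF : IsPosDensity volume F) (ham : Measurable a) (hC₀ : ∀ t, |a t| ≤ C₀)
    (hL : ∀ t, |a t - a s| ≤ L * |t - s|) (ha' : HasDerivAt a a' s) (ξ : Space N) :
    Tendsto (fun ε : ℝ => (((ε ^ α)⁻¹ : ℝ) : ℂ) * ((a s : ℂ) - ∫ v, (F v : ℂ) *
      ∫ r in Ioi (0 : ℝ), (Real.exp (-r) : ℂ) * (phase ε r v ξ * (a (s + ε ^ α * r) : ℂ))))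
      (𝓝[>] 0) (𝓝 ((a s * symbol α κ ξ - a' : ℝ) : ℂ)) := by
  have h1 := (Complex.continuous_ofReal.tendsto _).comp (h.tendsto ((2 * Real.pi) • ξ))
  have hk : κ * ‖(2 * Real.pi) • ξ‖ ^ α = symbol α κ ξ := by
    rw [symbol, norm_smul, Real.norm_of_nonneg Real.two_pi_pos.le]
  rw [hk] at h1
  have h2 : Tendsto (fun ε : ℝ => ∫ v, (F v : ℂ) * ∫ r in Ioi (0 : ℝ), (Real.exp (-r) : ℂ) *
      (phase ε r v ξ * (((a s - a (s + ε ^ α * r)) / ε ^ α : ℝ) : ℂ))) (𝓝[>] 0)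
      (𝓝 (∫ v, (F v : ℂ) * (-a' : ℂ))) := by
    refine tendsto_integral_filter_of_dominated_convergence (fun v => F v * L) ?_ ?_
      (hF.integrable.mul_const L) (ae_of_all _ fun v =>
        (inner_integral_tendsto hα ham hL ha' v ξ).const_mul _)
    · refine Eventually.of_forall fun ε => ?_
      have := stronglyMeasurable_inner_integral (N := N)
        (a := fun r => (a s - a (s + ε ^ α * r)) / ε ^ α) (by fun_prop) ε ξ
      exact (Complex.measurable_ofReal.comp hF.measurable).aestronglyMeasurable.mul
        this.aestronglyMeasurable
    · filter_upwards [self_mem_nhdsWithin] with ε hε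
      refine ae_of_all _ fun v => ?_
      rw [norm_mul, Complex.norm_real, Real.norm_of_nonneg (hF.pos v).le]
      exact mul_le_mul_of_nonneg_left (norm_inner_integral_le hL hε v ξ) (hF.pos v).le
  rw [integral_mul_const, integral_complex_ofReal, hF.integral_eq_one] at h2
  have h3 := (h1.const_mul (a s : ℂ)).add h2
  have e : (a s : ℂ) * (symbol α κ ξ : ℂ) + ((1 : ℝ) : ℂ) * (-a' : ℂ) =
      ((a s * symbol α κ ξ - a' : ℝ) : ℂ) := by push_cast; ring
  rw [e] at h3
  refine h3.congr' ?_
  filter_upwards [self_mem_nhdsWithin] with ε hε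
  rw [multiplier_eq hF h.even ham hC₀ hε]
  rfl

/-- The same splitting bounds both parts for ε ≤ 1, with a constant depending only on F and α; this
is the domination needed over a band. -/
theorem HasDissipationLimit.exists_multiplier_bound (h : HasDissipationLimit α κ F)
    (hF : IsPosDensity volume F) : ∃ C : ℝ, 0 ≤ C ∧ ∀ (a : ℝ → ℝ) (s C₀ L : ℝ), Measurable a →
      (∀ t, |a t| ≤ C₀) → (∀ t, |a t - a s| ≤ L * |t - s|) → ∀ (ξ : Space N), ∀ ε ∈ Ioc (0 : ℝ) 1,
      ‖(((ε ^ α)⁻¹ : ℝ) : ℂ) * ((a s : ℂ) - ∫ v, (F v : ℂ) *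
      ∫ r in Ioi (0 : ℝ), (Real.exp (-r) : ℂ) * (phase ε r v ξ * (a (s + ε ^ α * r) : ℂ)))‖ ≤
        C₀ * (C * (1 + ‖(2 * Real.pi) • ξ‖ ^ 2)) + L := by
  obtain ⟨C, hC, hCb⟩ := h.bound
  refine ⟨C, hC, fun a s C₀ L ham hC₀ hL ξ ε hε => ?_⟩
  rw [multiplier_eq hF h.even ham hC₀ hε.1]
  refine (norm_add_le _ _).trans (add_le_add ?_ ?_)
  · rw [norm_mul, Complex.norm_real, Complex.norm_real]
    exact mul_le_mul (hC₀ s) (hCb _ ε hε) (abs_nonneg _) ((abs_nonneg _).trans (hC₀ s))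
  · have := norm_integral_le_of_norm_le (f := fun v => (F v : ℂ) * ∫ r in Ioi (0 : ℝ),
      (Real.exp (-r) : ℂ) * (phase ε r v ξ * (((a s - a (s + ε ^ α * r)) / ε ^ α : ℝ) : ℂ)))
      (hF.integrable.mul_const L) (ae_of_all _ fun v => by
        rw [norm_mul, Complex.norm_real, Real.norm_of_nonneg (hF.pos v).le]
        exact mul_le_mul_of_nonneg_left (norm_inner_integral_le hL hε.1 v ξ) (hF.pos v).le)
    rwa [integral_mul_const, hF.integral_eq_one, one_mul] at this

end Multiplier

end FractionalDiffusion

namespace FractionalDiffusion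

/-! ### Convergence of the densities on band-limited tests -/

section KineticLimit

variable {N : ℕ} {α κ : ℝ} {F : Space N → ℝ} {f₀ : Space N × Space N → ℝ} {η : ℝ → ℝ} {T : ℝ}
  {b : Space N → ℂ}

theorem tendsto_rpow_nhdsGT_zero (hα : 0 < α) :
    Tendsto (fun ε : ℝ => ε ^ α) (𝓝[>] 0) (𝓝 0) := by
  have := (Real.continuousAt_rpow_const 0 α (Or.inr hα.le)).tendsto
  rw [Real.zero_rpow hα.ne'] at this
  exact this.mono_left nhdsWithin_le_nhds

/-- The band limited solution of the adjoint fractional heat equation with source `η b`. -/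
noncomputable def adjointFamily (α κ : ℝ) (η : ℝ → ℝ) (b : Space N → ℂ) (p : ℝ × Space N) : ℂ :=
  b p.2 * (adjointFlow η (symbol α κ p.2) p.1 : ℂ)

theorem isBandFamily_adjointFamily (hα : 0 ≤ α) (hκ : 0 ≤ κ) (hη : η ∈ testFunctions (Ioo 0 T))
    (hb : IsBand b) : IsBandFamily (adjointFamily α κ η b) := by
  obtain ⟨B, hB⟩ := hb.bounded
  obtain ⟨r, hr⟩ := hb.support
  refine ⟨?_, ⟨B * ∫ σ, |η σ|, fun z => ?_⟩, r, fun z hz => by simp [adjointFamily, hr _ hz]⟩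
  · have h1 : Measurable fun p : ℝ × Space N => adjointFlow η (symbol α κ p.2) p.1 :=
      (measurable_adjointFlow hη).comp
        (((continuous_symbol hα κ).measurable.comp measurable_snd).prodMk measurable_fst)
    exact (hb.measurable.comp measurable_snd).mul (Complex.measurable_ofReal.comp h1)
  · rw [adjointFamily, norm_mul, Complex.norm_real]
    exact mul_le_mul (hB _) (abs_adjointFlow_le hη (symbol_nonneg hκ _ _)) (abs_nonneg _)
      ((norm_nonneg _).trans (hB z.2))

theorem synth_eq_zero_of_slice {Z : Type*} {w : Z × Space N → ℂ} {z : Z × Space N}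
    (h : ∀ ξ, w (z.1, ξ) = 0) : synth w z = 0 := by
  simp [synth, Real.fourierInv_eq, h]

theorem synth_ofReal_mul {Z : Type*} (η : Z → ℝ) (b : Space N → ℂ) (z : Z × Space N) :
    synth (fun p : Z × Space N => (η p.1 : ℂ) * b p.2) z = η z.1 * (𝓕⁻ b z.2).re := by
  simp only [synth]
  rw [fourierInv_const_mul, Complex.re_ofReal_mul]

theorem averageFamily_adjointFamily (θ ε : ℝ) (s : ℝ) (v ξ : Space N) :
    averageFamily θ ε (adjointFamily α κ η b) ((s, v), ξ) =
      b ξ * ∫ r in Ioi (0 : ℝ), (Real.exp (-r) : ℂ) *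
        (phase ε r v ξ * (adjointFlow η (symbol α κ ξ) (s + θ * r) : ℂ)) := by
  rw [averageFamily, ← integral_const_mul]
  congr 1; ext r
  simp only [adjointFamily, phase]
  ring

theorem norm_averageFamily_adjointFamily_le (hκ : 0 ≤ κ) (hη : η ∈ testFunctions (Ioo 0 T)) {B : ℝ}
    (hB : ∀ ξ, ‖b ξ‖ ≤ B) (θ ε s : ℝ) (v ξ : Space N) :
    ‖averageFamily θ ε (adjointFamily α κ η b) ((s, v), ξ)‖ ≤ B * ∫ σ, |η σ| := by
  rw [averageFamily_adjointFamily, norm_mul]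
  refine mul_le_mul (hB ξ) ?_ (norm_nonneg _) ((norm_nonneg _).trans (hB ξ))
  have h := norm_integral_le_of_norm_le (μ := volume.restrict (Ioi (0 : ℝ)))
    (f := fun r => (Real.exp (-r) : ℂ) *
      (phase ε r v ξ * (adjointFlow η (symbol α κ ξ) (s + θ * r) : ℂ)))
    ((integrableOn_exp_neg_Ioi 0).mul_const (∫ σ, |η σ|)) (ae_of_all _ fun r => by
      rw [norm_mul, norm_mul, norm_phase, one_mul, Complex.norm_real, Complex.norm_real,
        Real.norm_of_nonneg (Real.exp_pos _).le]
      exact mul_le_mul_of_nonneg_left (abs_adjointFlow_le hη (symbol_nonneg hκ _ _))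
        (Real.exp_pos _).le)
  rwa [integral_mul_const, integral_exp_neg_Ioi_zero, one_mul] at h

theorem tendsto_averageFamily_adjointFamily (hα : 0 < α) (hκ : 0 ≤ κ)
    (hη : η ∈ testFunctions (Ioo 0 T)) (v ξ : Space N) :
    Tendsto (fun ε : ℝ => averageFamily (ε ^ α) ε (adjointFamily α κ η b) ((0, v), ξ)) (𝓝[>] 0)
      (𝓝 (adjointFamily α κ η b (0, ξ))) := by
  set a := adjointFlow η (symbol α κ ξ) with ha
  have hac : Continuous a :=
    continuous_iff_continuousAt.2 fun s => (hasDerivAt_adjointFlow hη _ s).continuousAt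
  simp only [averageFamily_adjointFamily, adjointFamily]
  refine Tendsto.const_mul _ ?_
  have e : ∫ r in Ioi (0 : ℝ), (Real.exp (-r) : ℂ) * (1 * (a 0 : ℂ)) = (a 0 : ℂ) := by
    rw [integral_mul_const, integral_complex_ofReal, integral_exp_neg_Ioi_zero]; simp
  rw [← ha, ← e]
  refine tendsto_integral_filter_of_dominated_convergence
    (fun r => Real.exp (-r) * ∫ σ, |η σ|) ?_ ?_ ((integrableOn_exp_neg_Ioi 0).mul_const _) ?_
  · refine Eventually.of_forall fun ε => Measurable.aestronglyMeasurable ?_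
    have h1 : Measurable fun r => phase ε r v ξ :=
      ((continuous_phase ε ξ).comp (by fun_prop : Continuous fun r : ℝ => (v, r))).measurable
    have := hac.measurable
    fun_prop
  · refine Eventually.of_forall fun ε => ae_of_all _ fun r => ?_
    rw [norm_mul, norm_mul, norm_phase, one_mul, Complex.norm_real, Complex.norm_real,
        Real.norm_of_nonneg (Real.exp_pos _).le]
    exact mul_le_mul_of_nonneg_left (abs_adjointFlow_le hη (symbol_nonneg hκ _ _))
        (Real.exp_pos _).le
  · refine ae_of_all _ fun r => Tendsto.const_mul _ (Tendsto.mul ?_ ?_)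
    · have : Continuous fun ε : ℝ => phase ε r v ξ := by unfold phase; fun_prop
      have := this.tendsto 0
      simp only [phase, zero_mul, mul_zero, Complex.ofReal_zero, Complex.exp_zero] at this
      exact this.mono_left nhdsWithin_le_nhds
    · have h1 := (tendsto_rpow_nhdsGT_zero hα).mul_const r
      have h2 := h1.const_add 0
      rw [zero_mul, add_zero] at h2
      exact (Complex.continuous_ofReal.tendsto _).comp ((hac.tendsto 0).comp h2)

/-- Densities of kinetic solutions are bounded in `L²` uniformly in the scaling parameters. -/
theorem IsKineticSolution.lintegral_sq_density_slab_le {θ ε : ℝ} {f : ℝ × Space N × Space N → ℝ}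
    (hF : IsPosDensity volume F) (hθ : 0 < θ) (hf : IsKineticSolution F θ ε f₀ f)
    (hf₀ : MemLp f₀ 2 (invWeight F)) (hfm : Measurable f) (hf₀m : Measurable f₀) (hT : 0 < T) :
    ∫⁻ p, ‖∫ w, f (p.1, p.2, w)‖ₑ ^ 2 ∂((volume.restrict (Ioo 0 T)).prod volume) ≤
      (∫⁻ y, ‖f₀ y‖ₑ ^ 2 ∂((volume : Measure (Space N)).prod (velWeight volume F))) *
        ENNReal.ofReal T := by
  rw [lintegral_prod _ ((measurable_density hfm).enorm.pow_const 2).aemeasurable]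
  calc _ ≤ ∫⁻ _ in Ioo 0 T,
        (∫⁻ y, ‖f₀ y‖ₑ ^ 2 ∂((volume : Measure (Space N)).prod (velWeight volume F))) := by
        refine lintegral_mono_ae ?_
        filter_upwards [hf.lintegral_sq_le_initial hF hθ hf₀ hfm hf₀m hT] with t ht
        exact (lintegral_sq_density_le hF hfm t).trans ht
    _ = _ := by rw [lintegral_const]; simp

theorem integrable_phase_mul_iff (hF : IsPosDensity volume F) {h c : Space N × Space N → ℝ} :
    Integrable (fun y => h y * (c y * F y.2))
        ((volume : Measure (Space N)).prod (velWeight volume F)) ↔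
      Integrable (fun y => h y * c y) := by
  have hm : Measurable fun y : Space N × Space N => F y.2 := hF.measurable.comp measurable_snd
  rw [prod_velWeight _ hF.measurable]
  exact integrable_velWeight_mul_iff (F := fun y : Space N × Space N => F y.2) hm
    (fun z => hF.pos _)

theorem integral_initial_mul (hF : IsPosDensity volume F) (hf₀ : MemLp f₀ 2 (invWeight F))
    {φ : Space N → ℝ} (hφ : MemLp φ 2) :
    ∫ y, f₀ y * φ y.1 = ∫ x, (∫ v, f₀ (x, v)) * φ x := by
  rw [invWeight_eq_prod hF.measurable] at hf₀
  have hi : Integrable (fun y : Space N × Space N => f₀ y * φ y.1) :=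
    (integrable_phase_mul_iff hF).1 (hf₀.integrable_mul (hφ.mul_prod_two hF.memLp_self))
  rw [Measure.volume_eq_prod] at hi ⊢
  rw [integral_prod _ hi]
  congr 1; ext x
  rw [← integral_mul_const]

/-- As ε tends to zero the free flights shrink, so the average started at time 0 tends to the test
function itself. This no longer depends on v, so only the density of f₀ survives. -/
theorem tendsto_initial_average (hF : IsPosDensity volume F) (hα : 0 < α) (hκ : 0 ≤ κ)
    (hf₀ : MemLp f₀ 2 (invWeight F)) (hf₀m : Measurable f₀) (hη : η ∈ testFunctions (Ioo 0 T))
    (hb : IsBand b) :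
    Tendsto (fun ε : ℝ => ∫ y : Space N × Space N, f₀ y *
      synth (averageFamily (ε ^ α) ε (adjointFamily α κ η b)) ((0, y.2), y.1)) (𝓝[>] 0)
      (𝓝 (∫ x, (∫ v, f₀ (x, v)) *
        (𝓕⁻ (fun ξ => adjointFamily α κ η b (0, ξ)) x).re)) := by
  have hGm : Measurable fun v => (F v)⁻¹ := hF.measurable.inv
  have hGp : ∀ v, 0 < (F v)⁻¹ := fun v => inv_pos.2 (hF.pos v)
  -- This is the probability measure F dv. Writing f₀ = gF moves the problem to a finite velocity
  -- measure, for which g is square integrable since g²F = f₀²/F.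
  set mF := velWeight (volume : Measure (Space N)) (fun v => (F v)⁻¹) with hmF
  have hfin : IsFiniteMeasure mF := ⟨by
    rw [← lintegral_one, hmF, lintegral_velWeight hGm]
    simp only [inv_inv, mul_one]
    rw [hF.lintegral_eq_one]; exact ENNReal.one_lt_top⟩
  set g : Space N × Space N → ℝ := fun z => f₀ (z.2, z.1) * (F z.1)⁻¹ with hg
  have hgm : Measurable g := by
    have := hF.measurable
    exact (hf₀m.comp measurable_swap).mul (by fun_prop)
  have hG2 : Measurable fun y : Space N × Space N => (F y.2)⁻¹ := hGm.comp measurable_snd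
  -- integrals against `f₀` as integrals with respect to the equilibrium
  have hint : ∀ S : Space N × Space N → ℝ,
      ∫ y, f₀ y * S (y.2, y.1) = ∫ z, g z * S z ∂(mF.prod volume) := by
    intro S
    rw [← integral_prod_swap, hmF, prod_velWeight _ hGm]
    have h := integral_velWeight_mul (μ := (volume : Measure (Space N)).prod volume)
      (F := fun y : Space N × Space N => (F y.2)⁻¹) hG2 (fun y => hGp _)
      (fun y => S (y.2, y.1)) f₀
    rw [Measure.volume_eq_prod]
    simp only [mul_comm (f₀ _)]
    rw [← h]
    congr 1; ext y
    simp only [hg, Prod.swap]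
    ring
  have hgL : ∫⁻ z, ‖g z‖ₑ ^ 2 ∂(mF.prod volume) < ⊤ := by
    rw [invWeight_eq_prod hF.measurable] at hf₀
    have h1 := (memLp_two_iff.1 hf₀).2
    refine lt_of_eq_of_lt ?_ h1
    rw [← lintegral_prod_swap, hmF, prod_velWeight _ hGm, prod_velWeight _ hF.measurable,
      lintegral_velWeight hG2, lintegral_velWeight (F := fun z : Space N × Space N => F z.2)
        (hF.measurable.comp measurable_snd)]
    congr 1; ext y
    have hy := hF.pos y.2
    simp only [hg, Prod.fst_swap, Prod.snd_swap, inv_inv, Prod.mk.eta]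
    rw [enorm_mul, mul_pow, mul_left_comm, mul_comm]
    congr 1
    rw [← ofReal_norm, Real.norm_of_nonneg (inv_pos.2 hy).le, ← ENNReal.ofReal_pow (inv_pos.2 hy).le,
      ← ENNReal.ofReal_mul hy.le]
    congr 1; field_simp
  have hgM : MemLp g 2 (mF.prod volume) := memLp_two_iff.2 ⟨hgm.aestronglyMeasurable, hgL⟩
  obtain ⟨B, hB⟩ := hb.bounded
  obtain ⟨r, hr⟩ := hb.support
  have hw := isBandFamily_adjointFamily hα.le hκ hη hb
  have hw₀ : IsBandFamily (fun p : Space N × Space N => adjointFamily α κ η b (0, p.2)) := by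
    have h := hw.slice 0
    obtain ⟨B', hB'⟩ := h.bounded
    obtain ⟨r', hr'⟩ := h.support
    exact ⟨h.measurable.comp measurable_snd, ⟨B', fun z => hB' _⟩, r', fun z hz => hr' _ hz⟩
  have hlim := tendsto_integral_mul_synth_sub (m := mF) (l := 𝓝[>] (0 : ℝ)) (g := fun _ => g)
    hgL (Eventually.of_forall fun _ => ⟨hgM, le_rfl⟩)
    (w := fun ε p => averageFamily (ε ^ α) ε (adjointFamily α κ η b) ((0, p.1), p.2))
    (w₀ := fun p => adjointFamily α κ η b (0, p.2)) (B := B * ∫ σ, |η σ|) (r := r)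
    (Eventually.of_forall fun ε =>
      (isBandFamily_averageFamily hw _ _).measurable.comp (by fun_prop))
    (Eventually.of_forall fun ε z => norm_averageFamily_adjointFamily_le hκ hη hB _ _ _ _ _)
    (Eventually.of_forall fun ε z hz => by rw [averageFamily_adjointFamily, hr _ hz, zero_mul])
    hw₀ (fun z hz => by simp [adjointFamily, hr _ hz])
    (fun z => tendsto_averageFamily_adjointFamily hα hκ hη z.1 z.2)
  have h0 : ∫ z, g z * synth (fun p : Space N × Space N => adjointFamily α κ η b (0, p.2)) z
      ∂(mF.prod volume) = ∫ x, (∫ v, f₀ (x, v)) *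
        (𝓕⁻ (fun ξ => adjointFamily α κ η b (0, ξ)) x).re := by
    rw [← hint]
    exact integral_initial_mul hF hf₀ (memLp_re_fourierInv (hw.slice 0))
  rw [h0] at hlim
  have h1 := hlim.add_const (∫ x, (∫ v, f₀ (x, v)) *
        (𝓕⁻ (fun ξ => adjointFamily α κ η b (0, ξ)) x).re)
  rw [zero_add] at h1
  refine h1.congr fun ε => ?_
  rw [sub_add_cancel, ← hint]
  rfl

/-- The heart of the limit. Duality with the backward solution gives an exact identity at each ε,
with the rescaled multiplier defect on one side and the initial average on the other. The defect
converges boundedly to the source ηb, so by the uniform L² bound on the densities it may be replaced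
by ηb. -/
theorem tendsto_density_mul (hF : IsPosDensity volume F) (hD : HasDissipationLimit α κ F)
    (hα : 0 < α) (hκ : 0 ≤ κ) (hf₀ : MemLp f₀ 2 (invWeight F)) (hf₀m : Measurable f₀)
    {f : ℝ → ℝ × Space N × Space N → ℝ} (hfm : ∀ ε, 0 < ε → Measurable (f ε))
    (hf : ∀ ε : ℝ, 0 < ε → IsKineticSolution F (ε ^ α) ε f₀ (f ε)) (hT : 0 < T)
    (hη : η ∈ testFunctions (Ioo 0 T)) (hb : IsBand b) :
    Tendsto (fun ε : ℝ => ∫ p, (∫ w, f ε (p.1, p.2, w)) * (η p.1 * (𝓕⁻ b p.2).re)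
        ∂((volume.restrict (Ioo 0 T)).prod volume)) (𝓝[>] 0)
      (𝓝 (∫ x, (∫ v, f₀ (x, v)) *
        (𝓕⁻ (fun ξ => adjointFamily α κ η b (0, ξ)) x).re)) := by
  set I := volume.restrict (Ioo (0 : ℝ) T) with hI
  have hw := isBandFamily_adjointFamily hα.le hκ hη hb
  obtain ⟨B, hB⟩ := hb.bounded
  obtain ⟨r, hr⟩ := hb.support
  have hB0 : 0 ≤ B := (norm_nonneg _).trans (hB 0)
  set m : ℝ → ℝ × Space N → ℂ := fun ε p =>
    ∫ v, (F v : ℂ) * averageFamily (ε ^ α) ε (adjointFamily α κ η b) ((p.1, v), p.2) with hm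
  have hmb : ∀ ε, IsBandFamily (m ε) := fun ε =>
    (isBandFamily_averageFamily hw (ε ^ α) ε).integral hF.integrable hF.measurable
  set q : ℝ → ℝ × Space N → ℂ := fun ε p =>
    (((ε ^ α)⁻¹ : ℝ) : ℂ) * (adjointFamily α κ η b p - m ε p) with hq
  have hqeq : ∀ ε p, q ε p = b p.2 * ((((ε ^ α)⁻¹ : ℝ) : ℂ) *
      ((adjointFlow η (symbol α κ p.2) p.1 : ℂ) - ∫ v, (F v : ℂ) * ∫ r in Ioi (0 : ℝ),
        (Real.exp (-r) : ℂ) * (phase ε r v p.2 *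
          (adjointFlow η (symbol α κ p.2) (p.1 + ε ^ α * r) : ℂ)))) := by
    intro ε p
    have : m ε p = b p.2 * ∫ v, (F v : ℂ) * ∫ r in Ioi (0 : ℝ),
        (Real.exp (-r) : ℂ) * (phase ε r v p.2 *
          (adjointFlow η (symbol α κ p.2) (p.1 + ε ^ α * r) : ℂ)) := by
      simp only [hm]
      rw [← integral_const_mul]
      congr 1; ext v
      rw [averageFamily_adjointFamily]; ring
    simp only [hq]
    rw [this, adjointFamily]; ring
  -- the identity for fixed `ε`
  have hid : ∀ ε : ℝ, 0 < ε → ∫ p, (∫ w, f ε (p.1, p.2, w)) * synth (q ε) p ∂(I.prod volume) =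
      ∫ y : Space N × Space N, f₀ y *
        synth (averageFamily (ε ^ α) ε (adjointFamily α κ η b)) ((0, y.2), y.1) := by
    intro ε hε
    have hθ : 0 < ε ^ α := Real.rpow_pos_of_pos hε α
    have hρ := memLp_density hF ((hf ε hε).memLp hF hT)
    have h := (hf ε hε).integral_density_mul hF hθ hf₀ (hfm ε hε) hT
      (measurable_synth hw.measurable) (memLp_synth hw I) (fun z hz => synth_eq_zero_of_slice
        fun ξ => by rw [adjointFamily, adjointFlow_eq_zero hη hz]; simp)
    simp only [kineticAverage_synth hw] at h
    have e : ∀ p : ℝ × Space N, ∫ v, F v *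
        synth (averageFamily (ε ^ α) ε (adjointFamily α κ η b)) ((p.1, v), p.2) =
        synth (m ε) p := fun p =>
      integral_mul_synth hF.integrable hF.measurable (isBandFamily_averageFamily hw (ε ^ α) ε)
        p.1 p.2
    simp only [e] at h
    have e2 : ∀ p, (∫ w, f ε (p.1, p.2, w)) * synth (q ε) p = (ε ^ α)⁻¹ *
        ((∫ w, f ε (p.1, p.2, w)) * synth (adjointFamily α κ η b) p -
          (∫ w, f ε (p.1, p.2, w)) * synth (m ε) p) := by
      intro p
      rw [hq, synth_const_mul, synth_sub hw (hmb ε)]; ring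
    have i1 : Integrable (fun p : ℝ × Space N => (∫ w, f ε (p.1, p.2, w)) *
      synth (adjointFamily α κ η b) p) (I.prod volume) := hρ.integrable_mul (memLp_synth hw I)
    have i2 : Integrable (fun p : ℝ × Space N => (∫ w, f ε (p.1, p.2, w)) *
      synth (m ε) p) (I.prod volume) := hρ.integrable_mul (memLp_synth (hmb ε) I)
    simp only [e2]
    rw [integral_const_mul, integral_sub i1 i2, h, add_sub_cancel_right,
      inv_mul_cancel_left₀ hθ.ne']
  -- the limit of the multipliers
  obtain ⟨Cm, hCm0, hCm⟩ := hD.exists_multiplier_bound hF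
  obtain ⟨CL, hCL0, hCL⟩ := exists_lipschitz_adjointFlow hη
  set D := ∫ σ, |η σ| with hDdef
  have hD0 : 0 ≤ D := integral_nonneg fun _ => abs_nonneg _
  set R := max r 0
  have hlam : ∀ {ξ : Space N}, ‖ξ‖ ≤ r → symbol α κ ξ ≤ κ * (2 * Real.pi * R) ^ α := fun h =>
    symbol_le hα.le hκ (h.trans (le_max_left _ _))
  -- On the band both the symbol and |k|² are bounded; D bounds the adjoint flow and the second term
  -- its Lipschitz constant.
  set K := B * (D * (Cm * (1 + (2 * Real.pi * R) ^ 2)) +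
    CL * (1 + κ * (2 * Real.pi * R) ^ α)) with hK
  have ham : ∀ l, Measurable (adjointFlow η l) := fun l =>
    (measurable_adjointFlow hη).comp (by fun_prop : Measurable fun s : ℝ => (l, s))
  have hqB : ∀ᶠ ε in 𝓝[>] (0 : ℝ), ∀ z, ‖q ε z‖ ≤ K := by
    filter_upwards [Ioc_mem_nhdsGT (zero_lt_one' ℝ)] with ε hε z
    rw [hqeq]
    rcases le_or_gt ‖z.2‖ r with h | h
    · have hl := symbol_nonneg (V := Space N) hκ α z.2
      rw [norm_mul]
      refine mul_le_mul (hB _) ?_ (norm_nonneg _) hB0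
      refine (hCm _ z.1 D (CL * (1 + symbol α κ z.2)) (ham _)
        (fun t => abs_adjointFlow_le hη hl) (fun t => hCL _ _ _ hl) z.2 ε hε).trans ?_
      have h1 : ‖(2 * Real.pi) • z.2‖ ≤ 2 * Real.pi * R := by
        rw [norm_smul, Real.norm_of_nonneg Real.two_pi_pos.le]
        exact mul_le_mul_of_nonneg_left (h.trans (le_max_left _ _)) Real.two_pi_pos.le
      have h2 := hlam h
      gcongr
    · rw [hr _ h, zero_mul, norm_zero]
      have : 0 ≤ R := le_max_right _ _
      positivity
  have hC : (∫⁻ y, ‖f₀ y‖ₑ ^ 2 ∂((volume : Measure (Space N)).prod (velWeight volume F))) *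
        ENNReal.ofReal T < ⊤ := by
    have h := hf₀
    rw [invWeight_eq_prod hF.measurable] at h
    exact ENNReal.mul_lt_top (memLp_two_iff.1 h).2 ENNReal.ofReal_lt_top
  have hq₀ : IsBandFamily (fun p : ℝ × Space N => (η p.1 : ℂ) * b p.2) := by
    obtain ⟨E, hE⟩ := hη.1.continuous.bounded_above_of_compact_support hη.2.1
    have hηm := hη.1.continuous.measurable
    refine ⟨?_, ⟨E * B, fun z => ?_⟩, r, fun z hz => by rw [hr _ hz, mul_zero]⟩
    · exact (Complex.measurable_ofReal.comp (hηm.comp measurable_fst)).mul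
        (hb.measurable.comp measurable_snd)
    · rw [norm_mul, Complex.norm_real]
      exact mul_le_mul (hE _) (hB _) (norm_nonneg _) ((norm_nonneg _).trans (hE z.1))
  have hlim := tendsto_integral_mul_synth_sub (m := I) (l := 𝓝[>] (0 : ℝ))
    (g := fun ε p => ∫ w, f ε (p.1, p.2, w)) hC (by
      filter_upwards [self_mem_nhdsWithin] with ε hε
      exact ⟨memLp_density hF ((hf ε hε).memLp hF hT),
        (hf ε hε).lintegral_sq_density_slab_le hF (Real.rpow_pos_of_pos hε α) hf₀ (hfm ε hε)
          hf₀m hT⟩)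
    (w := q) (w₀ := fun p => (η p.1 : ℂ) * b p.2) (B := K) (r := r)
    (Eventually.of_forall fun ε => (hw.measurable.sub (hmb ε).measurable).const_mul _) hqB
    (Eventually.of_forall fun ε z hz => by rw [hqeq, hr _ hz, zero_mul]) hq₀
    (fun z hz => by rw [hr _ hz, mul_zero]) (fun z => by
      have hl := symbol_nonneg (V := Space N) hκ α z.2
      simp only [hqeq]
      -- The limit is lA - A' with A' = lA - η, that is η: the adjoint flow was chosen for this.
      have h := (hD.tendsto_multiplier hα hF (ham (symbol α κ z.2))
        (fun t => abs_adjointFlow_le hη hl) (fun t => hCL _ z.1 _ hl)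
        (hasDerivAt_adjointFlow hη _ z.1) z.2).const_mul (b z.2)
      refine h.trans_eq ?_
      congr 1
      rw [mul_comm]; congr 2; ring)
  have hJ := tendsto_initial_average hF hα hκ hf₀ hf₀m hη hb
  have h2 := hJ.sub hlim
  rw [sub_zero] at h2
  refine h2.congr' ?_
  filter_upwards [self_mem_nhdsWithin] with ε hε
  rw [hid ε hε, sub_sub_cancel]
  simp only [synth_ofReal_mul]

end KineticLimit

end FractionalDiffusion

namespace FractionalDiffusion

/-! ### Fourier transforms of time slices of test functions -/

section SliceFourier

variable {V : Type*} [NormedAddCommGroup V] [InnerProductSpace ℝ V] [FiniteDimensional ℝ V]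
  [MeasurableSpace V] [BorelSpace V]

/-- The weight `(1 + |ξ|)^{-(d+1)}`, which is integrable and square integrable. -/
noncomputable def decayWeight (ξ : V) : ℝ := (1 + ‖ξ‖) ^ (-((Module.finrank ℝ V : ℝ) + 1))

theorem decayWeight_nonneg (ξ : V) : 0 ≤ decayWeight ξ := by unfold decayWeight; positivity

theorem integrable_decayWeight : Integrable (decayWeight : V → ℝ) :=
  integrable_one_add_norm (by linarith)

theorem memLp_decayWeight : MemLp (decayWeight : V → ℝ) 2 := by
  have h1 : MemLp (decayWeight : V → ℝ) ⊤ := by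
    refine memLp_top_of_bound integrable_decayWeight.1 1 (ae_of_all _ fun ξ => ?_)
    rw [Real.norm_of_nonneg (decayWeight_nonneg ξ)]
    exact Real.rpow_le_one_of_one_le_of_nonpos (by linarith [norm_nonneg ξ]) (by
      have : (0 : ℝ) ≤ Module.finrank ℝ V := by positivity
      linarith)
  rw [memLp_two_iff_integrable_sq integrable_decayWeight.1]
  have h2 := (memLp_one_iff_integrable.2 (integrable_decayWeight (V := V))).mul (p := ⊤) (r := 1) h1
  simpa [sq, Pi.mul_def] using memLp_one_iff_integrable.1 h2

/-- The Fourier transforms in space of the slices of a function of time and space. -/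
noncomputable def sliceFourier (φ : ℝ × V → ℝ) (p : ℝ × V) : ℂ :=
  𝓕 (fun x => (φ (p.1, x) : ℂ)) p.2

theorem hasCompactSupport_slice {φ : ℝ × V → ℝ} (hφ : HasCompactSupport φ) (t : ℝ) :
    HasCompactSupport (fun x => φ (t, x)) := by
  refine HasCompactSupport.intro (hφ.isCompact.image continuous_snd) fun x hx => ?_
  exact image_eq_zero_of_notMem_tsupport fun h => hx ⟨(t, x), h, rfl⟩

/-- Integration by parts in x, uniformly in time: the x-derivatives of all slices are restrictions
of derivatives of one compactly supported function, hence are bounded by a constant on a fixed ball.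
-/
theorem exists_pow_mul_sliceFourier_le {φ : ℝ × V → ℝ} (hφ : ContDiff ℝ ∞ φ)
    (hc : HasCompactSupport φ) (n : ℕ) :
    ∃ C : ℝ, ∀ p : ℝ × V, ‖p.2‖ ^ n * ‖sliceFourier φ p‖ ≤ C := by
  set Φ : ℝ × V → ℂ := fun p => (φ p : ℂ) with hΦ
  have hΦs : ContDiff ℝ ∞ Φ := Complex.ofRealCLM.contDiff.comp hφ
  have hΦc : HasCompactSupport Φ := hc.comp_left (g := ((↑) : ℝ → ℂ)) rfl
  obtain ⟨r, hr⟩ := (hc.isCompact.image continuous_snd).isBounded.subset_closedBall (0 : V)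
  have hj : ∀ j : ℕ, ∃ B : ℝ, ∀ t x, ‖iteratedFDeriv ℝ j (fun x => Φ (t, x)) x‖ ≤
      (Metric.closedBall (0 : V) r).indicator (fun _ => B) x := by
    intro j
    have hcont : Continuous (iteratedFDeriv ℝ j Φ) :=
      hΦs.continuous_iteratedFDeriv (by exact_mod_cast le_top)
    obtain ⟨B, hB⟩ := hcont.bounded_above_of_compact_support (hΦc.iteratedFDeriv j)
    refine ⟨B, fun t x => ?_⟩
    have e : iteratedFDeriv ℝ j (fun x => Φ (t, x)) x =
        (iteratedFDeriv ℝ j Φ (t, x)).compContinuousLinearMap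
          fun _ => ContinuousLinearMap.inr ℝ ℝ V := by
      have h1 : (fun x => Φ (t, x)) = (fun z => Φ ((t, 0) + z)) ∘ ContinuousLinearMap.inr ℝ ℝ V := by
        ext x; simp
      have h2 : ContDiff ℝ ∞ fun z => Φ ((t, 0) + z) := hΦs.comp (by fun_prop)
      rw [h1, ContinuousLinearMap.iteratedFDeriv_comp_right _ h2 x (by exact_mod_cast le_top),
        iteratedFDeriv_comp_add_left]
      simp
    by_cases h : x ∈ Metric.closedBall (0 : V) r
    · rw [indicator_of_mem h, e]
      refine (ContinuousMultilinearMap.norm_compContinuousLinearMap_le _ _).trans ?_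
      refine (mul_le_of_le_one_right (norm_nonneg _) ?_).trans (hB _)
      exact Finset.prod_le_one (fun _ _ => norm_nonneg _)
        fun _ _ => ContinuousLinearMap.norm_inr_le_one ℝ ℝ V
    · have h0 : iteratedFDeriv ℝ j Φ (t, x) = 0 := by
        refine image_eq_zero_of_notMem_tsupport fun h' => h (hr ⟨(t, x), ?_, rfl⟩)
        exact (tsupport_iteratedFDeriv_subset j).trans
          (tsupport_comp_subset (g := ((↑) : ℝ → ℂ)) rfl φ) h'
      rw [indicator_of_notMem h, e, h0]
      refine le_of_eq ?_
      have : (0 : ContinuousMultilinearMap ℝ (fun _ : Fin j => ℝ × V) ℂ).compContinuousLinearMap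
          (fun _ => ContinuousLinearMap.inr ℝ ℝ V) = 0 := by ext; simp
      rw [this, norm_zero]
  choose B hB using hj
  have hI : ∀ j, Integrable ((Metric.closedBall (0 : V) r).indicator (fun _ => B j)) := fun j =>
    memLp_one_iff_integrable.1 (memLp_indicator_closedBall 1 r _)
  refine ⟨2 ^ n * ∑ j ∈ Finset.range (n + 1),
    ∫ x, (Metric.closedBall (0 : V) r).indicator (fun _ => B j) x, fun p => ?_⟩
  have hs : ContDiff ℝ ∞ fun x => Φ (p.1, x) := hΦs.comp (by fun_prop)
  have hsi : ∀ j : ℕ, Integrable (fun x => ‖iteratedFDeriv ℝ j (fun x => Φ (p.1, x)) x‖) := by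
    intro j
    refine (hI j).mono' ?_ (ae_of_all _ fun x => by rw [norm_norm]; exact hB j p.1 x)
    exact (hs.continuous_iteratedFDeriv (by exact_mod_cast le_top)).norm.aestronglyMeasurable
  have h := Real.pow_mul_norm_iteratedFDeriv_fourier_le (K := 0) (N := ⊤)
    (f := fun x => Φ (p.1, x)) (by exact_mod_cast hs) (fun k j hk _ => by
      have : k = 0 := by simpa using hk
      subst this
      simpa using hsi j) (k := 0) (n := n) le_rfl (by exact_mod_cast le_top) p.2
  simp only [norm_iteratedFDeriv_zero, pow_zero, Nat.cast_zero, mul_zero, zero_add, one_mul,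
    Finset.range_one] at h
  refine h.trans ?_
  rw [Finset.singleton_product, Finset.sum_map]
  simp only [Function.Embedding.coeFn_mk, pow_zero, one_mul]
  gcongr with j hj
  · exact hsi j
  · exact hI j
  · exact fun x => hB j p.1 x

/-- The extra factor (1+|ξ|)² leaves room for the symbol, since α < 2. The exponent d + 3 is 2 plus
the d + 1 of the decay weight, and only the powers 0 and d + 3 are needed. -/
theorem exists_sliceFourier_le {φ : ℝ × V → ℝ} (hφ : ContDiff ℝ ∞ φ)
    (hc : HasCompactSupport φ) :
    ∃ C : ℝ, 0 ≤ C ∧ ∀ p : ℝ × V, (1 + ‖p.2‖) ^ 2 * ‖sliceFourier φ p‖ ≤ C * decayWeight p.2 := by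
  set d := Module.finrank ℝ V
  obtain ⟨C₁, h1⟩ := exists_pow_mul_sliceFourier_le hφ hc 0
  obtain ⟨C₂, h2⟩ := exists_pow_mul_sliceFourier_le hφ hc (d + 3)
  have h0 : 0 ≤ 2 ^ (d + 2) * (C₁ + C₂) := by
    have h1 := h1 (0, 0)
    have h2 := h2 (0, 0)
    have e1 : 0 ≤ C₁ := le_trans (by positivity) h1
    have e2 : 0 ≤ C₂ := le_trans (by positivity) h2
    positivity
  refine ⟨2 ^ (d + 2) * (C₁ + C₂), h0, fun p => ?_⟩
  have hp : 0 < 1 + ‖p.2‖ := by positivity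
  have e : decayWeight p.2 = ((1 + ‖p.2‖) ^ (d + 1))⁻¹ := by
    rw [decayWeight, Real.rpow_neg hp.le]
    congr 1
    exact_mod_cast Real.rpow_natCast (1 + ‖p.2‖) (d + 1)
  rw [e, ← div_eq_mul_inv, le_div_iff₀ (by positivity)]
  calc (1 + ‖p.2‖) ^ 2 * ‖sliceFourier φ p‖ * (1 + ‖p.2‖) ^ (d + 1)
      = (1 + ‖p.2‖) ^ (d + 3) * ‖sliceFourier φ p‖ := by ring
    _ ≤ (2 ^ (d + 3 - 1) * (1 ^ (d + 3) + ‖p.2‖ ^ (d + 3))) * ‖sliceFourier φ p‖ := by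
        gcongr
        exact add_pow_le zero_le_one (norm_nonneg _) _
    _ = 2 ^ (d + 2) * (‖p.2‖ ^ 0 * ‖sliceFourier φ p‖ + ‖p.2‖ ^ (d + 3) * ‖sliceFourier φ p‖) := by
        simp only [one_pow, pow_zero, Nat.add_succ_sub_one]; ring
    _ ≤ _ := by gcongr; exacts [h1 p, h2 p]

theorem measurable_sliceFourier {φ : ℝ × V → ℝ} (hφ : Continuous φ) :
    Measurable (sliceFourier φ) := by
  have e : sliceFourier φ = fun p : ℝ × V => ∫ x, Complex.exp
      (↑(-2 * Real.pi * inner ℝ x p.2) * Complex.I) * (φ (p.1, x) : ℂ) := by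
    ext p; simp only [sliceFourier, Real.fourier_eq', smul_eq_mul]
  rw [e]
  refine (StronglyMeasurable.integral_prod_right' (f := fun q : (ℝ × V) × V => Complex.exp
      (↑(-2 * Real.pi * inner ℝ q.2 q.1.2) * Complex.I) * (φ (q.1.1, q.2) : ℂ)) ?_).measurable
  exact Continuous.stronglyMeasurable (by fun_prop)

/-- The time derivative of a function of time and space. -/
noncomputable def timeDeriv (φ : ℝ × V → ℝ) (z : ℝ × V) : ℝ := fderiv ℝ φ z (1, 0)

theorem contDiff_timeDeriv {φ : ℝ × V → ℝ} (hφ : ContDiff ℝ ∞ φ) : ContDiff ℝ ∞ (timeDeriv φ) :=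
  (hφ.fderiv_right (m := ∞) (by simp)).clm_apply contDiff_const

theorem hasCompactSupport_timeDeriv {φ : ℝ × V → ℝ} (hc : HasCompactSupport φ) :
    HasCompactSupport (timeDeriv φ) := hc.fderiv_apply ℝ (1, 0)

theorem hasDerivAt_timeDeriv {φ : ℝ × V → ℝ} (hφ : ContDiff ℝ ∞ φ) (t : ℝ) (x : V) :
    HasDerivAt (fun t => φ (t, x)) (timeDeriv φ (t, x)) t := by
  have h1 := (hφ.differentiable (by simp) (t, x)).hasFDerivAt
  have h2 : HasDerivAt (fun t : ℝ => (t, x)) ((1, 0) : ℝ × V) t :=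
    (hasDerivAt_id t).prodMk (hasDerivAt_const t x)
  exact h1.comp_hasDerivAt t h2

theorem hasDerivAt_sliceFourier {φ : ℝ × V → ℝ} (hφ : ContDiff ℝ ∞ φ)
    (hc : HasCompactSupport φ) (t : ℝ) (ξ : V) :
    HasDerivAt (fun t => sliceFourier φ (t, ξ)) (sliceFourier (timeDeriv φ) (t, ξ)) t := by
  simp only [sliceFourier, Real.fourier_eq', smul_eq_mul]
  have hd := contDiff_timeDeriv hφ
  have hdc := hasCompactSupport_timeDeriv hc
  obtain ⟨r, hr⟩ := (hdc.isCompact.image continuous_snd).isBounded.subset_closedBall (0 : V)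
  obtain ⟨B, hB⟩ := hd.continuous.bounded_above_of_compact_support hdc
  have hφc := hφ.continuous
  have hdcont := hd.continuous
  refine (hasDerivAt_integral_of_dominated_loc_of_deriv_le (𝕜 := ℝ) (μ := volume) (x₀ := t)
    (s := univ) (bound := (Metric.closedBall (0 : V) r).indicator (fun _ => B))
    (F := fun t x => Complex.exp (↑(-2 * Real.pi * inner ℝ x ξ) * Complex.I) * (φ (t, x) : ℂ))
    (F' := fun t x =>
      Complex.exp (↑(-2 * Real.pi * inner ℝ x ξ) * Complex.I) * (timeDeriv φ (t, x) : ℂ))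
    univ_mem ?_ ?_ ?_ ?_ ?_ ?_).2
  · exact Eventually.of_forall fun t => Continuous.aestronglyMeasurable (by fun_prop)
  · refine Continuous.integrable_of_hasCompactSupport (by fun_prop) ?_
    exact ((hasCompactSupport_slice hc t).comp_left (g := ((↑) : ℝ → ℂ)) rfl).mul_left
  · exact Continuous.aestronglyMeasurable (by fun_prop)
  · refine ae_of_all _ fun x s _ => ?_
    rw [norm_mul, Complex.norm_exp_ofReal_mul_I, one_mul, Complex.norm_real]
    by_cases h : x ∈ Metric.closedBall (0 : V) r
    · rw [indicator_of_mem h]; exact hB _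
    · rw [indicator_of_notMem h, image_eq_zero_of_notMem_tsupport
        (fun h' => h (hr ⟨(s, x), h', rfl⟩)), norm_zero]
  · exact memLp_one_iff_integrable.1 (memLp_indicator_closedBall 1 r B)
  · exact ae_of_all _ fun x s _ => ((hasDerivAt_timeDeriv hφ s x).ofReal_comp).const_mul _

end SliceFourier

/-! ### Reality of the fractional Laplacian -/

section FracLaplacian

variable {N : ℕ}

/-- The Fourier transform of a real function is Hermitian. -/
theorem conj_fourier_ofReal (ψ : Space N → ℝ) (ξ : Space N) :
    (starRingEnd ℂ) (𝓕 (fun y => (ψ y : ℂ)) ξ) = 𝓕 (fun y => (ψ y : ℂ)) (-ξ) := by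
  simp only [Real.fourier_eq', smul_eq_mul]
  rw [← integral_conj]
  congr 1; ext y
  rw [map_mul, ← Complex.exp_conj, Complex.conj_ofReal, map_mul, Complex.conj_I,
    Complex.conj_ofReal, inner_neg_right]
  congr 2; push_cast; ring

/-- The multiplier is real and even, so it preserves Hermitian symmetry, and taking the real part in
the definition loses nothing. -/
theorem ofReal_fracLaplacian (α : ℝ) (ψ : Space N → ℝ) (x : Space N) :
    (fracLaplacian α ψ x : ℂ) = 𝓕⁻ (fun ξ : Space N =>
      (((2 * Real.pi * ‖ξ‖) ^ α : ℝ) : ℂ) * 𝓕 (fun y : Space N => (ψ y : ℂ)) ξ) x := by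
  rw [fracLaplacian, eq_comm, Complex.ext_iff]
  refine ⟨by simp, ?_⟩
  rw [Complex.ofReal_im, ← Complex.conj_eq_iff_im]
  simp only [Real.fourierInv_eq', smul_eq_mul]
  rw [← integral_conj, ← integral_neg_eq_self]
  congr 1; ext ξ
  rw [map_mul, map_mul, conj_fourier_ofReal, neg_neg, ← Complex.exp_conj, map_mul,
    Complex.conj_ofReal, Complex.conj_I, Complex.conj_ofReal, inner_neg_left, norm_neg]
  congr 2; push_cast; ring

theorem fracLaplacian_const_mul (α c : ℝ) (ψ : Space N → ℝ) (x : Space N) :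
    fracLaplacian α (fun x => c * ψ x) x = c * fracLaplacian α ψ x := by
  have h := ofReal_fracLaplacian α (fun x => c * ψ x) x
  have h' := ofReal_fracLaplacian α ψ x
  have e : ∀ ξ : Space N, 𝓕 (fun y : Space N => ((c * ψ y : ℝ) : ℂ)) ξ =
      (c : ℂ) * 𝓕 (fun y : Space N => (ψ y : ℂ)) ξ := by
    intro ξ
    simp only [Real.fourier_eq', smul_eq_mul]
    rw [← integral_const_mul]
    congr 1; ext y; push_cast; ring
  simp only [e, mul_left_comm _ (c : ℂ)] at h
  rw [fourierInv_const_mul, ← h'] at h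
  exact_mod_cast h

theorem rpow_le_sq {α : ℝ} (hα : α ∈ Ioo (0 : ℝ) 2) (ξ : Space N) :
    (2 * Real.pi * ‖ξ‖) ^ α ≤ (2 * Real.pi) ^ α * (1 + ‖ξ‖) ^ 2 := by
  rw [Real.mul_rpow Real.two_pi_pos.le (norm_nonneg _)]
  gcongr
  calc ‖ξ‖ ^ α ≤ (1 + ‖ξ‖) ^ α := by gcongr; exacts [hα.1.le, by linarith]
    _ ≤ (1 + ‖ξ‖) ^ (2 : ℝ) := Real.rpow_le_rpow_of_exponent_le (by linarith [norm_nonneg ξ]) hα.2.le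
    _ = _ := by norm_num

end FracLaplacian

end FractionalDiffusion

namespace FractionalDiffusion

/-! ### The explicit fractional heat flow -/

section HeatFlow

variable {N : ℕ} {α κ : ℝ} {R : Space N → ℂ} {T : ℝ}

/-- The integrand is positive off the hyperplane w₁ = 0. Positivity makes the heat multipliers
decay. -/
theorem kappa_pos [NeZero N] {α κ₀ : ℝ} (hα : α ∈ Ioo (0 : ℝ) 2) (hκ₀ : 0 < κ₀) :
    0 < kappa N α κ₀ := by
  have hpos : ∀ w : Space N, 0 ≤ kappaIntegrand α κ₀ w := fun w => by
    unfold kappaIntegrand; positivity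
  rw [kappa, integral_pos_iff_support_of_nonneg hpos (integrable_kappaIntegrand hα hκ₀)]
  have ho : IsOpen {w : Space N | w 0 ≠ 0} :=
    isOpen_ne_fun (by fun_prop) continuous_const
  refine (ho.measure_pos volume ⟨EuclideanSpace.single 0 1, by simp⟩).trans_le
    (measure_mono fun w hw => ?_)
  have hw0 : w 0 ≠ 0 := hw
  have hwn : 0 < ‖w‖ := norm_pos_iff.2 fun h => hw0 (by simp [h])
  have : 0 < kappaIntegrand α κ₀ w := by unfold kappaIntegrand; positivity
  exact this.ne'

theorem one_add_rpow_le {α κ t : ℝ} (hα : 0 < α) (hκ : 0 < κ) (ht : 0 < t) :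
    ∃ C : ℝ, 0 < C ∧ ∀ ξ : Space N, (1 + ‖ξ‖) ^ α ≤ C * (1 + t * symbol α κ ξ) := by
  set c : ℝ := t * (κ * (2 * Real.pi) ^ α) with hc
  have hc0 : 0 < c := by positivity
  refine ⟨2 ^ α * (1 + c⁻¹), by positivity, fun ξ => ?_⟩
  have e : t * symbol α κ ξ = c * ‖ξ‖ ^ α := by
    rw [symbol, Real.mul_rpow Real.two_pi_pos.le (norm_nonneg _)]; ring
  rw [e, mul_assoc]
  have h1 : (1 + ‖ξ‖) ^ α ≤ 2 ^ α * (max 1 ‖ξ‖) ^ α := by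
    rw [← Real.mul_rpow zero_le_two (by positivity)]
    refine Real.rpow_le_rpow (by positivity) ?_ hα.le
    linarith [le_max_left 1 ‖ξ‖, le_max_right 1 ‖ξ‖]
  refine h1.trans (mul_le_mul_of_nonneg_left ?_ (by positivity))
  have hn : 0 ≤ ‖ξ‖ ^ α := by positivity
  have e2 : (1 + c⁻¹) * (1 + c * ‖ξ‖ ^ α) = 1 + ‖ξ‖ ^ α + c⁻¹ + c * ‖ξ‖ ^ α := by
    field_simp; ring
  rw [e2]
  have hci : 0 < c⁻¹ := by positivity
  have hcn : 0 ≤ c * ‖ξ‖ ^ α := by positivity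
  rcases max_choice 1 ‖ξ‖ with h | h <;> rw [h]
  · rw [Real.one_rpow]; linarith
  · linarith

/-- The multipliers of the fractional heat flow decay rapidly. -/
theorem exists_exp_neg_symbol_le (hα : 0 < α) (hκ : 0 < κ) {t : ℝ} (ht : 0 < t) :
    ∃ C : ℝ, ∀ ξ : Space N, Real.exp (-(t * symbol α κ ξ)) ≤ C * decayWeight ξ := by
  obtain ⟨C, hC, h⟩ := one_add_rpow_le (N := N) hα hκ ht
  set r : ℝ := (Module.finrank ℝ (Space N) : ℝ) + 1 with hr
  -- Powers of (1+|ξ|)^α are controlled by powers of 1 + tκ|k|^α, k = 2πξ, and exp(y) beats the n-th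
  -- power of 1 + y, so any n with αn ≥ r suffices.
  obtain ⟨n, hn⟩ := exists_nat_ge (r / α)
  have hn' : r ≤ α * n := by rwa [div_le_iff₀' hα] at hn
  refine ⟨C ^ n * (n.factorial * Real.exp 1), fun ξ => ?_⟩
  have hx : 0 < 1 + ‖ξ‖ := by positivity
  set y := t * symbol α κ ξ with hy
  have hy0 : 0 ≤ y := mul_nonneg ht.le (symbol_nonneg hκ.le _ _)
  have h1 : (1 + ‖ξ‖) ^ r ≤ C ^ n * (1 + y) ^ n := by
    calc (1 + ‖ξ‖) ^ r ≤ (1 + ‖ξ‖) ^ (α * n) :=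
          Real.rpow_le_rpow_of_exponent_le (by linarith [norm_nonneg ξ]) hn'
      _ = ((1 + ‖ξ‖) ^ α) ^ n := by rw [Real.rpow_mul hx.le, Real.rpow_natCast]
      _ ≤ (C * (1 + y)) ^ n := by gcongr; exact h ξ
      _ = _ := mul_pow _ _ _
  have h2 : (1 + y) ^ n ≤ n.factorial * (Real.exp 1 * Real.exp y) := by
    have := Real.pow_div_factorial_le_exp (1 + y) (by linarith) n
    rw [div_le_iff₀ (by positivity), Real.exp_add] at this
    linarith
  rw [decayWeight, Real.rpow_neg hx.le, ← hr, ← div_eq_mul_inv, le_div_iff₀ (by positivity),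
    Real.exp_neg, inv_mul_le_iff₀ (Real.exp_pos _)]
  calc (1 + ‖ξ‖) ^ r ≤ C ^ n * (n.factorial * (Real.exp 1 * Real.exp y)) :=
        h1.trans (by gcongr)
    _ = _ := by ring

/-- The Fourier side of the fractional heat flow with datum `R`. -/
noncomputable def heatSymbol (α κ : ℝ) (R : Space N → ℂ) (p : ℝ × Space N) : ℂ :=
  (Real.exp (-(p.1 * symbol α κ p.2)) : ℂ) * R p.2

/-- The real part of the fractional heat flow whose datum has the inverse Fourier transform `R`. -/
noncomputable def heatFlow (α κ : ℝ) (R : Space N → ℂ) (p : ℝ × Space N) : ℝ :=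
  (𝓕 (fun ξ => heatSymbol α κ R (p.1, ξ)) p.2).re

theorem measurable_exp_symbol (hα : 0 ≤ α) :
    Measurable fun p : ℝ × Space N => Real.exp (-(p.1 * symbol α κ p.2)) := by
  have := continuous_symbol (V := Space N) hα κ
  exact Continuous.measurable (by fun_prop)

theorem measurable_heatSymbol (hα : 0 ≤ α) (hR : Measurable R) :
    Measurable (heatSymbol α κ R) :=
  (Complex.measurable_ofReal.comp (measurable_exp_symbol hα)).mul (hR.comp measurable_snd)

theorem exp_neg_symbol_le_one (hκ : 0 ≤ κ) {t : ℝ} (ht : 0 ≤ t) (ξ : Space N) :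
    Real.exp (-(t * symbol α κ ξ)) ≤ 1 :=
  Real.exp_le_one_iff.2 (neg_nonpos.2 (mul_nonneg ht (symbol_nonneg hκ _ _)))

theorem norm_heatSymbol_le (hκ : 0 ≤ κ) {t : ℝ} (ht : 0 ≤ t) (ξ : Space N) :
    ‖heatSymbol α κ R (t, ξ)‖ ≤ ‖R ξ‖ := by
  rw [heatSymbol, norm_mul, Complex.norm_real, Real.norm_of_nonneg (Real.exp_pos _).le]
  exact mul_le_of_le_one_left (norm_nonneg _) (exp_neg_symbol_le_one hκ ht ξ)

theorem memLp_heatSymbol (hα : 0 ≤ α) (hκ : 0 ≤ κ) (hR : Measurable R) (hR2 : MemLp R 2)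
    {t : ℝ} (ht : 0 ≤ t) : MemLp (fun ξ => heatSymbol α κ R (t, ξ)) 2 :=
  hR2.of_le ((measurable_heatSymbol hα hR).comp (by fun_prop)).aestronglyMeasurable
    (ae_of_all _ fun ξ => norm_heatSymbol_le hκ ht ξ)

/-- At positive times the exponential is square integrable, and so is R. Hence the integral Fourier
transform applies and agrees with the L² one. -/
theorem integrable_heatSymbol (hα : 0 < α) (hκ : 0 < κ) (hR : Measurable R) (hR2 : MemLp R 2)
    {t : ℝ} (ht : 0 < t) : Integrable (fun ξ => heatSymbol α κ R (t, ξ)) := by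
  obtain ⟨C, hC⟩ := exists_exp_neg_symbol_le (N := N) hα hκ ht
  have h1 : Integrable (fun ξ => C * decayWeight ξ * ‖R ξ‖) :=
    (memLp_decayWeight.const_mul C).integrable_mul hR2.norm
  refine h1.mono' ((measurable_heatSymbol hα.le hR).comp (by fun_prop)).aestronglyMeasurable
    (ae_of_all _ fun ξ => ?_)
  rw [heatSymbol, norm_mul, Complex.norm_real, Real.norm_of_nonneg (Real.exp_pos _).le]
  exact mul_le_mul_of_nonneg_right (hC ξ) (norm_nonneg _)

theorem heatFlow_eq_synth (p : ℝ × Space N) :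
    heatFlow α κ R p = synth (heatSymbol α κ R) (p.1, -p.2) := by
  rw [heatFlow, synth, Real.fourierInv_eq_fourier_neg, neg_neg]

theorem measurable_heatFlow (hα : 0 ≤ α) (hR : Measurable R) : Measurable (heatFlow α κ R) := by
  rw [funext heatFlow_eq_synth]
  exact (measurable_synth (measurable_heatSymbol hα hR)).comp
    (measurable_fst.prodMk measurable_snd.neg)

theorem eLpNorm_heatFlow_le (hα : 0 < α) (hκ : 0 < κ) (hR : Measurable R) (hR2 : MemLp R 2)
    {t : ℝ} (ht : 0 < t) :
    eLpNorm (fun x => heatFlow α κ R (t, x)) 2 volume ≤ eLpNorm R 2 volume := by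
  calc eLpNorm (fun x => heatFlow α κ R (t, x)) 2 volume
      ≤ eLpNorm (𝓕 (fun ξ => heatSymbol α κ R (t, ξ))) 2 volume :=
        eLpNorm_mono fun x => by
          rw [heatFlow, Real.norm_eq_abs]; exact Complex.abs_re_le_norm _
    _ = eLpNorm (fun ξ => heatSymbol α κ R (t, ξ)) 2 volume :=
        eLpNorm_fourier (integrable_heatSymbol hα hκ hR hR2 ht)
          (memLp_heatSymbol hα.le hκ.le hR hR2 ht.le)
    _ ≤ _ := eLpNorm_mono fun ξ => norm_heatSymbol_le hκ.le ht.le ξ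

theorem memLinftyL2_heatFlow (hα : 0 < α) (hκ : 0 < κ) (hR : Measurable R) (hR2 : MemLp R 2)
    (T : ℝ) : MemLinftyL2 T volume (heatFlow α κ R) := by
  refine ⟨(measurable_heatFlow hα.le hR).aestronglyMeasurable, (eLpNorm R 2 volume).toReal, ?_⟩
  filter_upwards [ae_restrict_mem measurableSet_Ioo] with t ht
  rw [ENNReal.ofReal_toReal hR2.2.ne]
  exact eLpNorm_heatFlow_le hα hκ hR hR2 ht.1

theorem memLp_synth_of_le {w : ℝ × Space N → ℂ} (hw : Measurable w) {D : Space N → ℝ}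
    (hD1 : Integrable D) (hD2 : MemLp D 2) (hwD : ∀ p, ‖w p‖ ≤ D p.2) :
    (∀ t, Integrable (fun ξ => w (t, ξ)) ∧ MemLp (fun ξ => w (t, ξ)) 2) ∧
      MemLp (synth w) 2 ((volume.restrict (Ioo 0 T)).prod volume) := by
  have hs : ∀ t, Integrable (fun ξ => w (t, ξ)) ∧ MemLp (fun ξ => w (t, ξ)) 2 := fun t =>
    ⟨hD1.mono' (hw.comp (by fun_prop)).aestronglyMeasurable (ae_of_all _ fun ξ => hwD _),
      hD2.of_le (hw.comp (by fun_prop)).aestronglyMeasurable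
        (ae_of_all _ fun ξ => (hwD _).trans (le_abs_self _))⟩
  refine ⟨hs, memLp_two_of_ae_eLpNorm_le (C := (eLpNorm D 2 volume).toReal)
    (measurable_synth hw).aestronglyMeasurable (ae_of_all _ fun t => ?_)⟩
  rw [ENNReal.ofReal_toReal hD2.2.ne]
  calc eLpNorm (fun x => synth w (t, x)) 2 volume
      ≤ eLpNorm (𝓕⁻ (fun ξ => w (t, ξ))) 2 volume :=
        eLpNorm_mono fun x => by rw [Real.norm_eq_abs]; exact Complex.abs_re_le_norm _
    _ = eLpNorm (fun ξ => w (t, ξ)) 2 volume := eLpNorm_fourierInv (hs t).1 (hs t).2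
    _ ≤ _ := eLpNorm_mono fun ξ => (hwD _).trans (le_abs_self _)

/-- The pairing of the heat flow with a real function, on the Fourier side. -/
theorem integral_heatFlow_mul_synth (hα : 0 < α) (hκ : 0 < κ) (hR : Measurable R)
    (hR2 : MemLp R 2) {w : ℝ × Space N → ℂ} (hw : Measurable w) {D : Space N → ℝ}
    (hD1 : Integrable D) (hD2 : MemLp D 2) (hwD : ∀ p, ‖w p‖ ≤ D p.2)
    (hreal : ∀ z : ℝ × Space N, (𝓕⁻ (fun ξ => w (z.1, ξ)) z.2).im = 0) :
    ∫ z, heatFlow α κ R z * synth w z ∂((volume.restrict (Ioo 0 T)).prod volume) =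
      (∫ ξ, R ξ * ∫ t in Ioo 0 T, (Real.exp (-(t * symbol α κ ξ)) : ℂ) * w (t, ξ)).re := by
  obtain ⟨hs, hw2⟩ := memLp_synth_of_le (T := T) hw hD1 hD2 hwD
  obtain ⟨hPm, C, hPC⟩ := memLinftyL2_heatFlow hα hκ hR hR2 T
  have hP2 := memLp_two_of_ae_eLpNorm_le hPm hPC
  have hi : Integrable (fun z => heatFlow α κ R z * synth w z)
      ((volume.restrict (Ioo 0 T)).prod volume) := hP2.integrable_mul hw2
  rw [integral_prod _ hi]
  have hslice : ∀ t ∈ Ioo 0 T, ∫ x, heatFlow α κ R (t, x) * synth w (t, x) =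
      (∫ ξ, heatSymbol α κ R (t, ξ) * w (t, ξ)).re := by
    intro t ht
    have h1 := integrable_heatSymbol hα hκ hR hR2 ht.1
    have h2 := memLp_heatSymbol hα.le hκ.le hR hR2 ht.1.le
    rw [← integral_fourier_mul_fourierInv h1 h2 (hs t).1 (hs t).2]
    have hi2 : Integrable (fun x => 𝓕 (fun ξ => heatSymbol α κ R (t, ξ)) x *
        𝓕⁻ (fun ξ => w (t, ξ)) x) :=
      (memLp_fourier h1 h2).integrable_mul (memLp_fourierInv (hs t).1 (hs t).2)
    have := integral_re hi2
    simp only [RCLike.re_eq_complex_re] at this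
    rw [← this]
    -- The real part of a product is the product of real parts because one factor is real.
    refine integral_congr_ae (ae_of_all _ fun x => ?_)
    simp only [Complex.mul_re, hreal (t, x), mul_zero, sub_zero]
    rfl
  rw [setIntegral_congr_fun measurableSet_Ioo hslice]
  have hG : Integrable (Function.uncurry fun t ξ => heatSymbol α κ R (t, ξ) * w (t, ξ))
      ((volume.restrict (Ioo 0 T)).prod volume) := by
    have h1 : Integrable (fun ξ => ‖R ξ‖ * D ξ) := hR2.norm.integrable_mul hD2
    refine (h1.comp_snd (volume.restrict (Ioo 0 T))).mono'
      ((measurable_heatSymbol hα.le hR).mul hw).aestronglyMeasurable ?_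
    have : ∀ᵐ z ∂((volume.restrict (Ioo 0 T)).prod (volume : Measure (Space N))), z.1 ∈ Ioo 0 T :=
      Measure.quasiMeasurePreserving_fst.ae (ae_restrict_mem measurableSet_Ioo)
    filter_upwards [this] with z hz
    rw [Function.uncurry, norm_mul]
    exact mul_le_mul (norm_heatSymbol_le hκ.le hz.1.le _) (hwD _) (norm_nonneg _) (norm_nonneg _)
  have h3 := integral_re hG.integral_prod_left
  simp only [RCLike.re_eq_complex_re, Function.uncurry] at h3
  rw [h3, integral_integral_swap hG]
  congr 2; ext ξ
  rw [← integral_const_mul]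
  congr 1; ext t
  simp only [heatSymbol]; ring

end HeatFlow

end FractionalDiffusion

namespace FractionalDiffusion

/-! ### The heat flow solves the weak equation -/

section HeatWeak

variable {N : ℕ} {α κ : ℝ} {R : Space N → ℂ} {T : ℝ} {φ : ℝ × Space N → ℝ}

/-- The Fourier transforms in space of `∂_t φ - κ (-Δ)^{α/2} φ`. -/
noncomputable def heatFamily (α κ : ℝ) (φ : ℝ × Space N → ℝ) (p : ℝ × Space N) : ℂ :=
  sliceFourier (timeDeriv φ) p - (symbol α κ p.2 : ℂ) * sliceFourier φ p

theorem measurable_heatFamily (hα : 0 ≤ α) (hφ : ContDiff ℝ ∞ φ) :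
    Measurable (heatFamily α κ φ) := by
  have h1 := measurable_sliceFourier (contDiff_timeDeriv hφ).continuous
  have h2 := measurable_sliceFourier hφ.continuous
  have h3 := (continuous_symbol (V := Space N) hα κ).measurable
  exact h1.sub ((Complex.measurable_ofReal.comp (h3.comp measurable_snd)).mul h2)

theorem exists_norm_sliceFourier_le (hφ : ContDiff ℝ ∞ φ) (hc : HasCompactSupport φ) :
    ∃ C : ℝ, ∀ p : ℝ × Space N, ‖sliceFourier φ p‖ ≤ C * decayWeight p.2 := by
  obtain ⟨C, -, h⟩ := exists_sliceFourier_le hφ hc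
  refine ⟨C, fun p => le_trans ?_ (h p)⟩
  exact le_mul_of_one_le_left (norm_nonneg _) (one_le_pow₀ (by linarith [norm_nonneg p.2]))

theorem exists_norm_symbol_mul_sliceFourier_le (hα : α ∈ Ioo (0 : ℝ) 2) (hκ : 0 ≤ κ)
    (hφ : ContDiff ℝ ∞ φ) (hc : HasCompactSupport φ) :
    ∃ C : ℝ, ∀ p : ℝ × Space N,
      ‖(symbol α κ p.2 : ℂ) * sliceFourier φ p‖ ≤ C * decayWeight p.2 := by
  obtain ⟨C, -, h⟩ := exists_sliceFourier_le hφ hc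
  refine ⟨κ * (2 * Real.pi) ^ α * C, fun p => ?_⟩
  rw [norm_mul, Complex.norm_real, Real.norm_of_nonneg (symbol_nonneg hκ _ _), mul_assoc]
  calc symbol α κ p.2 * ‖sliceFourier φ p‖
      ≤ κ * ((2 * Real.pi) ^ α * (1 + ‖p.2‖) ^ 2) * ‖sliceFourier φ p‖ := by
        rw [symbol]; gcongr; exact rpow_le_sq hα _
    _ = κ * (2 * Real.pi) ^ α * ((1 + ‖p.2‖) ^ 2 * ‖sliceFourier φ p‖) := by ring
    _ ≤ κ * (2 * Real.pi) ^ α * (C * decayWeight p.2) :=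
        mul_le_mul_of_nonneg_left (h p) (by positivity)
    _ = _ := by ring

theorem exists_norm_heatFamily_le (hα : α ∈ Ioo (0 : ℝ) 2) (hκ : 0 ≤ κ)
    (hφ : ContDiff ℝ ∞ φ) (hc : HasCompactSupport φ) :
    ∃ C : ℝ, ∀ p : ℝ × Space N, ‖heatFamily α κ φ p‖ ≤ C * decayWeight p.2 := by
  obtain ⟨C₁, h1⟩ := exists_norm_sliceFourier_le (contDiff_timeDeriv hφ)
    (hasCompactSupport_timeDeriv hc)
  obtain ⟨C₂, h2⟩ := exists_norm_symbol_mul_sliceFourier_le hα hκ hφ hc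
  refine ⟨C₁ + C₂, fun p => (norm_sub_le _ _).trans ?_⟩
  rw [add_mul]
  exact add_le_add (h1 p) (h2 p)

theorem integrable_sliceFourier (hφ : ContDiff ℝ ∞ φ) (hc : HasCompactSupport φ) (t : ℝ) :
    Integrable (fun ξ => sliceFourier φ (t, ξ)) ∧ MemLp (fun ξ => sliceFourier φ (t, ξ)) 2 := by
  obtain ⟨C, h⟩ := exists_norm_sliceFourier_le hφ hc
  exact (memLp_synth_of_le (T := 1) (measurable_sliceFourier hφ.continuous)
    (integrable_decayWeight.const_mul C) (memLp_decayWeight.const_mul C) h).1 t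

theorem fourierInv_sliceFourier (hφ : ContDiff ℝ ∞ φ) (hc : HasCompactSupport φ) (t : ℝ)
    (x : Space N) : 𝓕⁻ (fun ξ => sliceFourier φ (t, ξ)) x = φ (t, x) := by
  have hcont := hφ.continuous
  have h1 : Continuous fun x : Space N => (φ (t, x) : ℂ) := by fun_prop
  have h2 : Integrable fun x : Space N => (φ (t, x) : ℂ) :=
    h1.integrable_of_hasCompactSupport
      ((hasCompactSupport_slice hc t).comp_left (g := ((↑) : ℝ → ℂ)) rfl)
  exact congrFun (h1.fourierInv_fourier_eq h2 (integrable_sliceFourier hφ hc t).1) x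

theorem fourierInv_heatFamily (hα : α ∈ Ioo (0 : ℝ) 2) (hκ : 0 ≤ κ) (hφ : ContDiff ℝ ∞ φ)
    (hc : HasCompactSupport φ) (z : ℝ × Space N) :
    𝓕⁻ (fun ξ => heatFamily α κ φ (z.1, ξ)) z.2 =
      ((timeDeriv φ z - κ * fracLaplacian α (fun x => φ (z.1, x)) z.2 : ℝ) : ℂ) := by
  obtain ⟨C, h⟩ := exists_norm_symbol_mul_sliceFourier_le hα hκ hφ hc
  have hm : Measurable fun p : ℝ × Space N => (symbol α κ p.2 : ℂ) * sliceFourier φ p :=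
    (Complex.measurable_ofReal.comp ((continuous_symbol (V := Space N) hα.1.le κ).measurable.comp
      measurable_snd)).mul (measurable_sliceFourier hφ.continuous)
  have hi := ((memLp_synth_of_le (T := 1) hm (integrable_decayWeight.const_mul C)
    (memLp_decayWeight.const_mul C) h).1 z.1).1
  have hi' := (integrable_sliceFourier (contDiff_timeDeriv hφ) (hasCompactSupport_timeDeriv hc)
    z.1).1
  have e : ∀ ξ : Space N, (symbol α κ ξ : ℂ) * sliceFourier φ (z.1, ξ) =
      (κ : ℂ) * ((((2 * Real.pi * ‖ξ‖) ^ α : ℝ) : ℂ) *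
        𝓕 (fun y : Space N => (φ (z.1, y) : ℂ)) ξ) := by
    intro ξ; rw [symbol, sliceFourier, Complex.ofReal_mul, mul_assoc]
  simp only [heatFamily]
  rw [fourierInv_sub hi' hi, fourierInv_sliceFourier (contDiff_timeDeriv hφ)
    (hasCompactSupport_timeDeriv hc)]
  simp only [e]
  rw [fourierInv_const_mul, ← ofReal_fracLaplacian]
  push_cast; rfl

theorem synth_heatFamily (hα : α ∈ Ioo (0 : ℝ) 2) (hκ : 0 ≤ κ) (hφ : ContDiff ℝ ∞ φ)
    (hc : HasCompactSupport φ) (z : ℝ × Space N) :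
    synth (heatFamily α κ φ) z =
      fderiv ℝ φ z (1, 0) - κ * fracLaplacian α (fun x => φ (z.1, x)) z.2 := by
  rw [synth, fourierInv_heatFamily hα hκ hφ hc, Complex.ofReal_re, timeDeriv]

theorem exists_forall_le_eq_zero (hc : HasCompactSupport φ) :
    ∃ T : ℝ, 0 < T ∧ ∀ t x, T ≤ t → φ (t, x) = 0 ∧ timeDeriv φ (t, x) = 0 := by
  obtain ⟨r, hr⟩ := (hc.isCompact.image continuous_fst).isBounded.subset_closedBall (0 : ℝ)
  refine ⟨max r 0 + 1, by positivity, fun t x ht => ?_⟩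
  have hn : (t, x) ∉ tsupport φ := fun h => by
    have := hr ⟨_, h, rfl⟩
    simp only [Metric.mem_closedBall, dist_zero_right, Real.norm_eq_abs] at this
    linarith [le_abs_self t, le_max_left r 0]
  refine ⟨image_eq_zero_of_notMem_tsupport hn, ?_⟩
  have : fderiv ℝ φ (t, x) = 0 :=
    image_eq_zero_of_notMem_tsupport fun h => hn (tsupport_fderiv_subset ℝ h)
  rw [timeDeriv, this]; rfl

theorem sliceFourier_eq_zero {t : ℝ} (h : ∀ x, φ (t, x) = 0) (ξ : Space N) :
    sliceFourier φ (t, ξ) = 0 := by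
  simp [sliceFourier, Real.fourier_eq', h]

/-- The weak form over the half space reduces to a pairing in `L²`. -/
theorem integral_mul_heat_eq (hα : α ∈ Ioo (0 : ℝ) 2) (hκ : 0 ≤ κ) (hφ : ContDiff ℝ ∞ φ)
    (hc : HasCompactSupport φ)
    (hT : ∀ t x, T ≤ t → φ (t, x) = 0 ∧ timeDeriv φ (t, x) = 0) (ρ : ℝ × Space N → ℝ) :
    ∫ z in Ioi (0 : ℝ) ×ˢ (univ : Set (Space N)),
      ρ z * (fderiv ℝ φ z (1, 0) - κ * fracLaplacian α (fun x => φ (z.1, x)) z.2) =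
    ∫ z, ρ z * synth (heatFamily α κ φ) z ∂((volume.restrict (Ioo 0 T)).prod volume) := by
  simp only [← synth_heatFamily hα hκ hφ hc]
  refine setIntegral_Ioi_prod_eq _ fun z hz => ?_
  rw [synth_eq_zero_of_slice fun ξ => ?_, mul_zero]
  rw [heatFamily, sliceFourier_eq_zero fun x => (hT _ x hz).1,
    sliceFourier_eq_zero fun x => (hT _ x hz).2, mul_zero, sub_zero]

/-- The integrand is the time derivative of exp(-tl) times the slice transform, which vanishes at T,
so only the value at 0 remains. -/
theorem integral_exp_mul_heatFamily (hφ : ContDiff ℝ ∞ φ) (hc : HasCompactSupport φ) (hT : 0 < T)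
    (h0 : ∀ x, φ (T, x) = 0) (ξ : Space N) :
    ∫ t in Ioo 0 T, (Real.exp (-(t * symbol α κ ξ)) : ℂ) * heatFamily α κ φ (t, ξ) =
      -sliceFourier φ (0, ξ) := by
  set l := symbol α κ ξ with hl
  have hs := hasDerivAt_sliceFourier hφ hc (ξ := ξ)
  have hs' := hasDerivAt_sliceFourier (contDiff_timeDeriv hφ) (hasCompactSupport_timeDeriv hc)
    (ξ := ξ)
  have hc1 : Continuous fun t => sliceFourier φ (t, ξ) :=
    continuous_iff_continuousAt.2 fun t => (hs t).continuousAt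
  have hc2 : Continuous fun t => sliceFourier (timeDeriv φ) (t, ξ) :=
    continuous_iff_continuousAt.2 fun t => (hs' t).continuousAt
  have hd : ∀ t : ℝ, HasDerivAt
      (fun t => (Real.exp (-(t * l)) : ℂ) * sliceFourier φ (t, ξ))
      ((Real.exp (-(t * l)) : ℂ) * heatFamily α κ φ (t, ξ)) t := by
    intro t
    have h1 : HasDerivAt (fun t : ℝ => Real.exp (-(t * l))) (Real.exp (-(t * l)) * -(1 * l)) t :=
      (((hasDerivAt_id t).mul_const l).neg).exp
    refine (h1.ofReal_comp.mul (hs t)).congr_deriv ?_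
    simp only [heatFamily, ← hl]
    push_cast; ring
  rw [← integral_Ioc_eq_integral_Ioo, ← intervalIntegral.integral_of_le hT.le,
    intervalIntegral.integral_eq_sub_of_hasDerivAt (fun t _ => hd t)]
  · rw [sliceFourier_eq_zero h0]; simp
  · refine Continuous.intervalIntegrable ?_ _ _
    simp only [heatFamily, ← hl]
    fun_prop

/-- The fractional heat flow solves the fractional heat equation. -/
theorem isFracHeatSolution_heatFlow (hα : α ∈ Ioo (0 : ℝ) 2) (hκ : 0 < κ) {ρ₀ : Space N → ℝ}
    (hR : Measurable R) (hR2 : MemLp R 2)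
    (hRρ : ∀ u : Space N → ℂ, Integrable u → MemLp u 2 →
      ∫ x, (ρ₀ x : ℂ) * 𝓕⁻ u x = ∫ ξ, R ξ * u ξ) :
    IsFracHeatSolution α κ ρ₀ (heatFlow α κ R) := by
  refine ⟨fun T _ => memLinftyL2_heatFlow hα.1 hκ hR hR2 T, fun φ hφ hc => ?_⟩
  obtain ⟨T, hT, h0⟩ := exists_forall_le_eq_zero hc
  obtain ⟨C, hC⟩ := exists_norm_heatFamily_le hα hκ.le hφ hc
  obtain ⟨h1, h2⟩ := integrable_sliceFourier hφ hc 0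
  rw [integral_mul_heat_eq hα hκ.le hφ hc h0,
    integral_heatFlow_mul_synth hα.1 hκ hR hR2 (measurable_heatFamily hα.1.le hφ)
      (integrable_decayWeight.const_mul C) (memLp_decayWeight.const_mul C) hC
      fun z => by rw [fourierInv_heatFamily hα hκ.le hφ hc, Complex.ofReal_im]]
  simp only [integral_exp_mul_heatFamily hφ hc hT fun x => (h0 T x le_rfl).1, mul_neg]
  rw [integral_neg, ← hRρ _ h1 h2]
  simp only [fourierInv_sliceFourier hφ hc]
  have : ∀ x, (ρ₀ x : ℂ) * (φ (0, x) : ℂ) = ((ρ₀ x * φ (0, x) : ℝ) : ℂ) := fun x => by push_cast; rfl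
  simp only [this, integral_complex_ofReal, Complex.neg_re, Complex.ofReal_re]
  ring

/-- The Hermitian part of a function, whose Fourier transform is the real part. -/
noncomputable def hermitianPart (b : Space N → ℂ) (ξ : Space N) : ℂ :=
  (1 / 2 : ℂ) * (b ξ + (starRingEnd ℂ) (b (-ξ)))

theorem isBand_hermitianPart {b : Space N → ℂ} (hb : IsBand b) : IsBand (hermitianPart b) := by
  obtain ⟨B, hB⟩ := hb.bounded
  obtain ⟨r, hr⟩ := hb.support
  refine IsBand.const_mul ⟨?_, ⟨B + B, fun ξ => ?_⟩, r, fun ξ h => ?_⟩ _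
  · exact hb.measurable.add (Complex.continuous_conj.measurable.comp
      (hb.measurable.comp measurable_neg))
  · refine (norm_add_le _ _).trans (add_le_add (hB _) ?_)
    rw [RCLike.norm_conj]; exact hB _
  · rw [hr ξ h, hr (-ξ) (by rwa [norm_neg])]; simp

theorem fourierInv_hermitianPart {b : Space N → ℂ} (hb : IsBand b) (x : Space N) :
    𝓕⁻ (hermitianPart b) x = ((𝓕⁻ b x).re : ℂ) := by
  have e : 𝓕⁻ (fun ξ => (starRingEnd ℂ) (b (-ξ))) x = (starRingEnd ℂ) (𝓕⁻ b x) := by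
    simp only [Real.fourierInv_eq', smul_eq_mul]
    rw [← integral_conj, ← integral_neg_eq_self]
    congr 1; ext ξ
    rw [neg_neg, map_mul, ← Complex.exp_conj, map_mul, Complex.conj_ofReal, Complex.conj_I,
      inner_neg_left]
    congr 2; push_cast; ring
  have hb' : IsBand (fun ξ => (starRingEnd ℂ) (b (-ξ))) := by
    obtain ⟨B, hB⟩ := hb.bounded
    obtain ⟨r, hr⟩ := hb.support
    refine ⟨Complex.continuous_conj.measurable.comp (hb.measurable.comp measurable_neg),
      ⟨B, fun ξ => ?_⟩, r, fun ξ h => ?_⟩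
    · rw [RCLike.norm_conj]; exact hB _
    · rw [hr (-ξ) (by rwa [norm_neg]), map_zero]
  have h2 : 𝓕⁻ (fun ξ => b ξ - (-1 : ℂ) * (starRingEnd ℂ) (b (-ξ))) x =
      𝓕⁻ b x + (starRingEnd ℂ) (𝓕⁻ b x) := by
    rw [fourierInv_sub hb.integrable (hb'.const_mul _).integrable, fourierInv_const_mul, e]
    ring
  have e3 : hermitianPart b =
      fun ξ => (1 / 2 : ℂ) * (b ξ - (-1 : ℂ) * (starRingEnd ℂ) (b (-ξ))) := by
    ext ξ; simp only [hermitianPart]; ring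
  rw [e3, fourierInv_const_mul, h2, Complex.add_conj]
  push_cast; ring

/-- The pairing of the heat flow with band limited test functions. -/
theorem integral_heatFlow_mul (hα : 0 < α) (hκ : 0 < κ) {ρ₀ : Space N → ℝ}
    (hR : Measurable R) (hR2 : MemLp R 2)
    (hRρ : ∀ u : Space N → ℂ, Integrable u → MemLp u 2 →
      ∫ x, (ρ₀ x : ℂ) * 𝓕⁻ u x = ∫ ξ, R ξ * u ξ) {η : ℝ → ℝ} (hη : η ∈ testFunctions (Ioo 0 T))
    {b : Space N → ℂ} (hb : IsBand b) :
    ∫ p, heatFlow α κ R p * (η p.1 * (𝓕⁻ b p.2).re)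
      ∂((volume.restrict (Ioo 0 T)).prod volume) =
    ∫ x, ρ₀ x * (𝓕⁻ (fun ξ => adjointFamily α κ η b (0, ξ)) x).re := by
  have hbh := isBand_hermitianPart hb
  -- Passing to the Hermitian part makes the inverse transform real, as the pairing formula
  -- requires, without changing its real part.
  set w : ℝ × Space N → ℂ := fun p => (η p.1 : ℂ) * hermitianPart b p.2 with hw
  have hws : ∀ p, synth w p = η p.1 * (𝓕⁻ b p.2).re := by
    intro p
    rw [hw, synth_ofReal_mul, fourierInv_hermitianPart hb, Complex.ofReal_re]
  obtain ⟨M, hM⟩ := hη.1.continuous.bounded_above_of_compact_support hη.2.1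
  have hM0 : 0 ≤ M := (norm_nonneg _).trans (hM 0)
  obtain ⟨B, r, hB, hBr⟩ := hbh.exists_le_indicator
  set D : Space N → ℝ := (Metric.closedBall (0 : Space N) r).indicator fun _ => B
  have hD : ∀ p, MemLp D p := fun p => memLp_indicator_closedBall p r B
  have hηm := hη.1.continuous.measurable
  have hwm : Measurable w := (Complex.measurable_ofReal.comp (hηm.comp measurable_fst)).mul
    (hbh.measurable.comp measurable_snd)
  simp only [← hws]
  rw [integral_heatFlow_mul_synth hα hκ hR hR2 hwm
    ((memLp_one_iff_integrable.1 (hD 1)).const_mul M) ((hD 2).const_mul M) (fun p => by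
      rw [hw, norm_mul, Complex.norm_real]
      exact mul_le_mul (hM _) (hBr _) (norm_nonneg _) hM0) (fun z => by
      simp only [hw]
      rw [fourierInv_const_mul, fourierInv_hermitianPart hb, ← Complex.ofReal_mul,
        Complex.ofReal_im])]
  have hA := (isBandFamily_adjointFamily hα.le hκ.le hη hb).slice 0
  -- Integrating the heat exponential against η in time gives the adjoint flow at time 0. This
  -- matches the heat flow with the limit of the kinetic pairings.
  have e1 : ∀ ξ, ∫ t in Ioo 0 T, (Real.exp (-(t * symbol α κ ξ)) : ℂ) * w (t, ξ) =
      hermitianPart (fun ξ => adjointFamily α κ η b (0, ξ)) ξ := by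
    intro ξ
    have e2 : symbol α κ (-ξ) = symbol α κ ξ := by rw [symbol, symbol, norm_neg]
    simp only [hw, hermitianPart, adjointFamily, e2, map_mul, Complex.conj_ofReal]
    rw [adjointFlow_zero hη, ← integral_complex_ofReal, ← add_mul, ← mul_assoc,
      ← integral_const_mul]
    congr 1; ext t
    rw [mul_comm t]
    push_cast; ring
  simp only [e1]
  rw [← hRρ _ (isBand_hermitianPart hA).integrable ((isBand_hermitianPart hA).memLp 2)]
  simp only [fourierInv_hermitianPart hA, ← Complex.ofReal_mul]
  rw [integral_complex_ofReal, Complex.ofReal_re]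

end HeatWeak

end FractionalDiffusion

namespace FractionalDiffusion

/-! ### Transforms of test functions separate functions of polynomial growth -/

section TestFourier

variable {V : Type*} [NormedAddCommGroup V] [InnerProductSpace ℝ V] [FiniteDimensional ℝ V]
  [MeasurableSpace V] [BorelSpace V]

theorem exists_testFunctions_eq_one : ∃ χ ∈ testFunctions (univ : Set ℝ), χ 0 = 1 := by
  let f : ContDiffBump (0 : ℝ) := ⟨1, 2, one_pos, one_lt_two⟩
  exact ⟨f, ⟨f.contDiff, f.hasCompactSupport, subset_univ _⟩,
    f.one_of_mem_closedBall (by simp [f])⟩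

theorem contDiff_tensor {χ : ℝ → ℝ} {g : V → ℝ} (hχ : ContDiff ℝ ∞ χ) (hg : ContDiff ℝ ∞ g) :
    ContDiff ℝ ∞ fun p : ℝ × V => χ p.1 * g p.2 :=
  (hχ.comp contDiff_fst).mul (hg.comp contDiff_snd)

theorem hasCompactSupport_tensor {E E' : Type*} [TopologicalSpace E] [TopologicalSpace E']
    [R1Space E] [R1Space E'] {χ : E → ℝ} {g : E' → ℝ}
    (hχ : HasCompactSupport χ) (hg : HasCompactSupport g) :
    HasCompactSupport fun p : E × E' => χ p.1 * g p.2 := by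
  refine HasCompactSupport.intro (hχ.isCompact.prod hg.isCompact) fun p hp => ?_
  by_cases h : p.1 ∈ tsupport χ
  · rw [image_eq_zero_of_notMem_tsupport (fun h' => hp ⟨h, h'⟩), mul_zero]
  · rw [image_eq_zero_of_notMem_tsupport h, zero_mul]

theorem fourier_const_mul (c : ℂ) (b : V → ℂ) (x : V) :
    𝓕 (fun ξ => c * b ξ) x = c * 𝓕 b x := by
  simp only [Real.fourier_eq', smul_eq_mul]
  rw [← integral_const_mul]
  congr 1; ext; ring

theorem sliceFourier_tensor (χ : ℝ → ℝ) (g : V → ℝ) (p : ℝ × V) :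
    sliceFourier (fun q : ℝ × V => χ q.1 * g q.2) p = χ p.1 * 𝓕 (fun x => (g x : ℂ)) p.2 := by
  simp only [sliceFourier, Complex.ofReal_mul]
  exact fourier_const_mul _ _ _

theorem exists_fourier_test_le {g : V → ℝ} (hg : g ∈ testFunctions univ) :
    ∃ C : ℝ, ∀ ξ : V, (1 + ‖ξ‖) ^ 2 * ‖𝓕 (fun x => (g x : ℂ)) ξ‖ ≤ C * decayWeight ξ := by
  obtain ⟨χ, hχ, h1⟩ := exists_testFunctions_eq_one
  obtain ⟨C, -, h⟩ := exists_sliceFourier_le (contDiff_tensor hχ.1 hg.1)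
    (hasCompactSupport_tensor hχ.2.1 hg.2.1)
  refine ⟨C, fun ξ => ?_⟩
  have := h (0, ξ)
  rwa [sliceFourier_tensor, h1, Complex.ofReal_one, one_mul] at this

theorem fourier_translate (g : V → ℝ) (y ξ : V) :
    𝓕 (fun x => (g (x - y) : ℂ)) ξ =
      Complex.exp (↑(-2 * Real.pi * inner ℝ ξ y) * Complex.I) * 𝓕 (fun x => (g x : ℂ)) ξ := by
  simp only [Real.fourier_eq', smul_eq_mul]
  rw [← integral_add_right_eq_self _ y, ← integral_const_mul]
  congr 1; ext x
  rw [add_sub_cancel_right, ← mul_assoc, ← Complex.exp_add, inner_add_left, real_inner_comm y ξ]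
  congr 2; push_cast; ring

/-- Approximations of the identity: their Fourier transforms tend to one. -/
theorem exists_tendsto_fourier_one : ∃ g : ℕ → V → ℝ, (∀ n, g n ∈ testFunctions univ) ∧
    ∀ ξ, Tendsto (fun n => 𝓕 (fun x => (g n x : ℂ)) ξ) atTop (𝓝 1) := by
  let f : ℕ → ContDiffBump (0 : V) := fun n =>
    ⟨1 / (2 * ((n : ℝ) + 1)), 1 / ((n : ℝ) + 1), by positivity, by
      apply one_div_lt_one_div_of_lt <;> linarith [(n.cast_nonneg : (0 : ℝ) ≤ n)]⟩
  refine ⟨fun n => (f n).normed volume, fun n => ⟨(f n).contDiff_normed,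
    (f n).hasCompactSupport_normed, subset_univ _⟩, fun ξ => ?_⟩
  have hr : Tendsto (fun n => (f n).rOut) atTop (𝓝 0) := tendsto_one_div_add_atTop_nhds_zero_nat
  have hG : Continuous fun x : V => Complex.exp (↑(2 * Real.pi * inner ℝ x ξ) * Complex.I) := by
    fun_prop
  have h := ContDiffBump.convolution_tendsto_right_of_continuous (μ := volume) hr hG 0
  simp only [inner_zero_left, mul_zero, Complex.ofReal_zero, zero_mul, Complex.exp_zero] at h
  refine h.congr fun n => ?_
  rw [MeasureTheory.convolution_def, Real.fourier_eq']
  congr 1; ext x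
  simp only [ContinuousLinearMap.lsmul_apply, zero_sub, inner_neg_left, smul_eq_mul,
    Complex.real_smul]
  rw [mul_comm]
  congr 3; push_cast; ring

/-- Translating g multiplies its transform by a character, so the vanishing for all translates says
that the Fourier transform of h times the transform of g is zero, hence so is the product. Along an
approximation of the identity the transforms of g tend to one. The quadratic growth of h is absorbed
by their decay. -/
theorem ae_eq_zero_of_forall_integral_mul_fourier {h : V → ℂ} (hm : Measurable h) {k : V → ℝ}
    (hk : MemLp k 2) (hhk : ∀ ξ, ‖h ξ‖ ≤ (1 + ‖ξ‖) ^ 2 * k ξ)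
    (h0 : ∀ g ∈ testFunctions (univ : Set V), ∫ ξ, h ξ * 𝓕 (fun x => (g x : ℂ)) ξ = 0) :
    h =ᵐ[volume] 0 := by
  have key : ∀ g ∈ testFunctions (univ : Set V), ∀ᵐ ξ, h ξ * 𝓕 (fun x => (g x : ℂ)) ξ = 0 := by
    intro g hg
    obtain ⟨C, hC⟩ := exists_fourier_test_le hg
    have hgi : Integrable (fun x => (g x : ℂ)) :=
      (Complex.continuous_ofReal.comp hg.1.continuous).integrable_of_hasCompactSupport
        (hg.2.1.comp_left (g := ((↑) : ℝ → ℂ)) rfl)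
    set u : V → ℂ := fun ξ => h ξ * 𝓕 (fun x => (g x : ℂ)) ξ with hu
    have hum : AEStronglyMeasurable u volume :=
      (hm.mul (continuous_fourier hgi).measurable).aestronglyMeasurable
    have hub : ∀ ξ, ‖u ξ‖ ≤ k ξ * (C * decayWeight ξ) := by
      intro ξ
      have hk0 : 0 ≤ k ξ := by
        have := (norm_nonneg _).trans (hhk ξ)
        exact nonneg_of_mul_nonneg_right this (by positivity)
      rw [hu, norm_mul]
      calc ‖h ξ‖ * ‖𝓕 (fun x => (g x : ℂ)) ξ‖
          ≤ ((1 + ‖ξ‖) ^ 2 * k ξ) * ‖𝓕 (fun x => (g x : ℂ)) ξ‖ := by gcongr; exact hhk ξ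
        _ = k ξ * ((1 + ‖ξ‖) ^ 2 * ‖𝓕 (fun x => (g x : ℂ)) ξ‖) := by ring
        _ ≤ _ := mul_le_mul_of_nonneg_left (hC ξ) hk0
    have hu1 : Integrable u := by
      have : Integrable fun ξ => k ξ * (C * decayWeight ξ) :=
        hk.integrable_mul (memLp_decayWeight.const_mul C)
      exact this.mono' hum (ae_of_all _ hub)
    have hu2 : MemLp u 2 := by
      refine (hk.norm.const_mul |C|).of_le hum (ae_of_all _ fun ξ => (hub ξ).trans ?_)
      have hd : decayWeight ξ ≤ 1 := Real.rpow_le_one_of_one_le_of_nonpos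
        (by linarith [norm_nonneg ξ]) (by
          have : (0 : ℝ) ≤ Module.finrank ℝ V := by positivity
          linarith)
      rw [Real.norm_eq_abs, abs_mul, abs_abs, Real.norm_eq_abs, abs_abs, mul_comm]
      refine (le_abs_self _).trans ?_
      rw [abs_mul, abs_mul, abs_of_nonneg (decayWeight_nonneg ξ)]
      gcongr
      exact mul_le_of_le_one_right (abs_nonneg _) hd
    have hF : 𝓕 u = 0 := by
      ext y
      have hgy : (fun x => g (x - y)) ∈ testFunctions (univ : Set V) :=
        ⟨hg.1.comp (by fun_prop), hg.2.1.comp_homeomorph (Homeomorph.subRight y), subset_univ _⟩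
      rw [Pi.zero_apply, ← h0 _ hgy, Real.fourier_eq']
      congr 1; ext ξ
      rw [fourier_translate, smul_eq_mul, hu]
      ring
    have hn := eLpNorm_fourier hu1 hu2
    rw [hF, eLpNorm_zero, eq_comm, eLpNorm_eq_zero_iff hum two_ne_zero] at hn
    exact hn
  obtain ⟨g, hg, hlim⟩ := exists_tendsto_fourier_one (V := V)
  filter_upwards [ae_all_iff.2 fun n => key (g n) (hg n)] with ξ hξ
  have h1 := (hlim ξ).const_mul (h ξ)
  simp only [hξ, mul_one] at h1
  exact tendsto_nhds_unique h1 tendsto_const_nhds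

end TestFourier

end FractionalDiffusion

namespace FractionalDiffusion

/-! ### Uniqueness: reduction to frequency bands -/

section Uniqueness

variable {N : ℕ} {α κ : ℝ} {T : ℝ} {d : ℝ × Space N → ℝ}

theorem integral_mul_tensor_left {X Y : Type*} [MeasurableSpace X] [MeasurableSpace Y]
    {μ : Measure X} {ν : Measure Y} [SFinite μ] [SFinite ν] {d : X × Y → ℝ}
    (hd : MemLp d 2 (μ.prod ν)) {a : X → ℝ} {b : Y → ℝ} (ha : MemLp a 2 μ) (hb : MemLp b 2 ν) :
    ∫ z, d z * (a z.1 * b z.2) ∂(μ.prod ν) = ∫ x, a x * ∫ y, d (x, y) * b y ∂ν ∂μ := by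
  have hi : Integrable (fun z => d z * (a z.1 * b z.2)) (μ.prod ν) :=
    hd.integrable_mul (ha.mul_prod_two hb)
  rw [integral_prod _ hi]
  congr 1; ext x
  rw [← integral_const_mul]
  congr 1; ext y; ring

theorem integral_mul_tensor_right {X Y : Type*} [MeasurableSpace X] [MeasurableSpace Y]
    {μ : Measure X} {ν : Measure Y} [SFinite μ] [SFinite ν] {d : X × Y → ℝ}
    (hd : MemLp d 2 (μ.prod ν)) {a : X → ℝ} {b : Y → ℝ} (ha : MemLp a 2 μ) (hb : MemLp b 2 ν) :
    ∫ z, d z * (a z.1 * b z.2) ∂(μ.prod ν) = ∫ y, (∫ x, d (x, y) * a x ∂μ) * b y ∂ν := by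
  have hi : Integrable (fun z => d z * (a z.1 * b z.2)) (μ.prod ν) :=
    hd.integrable_mul (ha.mul_prod_two hb)
  rw [integral_prod_symm _ hi]
  congr 1; ext y
  rw [← integral_mul_const]
  congr 1; ext x; ring

theorem timeDeriv_tensor {χ : ℝ → ℝ} {g : Space N → ℝ} (hχ : ContDiff ℝ ∞ χ)
    (hg : ContDiff ℝ ∞ g) (z : ℝ × Space N) :
    timeDeriv (fun p : ℝ × Space N => χ p.1 * g p.2) z = deriv χ z.1 * g z.2 := by
  have h1 := hasDerivAt_timeDeriv (contDiff_tensor hχ hg) z.1 z.2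
  have h2 : HasDerivAt (fun t => χ t * g z.2) (deriv χ z.1 * g z.2) z.1 :=
    ((hχ.differentiable (by simp) z.1).hasDerivAt).mul_const _
  exact h1.unique h2

theorem integral_ofReal_mul_eq_re {X : Type*} [MeasurableSpace X] {μ : Measure X} {h : X → ℝ}
    {w : X → ℂ} (hw : ∀ x, (w x).im = 0) :
    ∫ x, (h x : ℂ) * w x ∂μ = ((∫ x, h x * (w x).re ∂μ : ℝ) : ℂ) := by
  rw [← integral_complex_ofReal]
  congr 1; ext x
  rw [Complex.ofReal_mul]
  congr 1
  exact Complex.ext (by simp) (by simp [hw x])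

/-- The weak fractional heat equation on `(0, T)`, with zero datum. -/
def IsHeatNull (α κ T : ℝ) (d : ℝ × Space N → ℝ) : Prop :=
  ∀ φ : ℝ × Space N → ℝ, ContDiff ℝ ∞ φ → HasCompactSupport φ →
    (∀ t x, T ≤ t → φ (t, x) = 0 ∧ timeDeriv φ (t, x) = 0) →
    ∫ z, d z * synth (heatFamily α κ φ) z ∂((volume.restrict (Ioo 0 T)).prod volume) = 0

/-- The equation satisfied by the Fourier transforms of the time averages. -/
theorem IsHeatNull.fourier_eq (hα : α ∈ Ioo (0 : ℝ) 2) (hκ : 0 ≤ κ)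
    (hd2 : MemLp d 2 ((volume.restrict (Ioo 0 T)).prod volume)) (h : IsHeatNull α κ T d)
    {χ : ℝ → ℝ} (hχ : ContDiff ℝ ∞ χ) (hχc : HasCompactSupport χ) (hχT : ∀ t, T ≤ t → χ t = 0)
    (hχT' : ∀ t, T ≤ t → deriv χ t = 0) {S S' : Space N → ℂ} (hS : Measurable S)
    (hS2 : MemLp S 2) (hS' : Measurable S') (hS2' : MemLp S' 2)
    (hSu : ∀ u : Space N → ℂ, Integrable u → MemLp u 2 →
      ∫ x, ((∫ t in Ioo 0 T, d (t, x) * χ t : ℝ) : ℂ) * 𝓕⁻ u x = ∫ ξ, S ξ * u ξ)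
    (hSu' : ∀ u : Space N → ℂ, Integrable u → MemLp u 2 →
      ∫ x, ((∫ t in Ioo 0 T, d (t, x) * deriv χ t : ℝ) : ℂ) * 𝓕⁻ u x = ∫ ξ, S' ξ * u ξ) :
    ∀ᵐ ξ, S' ξ = (symbol α κ ξ : ℂ) * S ξ := by
  have hsm : Measurable fun ξ : Space N => (symbol α κ ξ : ℂ) :=
    Complex.measurable_ofReal.comp (continuous_symbol hα.1.le κ).measurable
  suffices h1 : (fun ξ => S' ξ - (symbol α κ ξ : ℂ) * S ξ) =ᵐ[volume] 0 by
    filter_upwards [h1] with ξ hξ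
    exact sub_eq_zero.1 hξ
  refine ae_eq_zero_of_forall_integral_mul_fourier (hS'.sub (hsm.mul hS))
    (k := fun ξ => ‖S' ξ‖ + κ * (2 * Real.pi) ^ α * ‖S ξ‖)
    (hS2'.norm.add (hS2.norm.const_mul _)) (fun ξ => ?_) fun g hg => ?_
  · refine (norm_sub_le _ _).trans ?_
    rw [norm_mul, Complex.norm_real, Real.norm_of_nonneg (symbol_nonneg hκ _ _), mul_add]
    refine add_le_add (le_mul_of_one_le_left (norm_nonneg _)
      (one_le_pow₀ (by linarith [norm_nonneg ξ]))) ?_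
    calc symbol α κ ξ * ‖S ξ‖ ≤ κ * ((2 * Real.pi) ^ α * (1 + ‖ξ‖) ^ 2) * ‖S ξ‖ := by
          rw [symbol]; gcongr; exact rpow_le_sq hα _
      _ = _ := by ring
  -- A time factor equal to one at 0 lets the slice estimates serve for a function of x alone.
  obtain ⟨χ₁, hχ₁, h11⟩ := exists_testFunctions_eq_one
  set φ₁ : ℝ × Space N → ℝ := fun p => χ₁ p.1 * g p.2 with hφ₁
  have hφ₁s : ContDiff ℝ ∞ φ₁ := contDiff_tensor hχ₁.1 hg.1
  have hφ₁c : HasCompactSupport φ₁ := hasCompactSupport_tensor hχ₁.2.1 hg.2.1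
  set G : Space N → ℂ := 𝓕 (fun x : Space N => (g x : ℂ)) with hG
  have hs1 : ∀ ξ, sliceFourier φ₁ (0, ξ) = G ξ := fun ξ => by
    rw [hφ₁, sliceFourier_tensor]
    simp only [h11, Complex.ofReal_one, one_mul]
    rfl
  -- the transforms of the test function
  have hGi := integrable_sliceFourier hφ₁s hφ₁c 0
  simp only [hs1] at hGi
  have hGinv : ∀ x, 𝓕⁻ G x = (g x : ℂ) := fun x => by
    have := fourierInv_sliceFourier hφ₁s hφ₁c 0 x
    simp only [hs1] at this
    rw [this, hφ₁]; simp only [h11, one_mul]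
  obtain ⟨C, hC⟩ := exists_norm_symbol_mul_sliceFourier_le hα hκ hφ₁s hφ₁c
  have hLi := (memLp_synth_of_le (T := 1) ((hsm.comp measurable_snd).mul
    (measurable_sliceFourier hφ₁s.continuous)) (integrable_decayWeight.const_mul C)
    (memLp_decayWeight.const_mul C) hC).1 0
  simp only [Pi.mul_apply, Function.comp_apply, hs1] at hLi
  have hLinv : ∀ x, 𝓕⁻ (fun ξ => (symbol α κ ξ : ℂ) * G ξ) x = ((κ * fracLaplacian α g x : ℝ) : ℂ) := by
    intro x
    have e : (fun ξ => (symbol α κ ξ : ℂ) * G ξ) = fun ξ => (κ : ℂ) *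
        ((((2 * Real.pi * ‖ξ‖) ^ α : ℝ) : ℂ) * 𝓕 (fun y : Space N => (g y : ℂ)) ξ) := by
      ext ξ; rw [symbol, Complex.ofReal_mul, mul_assoc]
    rw [e, fourierInv_const_mul, ← ofReal_fracLaplacian]
    push_cast; rfl
  have hg2 : MemLp g 2 := hg.1.continuous.memLp_of_hasCompactSupport hg.2.1
  have hL2 : MemLp (fun x => κ * fracLaplacian α g x) 2 := by
    have := (memLp_fourierInv hLi.1 hLi.2).re
    simpa only [hLinv, RCLike.re_eq_complex_re, Complex.ofReal_re] using this
  -- the weak formulation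
  have hw := h _ (contDiff_tensor hχ hg.1) (hasCompactSupport_tensor hχc hg.2.1) fun t x ht => by
    rw [timeDeriv_tensor hχ hg.1]
    simp only [hχT t ht, hχT' t ht, zero_mul, and_self]
  have hχ2 : MemLp χ 2 (volume.restrict (Ioo 0 T)) :=
    (hχ.continuous.memLp_of_hasCompactSupport hχc).restrict _
  have hχ2' : MemLp (deriv χ) 2 (volume.restrict (Ioo 0 T)) :=
    ((hχ.continuous_deriv (by simp)).memLp_of_hasCompactSupport hχc.deriv).restrict _
  have e1 : ∀ z : ℝ × Space N, d z * synth (heatFamily α κ fun p => χ p.1 * g p.2) z =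
      d z * (deriv χ z.1 * g z.2) - d z * (χ z.1 * (κ * fracLaplacian α g z.2)) := by
    intro z
    rw [synth_heatFamily hα hκ (contDiff_tensor hχ hg.1) (hasCompactSupport_tensor hχc hg.2.1)]
    have := timeDeriv_tensor hχ hg.1 z
    rw [timeDeriv] at this
    have e2 := fracLaplacian_const_mul α (χ z.1) g z.2
    rw [this, e2]
    ring
  simp only [e1] at hw
  have i1 : Integrable (fun z : ℝ × Space N => d z * (deriv χ z.1 * g z.2))
    ((volume.restrict (Ioo 0 T)).prod volume) := hd2.integrable_mul (hχ2'.mul_prod_two hg2)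
  have i2 : Integrable (fun z : ℝ × Space N => d z * (χ z.1 * (κ * fracLaplacian α g z.2)))
    ((volume.restrict (Ioo 0 T)).prod volume) := hd2.integrable_mul (hχ2.mul_prod_two hL2)
  rw [integral_sub i1 i2, integral_mul_tensor_right hd2 hχ2' hg2,
    integral_mul_tensor_right hd2 hχ2 hL2] at hw
  have j1 := hSu' G hGi.1 hGi.2
  have j2 := hSu _ hLi.1 hLi.2
  rw [integral_ofReal_mul_eq_re fun x => by rw [hGinv, Complex.ofReal_im]] at j1
  rw [integral_ofReal_mul_eq_re fun x => by rw [hLinv, Complex.ofReal_im]] at j2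
  simp only [hGinv, Complex.ofReal_re] at j1
  simp only [hLinv, Complex.ofReal_re] at j2
  have k1 : Integrable fun ξ => S' ξ * G ξ := hS2'.integrable_mul hGi.2
  have k2 : Integrable fun ξ => S ξ * ((symbol α κ ξ : ℂ) * G ξ) := hS2.integrable_mul hLi.2
  have e2 : ∀ ξ, (S' ξ - (symbol α κ ξ : ℂ) * S ξ) * G ξ =
      S' ξ * G ξ - S ξ * ((symbol α κ ξ : ℂ) * G ξ) := fun ξ => by ring
  change ∫ ξ, (S' ξ - (symbol α κ ξ : ℂ) * S ξ) * G ξ = 0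
  simp only [e2]
  rw [integral_sub k1 k2, ← j1, ← j2, ← Complex.ofReal_sub, hw, Complex.ofReal_zero]

theorem IsBand.symbol_mul {b : Space N → ℂ} (hα : 0 ≤ α) (hκ : 0 ≤ κ) (hb : IsBand b) :
    IsBand (fun ξ => (symbol α κ ξ : ℂ) * b ξ) := by
  have := hb.mul (c := fun ξ => (symbol α κ ξ : ℂ))
    (Complex.measurable_ofReal.comp (continuous_symbol hα κ).measurable)
    fun r => ⟨κ * (2 * Real.pi * r) ^ α, fun ξ hξ => by
      rw [Complex.norm_real, Real.norm_of_nonneg (symbol_nonneg hκ _ _)]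
      exact symbol_le hα hκ hξ⟩
  simpa only [mul_comm] using this

/-- The equation satisfied by the pairings with band limited functions. -/
theorem IsHeatNull.ae_eq_neg_setIntegral (hα : α ∈ Ioo (0 : ℝ) 2) (hκ : 0 ≤ κ) (hT : 0 < T)
    (hd2 : MemLp d 2 ((volume.restrict (Ioo 0 T)).prod volume)) (h : IsHeatNull α κ T d)
    {b : Space N → ℂ} (hb : IsBand b) :
    ∀ᵐ t ∂(volume.restrict (Ioo 0 T)), ∫ x, d (t, x) * (𝓕⁻ b x).re =
      -∫ s in Ioo 0 t, ∫ x, d (s, x) *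
        (𝓕⁻ (fun ξ => (symbol α κ ξ : ℂ) * b ξ) x).re := by
  have hb' := hb.symbol_mul hα.1.le hκ
  have m1 := memLp_re_fourierInv hb
  have m2 := memLp_re_fourierInv hb'
  have hone : MemLp (fun _ : ℝ => (1 : ℝ)) 2 (volume.restrict (Ioo 0 T)) := memLp_const 1
  have hint : ∀ {g : Space N → ℝ}, MemLp g 2 →
      IntegrableOn (fun t => ∫ x, d (t, x) * g x) (Ioo 0 T) := by
    intro g hg
    have hi : Integrable (fun z : ℝ × Space N => d z * (1 * g z.2))
      ((volume.restrict (Ioo 0 T)).prod volume) := hd2.integrable_mul (hone.mul_prod_two hg)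
    have := hi.integral_prod_left
    simp only [one_mul] at this
    exact this
  have := ae_eq_add_setIntegral_of_weak hT (hint m1) (hint m2).neg (c := 0) fun χ h1 h2 h3 => ?_
  · filter_upwards [this] with t ht
    rw [ht, zero_add]
    exact integral_neg _
  have h3' : ∀ t, T ≤ t → deriv χ t = 0 := by
    intro t ht
    have hu : HasDerivWithinAt χ 0 (Ici t) t :=
      (hasDerivWithinAt_const t (Ici t) (0 : ℝ)).congr
        (fun s hs => h3 s (ht.trans hs)) (h3 t ht)
    exact (uniqueDiffWithinAt_Ici t).eq_deriv _
      ((h1.differentiable (by simp) t).hasDerivAt.hasDerivWithinAt) hu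
  have hχ2 : MemLp χ 2 (volume.restrict (Ioo 0 T)) :=
    (h1.continuous.memLp_of_hasCompactSupport h2).restrict _
  have hχ2' : MemLp (deriv χ) 2 (volume.restrict (Ioo 0 T)) :=
    ((h1.continuous_deriv (by simp)).memLp_of_hasCompactSupport h2.deriv).restrict _
  have w1 := hd2.integral_mul_left_two hχ2
  have w2 := hd2.integral_mul_left_two hχ2'
  -- Band-limited functions lack compact support, so they are not admissible tests. The equation for
  -- time averages is established on the Fourier side, where multiplying by b is harmless.
  obtain ⟨S, hS, hS2, -, hSu⟩ := exists_fourierInv_two (V := Space N) w1.ofReal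
  obtain ⟨S', hS', hS2', -, hSu'⟩ := exists_fourierInv_two (V := Space N) w2.ofReal
  have heq := h.fourier_eq hα hκ hd2 h1 h2 h3 h3' hS.measurable hS2 hS'.measurable hS2' hSu hSu'
  have e : ∫ x, (∫ t in Ioo 0 T, d (t, x) * deriv χ t) * (𝓕⁻ b x).re =
      ∫ x, (∫ t in Ioo 0 T, d (t, x) * χ t) *
        (𝓕⁻ (fun ξ => (symbol α κ ξ : ℂ) * b ξ) x).re := by
    rw [← re_integral_ofReal_mul w2 (memLp_fourierInv hb.integrable (hb.memLp 2)),
      ← re_integral_ofReal_mul w1 (memLp_fourierInv hb'.integrable (hb'.memLp 2))]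
    congr 1
    refine (hSu' _ hb.integrable (hb.memLp 2)).trans
      (Eq.trans ?_ (hSu _ hb'.integrable (hb'.memLp 2)).symm)
    refine integral_congr_ae ?_
    filter_upwards [heq] with ξ hξ
    rw [hξ]; ring
  rw [← integral_mul_tensor_right hd2 hχ2' m1, ← integral_mul_tensor_right hd2 hχ2 m2,
    integral_mul_tensor_left hd2 hχ2' m1, integral_mul_tensor_left hd2 hχ2 m2] at e
  have k1 : Integrable (fun t => deriv χ t * ∫ x, d (t, x) * (𝓕⁻ b x).re)
      (volume.restrict (Ioo 0 T)) := (hint m1).bdd_mul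
        (h1.continuous_deriv (by simp)).aestronglyMeasurable
        (ae_of_all _ ((h1.continuous_deriv (by simp)).bounded_above_of_compact_support
          h2.deriv).choose_spec)
  have k2 : Integrable (fun t => χ t * ∫ x, d (t, x) *
      (𝓕⁻ (fun ξ => (symbol α κ ξ : ℂ) * b ξ) x).re)
      (volume.restrict (Ioo 0 T)) := (hint m2).bdd_mul
        h1.continuous.aestronglyMeasurable
        (ae_of_all _ (h1.continuous.bounded_above_of_compact_support h2).choose_spec)
  simp only [smul_eq_mul, mul_zero, add_zero, Pi.neg_apply, mul_neg, ← sub_eq_add_neg]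
  rw [integral_sub k1 k2, e, sub_self]

end Uniqueness

end FractionalDiffusion

namespace FractionalDiffusion

/-! ### Uniqueness: Picard iteration on a band -/

section Uniqueness

variable {N : ℕ} {α κ : ℝ} {T : ℝ} {d : ℝ × Space N → ℝ}

theorem abs_integral_mul_le_of_eLpNorm_le {X : Type*} [MeasurableSpace X] {μ : Measure X}
    {f g : X → ℝ} (hf : AEStronglyMeasurable f μ) (hg : AEStronglyMeasurable g μ) {A B : ℝ}
    (hA : 0 ≤ A) (hB : 0 ≤ B) (hfA : eLpNorm f 2 μ ≤ ENNReal.ofReal A)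
    (hgB : eLpNorm g 2 μ ≤ ENNReal.ofReal B) : |∫ x, f x * g x ∂μ| ≤ A * B := by
  rw [eLpNorm_two_le_iff] at hfA hgB
  have h1 := (sq_lintegral_mul_le μ hf.enorm hg.enorm).trans (mul_le_mul' hfA hgB)
  rw [← mul_pow, ENNReal.pow_le_pow_left_iff two_ne_zero, ← ENNReal.ofReal_mul hA] at h1
  simp only [← enorm_mul] at h1
  have h2 := (enorm_integral_le_lintegral_enorm (μ := μ) fun x => f x * g x).trans h1
  rw [Real.enorm_eq_ofReal_abs] at h2
  exact (ENNReal.ofReal_le_ofReal_iff (by positivity)).1 h2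

/-- The generator maps functions of the band |ξ| ≤ r to functions of the same band and multiplies
the bound by at most L. The integral equation for the pairings can therefore be iterated, each step
integrating one more power of t. The base case is Cauchy–Schwarz with Plancherel. -/
theorem IsHeatNull.ae_abs_le (hα : α ∈ Ioo (0 : ℝ) 2) (hκ : 0 ≤ κ) (hT : 0 < T)
    (hd : MemLinftyL2 T volume d) (h : IsHeatNull α κ T d) (r : ℝ) :
    ∃ K L : ℝ, ∀ n : ℕ, ∀ B : ℝ, 0 ≤ B → ∀ b : Space N → ℂ, IsBand b → (∀ ξ, ‖b ξ‖ ≤ B) →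
      (∀ ξ, r < ‖ξ‖ → b ξ = 0) → ∀ᵐ t ∂(volume.restrict (Ioo 0 T)),
        |∫ x, d (t, x) * (𝓕⁻ b x).re| ≤ K * B * ((L * t) ^ n / n.factorial) := by
  obtain ⟨hdm, C, hC⟩ := hd
  have hd2 := memLp_two_of_ae_eLpNorm_le hdm hC
  set i : Space N → ℝ := (Metric.closedBall (0 : Space N) r).indicator (fun _ => 1)
  have hi : MemLp i 2 := memLp_indicator_closedBall 2 r 1
  set A := (eLpNorm i 2 volume).toReal with hA
  refine ⟨max C 0 * A, κ * (2 * Real.pi * max r 0) ^ α, fun n => ?_⟩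
  set L := κ * (2 * Real.pi * max r 0) ^ α with hL
  have hL0 : 0 ≤ L := by positivity
  induction n with
  | zero =>
    intro B hB b hb hbB hbr
    filter_upwards [hC, hdm.prodMk_left] with t ht htm
    have h1 : eLpNorm (fun x => (𝓕⁻ b x).re) 2 volume ≤ ENNReal.ofReal (A * B) := by
      calc eLpNorm (fun x => (𝓕⁻ b x).re) 2 volume ≤ eLpNorm (𝓕⁻ b) 2 volume :=
            eLpNorm_mono fun x => by rw [Real.norm_eq_abs]; exact Complex.abs_re_le_norm _
        _ = eLpNorm b 2 volume := eLpNorm_fourierInv hb.integrable (hb.memLp 2)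
        _ ≤ eLpNorm (fun ξ => B * i ξ) 2 volume := by
            refine eLpNorm_mono fun ξ => le_trans ?_ (le_abs_self _)
            by_cases hξ : ξ ∈ Metric.closedBall (0 : Space N) r
            · simp only [i, indicator_of_mem hξ, mul_one]; exact hbB ξ
            · simp only [i, indicator_of_notMem hξ, mul_zero]
              rw [hbr ξ (by simpa using hξ), norm_zero]
        _ = ENNReal.ofReal (A * B) := by
            have := eLpNorm_const_smul B i 2 (volume : Measure (Space N))
            rw [mul_comm A, ENNReal.ofReal_mul hB, hA, ENNReal.ofReal_toReal hi.2.ne,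
              ← Real.enorm_of_nonneg hB, ← this]
            rfl
    have := abs_integral_mul_le_of_eLpNorm_le htm (memLp_re_fourierInv hb).1 (le_max_right C 0)
      (by positivity) (ht.trans (ENNReal.ofReal_le_ofReal (le_max_left _ _))) h1
    simp only [pow_zero, Nat.factorial_zero, Nat.cast_one, div_one, mul_one]
    linarith
  | succ n ih =>
    intro B hB b hb hbB hbr
    have hb' := hb.symbol_mul hα.1.le hκ
    -- The induction hypothesis is used for the symbol times b, which is why it ranges over all
    -- bounds B and all b of the band.
    have ih' := ih (L * B) (by positivity) _ hb' (fun ξ => by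
      rw [norm_mul, Complex.norm_real, Real.norm_of_nonneg (symbol_nonneg hκ _ _)]
      rcases le_or_gt ‖ξ‖ r with hξ | hξ
      · exact mul_le_mul (symbol_le hα.1.le hκ (hξ.trans (le_max_left _ _))) (hbB ξ)
          (norm_nonneg _) hL0
      · rw [hbr ξ hξ, norm_zero, mul_zero]; positivity) (fun ξ hξ => by
      rw [hbr ξ hξ, mul_zero])
    filter_upwards [h.ae_eq_neg_setIntegral hα hκ hT hd2 hb, ae_restrict_mem measurableSet_Ioo]
      with t ht hmem
    rw [ht, abs_neg]
    have hsub : ∀ᵐ s ∂(volume.restrict (Ioo 0 t)),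
        ‖∫ x, d (s, x) * (𝓕⁻ (fun ξ => (symbol α κ ξ : ℂ) * b ξ) x).re‖ ≤
          max C 0 * A * (L * B) * ((L * s) ^ n / n.factorial) :=
      ae_mono (Measure.restrict_mono (Ioo_subset_Ioo_right hmem.2.le) le_rfl) ih'
    have hint : IntegrableOn
        (fun s => max C 0 * A * (L * B) * ((L * s) ^ n / n.factorial)) (Ioo 0 t) :=
      (Continuous.integrableOn_Icc (by fun_prop)).mono_set Ioo_subset_Icc_self
    refine (norm_integral_le_of_norm_le hint hsub).trans (le_of_eq ?_)
    rw [integral_const_mul, ← integral_Ioc_eq_integral_Ioo,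
      ← intervalIntegral.integral_of_le hmem.1.le]
    simp only [mul_pow, mul_div_assoc]
    rw [intervalIntegral.integral_const_mul, intervalIntegral.integral_div, integral_pow,
      Nat.factorial_succ]
    push_cast
    have : (n.factorial : ℝ) ≠ 0 := by positivity
    have : (n : ℝ) + 1 ≠ 0 := by positivity
    field_simp
    ring

/-- Bounded solutions of the fractional heat equation with zero datum vanish. -/
theorem IsHeatNull.ae_eq_zero (hα : α ∈ Ioo (0 : ℝ) 2) (hκ : 0 ≤ κ) (hT : 0 < T)
    (hd : MemLinftyL2 T volume d) (h : IsHeatNull α κ T d) :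
    d =ᵐ[(volume.restrict (Ioo 0 T)).prod volume] 0 := by
  obtain ⟨C, hC⟩ := hd.2
  have hd2 := memLp_two_of_ae_eLpNorm_le hd.1 hC
  have hA := (isTotalL2_testFunctions (volume : Measure ℝ) (isOpen_Ioo (a := 0) (b := T))).prod
    (isTotalL2_re_fourierInv (V := Space N))
  refine hA.ae_eq_zero d hd2 ?_
  rintro _ ⟨a, ha, _, ⟨b, hb, rfl⟩, rfl⟩
  have ha2 := (isTotalL2_testFunctions (volume : Measure ℝ) (isOpen_Ioo (a := 0) (b := T))).memLp
    a ha
  rw [integral_mul_tensor_left hd2 ha2 (memLp_re_fourierInv hb)]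
  obtain ⟨r, hr⟩ := hb.support
  obtain ⟨B, hB⟩ := hb.bounded
  obtain ⟨K, L, hKL⟩ := h.ae_abs_le hα hκ hT hd r
  have hz := ae_all_iff.2 fun n => hKL n B ((norm_nonneg _).trans (hB 0)) b hb hB hr
  refine integral_eq_zero_of_ae ?_
  filter_upwards [hz] with t ht
  -- The estimates hold for all n outside one null set of times, so the factorial wins at each
  -- remaining t.
  have hlim := (FloorSemiring.tendsto_pow_div_factorial_atTop (L * t)).const_mul (K * B)
  rw [mul_zero] at hlim
  have := ge_of_tendsto' hlim ht
  rw [abs_nonpos_iff.1 this, mul_zero, Pi.zero_apply]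

theorem IsFracHeatSolution.isHeatNull_sub (hα : α ∈ Ioo (0 : ℝ) 2) (hκ : 0 ≤ κ)
    {ρ₀ : Space N → ℝ} {ρ₁ ρ₂ : ℝ × Space N → ℝ} (h1 : IsFracHeatSolution α κ ρ₀ ρ₁)
    (h2 : IsFracHeatSolution α κ ρ₀ ρ₂) (hT : 0 < T) :
    IsHeatNull α κ T fun z => ρ₁ z - ρ₂ z := by
  intro φ hφ hc h0
  have e1 := h1.2 φ hφ hc
  have e2 := h2.2 φ hφ hc
  rw [integral_mul_heat_eq hα hκ hφ hc h0] at e1 e2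
  obtain ⟨D, hD⟩ := exists_norm_heatFamily_le hα hκ hφ hc
  have hs := (memLp_synth_of_le (T := T) (measurable_heatFamily hα.1.le hφ)
    (integrable_decayWeight.const_mul D) (memLp_decayWeight.const_mul D) hD).2
  obtain ⟨m1, C1, hC1⟩ := h1.1 T hT
  obtain ⟨m2, C2, hC2⟩ := h2.1 T hT
  have i1 : Integrable (fun z => ρ₁ z * synth (heatFamily α κ φ) z)
    ((volume.restrict (Ioo 0 T)).prod volume) :=
    (memLp_two_of_ae_eLpNorm_le m1 hC1).integrable_mul hs
  have i2 : Integrable (fun z => ρ₂ z * synth (heatFamily α κ φ) z)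
    ((volume.restrict (Ioo 0 T)).prod volume) :=
    (memLp_two_of_ae_eLpNorm_le m2 hC2).integrable_mul hs
  simp only [sub_mul]
  rw [integral_sub i1 i2]
  linarith

theorem MemLinftyL2.sub {Y : Type*} [MeasurableSpace Y] {ν : Measure Y} [SFinite ν]
    {g₁ g₂ : ℝ × Y → ℝ} (h1 : MemLinftyL2 T ν g₁) (h2 : MemLinftyL2 T ν g₂) :
    MemLinftyL2 T ν fun z => g₁ z - g₂ z := by
  obtain ⟨m1, C1, hC1⟩ := h1
  obtain ⟨m2, C2, hC2⟩ := h2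
  refine ⟨m1.sub m2, max C1 0 + max C2 0, ?_⟩
  filter_upwards [hC1, hC2, m1.prodMk_left, m2.prodMk_left] with t t1 t2 n1 n2
  rw [ENNReal.ofReal_add (le_max_right _ _) (le_max_right _ _)]
  refine (eLpNorm_sub_le n1 n2 one_le_two).trans (add_le_add ?_ ?_)
  · exact t1.trans (ENNReal.ofReal_le_ofReal (le_max_left _ _))
  · exact t2.trans (ENNReal.ofReal_le_ofReal (le_max_left _ _))

theorem ae_restrict_Ioi_prod {Y : Type*} [MeasureSpace Y] [SigmaFinite (volume : Measure Y)]
    {p : ℝ × Y → Prop}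
    (h : ∀ T : ℝ, 0 < T → ∀ᵐ z ∂((volume.restrict (Ioo 0 T)).prod (volume : Measure Y)), p z) :
    ∀ᵐ z ∂(volume.restrict (Ioi (0 : ℝ) ×ˢ (univ : Set Y))), p z := by
  have e : Ioi (0 : ℝ) ×ˢ (univ : Set Y) = ⋃ n : ℕ, Ioo (0 : ℝ) (n + 1) ×ˢ (univ : Set Y) := by
    ext z
    simp only [mem_prod, mem_Ioi, mem_univ, and_true, mem_iUnion, mem_Ioo]
    refine ⟨fun hz => ?_, fun ⟨n, hn⟩ => hn.1⟩
    obtain ⟨n, hn⟩ := exists_nat_gt z.1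
    exact ⟨n, hz, by linarith⟩
  rw [e, ae_restrict_iUnion_iff]
  intro n
  have := h (n + 1) (by positivity)
  rwa [← Measure.restrict_univ (μ := (volume : Measure Y)), Measure.prod_restrict,
    ← Measure.volume_eq_prod] at this

/-- Weak solutions of the fractional heat equation are unique. -/
theorem IsFracHeatSolution.unique (hα : α ∈ Ioo (0 : ℝ) 2) (hκ : 0 ≤ κ)
    {ρ₀ : Space N → ℝ} {ρ₁ ρ₂ : ℝ × Space N → ℝ} (h1 : IsFracHeatSolution α κ ρ₀ ρ₁)
    (h2 : IsFracHeatSolution α κ ρ₀ ρ₂) :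
    ρ₁ =ᵐ[volume.restrict (Ioi (0 : ℝ) ×ˢ (univ : Set (Space N)))] ρ₂ := by
  refine ae_restrict_Ioi_prod fun T hT => ?_
  filter_upwards [(h1.isHeatNull_sub hα hκ h2 hT).ae_eq_zero hα hκ hT
    ((h1.1 T hT).sub (h2.1 T hT))] with z hz
  exact sub_eq_zero.1 hz

end Uniqueness

end FractionalDiffusion

namespace FractionalDiffusion

/-! ### Weak relaxation to local equilibrium -/

section Relaxation

variable {N : ℕ} {F : Space N → ℝ} {θ ε : ℝ} {f₀ : Space N × Space N → ℝ}
  {f : ℝ × Space N × Space N → ℝ} {T : ℝ} {η : ℝ → ℝ} {a c : Space N → ℝ}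

theorem contDiff_tensor_three (hη : ContDiff ℝ ∞ η) (ha : ContDiff ℝ ∞ a) (hc : ContDiff ℝ ∞ c) :
    ContDiff ℝ ∞ fun z : ℝ × Space N × Space N => η z.1 * (a z.2.1 * c z.2.2) := by
  fun_prop

theorem fderiv_tensor_time (hη : ContDiff ℝ ∞ η) (ha : ContDiff ℝ ∞ a) (hc : ContDiff ℝ ∞ c)
    (z : ℝ × Space N × Space N) :
    fderiv ℝ (fun z : ℝ × Space N × Space N => η z.1 * (a z.2.1 * c z.2.2)) z (1, 0, 0) =
      deriv η z.1 * (a z.2.1 * c z.2.2) := by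
  have h1 := ((contDiff_tensor_three hη ha hc).differentiable (by simp) z).hasFDerivAt
  have h2 : HasDerivAt (fun t : ℝ => (t, z.2)) ((1, 0, 0) : ℝ × Space N × Space N) z.1 :=
    (hasDerivAt_id z.1).prodMk (hasDerivAt_const z.1 z.2)
  have h3 : HasDerivAt (fun t => η t * (a z.2.1 * c z.2.2))
      (deriv η z.1 * (a z.2.1 * c z.2.2)) z.1 :=
    ((hη.differentiable (by simp) z.1).hasDerivAt).mul_const _
  have h4 : HasDerivAt (fun t => η t * (a z.2.1 * c z.2.2))
      (fderiv ℝ (fun z : ℝ × Space N × Space N => η z.1 * (a z.2.1 * c z.2.2)) z (1, 0, 0)) z.1 :=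
    HasFDerivAt.comp_hasDerivAt (f := fun t : ℝ => (t, z.2))
      (l := fun z : ℝ × Space N × Space N => η z.1 * (a z.2.1 * c z.2.2)) z.1 h1 h2
  exact h4.unique h3

theorem fderiv_tensor_space (hη : ContDiff ℝ ∞ η) (ha : ContDiff ℝ ∞ a) (hc : ContDiff ℝ ∞ c)
    (z : ℝ × Space N × Space N) (w : Space N) :
    fderiv ℝ (fun z : ℝ × Space N × Space N => η z.1 * (a z.2.1 * c z.2.2)) z (0, w, 0) =
      η z.1 * (fderiv ℝ a z.2.1 w * c z.2.2) := by
  have h1 := ((contDiff_tensor_three hη ha hc).differentiable (by simp) z).hasFDerivAt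
  have hl : HasDerivAt (fun s : ℝ => z.2.1 + s • w) w 0 := by
    simpa using ((hasDerivAt_id (0 : ℝ)).smul_const w).const_add z.2.1
  have h2 : HasDerivAt (fun s : ℝ => (z.1, z.2.1 + s • w, z.2.2))
      ((0, w, 0) : ℝ × Space N × Space N) 0 :=
    (hasDerivAt_const (0 : ℝ) z.1).prodMk (hl.prodMk (hasDerivAt_const (0 : ℝ) z.2.2))
  have ha' : HasFDerivAt a (fderiv ℝ a z.2.1) (z.2.1 + (0 : ℝ) • w) := by
    simpa using (ha.differentiable (by simp) z.2.1).hasFDerivAt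
  have h3 : HasDerivAt (fun s : ℝ => η z.1 * (a (z.2.1 + s • w) * c z.2.2))
      (η z.1 * (fderiv ℝ a z.2.1 w * c z.2.2)) 0 :=
    ((ha'.comp_hasDerivAt (0 : ℝ) hl).mul_const _).const_mul _
  have h1' : HasFDerivAt (fun z : ℝ × Space N × Space N => η z.1 * (a z.2.1 * c z.2.2))
      (fderiv ℝ (fun z : ℝ × Space N × Space N => η z.1 * (a z.2.1 * c z.2.2)) z)
      (z.1, z.2.1 + (0 : ℝ) • w, z.2.2) := by
    simpa using h1
  have h4 : HasDerivAt (fun s : ℝ => η z.1 * (a (z.2.1 + s • w) * c z.2.2))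
      (fderiv ℝ (fun z : ℝ × Space N × Space N => η z.1 * (a z.2.1 * c z.2.2)) z (0, w, 0)) 0 :=
    HasFDerivAt.comp_hasDerivAt (f := fun s : ℝ => (z.1, z.2.1 + s • w, z.2.2))
      (l := fun z : ℝ × Space N × Space N => η z.1 * (a z.2.1 * c z.2.2)) (0 : ℝ) h1' h2
  exact h4.unique h3

/-- Continuous functions dominated by products of compactly supported ones, as test functions. -/
theorem memLp_slab_of_le (hF : IsPosDensity volume F) {Ψ : ℝ × Space N × Space N → ℝ}
    (hΨ : Continuous Ψ) {p : ℝ → ℝ} {q r : Space N → ℝ} (hp : Continuous p)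
    (hpc : HasCompactSupport p) (hq : Continuous q) (hqc : HasCompactSupport q)
    (hr : Continuous r) (hrc : HasCompactSupport r)
    (h : ∀ z, |Ψ z| ≤ |p z.1 * (q z.2.1 * r z.2.2)|) (T : ℝ) :
    MemLp (fun z => Ψ z * F z.2.2) 2 (slab T F) := by
  obtain ⟨C, hC⟩ := hr.bounded_above_of_compact_support hrc
  have h1 : MemLp (fun z : ℝ × Space N × Space N => p z.1 * (q z.2.1 * (r z.2.2 * F z.2.2))) 2
      (slab T F) :=
    ((hp.memLp_of_hasCompactSupport hpc).restrict _).mul_prod_two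
      ((hq.memLp_of_hasCompactSupport hqc).mul_prod_two (hF.memLp_mul hr.measurable hC))
  refine h1.of_le (hΨ.measurable.mul
    (hF.measurable.comp measurable_snd.snd)).aestronglyMeasurable (ae_of_all _ fun z => ?_)
  have e : p z.1 * (q z.2.1 * (r z.2.2 * F z.2.2)) = p z.1 * (q z.2.1 * r z.2.2) * F z.2.2 := by ring
  rw [e, norm_mul, norm_mul]
  exact mul_le_mul_of_nonneg_right (h z) (norm_nonneg _)

theorem abs_integral_flatSlab_le (hF : IsPosDensity volume F) {Ψ : ℝ × Space N × Space N → ℝ}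
    (hΨ : MemLp (fun z => Ψ z * F z.2.2) 2 (slab T F)) (hf : MemLp f 2 (slab T F)) {M : ℝ}
    (hM : 0 ≤ M) (hfM : eLpNorm f 2 (slab T F) ≤ ENNReal.ofReal M) :
    |∫ z, f z * Ψ z ∂(flatSlab N T)| ≤
      M * (eLpNorm (fun z => Ψ z * F z.2.2) 2 (slab T F)).toReal := by
  have e := integral_slab_mul hF T f Ψ
  change _ = ∫ z, f z * Ψ z ∂(flatSlab N T) at e
  rw [← e]
  refine abs_integral_mul_le_of_eLpNorm_le hf.1 hΨ.1 hM ENNReal.toReal_nonneg hfM ?_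
  rw [ENNReal.ofReal_toReal hΨ.2.ne]

/-- Relaxation: up to small terms the solution is a local equilibrium. -/
theorem IsKineticSolution.integral_mul_sub (hF : IsPosDensity volume F)
    (hf : IsKineticSolution F θ ε f₀ f) (hT : 0 < T) (hη : η ∈ testFunctions (Ioo 0 T))
    (ha : a ∈ testFunctions univ) (hc : c ∈ testFunctions univ) :
    ∫ z, f z * (η z.1 * (a z.2.1 * c z.2.2)) ∂(flatSlab N T) -
      ∫ z, source F f z * (η z.1 * (a z.2.1 * c z.2.2)) ∂(flatSlab N T) =
    θ * ∫ z, f z * (deriv η z.1 * (a z.2.1 * c z.2.2)) ∂(flatSlab N T) +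
      ε * ∫ z, f z * (η z.1 * (fderiv ℝ a z.2.1 z.2.2 * c z.2.2)) ∂(flatSlab N T) := by
  have hη0 : ∀ t, T ≤ t → η t = 0 := fun t ht =>
    eq_zero_of_mem_testFunctions hη fun h => absurd h.2 (not_lt.2 ht)
  have hη0' : ∀ t, T ≤ t → deriv η t = 0 := fun t ht =>
    deriv_eq_zero_of_eq_zero_on_Ici hη.1 hη0 ht
  have h := hf.2 _ (contDiff_tensor_three hη.1 ha.1 hc.1)
    (hasCompactSupport_tensor hη.2.1 (hasCompactSupport_tensor ha.2.1 hc.2.1))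
  -- The time factor lives in the open interval, so the initial datum drops out.
  have h00 : η 0 = 0 := eq_zero_of_mem_testFunctions hη fun h => lt_irrefl _ h.1
  simp only [h00, zero_mul, mul_zero, integral_zero, add_zero, fderiv_tensor_time hη.1 ha.1 hc.1,
    fderiv_tensor_space hη.1 ha.1 hc.1] at h
  rw [setIntegral_Ioi_prod_eq (T := T)] at h
  swap
  · intro z hz
    rw [hη0 _ hz, hη0' _ hz]; ring
  change ∫ z, _ ∂(flatSlab N T) = 0 at h
  have hfL := hf.memLp hF hT
  have hint : ∀ {g Ψ : ℝ × Space N × Space N → ℝ}, MemLp g 2 (slab T F) →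
      MemLp (fun z => Ψ z * F z.2.2) 2 (slab T F) →
      Integrable (fun z => g z * Ψ z) (flatSlab N T) := fun hg hΨ =>
    (integrable_slab_mul_iff hF).1 (hg.integrable_mul hΨ)
  have hac := ha.1.continuous
  have hcc := hc.1.continuous
  have hηc := hη.1.continuous
  have hdc := hη.1.continuous_deriv (by simp)
  have hfa := ha.1.continuous_fderiv (by simp)
  have m1 := memLp_slab_of_le (Ψ := fun z => η z.1 * (a z.2.1 * c z.2.2)) hF (by fun_prop)
    hηc hη.2.1 hac ha.2.1 hcc hc.2.1 (fun z => le_rfl) T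
  have m2 := memLp_slab_of_le (Ψ := fun z => deriv η z.1 * (a z.2.1 * c z.2.2)) hF (by fun_prop)
    hdc hη.2.1.deriv hac ha.2.1 hcc hc.2.1 (fun z => le_rfl) T
  -- The transport term brings a factor |v|, which the compact support of c absorbs; no velocity
  -- moment of F is needed.
  have m3 := memLp_slab_of_le (Ψ := fun z => η z.1 * (fderiv ℝ a z.2.1 z.2.2 * c z.2.2)) hF
    (by fun_prop) hηc hη.2.1 (q := fun x => ‖fderiv ℝ a x‖) hfa.norm (ha.2.1.fderiv ℝ).norm
    (r := fun v => ‖v‖ * c v) (by fun_prop) hc.2.1.mul_left (fun z => by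
      rw [abs_mul, abs_mul, abs_mul, abs_mul, abs_mul, abs_norm, abs_norm, ← mul_assoc ‖_‖]
      gcongr
      exact (fderiv ℝ a z.2.1).le_opNorm _) T
  have i1 := hint hfL m1
  have i2 := hint hfL m2
  have i3 := hint hfL m3
  have i4 := hint (memLp_source hF hfL) m1
  have key : ∀ {A B C D : ℝ × Space N × Space N → ℝ}, Integrable A (flatSlab N T) →
      Integrable B (flatSlab N T) → Integrable C (flatSlab N T) → Integrable D (flatSlab N T) →
      ∫ z, ((θ * A z + ε * B z) - (C z - D z)) ∂(flatSlab N T) =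
        (θ * ∫ z, A z ∂(flatSlab N T) + ε * ∫ z, B z ∂(flatSlab N T)) -
          (∫ z, C z ∂(flatSlab N T) - ∫ z, D z ∂(flatSlab N T)) := by
    intro A B C D hA hB hC hD
    have s1 : Integrable (fun z => θ * A z + ε * B z) (flatSlab N T) :=
      (hA.const_mul θ).add (hB.const_mul ε)
    have s2 : Integrable (fun z => C z - D z) (flatSlab N T) := hC.sub hD
    rw [integral_sub s1 s2,
      integral_add (hA.const_mul θ) (hB.const_mul ε), integral_sub hC hD, integral_const_mul,
      integral_const_mul]
  have e := key i2 i3 i1 i4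
  rw [eq_comm, ← sub_eq_zero, ← e, ← h]
  congr 1; ext z
  simp only [source, relaxation]
  ring

theorem integral_flatSlab_tensor {h : ℝ × Space N → ℝ} {k : Space N → ℝ} :
    ∫ z, h (z.1, z.2.1) * k z.2.2 ∂(flatSlab N T) =
      (∫ p, h p ∂((volume.restrict (Ioo 0 T)).prod volume)) * ∫ v, k v := by
  have hmp := measurePreserving_prodAssoc (volume.restrict (Ioo (0 : ℝ) T))
    (volume : Measure (Space N)) (volume : Measure (Space N))
  rw [← hmp.integral_comp']
  exact integral_prod_mul (μ := (volume.restrict (Ioo 0 T)).prod volume) h k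

theorem integral_flatSlab_local (h : ℝ × Space N → ℝ) (η : ℝ → ℝ) (a c : Space N → ℝ) :
    ∫ z, (h (z.1, z.2.1) * F z.2.2) * (η z.1 * (a z.2.1 * c z.2.2)) ∂(flatSlab N T) =
      (∫ p, h p * (η p.1 * a p.2) ∂((volume.restrict (Ioo 0 T)).prod volume)) *
        ∫ v, F v * c v := by
  rw [← integral_flatSlab_tensor]
  congr 1; ext z; ring

end Relaxation

/-! ### Convergence on products of test functions -/

section Limit

variable {N : ℕ} {α κ : ℝ} {F : Space N → ℝ} {f₀ : Space N × Space N → ℝ}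
  {f : ℝ → ℝ × Space N × Space N → ℝ} {T : ℝ}

theorem IsKineticSolution.ae_eLpNorm_le {f : ℝ × Space N × Space N → ℝ} {θ ε : ℝ}
    (hF : IsPosDensity volume F) (hθ : 0 < θ)
    (hf : IsKineticSolution F θ ε f₀ f) (hf₀ : MemLp f₀ 2 (invWeight F)) (hfm : Measurable f)
    (hf₀m : Measurable f₀) (hT : 0 < T) :
    ∀ᵐ t ∂(volume.restrict (Ioo 0 T)),
      eLpNorm (fun y => f (t, y)) 2 ((volume : Measure (Space N)).prod (velWeight volume F)) ≤
        ENNReal.ofReal (eLpNorm f₀ 2 (invWeight F)).toReal := by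
  filter_upwards [hf.lintegral_sq_le_initial hF hθ hf₀ hfm hf₀m hT] with t ht
  rw [ENNReal.ofReal_toReal hf₀.2.ne, eLpNorm_two_le_iff, eLpNorm_two_sq,
    invWeight_eq_prod hF.measurable]
  exact ht

theorem exists_eLpNorm_slab_le (hF : IsPosDensity volume F)
    (hf₀ : MemLp f₀ 2 (invWeight F)) (hf₀m : Measurable f₀)
    (hfm : ∀ ε, 0 < ε → Measurable (f ε))
    (hf : ∀ ε : ℝ, 0 < ε → IsKineticSolution F (ε ^ α) ε f₀ (f ε)) (hT : 0 < T) :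
    ∃ M : ℝ, 0 ≤ M ∧ ∀ ε, 0 < ε → eLpNorm (f ε) 2 (slab T F) ≤ ENNReal.ofReal M := by
  set A := ENNReal.ofReal (eLpNorm f₀ 2 (invWeight F)).toReal ^ 2 * ENNReal.ofReal T with hA
  have hAt : A ≠ ⊤ := by rw [hA]; finiteness
  refine ⟨Real.sqrt A.toReal, Real.sqrt_nonneg _, fun ε hε => ?_⟩
  rw [eLpNorm_two_le_iff, ← ENNReal.ofReal_pow (Real.sqrt_nonneg _),
    Real.sq_sqrt ENNReal.toReal_nonneg, ENNReal.ofReal_toReal hAt]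
  exact lintegral_sq_le_of_ae_eLpNorm_le (hfm ε hε).aestronglyMeasurable
    ((hf ε hε).ae_eLpNorm_le hF (Real.rpow_pos_of_pos hε α) hf₀ (hfm ε hε) hf₀m hT)

/-- The macroscopic densities converge weakly as soon as they converge on band limited
test functions. -/
theorem tendsto_density (hF : IsPosDensity volume F) (hf₀ : MemLp f₀ 2 (invWeight F))
    (hf₀m : Measurable f₀) (hfm : ∀ ε, 0 < ε → Measurable (f ε))
    (hf : ∀ ε : ℝ, 0 < ε → IsKineticSolution F (ε ^ α) ε f₀ (f ε)) (hT : 0 < T)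
    {ρ : ℝ × Space N → ℝ} (hρ : MemLp ρ 2 ((volume.restrict (Ioo 0 T)).prod volume))
    (hlim : ∀ η ∈ testFunctions (Ioo 0 T), ∀ b : Space N → ℂ, IsBand b →
      Tendsto (fun ε : ℝ => ∫ p, (∫ w, f ε (p.1, p.2, w)) * (η p.1 * (𝓕⁻ b p.2).re)
        ∂((volume.restrict (Ioo 0 T)).prod volume)) (𝓝[>] 0)
      (𝓝 (∫ p, ρ p * (η p.1 * (𝓕⁻ b p.2).re) ∂((volume.restrict (Ioo 0 T)).prod volume))))
    {φ : ℝ × Space N → ℝ} (hφ : MemLp φ 2 ((volume.restrict (Ioo 0 T)).prod volume)) :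
    Tendsto (fun ε : ℝ => ∫ p, (∫ w, f ε (p.1, p.2, w)) * φ p
        ∂((volume.restrict (Ioo 0 T)).prod volume)) (𝓝[>] 0)
      (𝓝 (∫ p, ρ p * φ p ∂((volume.restrict (Ioo 0 T)).prod volume))) := by
  have hA := (isTotalL2_testFunctions (volume : Measure ℝ) (isOpen_Ioo (a := 0) (b := T))).prod
    (isTotalL2_re_fourierInv (V := Space N))
  set A := (∫⁻ y, ‖f₀ y‖ₑ ^ 2 ∂((volume : Measure (Space N)).prod (velWeight volume F))) *
        ENNReal.ofReal T with hAd
  have hAt : A ≠ ⊤ := by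
    have := (memLp_two_iff.1 hf₀).2
    rw [invWeight_eq_prod hF.measurable] at this
    rw [hAd]; exact ENNReal.mul_ne_top this.ne ENNReal.ofReal_ne_top
  refine tendsto_integral_mul_of_isTotalL2 hA (M := Real.sqrt A.toReal) ?_ hρ ?_ hφ
  · filter_upwards [self_mem_nhdsWithin] with ε hε
    refine ⟨memLp_density hF ((hf ε hε).memLp hF hT), ?_⟩
    rw [eLpNorm_two_le_iff, ← ENNReal.ofReal_pow (Real.sqrt_nonneg _),
      Real.sq_sqrt ENNReal.toReal_nonneg, ENNReal.ofReal_toReal hAt]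
    exact (hf ε hε).lintegral_sq_density_slab_le hF (Real.rpow_pos_of_pos hε α) hf₀ (hfm ε hε)
      hf₀m hT
  · rintro _ ⟨η, hη, _, ⟨b, hb, rfl⟩, rfl⟩
    exact hlim η hη b hb

/-- Convergence of the solutions on products of test functions. -/
theorem tendsto_integral_flatSlab (hα : 0 < α) (hF : IsPosDensity volume F)
    (hf₀ : MemLp f₀ 2 (invWeight F))
    (hf₀m : Measurable f₀) (hfm : ∀ ε, 0 < ε → Measurable (f ε))
    (hf : ∀ ε : ℝ, 0 < ε → IsKineticSolution F (ε ^ α) ε f₀ (f ε)) (hT : 0 < T)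
    {ρ : ℝ × Space N → ℝ}
    (hlim : ∀ φ : ℝ × Space N → ℝ, MemLp φ 2 ((volume.restrict (Ioo 0 T)).prod volume) →
      Tendsto (fun ε : ℝ => ∫ p, (∫ w, f ε (p.1, p.2, w)) * φ p
        ∂((volume.restrict (Ioo 0 T)).prod volume)) (𝓝[>] 0)
      (𝓝 (∫ p, ρ p * φ p ∂((volume.restrict (Ioo 0 T)).prod volume))))
    {η : ℝ → ℝ} {a c : Space N → ℝ} (hη : η ∈ testFunctions (Ioo 0 T))
    (ha : a ∈ testFunctions univ) (hc : c ∈ testFunctions univ) :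
    Tendsto (fun ε : ℝ => ∫ z, f ε z * (η z.1 * (a z.2.1 * c z.2.2)) ∂(flatSlab N T)) (𝓝[>] 0)
      (𝓝 (∫ z, (ρ (z.1, z.2.1) * F z.2.2) * (η z.1 * (a z.2.1 * c z.2.2)) ∂(flatSlab N T))) := by
  obtain ⟨M, hM, hfM⟩ := exists_eLpNorm_slab_le hF hf₀ hf₀m hfm hf hT
  have hac := ha.1.continuous
  have hcc := hc.1.continuous
  have hηc := hη.1.continuous
  have hdc := hη.1.continuous_deriv (by simp)
  have hfa := ha.1.continuous_fderiv (by simp)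
  have m2 := memLp_slab_of_le (Ψ := fun z => deriv η z.1 * (a z.2.1 * c z.2.2)) hF (by fun_prop)
    hdc hη.2.1.deriv hac ha.2.1 hcc hc.2.1 (fun z => le_rfl) T
  have m3 := memLp_slab_of_le (Ψ := fun z => η z.1 * (fderiv ℝ a z.2.1 z.2.2 * c z.2.2)) hF
    (by fun_prop) hηc hη.2.1 (q := fun x => ‖fderiv ℝ a x‖) hfa.norm (ha.2.1.fderiv ℝ).norm
    (r := fun v => ‖v‖ * c v) (by fun_prop) hc.2.1.mul_left (fun z => by
      rw [abs_mul, abs_mul, abs_mul, abs_mul, abs_mul, abs_norm, abs_norm, ← mul_assoc ‖_‖]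
      gcongr
      exact (fderiv ℝ a z.2.1).le_opNorm _) T
  -- The pairings are bounded uniformly in ε, so the prefactors ε^α and ε of the relaxation identity
  -- send them to zero.
  have hsmall : ∀ {Ψ : ℝ × Space N × Space N → ℝ} {s : ℝ → ℝ},
      MemLp (fun z => Ψ z * F z.2.2) 2 (slab T F) → Tendsto s (𝓝[>] 0) (𝓝 0) →
      Tendsto (fun ε => s ε * ∫ z, f ε z * Ψ z ∂(flatSlab N T)) (𝓝[>] 0) (𝓝 0) := by
    intro Ψ s hΨ hs
    refine hs.zero_mul_isBoundedUnder_le ⟨M * (eLpNorm (fun z => Ψ z * F z.2.2) 2 (slab T F)).toReal, ?_⟩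
    rw [eventually_map]
    filter_upwards [self_mem_nhdsWithin] with ε hε
    exact abs_integral_flatSlab_le hF hΨ ((hf ε hε).memLp hF hT) hM (hfM ε hε)
  have t2 := hsmall m2 (tendsto_rpow_nhdsGT_zero hα)
  have t3 := hsmall m3 (tendsto_nhdsWithin_of_tendsto_nhds tendsto_id)
  have hηa : MemLp (fun p : ℝ × Space N => η p.1 * a p.2) 2
      ((volume.restrict (Ioo 0 T)).prod volume) :=
    ((hηc.memLp_of_hasCompactSupport hη.2.1).restrict _).mul_prod_two
      (hac.memLp_of_hasCompactSupport ha.2.1)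
  have t1 := (hlim _ hηa).mul_const (∫ v, F v * c v)
  have := (t2.add t3).add t1
  rw [add_zero, zero_add, ← integral_flatSlab_local] at this
  refine this.congr' ?_
  filter_upwards [self_mem_nhdsWithin] with ε hε
  rw [← integral_flatSlab_local (F := F) (fun p => ∫ w, f ε (p.1, p.2, w)) η a c]
  have h := (hf ε hε).integral_mul_sub hF hT hη ha hc
  simp only [source, id] at h ⊢
  linarith

end Limit

end FractionalDiffusion

namespace FractionalDiffusion

/-! ### Weak-* limits for regular representatives -/

section WeakStar

variable {N : ℕ} {α κ : ℝ} {F : Space N → ℝ} {f₀ : Space N × Space N → ℝ}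
  {f : ℝ → ℝ × Space N × Space N → ℝ} {T : ℝ} {ρ : ℝ × Space N → ℝ}

theorem MemLinftyL2.mul_velocity {σ : Measure (Space N)} [SFinite σ]
    (hρ : MemLinftyL2 T volume ρ) (hF : MemLp F 2 σ) :
    MemLinftyL2 T ((volume : Measure (Space N)).prod σ) fun z => ρ (z.1, z.2.1) * F z.2.2 := by
  obtain ⟨hm, C, hC⟩ := hρ
  refine ⟨?_, max C 0 * (eLpNorm F 2 σ).toReal, ?_⟩
  · exact (hm.comp_fst.mul hF.1.comp_snd).comp_measurePreserving
      (measurePreserving_assoc_flatSlab T σ)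
  filter_upwards [hC, hm.prodMk_left] with t ht htm
  rw [ENNReal.ofReal_mul (le_max_right _ _), ENNReal.ofReal_toReal hF.2.ne, eLpNorm_two_le_iff]
  simp only [enorm_mul, mul_pow]
  rw [lintegral_prod_mul (htm.enorm.pow_const 2) (hF.1.enorm.pow_const 2), ← eLpNorm_two_sq,
    ← eLpNorm_two_sq]
  gcongr
  exact ht.trans (ENNReal.ofReal_le_ofReal (le_max_left _ _))

theorem isTotalL2_testFunctions_univ :
    IsTotalL2 (volume : Measure (Space N)) (testFunctions univ) := by
  have h := isTotalL2_testFunctions (volume : Measure (Space N)) isOpen_univ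
  rwa [Measure.restrict_univ] at h

theorem tendstoWeakStar_weighted (hF : IsPosDensity volume F)
    (hf₀ : MemLp f₀ 2 (invWeight F)) (hf₀m : Measurable f₀)
    (hfm : ∀ ε, 0 < ε → Measurable (f ε))
    (hf : ∀ ε : ℝ, 0 < ε → IsKineticSolution F (ε ^ α) ε f₀ (f ε)) (hT : 0 < T)
    (hρ : MemLinftyL2 T volume ρ)
    (hlim : ∀ η ∈ testFunctions (Ioo 0 T), ∀ a ∈ testFunctions univ, ∀ c ∈ testFunctions univ,
      Tendsto (fun ε : ℝ => ∫ z, f ε z * (η z.1 * (a z.2.1 * c z.2.2)) ∂(flatSlab N T)) (𝓝[>] 0)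
      (𝓝 (∫ z, (ρ (z.1, z.2.1) * F z.2.2) * (η z.1 * (a z.2.1 * c z.2.2)) ∂(flatSlab N T)))) :
    TendstoWeakStar T (invWeight F) f (fun z => ρ (z.1, z.2.1) * F z.2.2) := by
  rw [invWeight_eq_prod hF.measurable] at *
  have hA := (isTotalL2_testFunctions (volume : Measure ℝ) (isOpen_Ioo (a := 0) (b := T))).prod
    (isTotalL2_phaseTests hF)
  have hb : ∀ ε, 0 < ε → ∀ᵐ t ∂(volume.restrict (Ioo 0 T)),
      eLpNorm (fun y => f ε (t, y)) 2 ((volume : Measure (Space N)).prod (velWeight volume F)) ≤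
        ENNReal.ofReal (eLpNorm f₀ 2 (invWeight F)).toReal := fun ε hε =>
    (hf ε hε).ae_eLpNorm_le hF (Real.rpow_pos_of_pos hε α)
      (by rwa [invWeight_eq_prod hF.measurable]) (hfm ε hε) hf₀m hT
  refine TendstoWeakStar.of_isTotalL2 hA (fun ε hε => (hfm ε hε).aestronglyMeasurable) hb
    (hρ.mul_velocity hF.memLp_self) ?_
  rintro _ ⟨η, hη, _, ⟨a, ha, _, ⟨c, hc, rfl⟩, rfl⟩, rfl⟩
  have e : ∀ h : ℝ × Space N × Space N → ℝ,
      ∫ z, h z * (η z.1 * (a z.2.1 * (c z.2.2 * F z.2.2)))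
        ∂((volume.restrict (Ioo 0 T)).prod
          ((volume : Measure (Space N)).prod (velWeight volume F))) =
      ∫ z, h z * (η z.1 * (a z.2.1 * c z.2.2)) ∂(flatSlab N T) := fun h => by
    refine Eq.trans ?_ (integral_slab_mul hF T h fun z => η z.1 * (a z.2.1 * c z.2.2))
    congr 1; ext z; ring
  simp only [e]
  exact hlim η hη a ha c hc

/-- Only the uniform bound differs from the weighted case. The density is already controlled by the
norm in L²(F⁻¹), so the Duhamel estimate with the flat velocity measure bounds the flat norm by
those of f₀ and F, without a contraction argument. -/
theorem tendstoWeakStar_flat (hF : IsPosDensity volume F)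
    (hf₀ : MemLp f₀ 2 (invWeight F)) (hf₀m : Measurable f₀)
    (hfm : ∀ ε, 0 < ε → Measurable (f ε))
    (hf : ∀ ε : ℝ, 0 < ε → IsKineticSolution F (ε ^ α) ε f₀ (f ε)) (hT : 0 < T)
    (hρ : MemLinftyL2 T volume ρ) (hF2 : MemLp F 2) (hf₀2 : MemLp f₀ 2)
    (hlim : ∀ η ∈ testFunctions (Ioo 0 T), ∀ a ∈ testFunctions univ, ∀ c ∈ testFunctions univ,
      Tendsto (fun ε : ℝ => ∫ z, f ε z * (η z.1 * (a z.2.1 * c z.2.2)) ∂(flatSlab N T)) (𝓝[>] 0)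
      (𝓝 (∫ z, (ρ (z.1, z.2.1) * F z.2.2) * (η z.1 * (a z.2.1 * c z.2.2)) ∂(flatSlab N T)))) :
    TendstoWeakStar T volume f (fun z => ρ (z.1, z.2.1) * F z.2.2) := by
  have hA := (isTotalL2_testFunctions (volume : Measure ℝ) (isOpen_Ioo (a := 0) (b := T))).prod
    ((isTotalL2_testFunctions_univ (N := N)).prod (isTotalL2_testFunctions_univ (N := N)))
  set M := ∫⁻ y, ‖f₀ y‖ₑ ^ 2 ∂((volume : Measure (Space N)).prod (velWeight volume F)) with hM
  have hMt : M < ⊤ := by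
    have := (memLp_two_iff.1 hf₀).2
    rwa [invWeight_eq_prod hF.measurable] at this
  set D := (∫⁻ y, ‖f₀ y‖ₑ ^ 2 ∂((volume : Measure (Space N)).prod volume)) +
    M * ∫⁻ v, ‖F v‖ₑ ^ 2 with hD
  have hDt : D ≠ ⊤ :=
    (ENNReal.add_lt_top.2 ⟨(memLp_two_iff.1 hf₀2).2,
      ENNReal.mul_lt_top hMt (memLp_two_iff.1 hF2).2⟩).ne
  refine TendstoWeakStar.of_isTotalL2 hA (C := Real.sqrt D.toReal)
    (fun ε hε => (hfm ε hε).aestronglyMeasurable) (fun ε hε => ?_) (hρ.mul_velocity hF2) ?_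
  · have hθ := Real.rpow_pos_of_pos hε α
    have h1 : ∀ᵐ s ∂(volume.restrict (Ioo 0 T)), ∫⁻ x, ‖∫ w, f ε (s, x, w)‖ₑ ^ 2 ≤ M := by
      filter_upwards [(hf ε hε).lintegral_sq_le_initial hF hθ hf₀ (hfm ε hε) hf₀m hT] with s hs
      exact (lintegral_sq_density_le hF (hfm ε hε) s).trans hs
    filter_upwards [(hf ε hε).lintegral_sq_le hF hθ hf₀ (hfm ε hε) hf₀m hT volume
      Measure.AbsolutelyContinuous.rfl h1, ae_restrict_mem measurableSet_Ioo] with t ht ht0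
    rw [eLpNorm_two_le_iff, ← ENNReal.ofReal_pow (Real.sqrt_nonneg _),
      Real.sq_sqrt ENNReal.toReal_nonneg, ENNReal.ofReal_toReal hDt]
    refine ht.trans (add_le_add (mul_le_of_le_one_left' ?_) (mul_le_of_le_one_left' ?_))
    · rw [ENNReal.ofReal_le_one, Real.exp_le_one_iff, neg_div]
      exact neg_nonpos.2 (div_nonneg ht0.1.le hθ.le)
    · rw [ENNReal.ofReal_le_one]
      linarith [Real.exp_pos (-t / ε ^ α)]
  · rintro _ ⟨η, hη, _, ⟨a, ha, c, hc, rfl⟩, rfl⟩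
    exact hlim η hη a ha c hc

/-- The fractional diffusion limit for everywhere positive equilibria and measurable data. -/
theorem exists_fracHeat_limit (hF : IsPosDensity volume F) (hD : HasDissipationLimit α κ F)
    (hα : α ∈ Ioo (0 : ℝ) 2) (hκ : 0 < κ) (hf₀ : MemLp f₀ 2 (invWeight F)) (hf₀m : Measurable f₀)
    (hfm : ∀ ε, 0 < ε → Measurable (f ε))
    (hf : ∀ ε : ℝ, 0 < ε → IsKineticSolution F (ε ^ α) ε f₀ (f ε)) :
    ∃ ρ : ℝ × Space N → ℝ, IsFracHeatSolution α κ (fun x => ∫ v, f₀ (x, v)) ρ ∧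
      (∀ T : ℝ, 0 < T →
        TendstoWeakStar T (invWeight F) f (fun z => ρ (z.1, z.2.1) * F z.2.2)) ∧
      (MemLp F 2 volume → MemLp f₀ 2 volume → ∀ T : ℝ, 0 < T →
        TendstoWeakStar T volume f (fun z => ρ (z.1, z.2.1) * F z.2.2)) := by
  have hρ₀ : MemLp (fun x => ∫ v, f₀ (x, v)) 2 := by
    rw [invWeight_eq_prod hF.measurable] at hf₀
    exact hF.memLp_integral hf₀
  obtain ⟨R, hRm, hR2, -, hR⟩ := exists_fourierInv_two (V := Space N) hρ₀.ofReal
  have hρ := memLinftyL2_heatFlow hα.1 hκ hRm.measurable hR2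
  have hlim : ∀ T : ℝ, 0 < T → ∀ η ∈ testFunctions (Ioo 0 T), ∀ a ∈ testFunctions univ,
      ∀ c ∈ testFunctions univ,
      Tendsto (fun ε : ℝ => ∫ z, f ε z * (η z.1 * (a z.2.1 * c z.2.2)) ∂(flatSlab N T)) (𝓝[>] 0)
      (𝓝 (∫ z, (heatFlow α κ R (z.1, z.2.1) * F z.2.2) * (η z.1 * (a z.2.1 * c z.2.2))
        ∂(flatSlab N T))) := by
    intro T hT η hη a ha c hc
    obtain ⟨hρm, C, hC⟩ := hρ T
    refine tendsto_integral_flatSlab hα.1 hF hf₀ hf₀m hfm hf hT (fun φ hφ => ?_) hη ha hc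
    refine tendsto_density hF hf₀ hf₀m hfm hf hT (memLp_two_of_ae_eLpNorm_le hρm hC) ?_ hφ
    intro η hη b hb
    -- The heat flow and the kinetic limit have the same pairing: ρ₀ against the backward solution
    -- at time 0.
    rw [integral_heatFlow_mul hα.1 hκ hRm.measurable hR2 hR hη hb]
    exact tendsto_density_mul hF hD hα.1 hκ.le hf₀ hf₀m hfm hf hT hη hb
  refine ⟨heatFlow α κ R, isFracHeatSolution_heatFlow hα hκ hRm.measurable hR2 hR,
    fun T hT => ?_, fun hF2 hf₀2 T hT => ?_⟩
  · exact tendstoWeakStar_weighted hF hf₀ hf₀m hfm hf hT (hρ T) (hlim T hT)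
  · exact tendstoWeakStar_flat hF hf₀ hf₀m hfm hf hT (hρ T) hF2 hf₀2 (hlim T hT)

/-- The rescaled integrals do not see null sets, so a representative of F inherits the limit. Its
evenness survives only almost everywhere, which is all that is used. -/
theorem hasDissipationLimit [NeZero N] {κ₀ : ℝ} (hα : α ∈ Ioo (0 : ℝ) 2) (hκ₀ : 0 < κ₀)
    (hF : IsEquilibrium F)
    (hFtail : Asymptotics.IsEquivalent (cocompact (Space N)) F
      (fun v => κ₀ / ‖v‖ ^ ((N : ℝ) + α))) {F' : Space N → ℝ} (hF' : F =ᵐ[volume] F') :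
    HasDissipationLimit α (kappa N α κ₀) F' := by
  obtain ⟨h1, C, h2⟩ := tendsto_rescaled_integral hα hκ₀ hF.integrable hFtail
  have hm : ∀ k : Space N, Measurable (dissipation k) := fun k => by
    unfold dissipation; fun_prop
  have hb : ∀ k w : Space N, |dissipation k w| ≤ (1 + ‖k‖ ^ 2) * min 1 (‖w‖ ^ 2) := fun k w => by
    rw [abs_of_nonneg (dissipation_nonneg k w)]; exact dissipation_le k w
  have e : ∀ (k : Space N) (ε : ℝ), ∫ v, F' v * dissipation k (ε • v) =
      ∫ v, F v * dissipation k (ε • v) := fun k ε => by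
    refine integral_congr_ae ?_
    filter_upwards [hF'] with v hv
    rw [hv]
  refine ⟨?_, fun k => ?_, max C 0, le_max_right _ _, fun k ε hε => ?_⟩
  · filter_upwards [hF', (Measure.measurePreserving_neg volume).quasiMeasurePreserving.ae hF']
      with v hv hv'
    rw [← hv', hF.even, hv]
  · simp only [e]
    rw [← integral_dissipation_div hα]
    exact h1 _ _ (hm k) (hb k)
  · rw [e]
    refine (h2 _ _ (hm k) (hb k) ε hε).trans ?_
    gcongr
    exact le_max_left _ _

/-- A measurable representative is changed to 1 on the null set where it fails to be positive; any
positive value would do. -/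
theorem IsEquilibrium.exists_isPosDensity (hF : IsEquilibrium F) :
    ∃ F' : Space N → ℝ, IsPosDensity volume F' ∧ F =ᵐ[volume] F' := by
  have hm := hF.integrable.1.aemeasurable
  set g := hm.mk F
  have hg : Measurable g := hm.measurable_mk
  have he : F =ᵐ[volume] fun v => if 0 < g v then g v else 1 := by
    filter_upwards [hm.ae_eq_mk, hF.pos] with v hv hp
    rw [hv] at hp
    rw [if_pos hp, hv]
  refine ⟨_, ⟨Measurable.ite (measurableSet_lt measurable_const hg) hg measurable_const,
    fun v => ?_, hF.integrable.congr he, ?_⟩, he⟩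
  · split_ifs with h
    exacts [h, one_pos]
  · rw [← integral_congr_ae he, hF.integral_eq_one]

end WeakStar

end FractionalDiffusion

namespace FractionalDiffusion

/-! ### Independence of the choice of representatives -/

section Congruence

variable {N : ℕ} {α κ : ℝ} {F F' : Space N → ℝ} {θ ε : ℝ} {f₀ f₀' : Space N × Space N → ℝ}
  {f f' : ℝ × Space N × Space N → ℝ} {T : ℝ}

theorem MemLinftyL2.congr {Y : Type*} [MeasurableSpace Y] {ν : Measure Y} [SFinite ν]
    {g g' : ℝ × Y → ℝ} (h : MemLinftyL2 T ν g)
    (he : g =ᵐ[(volume.restrict (Ioo 0 T)).prod ν] g') : MemLinftyL2 T ν g' := by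
  obtain ⟨hm, C, hC⟩ := h
  refine ⟨hm.congr he, C, ?_⟩
  filter_upwards [hC, Measure.ae_ae_of_ae_prod he] with t ht hte
  rwa [← eLpNorm_congr_ae hte]

theorem TendstoWeakStar.congr {Y : Type*} [MeasurableSpace Y] {ν : Measure Y} [SFinite ν]
    {g g' : ℝ → ℝ × Y → ℝ} {g₀ g₀' : ℝ × Y → ℝ} (h : TendstoWeakStar T ν g g₀)
    (he : ∀ ε, 0 < ε → g ε =ᵐ[(volume.restrict (Ioo 0 T)).prod ν] g' ε)
    (he₀ : g₀ =ᵐ[(volume.restrict (Ioo 0 T)).prod ν] g₀') : TendstoWeakStar T ν g' g₀' := by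
  refine ⟨fun ε hε => (h.1 ε hε).congr (he ε hε), h.2.1.congr he₀, fun φ hφ => ?_⟩
  have hc : ∀ {u u' : ℝ × Y → ℝ}, u =ᵐ[(volume.restrict (Ioo 0 T)).prod ν] u' →
      ∫ z, u z * φ z ∂((volume.restrict (Ioo 0 T)).prod ν) =
        ∫ z, u' z * φ z ∂((volume.restrict (Ioo 0 T)).prod ν) := fun hu => by
    refine integral_congr_ae ?_
    filter_upwards [hu] with z hz
    rw [hz]
  rw [← hc he₀]
  refine (h.2.2 φ hφ).congr' ?_
  filter_upwards [self_mem_nhdsWithin] with ε hε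
  exact hc (he ε hε)

theorem invWeight_congr (h : F =ᵐ[volume] F') : invWeight F = invWeight F' := by
  refine withDensity_congr_ae ?_
  have : ∀ᵐ y : Space N × Space N, F y.2 = F' y.2 := Measure.quasiMeasurePreserving_snd.ae h
  filter_upwards [this] with y hy
  rw [hy]

theorem invWeight_ac : invWeight F ≪ volume := withDensity_absolutelyContinuous _ _

theorem ac_invWeight (hF : IsPosDensity volume F) : volume ≪ invWeight F := by
  rw [invWeight_eq_prod hF.measurable]
  exact Measure.AbsolutelyContinuous.rfl.prod (ac_velWeight hF.measurable hF.pos)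

instance : SFinite (invWeight F) := by unfold invWeight; infer_instance

theorem restrict_Ioi_prod_univ {Y : Type*} [MeasureSpace Y] [SFinite (volume : Measure Y)]
    (s : Set ℝ) : (volume : Measure (ℝ × Y)).restrict (s ×ˢ univ) =
      (volume.restrict s).prod volume := by
  rw [Measure.volume_eq_prod, ← Measure.prod_restrict, Measure.restrict_univ]

theorem ae_eq_slab_of_ae_eq {Y : Type*} [MeasureSpace Y] [SFinite (volume : Measure Y)]
    {g g' : ℝ × Y → ℝ} (h : g =ᵐ[volume.restrict (Ioi (0 : ℝ) ×ˢ (univ : Set Y))] g')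
    {ν : Measure Y} [SFinite ν] (hν : ν ≪ volume) (T : ℝ) :
    g =ᵐ[(volume.restrict (Ioo 0 T)).prod ν] g' := by
  rw [restrict_Ioi_prod_univ] at h
  have : (volume.restrict (Ioo 0 T)).prod ν ≪
      (volume.restrict (Ioi (0 : ℝ))).prod (volume : Measure Y) :=
    (Measure.absolutelyContinuous_of_le
      (Measure.restrict_mono (fun t ht => ht.1) le_rfl)).prod hν
  exact this.ae_eq h

/-- The collision operator integrates whole velocity slices, so changing the representative requires
agreement of almost every slice, which Fubini supplies. -/
theorem ae_ae_eq_of_ae_eq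
    (h : f =ᵐ[volume.restrict (Ioi (0 : ℝ) ×ˢ (univ : Set (Space N × Space N)))] f') :
    ∀ᵐ z ∂(volume.restrict (Ioi (0 : ℝ) ×ˢ (univ : Set (Space N × Space N)))),
      (fun w => f (z.1, z.2.1, w)) =ᵐ[volume] fun w => f' (z.1, z.2.1, w) := by
  rw [restrict_Ioi_prod_univ] at h ⊢
  have hmp := measurePreserving_prodAssoc (volume.restrict (Ioi (0 : ℝ)))
    (volume : Measure (Space N)) (volume : Measure (Space N))
  have h1 := Measure.ae_ae_of_ae_prod (hmp.quasiMeasurePreserving.ae h)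
  exact (Measure.quasiMeasurePreserving_fst.comp hmp.symm.quasiMeasurePreserving).ae h1

/-- Kinetic solutions have measurable representatives. -/
theorem IsKineticSolution.exists_measurable (hf : IsKineticSolution F θ ε f₀ f)
    (hF' : IsPosDensity volume F') (hFF' : F =ᵐ[volume] F') (hf₀ : f₀ =ᵐ[volume] f₀') :
    ∃ f' : ℝ × Space N × Space N → ℝ, Measurable f' ∧ IsKineticSolution F' θ ε f₀' f' ∧
      f =ᵐ[volume.restrict (Ioi (0 : ℝ) ×ˢ (univ : Set (Space N × Space N)))] f' := by
  have hw := invWeight_congr hFF'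
  -- The slabs exhaust the half space, and on each of them measurability for the weight F⁻¹ is as
  -- good as for Lebesgue measure, since the weight is positive.
  have hm : AEMeasurable f
      (volume.restrict (Ioi (0 : ℝ) ×ˢ (univ : Set (Space N × Space N)))) := by
    have e : Ioi (0 : ℝ) ×ˢ (univ : Set (Space N × Space N)) =
        ⋃ n : ℕ, Ioo (0 : ℝ) (n + 1) ×ˢ (univ : Set (Space N × Space N)) := by
      rw [← iUnion_prod_const]
      congr 1
      ext t
      simp only [mem_Ioi, mem_iUnion, mem_Ioo]
      refine ⟨fun ht => ?_, fun ⟨n, hn⟩ => hn.1⟩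
      obtain ⟨n, hn⟩ := exists_nat_gt t
      exact ⟨n, ht, by linarith⟩
    rw [e, aemeasurable_iUnion_iff]
    intro n
    rw [restrict_Ioi_prod_univ]
    have h1 := (hf.1 (n + 1) (by positivity)).1
    rw [hw] at h1
    exact (h1.mono_ac (Measure.AbsolutelyContinuous.rfl.prod (ac_invWeight hF'))).aemeasurable
  have he := hm.ae_eq_mk
  refine ⟨hm.mk f, hm.measurable_mk, ⟨fun T hT => ?_, fun φ hφ hc => ?_⟩, he⟩
  · have := hf.1 T hT
    rw [hw] at this
    exact this.congr (ae_eq_slab_of_ae_eq he invWeight_ac T)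
  · refine Eq.trans ?_ (hf.2 φ hφ hc)
    have hF2 : ∀ᵐ z : ℝ × Space N × Space N, F z.2.2 = F' z.2.2 :=
      (Measure.quasiMeasurePreserving_snd.comp Measure.quasiMeasurePreserving_snd).ae hFF'
    congr 1
    · refine integral_congr_ae ?_
      filter_upwards [he, ae_ae_eq_of_ae_eq he, ae_restrict_of_ae hF2] with z h1 h2 h3
      simp only [relaxation]
      rw [h1, h3, integral_congr_ae h2]
    · congr 1
      refine integral_congr_ae ?_
      filter_upwards [hf₀] with y hy
      rw [hy]

theorem IsFracHeatSolution.congr_initial {ρ₀ ρ₀' : Space N → ℝ} {ρ : ℝ × Space N → ℝ}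
    (h : IsFracHeatSolution α κ ρ₀ ρ) (he : ρ₀ =ᵐ[volume] ρ₀') :
    IsFracHeatSolution α κ ρ₀' ρ := by
  refine ⟨h.1, fun φ hφ hc => ?_⟩
  refine Eq.trans ?_ (h.2 φ hφ hc)
  congr 1
  refine integral_congr_ae ?_
  filter_upwards [he] with x hx
  rw [hx]

end Congruence

end FractionalDiffusion
-- The limit theorem for general representatives
open FractionalDiffusion in
theorem mainTheorem2 (N : ℕ) [NeZero N] (α κ₀ : ℝ) (hα : α ∈ Ioo (0 : ℝ) 2) (hκ₀ : 0 < κ₀)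
    (F : Space N → ℝ) (hF : IsEquilibrium F)
    (hFtail : Asymptotics.IsEquivalent (cocompact (Space N)) F
      (fun v => κ₀ / ‖v‖ ^ ((N : ℝ) + α)))
    (f₀ : Space N × Space N → ℝ) (hf₀ : MemLp f₀ 2 (invWeight F))
    (f : ℝ → ℝ × Space N × Space N → ℝ)
    (hf : ∀ ε : ℝ, 0 < ε → IsKineticSolution F (ε ^ α) ε f₀ (f ε)) :
    Integrable (fun w : Space N => kappaIntegrand α κ₀ w) ∧
    ∃ ρ : ℝ × Space N → ℝ,
      -- `ρ` is the unique solution of the fractional heat equation with datum `∫ f₀ dv`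
      IsFracHeatSolution α (kappa N α κ₀) (fun x => ∫ v, f₀ (x, v)) ρ ∧
      (∀ ρ' : ℝ × Space N → ℝ,
        IsFracHeatSolution α (kappa N α κ₀) (fun x => ∫ v, f₀ (x, v)) ρ' →
          ρ' =ᵐ[volume.restrict (Ioi (0 : ℝ) ×ˢ (univ : Set (Space N)))] ρ) ∧
      -- convergence in `L^∞(0,T; L²(F⁻¹))`
      (∀ T : ℝ, 0 < T →
        TendstoWeakStar T (invWeight F) f (fun z => ρ (z.1, z.2.1) * F z.2.2)) ∧
      -- convergence in `L^∞(0,T; L²(ℝ^N × ℝ^N))` with the flat measure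
      (MemLp F 2 volume → MemLp f₀ 2 volume → ∀ T : ℝ, 0 < T →
        TendstoWeakStar T volume f (fun z => ρ (z.1, z.2.1) * F z.2.2)) := by
  refine ⟨integrable_kappaIntegrand hα hκ₀, ?_⟩
  have hκ := kappa_pos (N := N) hα hκ₀
  obtain ⟨F', hF', hFF'⟩ := hF.exists_isPosDensity
  have hw := invWeight_congr hFF'
  have hf₀m : AEMeasurable f₀ volume := by
    have := hf₀.1
    rw [hw] at this
    exact (this.mono_ac (ac_invWeight hF')).aemeasurable
  have he₀ := hf₀m.ae_eq_mk
  -- The function 0 chosen for ε ≤ 0 is a filler: only positive ε matter.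
  have hex : ∀ ε : ℝ, ∃ f' : ℝ × Space N × Space N → ℝ, 0 < ε → Measurable f' ∧
      IsKineticSolution F' (ε ^ α) ε (hf₀m.mk f₀) f' ∧
      f ε =ᵐ[volume.restrict (Ioi (0 : ℝ) ×ˢ (univ : Set (Space N × Space N)))] f' := by
    intro ε
    by_cases hε : 0 < ε
    · obtain ⟨f', h⟩ := (hf ε hε).exists_measurable hF' hFF' he₀
      exact ⟨f', fun _ => h⟩
    · exact ⟨0, fun h => absurd h hε⟩
  choose f' hf' using hex
  have hf₀' : MemLp (hf₀m.mk f₀) 2 (invWeight F') := by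
    rw [hw] at hf₀
    exact (memLp_congr_ae (invWeight_ac.ae_eq he₀)).1 hf₀
  obtain ⟨ρ, hρ, h1, h2⟩ := exists_fracHeat_limit hF' (hasDissipationLimit hα hκ₀ hF hFtail hFF')
    hα hκ hf₀' hf₀m.measurable_mk (fun ε hε => (hf' ε hε).1) (fun ε hε => (hf' ε hε).2.1)
  have hρ' : IsFracHeatSolution α (kappa N α κ₀) (fun x => ∫ v, f₀ (x, v)) ρ := by
    refine hρ.congr_initial ?_
    have he : ∀ᵐ y ∂((volume : Measure (Space N)).prod volume), f₀ y = hf₀m.mk f₀ y := he₀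
    filter_upwards [Measure.ae_ae_of_ae_prod he] with x hx
    exact (integral_congr_ae hx).symm
  have hlim : ∀ (T : ℝ) {ν : Measure (Space N × Space N)} [SFinite ν], ν ≪ volume →
      TendstoWeakStar T ν f' (fun z => ρ (z.1, z.2.1) * F' z.2.2) →
      TendstoWeakStar T ν f (fun z => ρ (z.1, z.2.1) * F z.2.2) := by
    intro T ν _ hν h
    refine h.congr (fun ε hε => (ae_eq_slab_of_ae_eq (hf' ε hε).2.2 hν T).symm)
      (ae_eq_slab_of_ae_eq (ae_restrict_of_ae ?_) hν T)
    have hF2 : ∀ᵐ z : ℝ × Space N × Space N, F z.2.2 = F' z.2.2 :=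
      (Measure.quasiMeasurePreserving_snd.comp Measure.quasiMeasurePreserving_snd).ae hFF'
    filter_upwards [hF2] with z hz
    rw [hz]
  refine ⟨ρ, hρ', fun ρ₁ hρ₁ => hρ₁.unique hα hκ.le hρ', fun T hT => ?_,
    fun hF2 hf₀2 T hT => ?_⟩
  · rw [hw]
    exact hlim T invWeight_ac (h1 T hT)
  · exact hlim T Measure.AbsolutelyContinuous.rfl
      (h2 ((memLp_congr_ae hFF').1 hF2) ((memLp_congr_ae he₀).1 hf₀2) T hT)
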